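/- **Setting.** Let $D\ge1$ be an integer and let $\tilde v:\mathbb R^D\to\mathbb C$ be integrable with $(2\pi)^{-D/2}\int\tilde v(z)\,d^Dz=1$. Let $v(k)=(2\pi)^{-D/2}\int e^{-ik\cdot z}\tilde v(z)\,d^Dz$, so that $v$ is uniformly continuous and $v(0)=1$, and let $g\in\mathbb C\setminus\{0\}$. For a dispersion relation $\epsilon$ consider the Schrödinger equation with separable potential $$\epsilon(k)\psi(k)+g\,v(k)\int v(k')\psi(k')\,d^Dk'=E\,\psi(k),$$ and put $K_{\rm sep}(\omega)=\int\frac{v(k)^2}{\omega-\epsilon(k)}d^Dk$ and $T_{\rm sep}(\omega,k,k')=\frac{v(k)v(k')}{g^{-1}-K_{\rm sep}(\omega)}$. Write $f(E\pm i0)=\lim_{\eta\to0^+}f(E\pm i\eta)$. Two cases are considered. (A) $D=1$, $\epsilon(k)=\sigma d\,k^m$ with $\sigma=\pm1$, $d>0$ and an integer $m\ge2$. The continuum is $R_c=\{E:\sigma E>0\}$ for even $m$ and $R_c=\mathbb R\setminus\{0\}$ for odd $m$. For $E\in R_c$, $S_{\rm sep}(E)$ is the matrix with entries $$\delta_{\alpha\beta}-2\pi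 i\,\frac{T_{\rm sep}(E+i0,k_\alpha,k_\beta)}{\sqrt{|\epsilon'(k_\alpha)\epsilon'(k_\beta)|}}$$ over the real momenta of energy $E$: $k_1=(|E|/d)^{1/m}$ and $k_2=-k_1$ for even $m$, and the single real solution of $\epsilon(k)=E$ for odd $m$. (B) Any $D\ge1$, $\epsilon(k)=|k|^a$ with real $a>0$, and $|v(k)|^2=o(|k|^{a-\gamma})$ as $|k|\to\infty$ for some $\gamma>D$ (automatic if $a>D$). The continuum is $R_c=(0,\infty)$. Let $(Y_\alpha)$ be an orthonormal basis of $L^2(S^{D-1})$ of spherical harmonics $Y_\alpha$ of degree $l_\alpha$, with $\alpha=1$ the unique index of degree $0$. Let $$\phi_{\alpha,E}(z)=b(D)^{-1/2}(kr)^{1-D/2}J_{l_\alpha+D/2-1}(kr)\,Y_\alpha(\hat z),\qquad r=|z|,\quad k=E^{1/a},$$ where $b(D)=2\pi^{D/2}/\Gamma(D/2)$, and let $\rho(E)=\frac{b(D)}{a}E^{-1+D/a}$. Then $$S_{\alpha\beta}(E)=\delta_{\alpha\beta}-2\pi i\,\rho(E)\,\langle\phi_{\beta,E}|T_{\rm sep}(E+i0)|\phi_{\alpha,E}\rangle,$$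 where $T_{\rm sep}(\omega)$ is the operator with momentum-space kernel $\langle k'|T_{\rm sep}(\omega)|k\rangle=T_{\rm sep}(\omega,k,k')$. Define $\det S_{\rm sep}(E)$ as the limit of the determinants of the finite submatrices of $S_{\rm sep}(E)$. **Terminology.** There is a *bound state in the continuum* at $E\in R_c$ if $g^{-1}=K_{\rm sep}(E+i0)$. A *zero-energy state* is a measurable solution $\psi$ (square integrable or not) of the Schrödinger equation with $E=0$ for which $v\psi$ is integrable and $\int v\psi\neq0$. $N_B$ is the number of square-integrable bound states, i.e. the dimension of the space spanned by all square-integrable eigenvectors and generalized eigenvectors of the Hamiltonian; for real $g$ and $v$ this is the number of linearly independent bound states. A *scattering phase* is a continuous real $\delta$ with $\det S_{\rm sep}=|\det S_{\rm sep}|\,e^{2i\delta}$ on $R_c$, and $\Delta\delta_{\rm sep}$ is its limit at the upper end minus its limit at the lower end of $R_c$; for odd $m$ it is the sum of these differences over $(-\infty,0)$ and $(0,\infty)$. **Theorem.** In both cases, for nonzero $\omega$ outside the continuum: if $g^{-1}\ne K_{\rm sep}(\omega)$, then $T_{\rm sep}(\omega,\cdot,\cdot)$ is the unique solution of the Lippmann–Schwinger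 equation $$T(k,k')=g\,v(k)v(k')+g\,v(k')\int\frac{v(k'')}{\omega-\epsilon(k'')}\,T(k,k'')\,d^Dk'';$$ and $\omega$ is the energy of a square-integrable bound state if and only if $g^{-1}=K_{\rm sep}(\omega)$. The limits $K_{\rm sep}(E\pm i0)$ exist for all $E\in R_c$. Moreover: 1. *Universal limits.* In case (A), for odd $m$, $\lim_{E\to0^\pm}S_{\rm sep}(E)=e^{\pm\pi i/m}$; for even $m$, $$\lim_{E\to\sigma0^+}S_{\rm sep}(E)=e^{\sigma i\pi/m}\begin{pmatrix}\cos(\pi/m)&\sigma i\sin(\pi/m)\\ \sigma i\sin(\pi/m)&\cos(\pi/m)\end{pmatrix}.$$ In case (B), suppose there is no zero-energy state (automatic if $a\ge D$). Then $\lim_{E\to0^+}S_{\alpha\beta}(E)=\delta_{\alpha\beta}$ for all $\alpha,\beta$, with one exception: if $a>D$ and $\alpha=\beta=1$, the limit is $e^{2\pi iD/a}$. 2. *Determinant.* If $E\in R_c$ and there is no bound state in the continuum at $E$, then $$\det S_{\rm sep}(E)=\frac{g^{-1}-K_{\rm sep}(E-i0)}{g^{-1}-K_{\rm sep}(E+i0)},$$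 where in case (B) the limit defining the determinant exists. 3. *Levinson's theorem.* Suppose there are no bound states in the continuum and $\det S_{\rm sep}(E)\neq0$ on $R_c$ (automatic for real $g$ and $v$ if there are no bound states in the continuum). In case (B) suppose also that there is no zero-energy state and, if $a\le D$, that $v$ is Hölder continuous of some positive order. Then $N_B$ is finite, a scattering phase exists, and every scattering phase has limits at the ends of the continuum, with $$\Delta\delta_{\rm sep}=-\pi N_B+\pi\frac{m-1}{m}$$ in case (A), and in case (B) $$\Delta\delta_{\rm sep}=\begin{cases}-\pi N_B+\pi\frac{a-D}{a}&a>D,\\-\pi N_B&0<a\le D.\end{cases}$$ -/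

import Mathlib

open Filter Topology MeasureTheory Complex
open scoped ComplexConjugate

namespace SepScattering

noncomputable section

/-! ### The model, in momentum space

`V` is the momentum space: `ℝ`, or `EuclideanSpace ℝ (Fin D)`. -/

section Model

variable {V : Type*} [NormedAddCommGroup V] [InnerProductSpace ℝ V] [FiniteDimensional ℝ V]
  [MeasurableSpace V] [BorelSpace V]

/-- The Fourier transform `k ↦ (2π)^(-D/2) ∫ exp(-i k·z) f(z) dz`, with `D = dim V`. -/
def unitaryFourier (f : V → ℂ) (k : V) : ℂ :=
  (((Real.sqrt (2 * Real.pi))⁻¹ ^ Module.finrank ℝ V : ℝ) : ℂ) *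
    ∫ z, Complex.exp (-(I * ((inner ℝ k z : ℝ) : ℂ))) * f z

/-- `K(ω) = ∫ v(k)² / (ω - ε(k)) dk`. -/
def Ksep (ε : V → ℝ) (v : V → ℂ) (ω : ℂ) : ℂ :=
  ∫ k, v k ^ 2 / (ω - (ε k : ℂ))

/-- The boundary value `f(E + i0) = lim_{η → 0⁺} f(E + iη)`. -/
def fromAbove (f : ℂ → ℂ) (E : ℝ) : ℂ :=
  limUnder (𝓝[>] (0 : ℝ)) fun η : ℝ => f ((E : ℂ) + (η : ℂ) * I)

/-- The boundary value `f(E - i0) = lim_{η → 0⁺} f(E - iη)`. -/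
def fromBelow (f : ℂ → ℂ) (E : ℝ) : ℂ :=
  limUnder (𝓝[>] (0 : ℝ)) fun η : ℝ => f ((E : ℂ) - (η : ℂ) * I)

/-- Both boundary values of `f` at the real point `E` exist (as finite limits). -/
def HasBoundaryValues (f : ℂ → ℂ) (E : ℝ) : Prop :=
  Tendsto (fun η : ℝ => f ((E : ℂ) + (η : ℂ) * I)) (𝓝[>] 0) (𝓝 (fromAbove f E)) ∧
  Tendsto (fun η : ℝ => f ((E : ℂ) - (η : ℂ) * I)) (𝓝[>] 0) (𝓝 (fromBelow f E))

/-- The complex energies that are nonzero and outside the continuum `Rc`. -/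
def offContinuum (Rc : Set ℝ) : Set ℂ :=
  {ω | ∀ E ∈ insert 0 Rc, ω ≠ ((E : ℝ) : ℂ)}

/-- The Lippmann-Schwinger equation for `T(ω, k, k')` with potential `g v(k') v(k)`:
`T(k,k') = g v(k) v(k') + g v(k') ∫ v(k'') / (ω - ε(k'')) T(k,k'') dk''`. -/
def SolvesLippmannSchwinger (ε : V → ℝ) (g : ℂ) (v : V → ℂ) (ω : ℂ) (T : V → V → ℂ) : Prop :=
  ∀ k, Integrable (fun k'' => v k'' / (ω - (ε k'' : ℂ)) * T k k'') ∧
    ∀ k', T k k' = g * v k * v k' +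
      g * v k' * ∫ k'', v k'' / (ω - (ε k'' : ℂ)) * T k k''

/-- The `T`-matrix `T(ω, k, k') = v(k) v(k') / (g⁻¹ - K(ω))`. -/
def Tsep (ε : V → ℝ) (g : ℂ) (v : V → ℂ) (ω : ℂ) (k k' : V) : ℂ :=
  v k * v k' / (g⁻¹ - Ksep ε v ω)

/-- `(H - E) ψ = χ` in `L²`, where `(H ψ)(k) = ε(k) ψ(k) + g v(k) ∫ v(k') ψ(k') dk'`. -/
def ShiftedHamiltonian (ε : V → ℝ) (g : ℂ) (v : V → ℂ) (E : ℂ)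
    (ψ χ : Lp ℂ 2 (volume : Measure V)) : Prop :=
  Integrable (fun k => v k * ψ k) ∧
    ∀ᵐ k, (ε k : ℂ) * ψ k + g * v k * (∫ k', v k' * ψ k') - E * ψ k = χ k

/-- `E` is a bound-state energy: the Schrödinger equation `H ψ = E ψ` has a nonzero
square-integrable solution. -/
def IsBoundStateEnergy (ε : V → ℝ) (g : ℂ) (v : V → ℂ) (E : ℂ) : Prop :=
  ∃ ψ : Lp ℂ 2 (volume : Measure V), ψ ≠ 0 ∧ ShiftedHamiltonian ε g v E ψ 0

/-- `(H - E)ⁿ ψ = 0`. -/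
def IsRootVector (ε : V → ℝ) (g : ℂ) (v : V → ℂ) (E : ℂ) :
    ℕ → Lp ℂ 2 (volume : Measure V) → Prop
  | 0, ψ => ψ = 0
  | n + 1, ψ => ∃ χ, ShiftedHamiltonian ε g v E ψ χ ∧ IsRootVector ε g v E n χ

/-- The space spanned by all bound states, of all energies. Generalized eigenvectors are
included, so that its dimension counts bound states with algebraic multiplicity. When `g` and
`v` are real, `H` is symmetric and this is the span of the ordinary eigenvectors. -/
def boundStateSpace (ε : V → ℝ) (g : ℂ) (v : V → ℂ) :
    Submodule ℂ (Lp ℂ 2 (volume : Measure V)) :=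
  Submodule.span ℂ {ψ | ∃ (E : ℂ) (n : ℕ), IsRootVector ε g v E n ψ}

/-- The number `N_B` of bound states. -/
def boundStateNumber (ε : V → ℝ) (g : ℂ) (v : V → ℂ) : ℕ :=
  Module.finrank ℂ (boundStateSpace ε g v)

/-- A bound state in the continuum at the energy `E`: `g⁻¹ - K(E + i0) = 0`, so that the
`T`-matrix has no boundary value `T(E + i0)`. -/
def IsBoundStateInContinuum (ε : V → ℝ) (g : ℂ) (v : V → ℂ) (E : ℝ) : Prop :=
  g⁻¹ - fromAbove (Ksep ε v) E = 0

/-- A zero-energy solution `ψ` (square integrable or not) of the Schrödinger equation that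
couples to the potential, i.e. `∫ v ψ ≠ 0`. -/
def HasZeroEnergyState (ε : V → ℝ) (g : ℂ) (v : V → ℂ) : Prop :=
  ∃ ψ : V → ℂ, AEStronglyMeasurable ψ volume ∧ Integrable (fun k => v k * ψ k) ∧
    (∫ k, v k * ψ k) ≠ 0 ∧
    ∀ᵐ k, (ε k : ℂ) * ψ k + g * v k * (∫ k', v k' * ψ k') = 0

end Model

/-! ### Scattering phases -/

/-- `δ` is a scattering phase of `f` on `J`: it is continuous, and `f = |f| exp(2iδ)`. -/
def IsScatteringPhase (f : ℝ → ℂ) (J : Set ℝ) (δ : ℝ → ℝ) : Prop :=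
  ContinuousOn δ J ∧ ∀ E ∈ J, f E = (‖f E‖ : ℂ) * Complex.exp (2 * I * (δ E : ℂ))

/-- A scattering phase of `f` on `J` exists, and every such phase has limits at the two ends of
`J`, given by the filters `lo` and `hi`, which differ by `Δ = δ(hi) - δ(lo)`. -/
def HasPhaseChange (f : ℝ → ℂ) (J : Set ℝ) (lo hi : Filter ℝ) (Δ : ℝ) : Prop :=
  (∃ δ, IsScatteringPhase f J δ) ∧
    ∀ δ, IsScatteringPhase f J δ →
      ∃ δlo δhi : ℝ, Tendsto δ lo (𝓝 δlo) ∧ Tendsto δ hi (𝓝 δhi) ∧ δhi - δlo = Δ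

/-! ### One dimension, dispersion relation `σ d kᵐ` -/

/-- `ε(k) = σ d kᵐ`. -/
def dispersion (σ d : ℝ) (m : ℕ) (k : ℝ) : ℝ := σ * d * k ^ m

/-- The matrix `δ_{αβ} - 2πi T(E + i0, p_α, p_β) / √|ε'(p_α) ε'(p_β)|`
for momenta `p_1, …, p_n` of energy `E`. -/
def onShellS (ε : ℝ → ℝ) (g : ℂ) (v : ℝ → ℂ) (E : ℝ) {n : ℕ} (p : Fin n → ℝ) :
    Matrix (Fin n) (Fin n) ℂ := fun α β =>
  (if α = β then 1 else 0) -
    2 * (Real.pi : ℂ) * I * fromAbove (fun ω => Tsep ε g v ω (p α) (p β)) E /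
      ((Real.sqrt |deriv ε (p α) * deriv ε (p β)| : ℝ) : ℂ)

/-- The `2 × 2` matrix `S(E)` for even `m`; the momenta are `k₁ = (|E|/d)^(1/m)`, `k₂ = -k₁`. -/
def SEven (σ d : ℝ) (m : ℕ) (g : ℂ) (v : ℝ → ℂ) (E : ℝ) : Matrix (Fin 2) (Fin 2) ℂ :=
  onShellS (dispersion σ d m) g v E
    ![(|E| / d) ^ (1 / (m : ℝ)), -(|E| / d) ^ (1 / (m : ℝ))]

/-- The `1 × 1` matrix `S(E)` for odd `m`; the momentum is the real solution of `σ d kᵐ = E`. -/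
def SOdd (σ d : ℝ) (m : ℕ) (g : ℂ) (v : ℝ → ℂ) (E : ℝ) : Matrix (Fin 1) (Fin 1) ℂ :=
  onShellS (dispersion σ d m) g v E ![σ * Real.sign E * (|E| / d) ^ (1 / (m : ℝ))]

/-- The continuum `(0,∞)` or `(-∞,0)` for even `m`. -/
def continuumEven (σ : ℝ) : Set ℝ := {E | 0 < σ * E}

/-! ### `D` dimensions, dispersion relation `|k|ᵃ` -/

/-- `ε(k) = |k|ᵃ`. -/
def radialDispersion (D : ℕ) (a : ℝ) (k : EuclideanSpace ℝ (Fin D)) : ℝ := ‖k‖ ^ a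

/-- The area `b(D) = 2 π^(D/2) / Γ(D/2)` of the unit sphere. -/
def sphereArea (D : ℕ) : ℝ := 2 * Real.pi ^ ((D : ℝ) / 2) / Real.Gamma ((D : ℝ) / 2)

/-- The density of states `ρ(E) = (b(D)/a) E^(-1 + D/a)`. -/
def densityOfStates (D : ℕ) (a E : ℝ) : ℝ := sphereArea D / a * E ^ (-1 + (D : ℝ) / a)

/-- The unit sphere of momentum directions. -/
abbrev UnitSphere (D : ℕ) : Type := Metric.sphere (0 : EuclideanSpace ℝ (Fin D)) 1

/-- The surface measure of the unit sphere. -/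
abbrev surfaceMeasure (D : ℕ) : Measure (UnitSphere D) :=
  (volume : Measure (EuclideanSpace ℝ (Fin D))).toSphere

/-- A spherical harmonic of degree `l`: the restriction to the unit sphere of a harmonic
homogeneous polynomial of degree `l`. -/
def IsSphericalHarmonic {D : ℕ} (l : ℕ) (Y : UnitSphere D → ℂ) : Prop :=
  ∃ P : MvPolynomial (Fin D) ℂ, P.IsHomogeneous l ∧
    ∑ i, MvPolynomial.pderiv i (MvPolynomial.pderiv i P) = 0 ∧
    Y =ᵐ[surfaceMeasure D] fun Ω =>
      MvPolynomial.eval (fun i => (((Ω : EuclideanSpace ℝ (Fin D)) i : ℝ) : ℂ)) P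

/-- An orthonormal basis of `L²` of the unit sphere that consists of spherical harmonics. Its
index runs over the pairs `(l, q_l)`; there is exactly one index with `l = 0`, the s-wave. -/
structure AngularBasis (D : ℕ) (ι : Type*) where
  /-- the spherical harmonics -/
  Y : HilbertBasis ι ℂ (Lp ℂ 2 (surfaceMeasure D))
  /-- the angular momentum `l` -/
  degree : ι → ℕ
  /-- the index of the s-wave -/
  sWave : ι
  degree_eq_zero_iff : ∀ α, degree α = 0 ↔ α = sWave
  harmonic : ∀ α, IsSphericalHarmonic (degree α) (Y α : UnitSphere D → ℂ)

variable {D : ℕ} {ι : Type*}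

/-- The matrix element `⟨φ_{β,E}| T |φ_{α,E}⟩` of the operator with momentum-space kernel
`⟨k'| T |k⟩ = T(k,k')`, at `E = κᵃ`, in the angular momentum eigenstates
`φ_{α,E}(z) = b(D)^(-1/2) (κr)^(1-D/2) J_{l+D/2-1}(κr) Y_α(ẑ)`.
By `(2π)^(-D/2) ∫ exp(iκ Ω·z) Y_α(Ω) dΩ = i^l (κr)^(1-D/2) J_{l+D/2-1}(κr) Y_α(ẑ)`, the state
`φ_{α,E}` is the superposition `b(D)^(-1/2) (-i)^l ∫ Y_α(Ω) |κΩ⟩ dΩ` of the plane waves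
`(2π)^(-D/2) exp(iκ Ω·z)`. -/
def angularElement (B : AngularBasis D ι) (T : EuclideanSpace ℝ (Fin D) →
    EuclideanSpace ℝ (Fin D) → ℂ) (κ : ℝ) (α β : ι) : ℂ :=
  ((sphereArea D : ℝ) : ℂ)⁻¹ * ((-I) ^ B.degree α * conj ((-I) ^ B.degree β)) *
    ∫ Ω' : UnitSphere D, ∫ Ω : UnitSphere D,
      conj (B.Y β Ω') * T (κ • (Ω : EuclideanSpace ℝ (Fin D)))
        (κ • (Ω' : EuclideanSpace ℝ (Fin D))) * B.Y α Ω
      ∂(surfaceMeasure D) ∂(surfaceMeasure D)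

open Classical in
/-- `S_{αβ}(E) = δ_{αβ} - 2πi ρ(E) T(E + i0, α, E, β, E)` for the dispersion relation `|k|ᵃ`. -/
def SAngular (B : AngularBasis D ι) (a : ℝ) (g : ℂ) (v : EuclideanSpace ℝ (Fin D) → ℂ)
    (E : ℝ) : Matrix ι ι ℂ := fun α β =>
  (if α = β then 1 else 0) -
    2 * (Real.pi : ℂ) * I * ((densityOfStates D a E : ℝ) : ℂ) *
      fromAbove (fun ω => angularElement B (Tsep (radialDispersion D a) g v ω)
        (E ^ (1 / a)) α β) E

open Classical in
/-- The determinant of the submatrix of `S(E)` on a finite set `s` of channels. -/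
def finiteDet (B : AngularBasis D ι) (a : ℝ) (g : ℂ) (v : EuclideanSpace ℝ (Fin D) → ℂ)
    (E : ℝ) (s : Finset ι) : ℂ :=
  Matrix.det (fun α β : s => SAngular B a g v E α β)

/-- `det S(E)`, the limit of the determinants of finite submatrices. -/
def detSAngular (B : AngularBasis D ι) (a : ℝ) (g : ℂ) (v : EuclideanSpace ℝ (Fin D) → ℂ)
    (E : ℝ) : ℂ :=
  limUnder (atTop : Filter (Finset ι)) (finiteDet B a g v E)

end

end SepScattering

/-! Everything is governed by the single function D(ω) = g⁻¹ - K(ω), analytic off the continuum. The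
potential has rank one, so the Lippmann-Schwinger equation and the eigenvalue equation both reduce
to one scalar equation with coefficient D(ω). Hence off the continuum the bound-state energies are
the zeros of D. Expanding D at a zero of order r shows that v/(ε-ω), ..., v/(ε-ω)^r form a maximal
Jordan chain there, so N_B is the number of zeros counted with multiplicity
(`finrank_boundStateSpace`).

On the energy shell S is the identity plus a rank-one matrix, so det S is one plus a trace: the sum
of v² over the shell, divided by D(E+i0). In case (B) the sum over channels is Parseval's identity
(`hasSum_channels`). By the Plemelj jump of K this trace equals (K(E+i0) - K(E-i0))/D(E+i0), and det
S = D(E-i0)/D(E+i0) follows (`ratio_eq`).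

Levinson's theorem is the argument principle for D. After the zeros are divided out, D has a
continuous logarithm on each closed half-plane without the origin, and only the two ends matter
(`exists_boundary_argument`, `HalfPlaneData.exists_phase`). At infinity D → g⁻¹. At zero, with p =
1/m in case (A) and p = D/a in case (B) (here D is the dimension), the function behaves for p < 1
like a constant, depending on the half-plane, times |ω|^(p-1) exp(i(p-1) arg ω), which produces the
fractional term π(1-p). For p ≥ 1 it tends to a nonzero constant or grows logarithmically without
winding.

The analysis concerns the Cauchy transform of densities t^(p-1) s(t^q), to which K reduces in the
variable t = |ε(k)|. Since v is only the Fourier transform of an integrable function, s need not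
have any prescribed modulus of continuity, and the classical Plemelj theorem is not available.
However, s is a superposition of exponentials exp(i r τ) with integrable weight, and near t = 1 the
Cauchy transform of t^(p-1) exp(i a t^q) is bounded uniformly in a (`exists_bound_localCauchy`).
Dominated convergence over the weight then gives the boundary values and shows that the part of the
transform near t = x is O(x^(p-1)).

At low energy with p < 1, s may be replaced by s(0) and g⁻¹ is negligible. There remains a pure
power, whose transform is C (-ω)^(p-1) with C sin(πp) = -π (`powerCauchy_eq`, `powerConst_mul_sin`);
this is why the limits of S are universal. For p = 1 a logarithm appears
(`tendsto_cauchy_zero_of_eq_one`). For p > 1 the function K is continuous at zero, and the absence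
of a zero-energy state means g⁻¹ ≠ K(0). At infinity K → 0, directly for p < 1, and for p ≥ 1 by
interpolating the decay of s with its Hölder continuity. -/

namespace SepScattering

/-! ### Winding along the boundary of a half-plane -/

/-- The open upper half plane. -/
def upper : Set ℂ := {ω | 0 < ω.im}

/-- The closed upper half plane without the origin. -/
def upperClosed : Set ℂ := {ω | 0 ≤ ω.im ∧ ω ≠ 0}

lemma isOpen_upper : IsOpen upper := isOpen_lt continuous_const Complex.continuous_im

lemma upper_subset_upperClosed : upper ⊆ upperClosed := fun ω hω =>
  ⟨le_of_lt hω, fun h => by simp [upper, h] at hω⟩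

lemma closure_upper : closure upper = {ω : ℂ | 0 ≤ ω.im} := Complex.closure_setOfPred_lt_im 0

lemma upperClosed_subset_closure : upperClosed ⊆ closure upper := by
  rw [closure_upper]; exact fun ω h => h.1

lemma ofReal_mem_closure_upper (E : ℝ) : (E : ℂ) ∈ closure upper := by
  rw [closure_upper]; simp

instance nhdsWithin_upper_neBot (E : ℝ) : (𝓝[upper] (E : ℂ)).NeBot :=
  mem_closure_iff_nhdsWithin_neBot.mp (ofReal_mem_closure_upper E)

lemma convex_upper : Convex ℝ upper := convex_halfSpace_im_gt 0

/-- A continuous function on a preconnected set with `exp ∘ g = c` is constant. -/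
lemma eq_of_exp_eq_const {X : Type*} [TopologicalSpace X] {S : Set X} (hS : IsPreconnected S)
    {g : X → ℂ} (hg : ContinuousOn g S) {c : ℂ} (h : ∀ x ∈ S, Complex.exp (g x) = c)
    {x y : X} (hx : x ∈ S) (hy : y ∈ S) : g x = g y := by
  -- Two values of `g` differ by an integer multiple of 2πi, and a continuous function into the
  -- discrete set of integers is constant on a preconnected set.
  have hT : DiscreteTopology (Set.range ((↑) : ℤ → ℝ)) :=
    (Int.isClosedEmbedding_coe_real.isEmbedding.toHomeomorph.symm.isEmbedding).discreteTopology
  have key : ∀ z ∈ S, ∃ n : ℤ, g z = g x + n * (2 * Real.pi * I) := fun z hz =>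
    Complex.exp_eq_exp_iff_exists_int.mp ((h z hz).trans (h x hx).symm)
  have hc : ContinuousOn (fun z => ((g z - g x) / (2 * Real.pi * I)).re) S := by fun_prop
  have hpi : (2 * Real.pi * I : ℂ) ≠ 0 := by simp [Real.pi_ne_zero]
  have hm : Set.MapsTo (fun z => ((g z - g x) / (2 * Real.pi * I)).re) S
      (Set.range ((↑) : ℤ → ℝ)) := by
    intro z hz
    obtain ⟨n, hn⟩ := key z hz
    refine ⟨n, ?_⟩
    simp only [hn, add_sub_cancel_left, mul_div_cancel_right₀ _ hpi]
    simp
  have := hS.constant_of_mapsTo ⟨hT⟩ hc hm hx hy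
  obtain ⟨n, hn⟩ := key y hy
  simp only [hn, add_sub_cancel_left, mul_div_cancel_right₀ _ hpi, sub_self, zero_div] at this
  have h0 : (0 : ℝ) = n := by simpa using this
  have : n = 0 := by exact_mod_cast h0.symm
  simp [hn, this]

/-- Limits of a continuous function pass from the open to the closed half plane. -/
lemma tendsto_upperClosed_of_tendsto_upper {G : ℂ → ℂ} {l : Filter ℂ}
    (hl : ∀ s ∈ l, ∀ᶠ x in l, s ∈ 𝓝 x) (hG : ContinuousOn G upperClosed) {c : ℂ}
    (h : Tendsto G (l ⊓ 𝓟 upper) (𝓝 c)) : Tendsto G (l ⊓ 𝓟 upperClosed) (𝓝 c) := by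
  -- By `hl` a set of the filter is a neighbourhood of nearby points. So near a boundary point x the
  -- values of `G` on `upper` lie in the closed set W, and by continuity so does `G x`.
  refine (closed_nhds_basis c).tendsto_right_iff.mpr fun W ⟨hW, hWc⟩ => ?_
  have h1 : ∀ᶠ x in l, x ∈ upper → G x ∈ W := eventually_inf_principal.mp (h hW)
  refine eventually_inf_principal.mpr ((hl _ h1).mono fun x hx hxB => ?_)
  have : (𝓝[upper] x).NeBot := mem_closure_iff_nhdsWithin_neBot.mp (upperClosed_subset_closure hxB)
  refine hWc.mem_of_tendsto ((hG x hxB).mono upper_subset_upperClosed) ?_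
  filter_upwards [mem_nhdsWithin_of_mem_nhds hx, self_mem_nhdsWithin] with y hy hyU using hy hyU

/-- Along the cut of `arg` the closed half-plane is approached only from above, the side on which
`arg` is continuous with value π. -/
lemma continuousOn_arg_upperClosed : ContinuousOn arg upperClosed := by
  rintro ω ⟨h1, h2⟩
  rcases h1.lt_or_eq with h | h
  · exact (continuousAt_arg (Or.inr h.ne')).continuousWithinAt
  · rcases lt_trichotomy ω.re 0 with hr | hr | hr
    · exact (continuousWithinAt_arg_of_re_neg_of_im_zero hr h.symm).mono fun z hz => hz.1
    · exact absurd (Complex.ext hr h.symm) h2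
    · exact (continuousAt_arg (Or.inl hr)).continuousWithinAt

/-- The hypothesis `hl` of `tendsto_upperClosed_of_tendsto_upper` at infinity: complements of closed
balls are open. -/
lemma eventually_mem_nhds_cobounded {s : Set ℂ} (hs : s ∈ Bornology.cobounded ℂ) :
    ∀ᶠ x in Bornology.cobounded ℂ, s ∈ 𝓝 x := by
  obtain ⟨R, -, hR⟩ := (Metric.hasBasis_cobounded_compl_closedBall (0 : ℂ)).mem_iff.mp hs
  have hm : (Metric.closedBall (0 : ℂ) R)ᶜ ∈ Bornology.cobounded ℂ :=
    (Metric.hasBasis_cobounded_compl_closedBall (0 : ℂ)).mem_of_mem trivial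
  filter_upwards [hm] with x hx
  exact mem_of_superset (Metric.isClosed_closedBall.isOpen_compl.mem_nhds hx) hR

lemma tendsto_ofReal_cobounded_atTop :
    Tendsto ((↑) : ℝ → ℂ) atTop (Bornology.cobounded ℂ ⊓ 𝓟 upperClosed) := by
  refine tendsto_inf.mpr ⟨?_, tendsto_principal.mpr ?_⟩
  · rw [← tendsto_norm_atTop_iff_cobounded]
    simpa using tendsto_abs_atTop_atTop
  · filter_upwards [eventually_gt_atTop 0] with E hE
    exact ⟨by simp, by exact_mod_cast hE.ne'⟩

lemma tendsto_ofReal_cobounded_atBot :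
    Tendsto ((↑) : ℝ → ℂ) atBot (Bornology.cobounded ℂ ⊓ 𝓟 upperClosed) := by
  refine tendsto_inf.mpr ⟨?_, tendsto_principal.mpr ?_⟩
  · rw [← tendsto_norm_atTop_iff_cobounded]
    simpa using tendsto_abs_atBot_atTop
  · filter_upwards [eventually_lt_atBot 0] with E hE
    exact ⟨by simp, by exact_mod_cast hE.ne⟩

lemma tendsto_ofReal_nhds_zero {s : Set ℝ} (hs : (0 : ℝ) ∉ s) :
    Tendsto ((↑) : ℝ → ℂ) (𝓝[s] 0) (𝓝 0 ⊓ 𝓟 upperClosed) := by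
  refine tendsto_inf.mpr ⟨?_, tendsto_principal.mpr ?_⟩
  · exact (Complex.continuous_ofReal.tendsto' 0 0 rfl).mono_left nhdsWithin_le_nhds
  · filter_upwards [self_mem_nhdsWithin] with E hE
    exact ⟨by simp, by rintro h; exact hs (by rwa [ofReal_eq_zero.mp h] at hE)⟩

/-- The continuous extension of `F` from the open upper half plane. -/
lemma continuousOn_extendFrom_upper {F : ℂ → ℂ} {Fb : ℝ → ℂ} (hF : ContinuousOn F upper)
    (hb : ∀ E : ℝ, E ≠ 0 → Tendsto F (𝓝[upper] (E : ℂ)) (𝓝 (Fb E))) :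
    ContinuousOn (extendFrom upper F) upperClosed ∧
    (∀ ω ∈ upper, extendFrom upper F ω = F ω) ∧
    ∀ E : ℝ, E ≠ 0 → extendFrom upper F E = Fb E := by
  refine ⟨continuousOn_extendFrom upperClosed_subset_closure fun ω hω => ?_, fun ω hω => ?_,
    fun E hE => ?_⟩
  · rcases hω.1.lt_or_eq with h | h
    · exact ⟨F ω, hF ω h⟩
    · have : ((ω.re : ℝ) : ℂ) = ω := Complex.ext rfl (by simpa using h)
      rw [← this]
      refine ⟨_, hb _ fun h0 => hω.2 ?_⟩
      rw [← this, h0]; simp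
  · exact extendFrom_eq (subset_closure hω) (hF ω hω)
  · exact extendFrom_eq (ofReal_mem_closure_upper E) (hb E hE)

lemma exp_mem_upperClosed {z : ℂ} (h0 : 0 ≤ z.im) (h1 : z.im ≤ Real.pi) :
    Complex.exp z ∈ upperClosed := by
  refine ⟨?_, Complex.exp_ne_zero z⟩
  rw [Complex.exp_im]
  exact mul_nonneg (Real.exp_pos _).le (Real.sin_nonneg_of_nonneg_of_le_pi h0 h1)

lemma log_mem_ball_of_dist {w : ℂ} (h : dist w 1 < 1) : w ∈ slitPlane := by
  have := Complex.mem_slitPlane_of_norm_lt_one (z := w - 1) (by simpa [dist_eq_norm] using h)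
  simpa using this

/-- The winding of a nonvanishing function along the boundary of the upper half plane. -/
theorem exists_boundary_argument {F : ℂ → ℂ} {Fb : ℝ → ℂ} (hF : ContinuousOn F upper)
    (h0 : ∀ ω ∈ upper, F ω ≠ 0)
    (hb : ∀ E : ℝ, E ≠ 0 → Tendsto F (𝓝[upper] (E : ℂ)) (𝓝 (Fb E)))
    (hb0 : ∀ E : ℝ, E ≠ 0 → Fb E ≠ 0)
    {c : ℂ} (hc : c ≠ 0) (hinf : Tendsto F (Bornology.cobounded ℂ ⊓ 𝓟 upper) (𝓝 c))
    {h : ℝ → ℝ} (hh : ∀ r, 0 < r → 0 < h r) (hhc : ContinuousOn h (Set.Ioi 0)) {e : ℝ} {c' : ℂ}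
    (hc' : c' ≠ 0) (hzero : Tendsto (fun ω => F ω * h ‖ω‖ * Complex.exp (-(I * e * arg ω)))
      (𝓝[upper] 0) (𝓝 c')) :
    ∃ l : ℝ → ℝ, ContinuousOn l {0}ᶜ ∧
      (∀ E : ℝ, E ≠ 0 → Fb E = ‖Fb E‖ * Complex.exp (I * l E)) ∧
      ∃ a b : ℝ, Tendsto l atTop (𝓝 a) ∧ Tendsto l atBot (𝓝 a) ∧
        Tendsto l (𝓝[>] 0) (𝓝 b) ∧ Tendsto l (𝓝[<] 0) (𝓝 (b + e * Real.pi)) := by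
  -- The closed half-plane without 0 is the image under exp of the strip 0 ≤ Im z ≤ π. A continuous
  -- logarithm `L` of G(exp z) on the strip gives the phase: Im L(log E) for E > 0 and Im L(log(-E)
  -- + πi) for E < 0. The limits follow by comparing `L` with principal logarithms at the two ends
  -- of the strip.
  obtain ⟨hGc, hGU, hGb⟩ := continuousOn_extendFrom_upper hF hb
  set G := extendFrom upper F with hGdef
  have hG0 : ∀ ω ∈ upperClosed, G ω ≠ 0 := by
    intro ω hω
    rcases hω.1.lt_or_eq with h | h
    · rw [hGU ω h]; exact h0 ω h
    · have he : ((ω.re : ℝ) : ℂ) = ω := Complex.ext rfl (by simpa using h)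
      have hne : ω.re ≠ 0 := fun h0 => hω.2 (by rw [← he, h0]; simp)
      rw [← he, hGb _ hne]; exact hb0 _ hne
  -- clamp to the strip
  let cl : ℂ → ℂ := fun z => (z.re : ℂ) + ((max 0 (min z.im Real.pi) : ℝ) : ℂ) * I
  have hclc : Continuous cl := by fun_prop
  have hclim : ∀ z, (cl z).im = max 0 (min z.im Real.pi) := fun z => by simp [cl]
  have hclmem : ∀ z, Complex.exp (cl z) ∈ upperClosed := fun z =>
    exp_mem_upperClosed (by rw [hclim]; exact le_max_left _ _)
      (by rw [hclim]; exact max_le Real.pi_pos.le (min_le_right _ _))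
  have hclid : ∀ z : ℂ, 0 ≤ z.im → z.im ≤ Real.pi → cl z = z := fun z h1 h2 => by
    apply Complex.ext <;> simp [cl, h1, h2]
  -- Clamping the imaginary part extends G(exp z) to the whole plane without zeros, so that the
  -- lifting theorem for simply connected open sets applies.
  have hgc : Continuous fun z => G (Complex.exp (cl z)) :=
    hGc.comp_continuous (by fun_prop) hclmem
  have hsc : IsSimplyConnected (Set.univ : Set ℂ) := by
    have : ContractibleSpace (Set.univ : Set ℂ) :=
      (convex_univ : Convex ℝ (Set.univ : Set ℂ)).contractibleSpace Set.univ_nonempty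
    exact SimplyConnectedSpace.ofContractible _
  obtain ⟨L, hLc, hL⟩ := Complex.exists_continuousOn_eqOn_exp_comp (U := (Set.univ : Set ℂ))
    hsc isOpen_univ hgc.continuousOn (by
      rintro ⟨z, -, hz⟩; exact hG0 _ (hclmem z) hz)
  have hLc : Continuous L := by simpa using hLc
  have hLS : ∀ z : ℂ, 0 ≤ z.im → z.im ≤ Real.pi → Complex.exp (L z) = G (Complex.exp z) :=
    fun z h1 h2 => by simpa [hclid z h1 h2] using hL (Set.mem_univ z)
  have hLp : ∀ x : ℝ, Complex.exp (L x) = G (Real.exp x) := fun x => by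
    rw [hLS x (by simp) (by simpa using Real.pi_pos.le)]; simp
  have hLn : ∀ x : ℝ, Complex.exp (L (x + Real.pi * I)) = G (-Real.exp x) := fun x => by
    rw [hLS _ (by simpa using Real.pi_pos.le) (by simp)]
    rw [Complex.exp_add, Complex.exp_pi_mul_I]; simp
  -- the limits on the closed half plane
  have hinf' : Tendsto G (Bornology.cobounded ℂ ⊓ 𝓟 upperClosed) (𝓝 c) :=
    tendsto_upperClosed_of_tendsto_upper (fun s hs => eventually_mem_nhds_cobounded hs) hGc
      (hinf.congr' (eventually_inf_principal.mpr (.of_forall fun ω hω => (hGU ω hω).symm)))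
  -- `Q` divides out the model behaviour at zero, of modulus 1/h and phase e·arg ω. What remains has
  -- a nonzero limit there.
  let Q : ℂ → ℂ := fun ω => G ω * h ‖ω‖ * Complex.exp (-(I * e * arg ω))
  have hQc : ContinuousOn Q upperClosed := by
    have h1 : ContinuousOn (fun ω : ℂ => h ‖ω‖) upperClosed :=
      hhc.comp continuous_norm.continuousOn fun ω hω => norm_pos_iff.mpr hω.2
    have h2 := continuousOn_arg_upperClosed
    exact (hGc.mul (Complex.continuous_ofReal.comp_continuousOn h1)).mul
      (Complex.continuous_exp.comp_continuousOn
        ((continuousOn_const.mul (Complex.continuous_ofReal.comp_continuousOn h2)).neg))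
  have hzero' : Tendsto Q (𝓝 0 ⊓ 𝓟 upperClosed) (𝓝 c') := by
    refine tendsto_upperClosed_of_tendsto_upper (fun s hs => eventually_eventually_nhds.mpr hs)
      hQc (hzero.congr' ?_)
    filter_upwards [self_mem_nhdsWithin] with ω hω
    simp only [Q, hGU ω hω]
  -- behaviour at infinity
  obtain ⟨κ₁, X₁, hκ₁⟩ : ∃ κ : ℂ, ∃ X : ℝ, ∀ z : ℂ, X ≤ z.re → 0 ≤ z.im → z.im ≤ Real.pi →
      L z = Complex.log (G (Complex.exp z) / c) + κ := by
    have h1 : ∀ᶠ ω in Bornology.cobounded ℂ, ω ∈ upperClosed → dist (G ω / c) 1 < 1 := by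
      have := (hinf'.div_const c)
      rw [div_self hc] at this
      exact eventually_inf_principal.mp (this.eventually (Metric.ball_mem_nhds 1 one_pos))
    obtain ⟨R, -, hR⟩ := (Metric.hasBasis_cobounded_compl_closedBall (0 : ℂ)).mem_iff.mp h1
    obtain ⟨X, hX⟩ : ∃ X : ℝ, R < Real.exp X := ⟨R, by linarith [Real.add_one_le_exp R]⟩
    have hd : ∀ z : ℂ, X ≤ z.re → 0 ≤ z.im → z.im ≤ Real.pi →
        G (Complex.exp z) / c ∈ slitPlane := fun z h1 h2 h3 =>
      log_mem_ball_of_dist (hR (by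
        simp only [Set.mem_compl_iff, Metric.mem_closedBall, dist_zero_right, not_le,
          Complex.norm_exp]
        exact hX.trans_le (Real.exp_le_exp.mpr h1)) (exp_mem_upperClosed h2 h3))
    let S : Set ℂ := {z | X ≤ z.re} ∩ ({z | 0 ≤ z.im} ∩ {z | z.im ≤ Real.pi})
    have hS : IsPreconnected S := ((convex_halfSpace_re_ge X).inter
      ((convex_halfSpace_im_ge 0).inter (convex_halfSpace_im_le _))).isPreconnected
    -- The difference of `L` and the principal logarithm of G/c is continuous on a convex half-strip
    -- and has constant exponential c, so it is a constant.
    have hMc : ContinuousOn (fun z => L z - Complex.log (G (Complex.exp z) / c)) S := by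
      refine hLc.continuousOn.sub (ContinuousOn.clog ((hGc.comp (by fun_prop) ?_).div_const c) ?_)
      · exact fun z hz => exp_mem_upperClosed hz.2.1 hz.2.2
      · exact fun z hz => hd z hz.1 hz.2.1 hz.2.2
    have hx0 : (X : ℂ) ∈ S := ⟨by simp, by simp, by simpa using Real.pi_pos.le⟩
    refine ⟨L X - Complex.log (G (Complex.exp X) / c), X, fun z h1 h2 h3 => ?_⟩
    have := eq_of_exp_eq_const (c := c) hS hMc (fun z hz => by
      rw [Complex.exp_sub, hLS z hz.2.1 hz.2.2, Complex.exp_log (Complex.slitPlane_ne_zero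
        (hd z hz.1 hz.2.1 hz.2.2))]
      field_simp [hG0 _ (exp_mem_upperClosed hz.2.1 hz.2.2)]) ⟨h1, h2, h3⟩ hx0
    rw [← this]; ring
  -- behaviour at zero
  obtain ⟨κ₀, X₀, hκ₀⟩ : ∃ κ : ℂ, ∃ X : ℝ, ∀ z : ℂ, z.re ≤ X → 0 ≤ z.im → z.im ≤ Real.pi →
      L z = Complex.log (Q (Complex.exp z) / c') + I * e * z.im - Real.log (h (Real.exp z.re))
        + κ := by
    have h1 : ∀ᶠ ω in 𝓝 (0 : ℂ), ω ∈ upperClosed → dist (Q ω / c') 1 < 1 := by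
      have := (hzero'.div_const c')
      rw [div_self hc'] at this
      exact eventually_inf_principal.mp (this.eventually (Metric.ball_mem_nhds 1 one_pos))
    obtain ⟨r, hr, hR⟩ := Metric.eventually_nhds_iff.mp h1
    obtain ⟨X, hX⟩ : ∃ X : ℝ, Real.exp X < r := ⟨Real.log (r / 2), by
      rw [Real.exp_log (by positivity)]; linarith⟩
    have hd : ∀ z : ℂ, z.re ≤ X → 0 ≤ z.im → z.im ≤ Real.pi →
        Q (Complex.exp z) / c' ∈ slitPlane := fun z h1 h2 h3 =>
      log_mem_ball_of_dist (hR (by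
        rw [dist_zero_right, Complex.norm_exp]
        exact (Real.exp_le_exp.mpr h1).trans_lt hX) (exp_mem_upperClosed h2 h3))
    let S : Set ℂ := {z | z.re ≤ X} ∩ ({z | 0 ≤ z.im} ∩ {z | z.im ≤ Real.pi})
    have hS : IsPreconnected S := ((convex_halfSpace_re_le X).inter
      ((convex_halfSpace_im_ge 0).inter (convex_halfSpace_im_le _))).isPreconnected
    -- The same argument with the model restored: on the strip arg(exp z) = Im z, and the
    -- exponential of the whole expression is c'.
    have hMc : ContinuousOn (fun z => L z - Complex.log (Q (Complex.exp z) / c')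
        - I * e * z.im + Real.log (h (Real.exp z.re))) S := by
      refine ((hLc.continuousOn.sub (ContinuousOn.clog ((hQc.comp (by fun_prop) ?_).div_const c')
        ?_)).sub (by fun_prop)).add (Complex.continuous_ofReal.comp_continuousOn
          (ContinuousOn.log (hhc.comp (by fun_prop) ?_) ?_))
      · exact fun z hz => exp_mem_upperClosed hz.2.1 hz.2.2
      · exact fun z hz => hd z hz.1 hz.2.1 hz.2.2
      · exact fun z hz => Real.exp_pos _
      · exact fun z hz => (hh _ (Real.exp_pos _)).ne'
    have hx0 : (X : ℂ) ∈ S := ⟨by simp, by simp, by simpa using Real.pi_pos.le⟩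
    refine ⟨L X - Complex.log (Q (Complex.exp X) / c') - I * e * (X : ℂ).im
      + Real.log (h (Real.exp (X : ℂ).re)), X, fun z h1 h2 h3 => ?_⟩
    have := eq_of_exp_eq_const (c := c') hS hMc (fun z hz => by
      have hpos := hh _ (Real.exp_pos z.re)
      rw [Complex.exp_add, Complex.exp_sub, Complex.exp_sub, hLS z hz.2.1 hz.2.2,
        Complex.exp_log (Complex.slitPlane_ne_zero (hd z hz.1 hz.2.1 hz.2.2)),
        ← Complex.ofReal_exp, Real.exp_log hpos]
      have harg : arg (Complex.exp z) = z.im := by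
        rw [← Complex.log_im, Complex.log_exp (by linarith [Real.pi_pos, show 0 ≤ z.im from hz.2.1]) hz.2.2]
      simp only [Q, harg, Complex.norm_exp, Complex.exp_neg]
      have e1 := hG0 _ (exp_mem_upperClosed hz.2.1 hz.2.2)
      have e2 : ((h (Real.exp z.re) : ℝ) : ℂ) ≠ 0 := by exact_mod_cast hpos.ne'
      have e3 := Complex.exp_ne_zero (I * e * z.im)
      field_simp) ⟨h1, h2, h3⟩ hx0
    rw [← this]; ring
  -- the phase
  let l : ℝ → ℝ := fun E =>
    if 0 < E then (L (Real.log E)).im else (L (Real.log (-E) + Real.pi * I)).im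
  have hlp : ∀ E, 0 < E → l E = (L (Real.log E)).im := fun E hE => by simp [l, hE]
  have hln : ∀ E, E < 0 → l E = (L (Real.log (-E) + Real.pi * I)).im := fun E hE => by
    simp [l, not_lt.mpr hE.le]
  have hlogp : ∀ E : ℝ, 0 < E → Complex.exp (Real.log E) = (E : ℂ) := fun E hE => by
    rw [← Complex.ofReal_exp, Real.exp_log hE]
  have hlogn : ∀ E : ℝ, E < 0 → Complex.exp (Real.log (-E) + Real.pi * I) = (E : ℂ) :=
    fun E hE => by
      rw [Complex.exp_add, Complex.exp_pi_mul_I, hlogp _ (by linarith)]; simp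
  have hpi0 : (0 : ℝ) ≤ Real.pi := Real.pi_pos.le
  have hlog0 : Tendsto (fun w : ℂ => Complex.log w) (𝓝 1) (𝓝 0) := by
    have := (continuousAt_clog (x := 1) (by simp)).tendsto
    rwa [Complex.log_one] at this
  have him0 : Tendsto (fun w : ℂ => (Complex.log w).im) (𝓝 1) (𝓝 0) :=
    (Complex.continuous_im.tendsto' 0 0 rfl).comp hlog0
  have hI : Tendsto (fun ω => (Complex.log (G ω / c)).im)
      (Bornology.cobounded ℂ ⊓ 𝓟 upperClosed) (𝓝 0) := by
    have := hinf'.div_const c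
    rw [div_self hc] at this
    exact him0.comp this
  have hZ : Tendsto (fun ω => (Complex.log (Q ω / c')).im) (𝓝 0 ⊓ 𝓟 upperClosed) (𝓝 0) := by
    have := hzero'.div_const c'
    rw [div_self hc'] at this
    exact him0.comp this
  refine ⟨l, ?_, ?_, κ₁.im, κ₀.im, ?_, ?_, ?_, ?_⟩
  · intro E hE
    rcases lt_or_gt_of_ne (show E ≠ 0 from hE) with h | h
    · have : ContinuousAt (fun E : ℝ => (L (Real.log (-E) + Real.pi * I)).im) E := by
        have : ContinuousAt (fun E : ℝ => Real.log (-E)) E :=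
          ContinuousAt.log (by fun_prop) (by linarith)
        fun_prop
      exact (this.congr ((eventually_lt_nhds h).mono fun x hx => (hln x hx).symm)).continuousWithinAt
    · have : ContinuousAt (fun E : ℝ => (L (Real.log E)).im) E := by
        have : ContinuousAt (fun E : ℝ => Real.log E) E := Real.continuousAt_log h.ne'
        fun_prop
      exact (this.congr ((eventually_gt_nhds h).mono fun x hx => (hlp x hx).symm)).continuousWithinAt
  · intro E hE
    have key : ∀ z : ℂ, Complex.exp z = ‖Complex.exp z‖ * Complex.exp (I * z.im) := fun z => by
      rw [Complex.norm_exp, Complex.ofReal_exp, ← Complex.exp_add]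
      congr 1
      conv_lhs => rw [← Complex.re_add_im z]
      ring
    rcases lt_or_gt_of_ne hE with h | h
    · have h2 := hLn (Real.log (-E))
      rw [Real.exp_log (by linarith)] at h2
      simp only [ofReal_neg, neg_neg] at h2
      rw [hln E h, ← hGb E hE, ← h2]; exact key _
    · have h2 := hLp (Real.log E)
      rw [Real.exp_log h] at h2
      rw [hlp E h, ← hGb E hE, ← h2]; exact key _
  · have := (hI.comp tendsto_ofReal_cobounded_atTop).add_const κ₁.im
    rw [zero_add] at this
    refine this.congr' ?_
    filter_upwards [eventually_gt_atTop 0, eventually_ge_atTop (Real.exp X₁)] with E hE hE2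
    rw [hlp E hE, hκ₁ _ (by
      simpa using (Real.le_log_iff_exp_le hE).mpr hE2) (by simp) (by simpa using hpi0),
      hlogp E hE]
    simp
  · have := (hI.comp tendsto_ofReal_cobounded_atBot).add_const κ₁.im
    rw [zero_add] at this
    refine this.congr' ?_
    filter_upwards [eventually_lt_atBot 0, eventually_le_atBot (-Real.exp X₁)] with E hE hE2
    rw [hln E hE, hκ₁ _ (by
      simpa using (Real.le_log_iff_exp_le (by linarith : 0 < -E)).mpr (by linarith))
      (by simpa using hpi0) (by simp), hlogn E hE]
    simp
  · have := (hZ.comp (tendsto_ofReal_nhds_zero (s := Set.Ioi 0) (by simp))).add_const κ₀.im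
    rw [zero_add] at this
    refine this.congr' ?_
    filter_upwards [self_mem_nhdsWithin, nhdsWithin_le_nhds (eventually_le_nhds
      (Real.exp_pos X₀))] with E hE hE2
    rw [hlp E hE, hκ₀ _ (by simpa using (Real.log_le_iff_le_exp hE).mpr hE2)
      (by simp) (by simpa using hpi0), hlogp E hE]
    simp
  -- Negative energies sit on the line Im z = π, where the model phase e·Im z contributes eπ.
  · have := (hZ.comp (tendsto_ofReal_nhds_zero (s := Set.Iio 0) (by simp))).add_const
      (κ₀.im + e * Real.pi)
    rw [zero_add] at this
    refine this.congr' ?_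
    filter_upwards [self_mem_nhdsWithin, nhdsWithin_le_nhds (eventually_ge_nhds
      (neg_neg_of_pos (Real.exp_pos X₀)))] with E hE hE2
    rw [hln E hE, hκ₀ _ (by
      simpa using (Real.log_le_iff_le_exp (by simpa using hE : 0 < -E)).mpr (by linarith))
      (by simpa using hpi0) (by simp), hlogn E hE]
    simp
    ring

/-! ### Phases -/

/-- Two phases of a nonvanishing function satisfy exp(2i(δ' - δ)) = 1, so on a preconnected set they
differ by a constant. One phase with limits therefore settles the matter for all. -/
lemma hasPhaseChange_of_phase {f : ℝ → ℂ} {J : Set ℝ} (hJ : IsPreconnected J) {lo hi : Filter ℝ}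
    (hlo : J ∈ lo) (hhi : J ∈ hi) (hf : ∀ E ∈ J, f E ≠ 0) {δ : ℝ → ℝ}
    (hδ : IsScatteringPhase f J δ) {a b : ℝ} (ha : Tendsto δ lo (𝓝 a)) (hb : Tendsto δ hi (𝓝 b)) :
    HasPhaseChange f J lo hi (b - a) := by
  refine ⟨⟨δ, hδ⟩, fun δ' hδ' => ?_⟩
  obtain ⟨k, hk⟩ : ∃ k : ℝ, ∀ E ∈ J, δ' E = δ E + k := by
    rcases J.eq_empty_or_nonempty with rfl | ⟨E₀, hE₀⟩
    · exact ⟨0, by simp⟩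
    refine ⟨δ' E₀ - δ E₀, fun E hE => ?_⟩
    have hc : ContinuousOn (fun E => 2 * I * ((δ' E : ℂ) - δ E)) J :=
      continuousOn_const.mul ((Complex.continuous_ofReal.comp_continuousOn hδ'.1).sub
        (Complex.continuous_ofReal.comp_continuousOn hδ.1))
    have h1 : ∀ E ∈ J, Complex.exp (2 * I * ((δ' E : ℂ) - δ E)) = 1 := by
      intro E hE
      have e1 := hδ.2 E hE
      have e2 := hδ'.2 E hE
      have hn : ((‖f E‖ : ℝ) : ℂ) ≠ 0 := by exact_mod_cast norm_ne_zero_iff.mpr (hf E hE)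
      rw [mul_sub, Complex.exp_sub, div_eq_one_iff_eq (Complex.exp_ne_zero _)]
      exact mul_left_cancel₀ hn (e2.symm.trans e1)
    have := eq_of_exp_eq_const hJ hc h1 hE hE₀
    have h2 : ((δ' E : ℂ) - δ E) = δ' E₀ - δ E₀ := by
      simpa using this
    have h3 : δ' E - δ E = δ' E₀ - δ E₀ := by exact_mod_cast h2
    linarith
  refine ⟨a + k, b + k, (ha.add_const k).congr' ?_, (hb.add_const k).congr' ?_, by ring⟩
  · filter_upwards [hlo] with E hE using (hk E hE).symm
  · filter_upwards [hhi] with E hE using (hk E hE).symm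

end SepScattering

/-! ### The phase of the ratio of lower and upper boundary values -/

namespace SepScattering

/-- The open lower half plane. -/
def lower : Set ℂ := {ω | ω.im < 0}

lemma isOpen_lower : IsOpen lower := isOpen_lt Complex.continuous_im continuous_const

lemma conj_mem_lower {ω : ℂ} (h : ω ∈ upper) : conj ω ∈ lower := by
  simpa [upper, lower] using h

lemma conj_mem_upper {ω : ℂ} (h : ω ∈ lower) : conj ω ∈ upper := by
  simpa [upper, lower] using h

lemma tendsto_conj_upper (z : ℂ) : Tendsto conj (𝓝[upper] z) (𝓝[lower] (conj z)) :=
  tendsto_nhdsWithin_iff.mpr ⟨(Complex.continuous_conj.tendsto z).mono_left nhdsWithin_le_nhds,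
    eventually_nhdsWithin_of_forall fun _ => conj_mem_lower⟩

lemma tendsto_conj_lower (z : ℂ) : Tendsto conj (𝓝[lower] z) (𝓝[upper] (conj z)) :=
  tendsto_nhdsWithin_iff.mpr ⟨(Complex.continuous_conj.tendsto z).mono_left nhdsWithin_le_nhds,
    eventually_nhdsWithin_of_forall fun _ => conj_mem_upper⟩

lemma tendsto_conj_cobounded : Tendsto conj (Bornology.cobounded ℂ) (Bornology.cobounded ℂ) := by
  rw [← tendsto_norm_atTop_iff_cobounded]
  simpa using tendsto_norm_cobounded_atTop (E := ℂ)

lemma tendsto_conj_cobounded_upper : Tendsto conj (Bornology.cobounded ℂ ⊓ 𝓟 upper)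
    (Bornology.cobounded ℂ ⊓ 𝓟 lower) :=
  tendsto_conj_cobounded.inf (tendsto_principal_principal.mpr fun _ => conj_mem_lower)

lemma tendsto_conj_cobounded_lower : Tendsto conj (Bornology.cobounded ℂ ⊓ 𝓟 lower)
    (Bornology.cobounded ℂ ⊓ 𝓟 upper) :=
  tendsto_conj_cobounded.inf (tendsto_principal_principal.mpr fun _ => conj_mem_upper)

instance nhdsWithin_lower_neBot (E : ℝ) : (𝓝[lower] (E : ℂ)).NeBot := by
  have := (tendsto_conj_upper E).neBot
  rwa [Complex.conj_ofReal] at this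

/-- The phase of the ratio of the lower and upper boundary values of a nonvanishing function. -/
theorem exists_phase_of_halfPlanes {F : ℂ → ℂ} {Fu Fl : ℝ → ℂ}
    (hFu : ContinuousOn F upper) (hFl : ContinuousOn F lower)
    (hu0 : ∀ ω ∈ upper, F ω ≠ 0) (hl0 : ∀ ω ∈ lower, F ω ≠ 0)
    (hbu : ∀ E : ℝ, E ≠ 0 → Tendsto F (𝓝[upper] (E : ℂ)) (𝓝 (Fu E)))
    (hbl : ∀ E : ℝ, E ≠ 0 → Tendsto F (𝓝[lower] (E : ℂ)) (𝓝 (Fl E)))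
    (hbu0 : ∀ E : ℝ, E ≠ 0 → Fu E ≠ 0) (hbl0 : ∀ E : ℝ, E ≠ 0 → Fl E ≠ 0)
    {c : ℂ} (hc : c ≠ 0) (hinfu : Tendsto F (Bornology.cobounded ℂ ⊓ 𝓟 upper) (𝓝 c))
    (hinfl : Tendsto F (Bornology.cobounded ℂ ⊓ 𝓟 lower) (𝓝 c))
    {h : ℝ → ℝ} (hh : ∀ r, 0 < r → 0 < h r) (hhc : ContinuousOn h (Set.Ioi 0)) {e : ℝ}
    {c₁ c₂ : ℂ} (hc₁ : c₁ ≠ 0) (hc₂ : c₂ ≠ 0)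
    (hzu : Tendsto (fun ω => F ω * h ‖ω‖ * Complex.exp (-(I * e * arg ω))) (𝓝[upper] 0) (𝓝 c₁))
    (hzl : Tendsto (fun ω => F ω * h ‖ω‖ * Complex.exp (-(I * e * arg ω))) (𝓝[lower] 0)
      (𝓝 c₂)) :
    ∃ δ : ℝ → ℝ, ContinuousOn δ {0}ᶜ ∧
      (∀ E : ℝ, E ≠ 0 → Fl E / Fu E = ‖Fl E / Fu E‖ * Complex.exp (2 * I * δ E)) ∧
      ∃ a b b' a' : ℝ, Tendsto δ atBot (𝓝 a) ∧ Tendsto δ (𝓝[<] 0) (𝓝 b) ∧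
        Tendsto δ (𝓝[>] 0) (𝓝 b') ∧ Tendsto δ atTop (𝓝 a') ∧
        (b - a) + (a' - b') = -(e * Real.pi) := by
  obtain ⟨l₁, h1c, h1, a₁, b₁, t1, t2, t3, t4⟩ :=
    exists_boundary_argument hFu hu0 hbu hbu0 hc hinfu hh hhc hc₁ hzu
  have hcc := Complex.continuous_conj
  -- The lower half-plane is reduced to the upper one by ω ↦ conj F(conj ω). Conjugation flips both
  -- the sign of i and that of arg, so the exponent `e` is unchanged.
  have hF' : ContinuousOn (fun ω => conj (F (conj ω))) upper :=
    hcc.comp_continuousOn (hFl.comp hcc.continuousOn fun ω => conj_mem_lower)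
  obtain ⟨l₂, h2c, h2, a₂, b₂, s1, s2, s3, s4⟩ :=
    exists_boundary_argument (F := fun ω => conj (F (conj ω))) (Fb := fun E => conj (Fl E)) hF'
      (fun ω hω => by simpa using hl0 _ (conj_mem_lower hω))
      (fun E hE => (hcc.tendsto _).comp ((hbl E hE).comp (by
        simpa using tendsto_conj_upper (E : ℂ))))
      (fun E hE => by simpa using hbl0 E hE) (c := conj c) (by simpa using hc)
      ((hcc.tendsto _).comp (hinfl.comp tendsto_conj_cobounded_upper)) hh hhc (e := e)
      (c' := conj c₂) (by simpa using hc₂) (by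
        have := (hcc.tendsto _).comp (hzl.comp (by simpa using tendsto_conj_upper (0 : ℂ)))
        refine this.congr' ?_
        filter_upwards [self_mem_nhdsWithin] with ω hω
        have harg : arg (conj ω) = -arg ω := by
          rw [Complex.arg_conj, if_neg]
          intro h
          have := Complex.arg_eq_pi_iff.mp h
          exact (ne_of_gt (show 0 < ω.im from hω)) this.2
        simp [harg, ← Complex.exp_conj])
  -- The conjugate of `Fl` has phase `l₂`, so Fl/Fu has phase -(l₁ + l₂) = 2δ. The limits at ±∞
  -- coincide and cancel; at zero each half-plane contributes -eπ/2.
  refine ⟨fun E => -(l₁ E + l₂ E) / 2, by fun_prop, fun E hE => ?_, _, _, _, _,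
    ((t2.add s2).neg.div_const 2), ((t4.add s4).neg.div_const 2), ((t3.add s3).neg.div_const 2),
    ((t1.add s1).neg.div_const 2), by ring⟩
  have e1 := h1 E hE
  have e2 : Fl E = ‖Fl E‖ * Complex.exp (-(I * l₂ E)) := by
    have := congrArg conj (h2 E hE)
    simpa [← Complex.exp_conj] using this
  have hu : ((‖Fu E‖ : ℝ) : ℂ) ≠ 0 := by exact_mod_cast norm_ne_zero_iff.mpr (hbu0 E hE)
  rw [norm_div]
  conv_lhs => rw [e1, e2]
  push_cast
  rw [show (2 * I * (-((l₁ E : ℂ) + l₂ E) / 2)) = -(I * l₂ E) - I * l₁ E by ring, Complex.exp_sub]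
  field_simp

/-! ### Zeros -/

lemma ofReal_mem_offContinuum {Rc : Set ℝ} {E : ℝ} (h0 : E ≠ 0) (h : E ∉ Rc) :
    (E : ℂ) ∈ offContinuum Rc := by
  rintro x hx hE
  have : E = x := by exact_mod_cast hE
  subst this
  rcases hx with rfl | hx
  · exact h0 rfl
  · exact h hx

lemma mem_offContinuum_of_im_ne {Rc : Set ℝ} {ω : ℂ} (h : ω.im ≠ 0) : ω ∈ offContinuum Rc := by
  rintro x - rfl
  simp at h

lemma offContinuum_eq (Rc : Set ℝ) :
    offContinuum Rc = ((fun x : ℝ => (x : ℂ)) '' (insert 0 Rc))ᶜ := by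
  ext ω
  simp only [offContinuum, Set.mem_ofPred_eq, Set.mem_compl_iff, Set.mem_image, not_exists, not_and]
  exact ⟨fun h x hx he => h x hx he.symm, fun h x hx he => h x hx he.symm⟩

lemma isOpen_offContinuum {Rc : Set ℝ} (h : IsClosed (insert 0 Rc)) : IsOpen (offContinuum Rc) := by
  rw [offContinuum_eq]
  exact (Complex.isometry_ofReal.isClosedEmbedding.isClosedMap _ h).isOpen_compl

lemma upper_subset_offContinuum (Rc : Set ℝ) : upper ⊆ offContinuum Rc := fun _ h =>
  mem_offContinuum_of_im_ne (ne_of_gt h)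

lemma lower_subset_offContinuum (Rc : Set ℝ) : lower ⊆ offContinuum Rc := fun _ h =>
  mem_offContinuum_of_im_ne (ne_of_lt h)

/-- The data of an analytic function on the complement of the continuum: boundary values on the
continuum, and behaviour at infinity and at zero. -/
structure HalfPlaneData (Rc : Set ℝ) (D : ℂ → ℂ) (Du Dl : ℝ → ℂ) (c : ℂ) (h : ℝ → ℝ) (e : ℝ)
    (c₁ c₂ : ℂ) : Prop where
  isOpen : IsOpen Rc
  zero_notMem : (0 : ℝ) ∉ Rc
  isClosed : IsClosed (insert 0 Rc)
  differentiableOn : DifferentiableOn ℂ D (offContinuum Rc)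
  tendsto_upper : ∀ E ∈ Rc, Tendsto D (𝓝[upper] (E : ℂ)) (𝓝 (Du E))
  tendsto_lower : ∀ E ∈ Rc, Tendsto D (𝓝[lower] (E : ℂ)) (𝓝 (Dl E))
  upper_ne_zero : ∀ E ∈ Rc, Du E ≠ 0
  lower_ne_zero : ∀ E ∈ Rc, Dl E ≠ 0
  c_ne_zero : c ≠ 0
  infty_upper : Tendsto D (Bornology.cobounded ℂ ⊓ 𝓟 upper) (𝓝 c)
  infty_lower : Tendsto D (Bornology.cobounded ℂ ⊓ 𝓟 lower) (𝓝 c)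
  h_pos : ∀ r, 0 < r → 0 < h r
  h_cont : ContinuousOn h (Set.Ioi 0)
  c₁_ne_zero : c₁ ≠ 0
  c₂_ne_zero : c₂ ≠ 0
  zero_upper : Tendsto (fun ω => D ω * h ‖ω‖ * Complex.exp (-(I * e * arg ω))) (𝓝[upper] 0) (𝓝 c₁)
  zero_lower : Tendsto (fun ω => D ω * h ‖ω‖ * Complex.exp (-(I * e * arg ω))) (𝓝[lower] 0) (𝓝 c₂)

namespace HalfPlaneData

variable {Rc : Set ℝ} {D : ℂ → ℂ} {Du Dl : ℝ → ℂ} {c : ℂ} {h : ℝ → ℝ} {e : ℝ} {c₁ c₂ : ℂ}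

/-- Nonvanishing on the half planes near a point of a well-behaved filter extends to the whole
domain. -/
lemma eventually_ne_of_halfPlanes (H : HalfPlaneData Rc D Du Dl c h e c₁ c₂) {l : Filter ℂ}
    (hl : ∀ s ∈ l, ∀ᶠ x in l, s ∈ 𝓝 x) {c₀ : ℂ} (hc₀ : c₀ ≠ 0) {k : ℂ → ℂ}
    (hk : ContinuousOn k upperClosed)
    (hu : Tendsto (fun ω => D ω * k ω) (l ⊓ 𝓟 upper) (𝓝 c₀)) {c₀' : ℂ} (hc₀' : c₀' ≠ 0)
    (hlo : Tendsto (fun ω => D ω * k ω) (l ⊓ 𝓟 lower) (𝓝 c₀')) :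
    ∀ᶠ ω in l, ω ∈ offContinuum Rc → D ω ≠ 0 := by
  obtain ⟨W, ⟨hW, hWc⟩, hWs⟩ := (closed_nhds_basis c₀).mem_iff.mp (isOpen_ne.mem_nhds hc₀)
  have h1 : ∀ᶠ ω in l, ω ∈ upper → D ω * k ω ∈ W := eventually_inf_principal.mp (hu hW)
  have h2 : ∀ᶠ ω in l, ω ∈ lower → D ω * k ω ≠ 0 :=
    eventually_inf_principal.mp (hlo (isOpen_ne.mem_nhds hc₀'))
  filter_upwards [h2, hl _ h1] with ω hω2 hω1 hΩ
  rcases lt_trichotomy ω.im 0 with hi | hi | hi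
  · exact left_ne_zero_of_mul (hω2 hi)
  -- A real point off the continuum is a limit of points of `upper`, and there D·k is continuous.
  -- Its value lies in the closed set `W`, which avoids 0.
  · have hcl : ω ∈ closure upper := by rw [closure_upper]; exact hi.ge
    have h0 : ω ≠ 0 := fun h0 => hΩ 0 (Set.mem_insert 0 Rc) (by simpa using h0)
    have : (𝓝[upper] ω).NeBot := mem_closure_iff_nhdsWithin_neBot.mp hcl
    have hD : Tendsto (fun z => D z * k z) (𝓝[upper] ω) (𝓝 (D ω * k ω)) :=
      (((H.differentiableOn.continuousOn ω hΩ).mono (upper_subset_offContinuum Rc)).mul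
        ((hk ω ⟨hi.ge, h0⟩).mono upper_subset_upperClosed))
    have := hWc.mem_of_tendsto hD (by
      filter_upwards [mem_nhdsWithin_of_mem_nhds hω1, self_mem_nhdsWithin] with y hy hyU
        using hy hyU)
    exact left_ne_zero_of_mul (hWs this)
  · exact left_ne_zero_of_mul (hWs (mem_of_mem_nhds hω1 hi))

end HalfPlaneData

end SepScattering

/-! ### Dividing out the zeros, and the argument principle -/

namespace SepScattering

lemma continuousOn_zero_factor {h : ℝ → ℝ} (hhc : ContinuousOn h (Set.Ioi 0)) (e : ℝ) :
    ContinuousOn (fun ω : ℂ => (h ‖ω‖ : ℂ) * Complex.exp (-(I * e * arg ω))) upperClosed := by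
  have h1 : ContinuousOn (fun ω : ℂ => h ‖ω‖) upperClosed :=
    hhc.comp continuous_norm.continuousOn fun ω hω => norm_pos_iff.mpr hω.2
  exact (Complex.continuous_ofReal.comp_continuousOn h1).mul
    (Complex.continuous_exp.comp_continuousOn ((continuousOn_const.mul
      (Complex.continuous_ofReal.comp_continuousOn continuousOn_arg_upperClosed)).neg))

lemma convex_lower : Convex ℝ lower := convex_halfSpace_im_lt 0

/-- An analytic function near the closure of a finite set of zeros of finite order is a polynomial
times a continuous function which does not vanish there. -/
lemma exists_factor_zeros {f : ℂ → ℂ} {Ω : Set ℂ} (hf : AnalyticOnNhd ℂ f Ω)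
    (Z : Finset ℂ) (hZ : ∀ z, z ∈ Z ↔ z ∈ Ω ∧ f z = 0)
    (hord : ∀ z ∈ Z, analyticOrderAt f z ≠ ⊤) :
    ∃ G : ℂ → ℂ, ContinuousOn G Ω ∧ (∀ ω ∈ Ω, G ω ≠ 0) ∧
      (∀ ω ∈ Ω, f ω = (∏ z ∈ Z, (ω - z) ^ analyticOrderNatAt f z) * G ω) := by
  classical
  have hloc : ∀ z ∈ Z, ∃ g : ℂ → ℂ, AnalyticAt ℂ g z ∧ g z ≠ 0 ∧
      ∀ᶠ w in 𝓝 z, f w = (w - z) ^ analyticOrderNatAt f z * g w := fun z hz => by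
    obtain ⟨g, h1, h2, h3⟩ := (hf z ((hZ z).mp hz).1).analyticOrderAt_ne_top.mp (hord z hz)
    refine ⟨g, h1, h2, ?_⟩
    filter_upwards [h3] with w hw
    simpa using hw
  choose! g hga hg0 hgf using hloc
  let P : Finset ℂ → ℂ → ℂ := fun S ω => ∏ z ∈ S, (ω - z) ^ analyticOrderNatAt f z
  have hPc : ∀ S, Continuous (P S) := fun S => by fun_prop
  have hP0 : ∀ S ω, ω ∉ S → P S ω ≠ 0 := fun S ω h =>
    Finset.prod_ne_zero_iff.mpr fun z hz => pow_ne_zero _ (sub_ne_zero.mpr fun e => h (e ▸ hz))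
  have hPe : ∀ z ∈ Z, ∀ ω, P Z ω = (ω - z) ^ analyticOrderNatAt f z * P (Z.erase z) ω :=
    fun z hz ω => (Finset.mul_prod_erase Z _ hz).symm
  -- At a zero the quotient is given by the local cofactor `g`, divided by the factors belonging to
  -- the other zeros.
  let G : ℂ → ℂ := fun ω => if ω ∈ Z then g ω ω / P (Z.erase ω) ω else f ω / P Z ω
  have hGz : ∀ z ∈ Z, ∀ᶠ w in 𝓝 z, G w = g z w / P (Z.erase z) w := by
    intro z hz
    have h1 : ∀ᶠ w in 𝓝 z, w ∉ Z.erase z :=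
      (Z.erase z).finite_toSet.isClosed.isOpen_compl.mem_nhds (by simp)
    filter_upwards [hgf z hz, h1] with w hw hw1
    by_cases hwz : w = z
    · subst hwz; simp [G, hz]
    · have hwZ : w ∉ Z := fun h => hw1 (Finset.mem_erase.mpr ⟨hwz, h⟩)
      have h2 : (w - z) ^ analyticOrderNatAt f z ≠ 0 := pow_ne_zero _ (sub_ne_zero.mpr hwz)
      simp only [G, hwZ, if_false]
      rw [hPe z hz, hw, mul_div_mul_left _ _ h2]
  refine ⟨G, fun ω hω => ContinuousAt.continuousWithinAt ?_, fun ω hω => ?_, fun ω hω => ?_⟩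
  · by_cases hz : ω ∈ Z
    · exact ContinuousAt.congr ((hga ω hz).continuousAt.div (hPc _).continuousAt
        (hP0 _ _ (by simp))) ((hGz ω hz).mono fun w hw => hw.symm)
    · have h1 : ∀ᶠ w in 𝓝 ω, w ∉ Z := Z.finite_toSet.isClosed.isOpen_compl.mem_nhds hz
      exact ContinuousAt.congr ((hf ω hω).continuousAt.div (hPc Z).continuousAt (hP0 _ _ hz))
        (h1.mono fun w hw => by simp [G, hw])
  · by_cases hz : ω ∈ Z
    · simpa [G, hz] using ⟨hg0 ω hz, hP0 (Z.erase ω) ω (by simp)⟩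
    · have : f ω ≠ 0 := fun h => hz ((hZ ω).mpr ⟨hω, h⟩)
      simpa [G, hz] using ⟨this, hP0 Z ω hz⟩
  · by_cases hz : ω ∈ Z
    · have := (hgf ω hz).self_of_nhds
      rw [(hGz ω hz).self_of_nhds]
      change f ω = P Z ω * _
      rw [hPe ω hz, this]
      field_simp [hP0 (Z.erase ω) ω (by simp)]
    · simp only [G, hz, if_false]
      exact (mul_div_cancel₀ _ (hP0 Z ω hz)).symm

namespace HalfPlaneData

variable {Rc : Set ℝ} {D : ℂ → ℂ} {Du Dl : ℝ → ℂ} {c : ℂ} {h : ℝ → ℝ} {e : ℝ} {c₁ c₂ : ℂ}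

lemma analyticOnNhd (H : HalfPlaneData Rc D Du Dl c h e c₁ c₂) :
    AnalyticOnNhd ℂ D (offContinuum Rc) :=
  H.differentiableOn.analyticOnNhd (isOpen_offContinuum H.isClosed)

/-- By the identity theorem, vanishing near one point would force `D` to vanish on a whole
half-plane, contrary to its nonzero limit at infinity. A point with Im z ≥ 0 is approached from
`upper`. -/
lemma not_eventually_zero (H : HalfPlaneData Rc D Du Dl c h e c₁ c₂) {z : ℂ} :
    ¬ ∀ᶠ w in 𝓝 z, D w = 0 := by
  have main : ∀ {A : Set ℂ}, IsOpen A → Convex ℝ A → A ⊆ offContinuum Rc →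
      Tendsto D (Bornology.cobounded ℂ ⊓ 𝓟 A) (𝓝 c) → (Bornology.cobounded ℂ ⊓ 𝓟 A).NeBot →
      ∀ z ∈ A, ¬ ∀ᶠ w in 𝓝 z, D w = 0 := by
    intro A _ hAc hA hlim hne z hz hev
    have h0 := (H.analyticOnNhd.mono hA).eqOn_zero_of_preconnected_of_eventuallyEq_zero
      hAc.isPreconnected hz hev
    have : Tendsto D (Bornology.cobounded ℂ ⊓ 𝓟 A) (𝓝 0) :=
      tendsto_const_nhds.congr' (eventually_inf_principal.mpr
        (.of_forall fun w hw => (h0 hw).symm))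
    exact H.c_ne_zero (tendsto_nhds_unique hlim this)
  have hneu : (Bornology.cobounded ℂ ⊓ 𝓟 upper).NeBot := by
    have : Tendsto (fun x : ℝ => (x : ℂ) * I) atTop (Bornology.cobounded ℂ ⊓ 𝓟 upper) := by
      refine tendsto_inf.mpr ⟨?_, tendsto_principal.mpr ?_⟩
      · rw [← tendsto_norm_atTop_iff_cobounded]
        simpa using tendsto_abs_atTop_atTop
      · filter_upwards [eventually_gt_atTop 0] with x hx
        simpa [upper] using hx
    exact this.neBot
  have hnel : (Bornology.cobounded ℂ ⊓ 𝓟 lower).NeBot := tendsto_conj_cobounded_upper.neBot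
  intro hev
  rcases lt_or_ge z.im 0 with hi | hi
  · exact main isOpen_lower convex_lower (lower_subset_offContinuum Rc) H.infty_lower hnel z hi hev
  · have hcl : z ∈ closure upper := by rw [closure_upper]; exact hi
    obtain ⟨w, hw, hwU⟩ := mem_closure_iff_nhds.mp hcl _ (eventually_eventually_nhds.mpr hev)
    exact main isOpen_upper convex_upper (upper_subset_offContinuum Rc) H.infty_upper hneu w hwU hw

/-- The zeros of `D` off the continuum are finitely many. -/
lemma finite_zeros (H : HalfPlaneData Rc D Du Dl c h e c₁ c₂) :
    {ω | ω ∈ offContinuum Rc ∧ D ω = 0}.Finite := by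
  by_contra hinf
  have h1 := H.eventually_ne_of_halfPlanes (l := Bornology.cobounded ℂ)
    (fun s hs => eventually_mem_nhds_cobounded hs) H.c_ne_zero (k := fun _ => 1)
    continuousOn_const (by simpa using H.infty_upper) H.c_ne_zero (by simpa using H.infty_lower)
  obtain ⟨R, -, hR⟩ := (Metric.hasBasis_cobounded_compl_closedBall (0 : ℂ)).mem_iff.mp h1
  have hsub : {ω | ω ∈ offContinuum Rc ∧ D ω = 0} ⊆ Metric.closedBall 0 R := fun ω hω => by
    by_contra hc
    exact hR hc hω.1 hω.2
  -- Infinitely many zeros in a ball would accumulate. Off the continuum zeros are isolated; near 0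
  -- the rescaled limits are nonzero; near a point of `Rc` the boundary values are nonzero and the
  -- real points are not in the domain.
  obtain ⟨z, -, hz⟩ := Set.Infinite.exists_accPt_of_subset_isCompact hinf
    (isCompact_closedBall (0 : ℂ) R) hsub
  rw [accPt_iff_frequently_nhdsNE] at hz
  refine hz ?_
  by_cases hzΩ : z ∈ offContinuum Rc
  · rcases (H.analyticOnNhd z hzΩ).eventually_eq_zero_or_eventually_ne_zero with h' | h'
    · exact absurd h' H.not_eventually_zero
    · exact h'.mono fun w hw hw' => hw hw'.2
  · have : ∃ x ∈ insert 0 Rc, z = ((x : ℝ) : ℂ) := by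
      by_contra hcon
      push Not at hcon
      exact hzΩ hcon
    obtain ⟨x, hx, rfl⟩ := this
    refine nhdsWithin_le_nhds ?_
    rcases hx with rfl | hx
    · rw [Complex.ofReal_zero]
      have h2 := H.eventually_ne_of_halfPlanes (l := 𝓝 0)
        (fun s hs => eventually_eventually_nhds.mpr hs) H.c₁_ne_zero
        (continuousOn_zero_factor H.h_cont e)
        (by simpa only [mul_assoc, nhdsWithin] using H.zero_upper) H.c₂_ne_zero
        (by simpa only [mul_assoc, nhdsWithin] using H.zero_lower)
      filter_upwards [h2] with w hw hw'
      exact hw hw'.1 hw'.2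
    · obtain ⟨ε, hε, hεR⟩ := Metric.isOpen_iff.mp H.isOpen x hx
      have hb : ∀ᶠ w in 𝓝 (x : ℂ), w.re ∈ Rc := by
        have : Tendsto Complex.re (𝓝 (x : ℂ)) (𝓝 x) := Complex.continuous_re.tendsto' _ _ (by simp)
        exact this (H.isOpen.mem_nhds hx)
      have hu : ∀ᶠ w in 𝓝 (x : ℂ), w ∈ upper → D w ≠ 0 :=
        eventually_nhdsWithin_iff.mp ((H.tendsto_upper x hx).eventually_ne (H.upper_ne_zero x hx))
      have hl : ∀ᶠ w in 𝓝 (x : ℂ), w ∈ lower → D w ≠ 0 :=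
        eventually_nhdsWithin_iff.mp ((H.tendsto_lower x hx).eventually_ne (H.lower_ne_zero x hx))
      filter_upwards [hb, hu, hl] with w hwb hwu hwl hw
      rcases lt_trichotomy w.im 0 with hi | hi | hi
      · exact hwl hi hw.2
      · exact hw.1 w.re (Or.inr hwb) (Complex.ext rfl (by simpa using hi))
      · exact hwu hi hw.2

/-- Used to divide out the zeros without changing the limit at infinity: the compensating power of ω
moves all their winding to the origin. -/
lemma tendsto_div_prod (Z : Finset ℂ) (p : ℂ → ℕ) :
    Tendsto (fun ω : ℂ => ω ^ (∑ z ∈ Z, p z) / ∏ z ∈ Z, (ω - z) ^ p z)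
      (Bornology.cobounded ℂ) (𝓝 1) := by
  have h1 : ∀ z : ℂ, Tendsto (fun ω : ℂ => ω / (ω - z)) (Bornology.cobounded ℂ) (𝓝 1) := by
    intro z
    have h2 : Tendsto (fun ω : ℂ => 1 - z * ω⁻¹) (Bornology.cobounded ℂ) (𝓝 1) := by
      simpa using (tendsto_const_nhds (x := (1 : ℂ))).sub
        (tendsto_inv₀_cobounded.const_mul z)
    have h3 := h2.inv₀ one_ne_zero
    rw [inv_one] at h3
    refine h3.congr' ?_
    have : ∀ᶠ ω in Bornology.cobounded ℂ, ω ≠ 0 := by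
      filter_upwards [(tendsto_norm_cobounded_atTop (E := ℂ)).eventually_gt_atTop 0] with ω hω
        using norm_pos_iff.mp hω
    filter_upwards [this] with ω hω
    rw [← inv_div]; congr 1; field_simp
  have h2 : Tendsto (fun ω : ℂ => ∏ z ∈ Z, (ω / (ω - z)) ^ p z) (Bornology.cobounded ℂ)
      (𝓝 (∏ z ∈ Z, (1 : ℂ) ^ p z)) := tendsto_finsetProd Z fun z _ => (h1 z).pow (p z)
  simp only [one_pow, Finset.prod_const_one, div_pow, Finset.prod_div_distrib,
    Finset.prod_pow_eq_pow_sum] at h2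
  exact h2

/-- **Levinson's theorem** for analytic functions off the continuum: the phase of the ratio of the
boundary values counts the zeros. -/
theorem exists_phase (H : HalfPlaneData Rc D Du Dl c h e c₁ c₂) (Z : Finset ℂ)
    (hZ : ∀ z, z ∈ Z ↔ z ∈ offContinuum Rc ∧ D z = 0) :
    ∃ δ : ℝ → ℝ, ContinuousOn δ {0}ᶜ ∧
      (∀ E ∈ Rc, Dl E / Du E = ‖Dl E / Du E‖ * Complex.exp (2 * I * δ E)) ∧
      (∀ E : ℝ, E ≠ 0 → E ∉ Rc → Complex.exp (2 * I * δ E) = 1) ∧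
      ∃ a b b' a' : ℝ, Tendsto δ atBot (𝓝 a) ∧ Tendsto δ (𝓝[<] 0) (𝓝 b) ∧
        Tendsto δ (𝓝[>] 0) (𝓝 b') ∧ Tendsto δ atTop (𝓝 a') ∧
        (b - a) + (a' - b') = -((e + ∑ z ∈ Z, analyticOrderNatAt D z) * Real.pi) := by
  classical
  have hΩo := isOpen_offContinuum H.isClosed
  obtain ⟨G, hGc, hG0, hG⟩ := exists_factor_zeros H.analyticOnNhd Z hZ fun z _ => by
    rw [Ne, analyticOrderAt_eq_top]; exact H.not_eventually_zero
  set p := analyticOrderNatAt D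
  set N := ∑ z ∈ Z, p z with hN
  set P : ℂ → ℂ := fun ω => ∏ z ∈ Z, (ω - z) ^ p z with hP
  have hPc : Continuous P := by fun_prop
  have hP0 : ∀ ω, ω ∉ Z → P ω ≠ 0 := fun ω h =>
    Finset.prod_ne_zero_iff.mpr fun z hz => pow_ne_zero _ (sub_ne_zero.mpr fun e => h (e ▸ hz))
  have hzero : (0 : ℂ) ∉ Z := fun h => ((hZ 0).mp h).1 0 (Set.mem_insert _ _) (by simp)
  have hRcZ : ∀ E ∈ Rc, (E : ℂ) ∉ Z := fun E hE h =>
    ((hZ _).mp h).1 E (Set.mem_insert_of_mem _ hE) rfl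
  have hΩ0 : ∀ ω ∈ offContinuum Rc, ω ≠ 0 := fun ω hω h0 =>
    hω 0 (Set.mem_insert _ _) (by simpa using h0)
  -- F = D·ω^N/∏(ω-z)^p(z) has no zeros in the domain and the same limit as D at infinity, while the
  -- exponent at zero becomes e + N. The extra factor is continuous across `Rc`, so it cancels in
  -- the ratio of the boundary values.
  let F : ℂ → ℂ := fun ω => G ω * ω ^ N
  have hFc : ContinuousOn F (offContinuum Rc) := hGc.mul (by fun_prop)
  have hF0 : ∀ ω ∈ offContinuum Rc, F ω ≠ 0 := fun ω hω =>
    mul_ne_zero (hG0 ω hω) (pow_ne_zero _ (hΩ0 ω hω))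
  have hFD : ∀ ω ∈ offContinuum Rc, ω ∉ Z → F ω = D ω * (ω ^ N / P ω) := fun ω hω hz => by
    have := hP0 ω hz
    have hG' : D ω = P ω * G ω := hG ω hω
    simp only [F]
    rw [hG']
    field_simp
  have hnotZ : ∀ z ∉ Z, ∀ᶠ w in 𝓝 z, w ∉ Z := fun z hz =>
    Z.finite_toSet.isClosed.isOpen_compl.mem_nhds hz
  -- Off `Rc` the two boundary values of `F` coincide, so their ratio is 1 there.
  let B : (ℝ → ℂ) → ℝ → ℂ := fun b E => if E ∈ Rc then b E * ((E : ℂ) ^ N / P E) else F E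
  have hbd : ∀ {A : Set ℂ}, A ⊆ offContinuum Rc → ∀ {b : ℝ → ℂ},
      (∀ E ∈ Rc, Tendsto D (𝓝[A] (E : ℂ)) (𝓝 (b E))) →
      ∀ E : ℝ, E ≠ 0 → Tendsto F (𝓝[A] (E : ℂ)) (𝓝 (B b E)) := by
    intro A hA b hb E hE
    by_cases hER : E ∈ Rc
    · simp only [B, hER, if_true]
      have h1 : Tendsto (fun ω : ℂ => ω ^ N / P ω) (𝓝[A] (E : ℂ)) (𝓝 ((E : ℂ) ^ N / P E)) :=
        ((continuous_pow N).continuousAt.div hPc.continuousAt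
          (hP0 _ (hRcZ E hER))).tendsto.mono_left nhdsWithin_le_nhds
      refine ((hb E hER).mul h1).congr' ?_
      filter_upwards [self_mem_nhdsWithin, nhdsWithin_le_nhds (hnotZ _ (hRcZ E hER))] with ω hω hωZ
        using (hFD ω (hA hω) hωZ).symm
    · simp only [B, hER, if_false]
      exact (hFc _ (ofReal_mem_offContinuum hE hER)).mono hA
  have hB0 : ∀ {b : ℝ → ℂ}, (∀ E ∈ Rc, b E ≠ 0) → ∀ E : ℝ, E ≠ 0 → B b E ≠ 0 := by
    intro b hb E hE
    by_cases hER : E ∈ Rc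
    · simp only [B, hER, if_true]
      exact mul_ne_zero (hb E hER) (div_ne_zero (pow_ne_zero _ (by exact_mod_cast hE))
        (hP0 _ (hRcZ E hER)))
    · simp only [B, hER, if_false]
      exact hF0 _ (ofReal_mem_offContinuum hE hER)
  have hinf : ∀ {A : Set ℂ}, A ⊆ offContinuum Rc →
      Tendsto D (Bornology.cobounded ℂ ⊓ 𝓟 A) (𝓝 c) →
      Tendsto F (Bornology.cobounded ℂ ⊓ 𝓟 A) (𝓝 c) := by
    intro A hA hD
    have h1 := hD.mul ((tendsto_div_prod Z p).mono_left
      (inf_le_left : Bornology.cobounded ℂ ⊓ 𝓟 A ≤ _))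
    rw [mul_one] at h1
    refine h1.congr' ?_
    have hZb : ∀ᶠ ω in Bornology.cobounded ℂ, ω ∉ Z := by
      exact Bornology.isBounded_def.mp Z.finite_toSet.isBounded
    filter_upwards [hZb.filter_mono inf_le_left, mem_inf_of_right (mem_principal_self A)]
      with ω hω hA' using (hFD ω (hA hA') hω).symm
  have hz : ∀ {A : Set ℂ}, A ⊆ offContinuum Rc → ∀ {c₀ : ℂ},
      Tendsto (fun ω => D ω * h ‖ω‖ * Complex.exp (-(I * e * arg ω))) (𝓝[A] 0) (𝓝 c₀) →
      Tendsto (fun ω => F ω * ((h ‖ω‖ / ‖ω‖ ^ N : ℝ) : ℂ) *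
        Complex.exp (-(I * ((e + N : ℝ) : ℂ) * arg ω))) (𝓝[A] 0) (𝓝 (c₀ / P 0)) := by
    intro A hA c₀ hD
    have h1 : Tendsto P (𝓝[A] 0) (𝓝 (P 0)) := (hPc.tendsto 0).mono_left nhdsWithin_le_nhds
    refine (hD.div h1 (hP0 0 hzero)).congr' ?_
    filter_upwards [self_mem_nhdsWithin, nhdsWithin_le_nhds (hnotZ _ hzero)] with ω hω hωZ
    have hω0 : ω ≠ 0 := hΩ0 ω (hA hω)
    have hn : ((‖ω‖ : ℝ) : ℂ) ≠ 0 := by exact_mod_cast norm_ne_zero_iff.mpr hω0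
    rw [hFD ω (hA hω) hωZ]
    have hpow : ω ^ N = (‖ω‖ : ℂ) ^ N * Complex.exp (I * N * arg ω) := by
      conv_lhs => rw [← Complex.norm_mul_exp_arg_mul_I ω]
      rw [mul_pow, ← Complex.exp_nat_mul]
      congr 2
      ring
    rw [hpow]
    push_cast
    rw [show -(I * ((e : ℂ) + N) * arg ω) = -(I * e * arg ω) - I * N * arg ω by ring,
      Complex.exp_sub]
    have := hP0 ω hωZ
    have := Complex.exp_ne_zero (I * N * arg ω)
    rw [Pi.div_apply]
    field_simp
  have hu := upper_subset_offContinuum Rc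
  have hl := lower_subset_offContinuum Rc
  obtain ⟨δ, hδc, hδ, hlim⟩ := exists_phase_of_halfPlanes (hFc.mono hu) (hFc.mono hl)
    (fun ω hω => hF0 ω (hu hω)) (fun ω hω => hF0 ω (hl hω)) (hbd hu H.tendsto_upper)
    (hbd hl H.tendsto_lower) (hB0 H.upper_ne_zero) (hB0 H.lower_ne_zero) H.c_ne_zero
    (hinf hu H.infty_upper) (hinf hl H.infty_lower) (h := fun r => h r / r ^ N)
    (fun r hr => div_pos (H.h_pos r hr) (pow_pos hr N))
    (H.h_cont.div (by fun_prop) fun r hr => pow_ne_zero _ (ne_of_gt hr)) (e := e + N)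
    (div_ne_zero H.c₁_ne_zero (hP0 0 hzero)) (div_ne_zero H.c₂_ne_zero (hP0 0 hzero))
    (hz hu H.zero_upper) (hz hl H.zero_lower)
  refine ⟨δ, hδc, fun E hE => ?_, fun E hE hER => ?_, ?_⟩
  · have hE0 : E ≠ 0 := fun h0 => H.zero_notMem (h0 ▸ hE)
    have hq : (E : ℂ) ^ N / P E ≠ 0 := div_ne_zero (pow_ne_zero _ (by exact_mod_cast hE0))
        (hP0 _ (hRcZ E hE))
    have := hδ E hE0
    simp only [B, hE, if_true] at this
    rwa [mul_div_mul_right _ _ hq] at this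
  · have := hδ E hE
    simp only [B, hER, if_false] at this
    rw [div_self (hF0 _ (ofReal_mem_offContinuum hE hER))] at this
    simpa using this.symm
  · simpa [hN] using hlim

end HalfPlaneData

end SepScattering

/-! ### The function K off the continuum, and bound-state energies -/

namespace SepScattering

/-- Off the continuum the distance to the spectrum grows linearly. -/
lemma exists_lower_bound_offContinuum {Rc : Set ℝ} (hc : IsClosed (insert 0 Rc)) {ω : ℂ}
    (hω : ω ∈ offContinuum Rc) :
    ∃ c > 0, ∀ᶠ ω' in 𝓝 ω, ∀ x ∈ insert 0 Rc, c * (1 + |x|) ≤ ‖((x : ℝ) : ℂ) - ω'‖ := by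
  obtain ⟨r, hr, hb⟩ := Metric.isOpen_iff.mp (isOpen_offContinuum hc) ω hω
  have hpos : 0 < 2 / r * (1 + ‖ω‖ + r) + 1 := by positivity
  -- If the ball of radius r around ω avoids the spectrum, then |x-ω'| ≥ r/2 and |x| ≤ |x-ω'| + |ω|
  -- + r. The constant 1 + |ω| + r is absorbed by the first bound at the price of the factor 2/r.
  refine ⟨(2 / r * (1 + ‖ω‖ + r) + 1)⁻¹, inv_pos.mpr hpos, ?_⟩
  filter_upwards [Metric.ball_mem_nhds ω (half_pos hr)] with ω' hω' x hx
  have h1 : r ≤ ‖(x : ℂ) - ω‖ := by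
    by_contra hc
    push Not at hc
    exact hb (by rwa [Metric.mem_ball, dist_eq_norm]) x hx rfl
  have h2 : ‖ω' - ω‖ < r / 2 := by rwa [Metric.mem_ball, dist_eq_norm] at hω'
  have h3 : ‖(x : ℂ) - ω‖ ≤ ‖(x : ℂ) - ω'‖ + ‖ω' - ω‖ := by
    have := norm_add_le ((x : ℂ) - ω') (ω' - ω); simpa using this
  have h4 : r / 2 ≤ ‖(x : ℂ) - ω'‖ := by linarith
  have h5 : |x| ≤ ‖(x : ℂ) - ω'‖ + ‖ω‖ + r := by
    have e1 : ‖(x : ℂ)‖ ≤ ‖(x : ℂ) - ω'‖ + ‖ω'‖ := by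
      have := norm_add_le ((x : ℂ) - ω') ω'; simpa using this
    have e2 : ‖ω'‖ ≤ ‖ω' - ω‖ + ‖ω‖ := by
      have := norm_add_le (ω' - ω) ω; simpa using this
    rw [Complex.norm_real, Real.norm_eq_abs] at e1
    linarith
  rw [inv_mul_le_iff₀ hpos]
  have h6 : (1 + ‖ω‖ + r) ≤ 2 / r * (1 + ‖ω‖ + r) * ‖(x : ℂ) - ω'‖ := by
    have e3 : 0 ≤ 2 / r * (1 + ‖ω‖ + r) := by positivity
    calc (1 + ‖ω‖ + r) = 2 / r * (1 + ‖ω‖ + r) * (r / 2) := by field_simp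
      _ ≤ _ := mul_le_mul_of_nonneg_left h4 e3
  linarith

section BoundStates

variable {V : Type*} [NormedAddCommGroup V] [InnerProductSpace ℝ V] [FiniteDimensional ℝ V]
  [MeasurableSpace V] [BorelSpace V]

/-- The standing assumptions on the dispersion relation and the form factor. -/
structure SeparableModel (ε : V → ℝ) (v : V → ℂ) (Rc : Set ℝ) : Prop where
  cont_ε : Continuous ε
  cont_v : Continuous v
  isClosed : IsClosed (insert 0 Rc)
  mem : ∀ k, ε k ∈ insert 0 Rc
  integrable : Integrable fun k => ‖v k‖ ^ 2 / (1 + |ε k|)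
  v_zero : v 0 = 1
  infinite : ∀ U ∈ 𝓝 (0 : V), (ε '' U).Infinite

/-- The function `v / (ε - ω)ʲ`. -/
noncomputable def resolventPow (ε : V → ℝ) (v : V → ℂ) (ω : ℂ) (j : ℕ) (k : V) : ℂ :=
  v k / ((ε k : ℂ) - ω) ^ j

/-- The integral of `v² / (ε - ω)ʲ`. -/
noncomputable def moment (ε : V → ℝ) (v : V → ℂ) (ω : ℂ) (j : ℕ) : ℂ :=
  ∫ k, v k ^ 2 / ((ε k : ℂ) - ω) ^ j

namespace SeparableModel

variable {ε : V → ℝ} {v : V → ℂ} {Rc : Set ℝ}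

lemma moment_one (ω : ℂ) : moment ε v ω 1 = -Ksep ε v ω := by
  rw [moment, Ksep, ← integral_neg]
  congr 1; ext k
  rw [pow_one, ← div_neg, neg_sub]

lemma exists_lower_bound (H : SeparableModel ε v Rc) {ω : ℂ} (hω : ω ∈ offContinuum Rc) :
    ∃ c > 0, ∀ᶠ ω' in 𝓝 ω, ∀ k, c * (1 + |ε k|) ≤ ‖(ε k : ℂ) - ω'‖ := by
  obtain ⟨c, hc, h⟩ := exists_lower_bound_offContinuum H.isClosed hω
  exact ⟨c, hc, h.mono fun _ h k => h _ (H.mem k)⟩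

lemma sub_ne_zero (H : SeparableModel ε v Rc) {ω : ℂ} (hω : ω ∈ offContinuum Rc) (k : V) :
    (ε k : ℂ) - ω ≠ 0 := fun h => hω (ε k) (H.mem k) (_root_.sub_eq_zero.mp h).symm

lemma continuous_resolventPow (H : SeparableModel ε v Rc) {ω : ℂ} (hω : ω ∈ offContinuum Rc)
    (j : ℕ) : Continuous (resolventPow ε v ω j) :=
  H.cont_v.div (((Complex.continuous_ofReal.comp H.cont_ε).sub continuous_const).pow j)
    fun k => pow_ne_zero _ (H.sub_ne_zero hω k)

omit [NormedAddCommGroup V] [InnerProductSpace ℝ V] [FiniteDimensional ℝ V] [MeasurableSpace V]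
  [BorelSpace V] in
/-- Domination of the integrands by `|v|² / (1 + |ε|)`. -/
lemma norm_sq_div_le {c : ℝ} (hc : 0 < c) {ω : ℂ} {k : V}
    (hk : c * (1 + |ε k|) ≤ ‖(ε k : ℂ) - ω‖) (j : ℕ) :
    ‖v k‖ ^ 2 / ‖(ε k : ℂ) - ω‖ ^ (j + 1) ≤ (c ^ (j + 1))⁻¹ * (‖v k‖ ^ 2 / (1 + |ε k|)) := by
  have h1 : (1 : ℝ) ≤ 1 + |ε k| := by linarith [abs_nonneg (ε k)]
  have h2 : c ^ (j + 1) * (1 + |ε k|) ≤ ‖(ε k : ℂ) - ω‖ ^ (j + 1) := by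
    calc c ^ (j + 1) * (1 + |ε k|) ≤ c ^ (j + 1) * (1 + |ε k|) ^ (j + 1) := by
          gcongr; exact le_self_pow₀ h1 (by simp)
      _ = (c * (1 + |ε k|)) ^ (j + 1) := (mul_pow _ _ _).symm
      _ ≤ _ := by gcongr
  calc ‖v k‖ ^ 2 / ‖(ε k : ℂ) - ω‖ ^ (j + 1) ≤ ‖v k‖ ^ 2 / (c ^ (j + 1) * (1 + |ε k|)) := by
        gcongr
    _ = _ := by field_simp

lemma integrable_sq_div (H : SeparableModel ε v Rc) {ω : ℂ} (hω : ω ∈ offContinuum Rc) {j : ℕ}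
    (hj : j ≠ 0) : Integrable fun k => v k ^ 2 / ((ε k : ℂ) - ω) ^ j := by
  obtain ⟨i, rfl⟩ := Nat.exists_eq_succ_of_ne_zero hj
  obtain ⟨c, hc, hb⟩ := H.exists_lower_bound hω
  have hb := hb.self_of_nhds
  refine (H.integrable.const_mul (c ^ (i + 1))⁻¹).mono' ?_ (.of_forall fun k => ?_)
  · exact ((H.cont_v.pow 2).div (((Complex.continuous_ofReal.comp H.cont_ε).sub
      continuous_const).pow _) fun k => pow_ne_zero _ (H.sub_ne_zero hω k)).aestronglyMeasurable
  · rw [norm_div, norm_pow, norm_pow]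
    exact norm_sq_div_le hc (hb k) i

lemma integrable_mul_resolventPow (H : SeparableModel ε v Rc) {ω : ℂ}
    (hω : ω ∈ offContinuum Rc) {j : ℕ} (hj : j ≠ 0) :
    Integrable fun k => v k * resolventPow ε v ω j k :=
  (H.integrable_sq_div hω hj).congr (.of_forall fun k => by simp only [resolventPow]; ring)

lemma integral_mul_resolventPow (ω : ℂ) (j : ℕ) :
    ∫ k, v k * resolventPow ε v ω j k = moment ε v ω j := by
  rw [moment]; congr 1; ext k; simp only [resolventPow]; ring

lemma memLp_resolventPow (H : SeparableModel ε v Rc) {ω : ℂ} (hω : ω ∈ offContinuum Rc) {j : ℕ}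
    (hj : j ≠ 0) : MemLp (resolventPow ε v ω j) 2 := by
  obtain ⟨i, rfl⟩ := Nat.exists_eq_succ_of_ne_zero hj
  obtain ⟨c, hc, hb⟩ := H.exists_lower_bound hω
  have hb := hb.self_of_nhds
  have hm := (H.continuous_resolventPow hω (i + 1)).aestronglyMeasurable (μ := volume)
  rw [memLp_two_iff_integrable_sq_norm hm]
  refine (H.integrable.const_mul (c ^ (2 * i + 1 + 1))⁻¹).mono' (hm.norm.pow 2)
    (.of_forall fun k => ?_)
  have := norm_sq_div_le (v := v) hc (hb k) (2 * i + 1)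
  rw [Real.norm_of_nonneg (by positivity)]
  simp only [resolventPow, norm_div, norm_pow, div_pow]
  rw [← pow_mul]
  convert this using 3
  ring

/-- Expansion of `g⁻¹ - K` around a point off the continuum. -/
lemma expansion (H : SeparableModel ε v Rc) (g : ℂ) {ω ω' : ℂ} (hω : ω ∈ offContinuum Rc)
    (hω' : ω' ∈ offContinuum Rc) (n : ℕ) :
    g⁻¹ - Ksep ε v ω' = g⁻¹ + ∑ i ∈ Finset.range n, (ω' - ω) ^ i * moment ε v ω (i + 1) +
      (ω' - ω) ^ n * ∫ k, v k ^ 2 / (((ε k : ℂ) - ω) ^ n * ((ε k : ℂ) - ω')) := by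
  have hint : ∀ n, Integrable fun k => v k ^ 2 / (((ε k : ℂ) - ω) ^ n * ((ε k : ℂ) - ω')) := by
    intro n
    obtain ⟨c, hc, hb⟩ := H.exists_lower_bound hω
    have hb := hb.self_of_nhds
    refine ((H.integrable_sq_div hω' one_ne_zero).norm.const_mul (c ^ n)⁻¹).mono' ?_
      (.of_forall fun k => ?_)
    · exact ((H.cont_v.pow 2).div ((((Complex.continuous_ofReal.comp H.cont_ε).sub
        continuous_const).pow _).mul ((Complex.continuous_ofReal.comp H.cont_ε).sub
        continuous_const)) fun k => mul_ne_zero (pow_ne_zero _ (H.sub_ne_zero hω k))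
          (H.sub_ne_zero hω' k)).aestronglyMeasurable
    · have h1 : c ^ n ≤ ‖(ε k : ℂ) - ω‖ ^ n := by
        gcongr
        exact le_trans (le_mul_of_one_le_right hc.le (by linarith [abs_nonneg (ε k)])) (hb k)
      rw [norm_div, norm_mul, norm_pow, norm_pow, norm_div, norm_pow, pow_one]
      rw [← div_div, div_right_comm, div_eq_inv_mul _ (‖(ε k : ℂ) - ω‖ ^ n)]
      gcongr
  induction n with
  | zero => simp [sub_eq_add_neg, ← moment_one, moment]
  | succ n ih =>
    rw [ih, Finset.sum_range_succ]
    -- The resolvent identity 1/(ε-ω') = 1/(ε-ω) + (ω'-ω)/((ε-ω)(ε-ω')), divided by (ε-ω)ⁿ.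
    have : ∫ k, v k ^ 2 / (((ε k : ℂ) - ω) ^ n * ((ε k : ℂ) - ω')) =
        moment ε v ω (n + 1) +
        (ω' - ω) * ∫ k, v k ^ 2 / (((ε k : ℂ) - ω) ^ (n + 1) * ((ε k : ℂ) - ω')) := by
      rw [moment, ← integral_const_mul, ← integral_add (H.integrable_sq_div hω (by simp))
        ((hint (n + 1)).const_mul _)]
      congr 1; ext k
      have h1 := H.sub_ne_zero hω k
      have h2 := H.sub_ne_zero hω' k
      field_simp
      ring
    rw [this]; ring

/-- Dominated convergence with the locally uniform lower bound on |ε-ω'|. This supplies both the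
derivative of K and the leading coefficient of g⁻¹ - K at a zero. -/
lemma tendsto_remainder (H : SeparableModel ε v Rc) {ω : ℂ} (hω : ω ∈ offContinuum Rc) (n : ℕ) :
    Tendsto (fun ω' => ∫ k, v k ^ 2 / (((ε k : ℂ) - ω) ^ n * ((ε k : ℂ) - ω'))) (𝓝 ω)
      (𝓝 (moment ε v ω (n + 1))) := by
  obtain ⟨c, hc, hb⟩ := H.exists_lower_bound hω
  have hb0 := hb.self_of_nhds
  have hΩ := (isOpen_offContinuum H.isClosed).mem_nhds hω
  have hce := Complex.continuous_ofReal.comp H.cont_ε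
  refine tendsto_integral_filter_of_dominated_convergence
    (fun k => (c ^ n * c)⁻¹ * (‖v k‖ ^ 2 / (1 + |ε k|))) ?_ ?_ (H.integrable.const_mul _) ?_
  · filter_upwards [hΩ] with ω' hω'
    exact ((H.cont_v.pow 2).div (((hce.sub continuous_const).pow _).mul (hce.sub
      continuous_const)) fun k => mul_ne_zero (pow_ne_zero _ (H.sub_ne_zero hω k))
          (H.sub_ne_zero hω' k)).aestronglyMeasurable
  · filter_upwards [hb] with ω' hω'
    refine .of_forall fun k => ?_
    have h1 : c ^ n ≤ ‖(ε k : ℂ) - ω‖ ^ n := by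
      gcongr
      exact le_trans (le_mul_of_one_le_right hc.le (by linarith [abs_nonneg (ε k)])) (hb0 k)
    rw [norm_div, norm_mul, norm_pow, norm_pow]
    have h0 : 0 < 1 + |ε k| := by linarith [abs_nonneg (ε k)]
    calc _ ≤ ‖v k‖ ^ 2 / (c ^ n * (c * (1 + |ε k|))) := by
          gcongr; exact hω' k
      _ = _ := by field_simp
  · refine .of_forall fun k => ?_
    have h1 := H.sub_ne_zero hω k
    have : ContinuousAt (fun ω' => v k ^ 2 / (((ε k : ℂ) - ω) ^ n * ((ε k : ℂ) - ω'))) ω :=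
      ContinuousAt.div (by fun_prop) (by fun_prop) (mul_ne_zero (pow_ne_zero _ h1) h1)
    simpa only [ContinuousAt, ← pow_succ] using this

/-- With n = 1 the expansion identifies the difference quotient with minus the remainder integral,
so the derivative is minus the second moment. -/
lemma differentiableOn_Ksep (H : SeparableModel ε v Rc) :
    DifferentiableOn ℂ (Ksep ε v) (offContinuum Rc) := by
  intro ω hω
  have hΩ := (isOpen_offContinuum H.isClosed).mem_nhds hω
  refine (HasDerivAt.differentiableAt (f' := -moment ε v ω 2) ?_).differentiableWithinAt
  rw [hasDerivAt_iff_tendsto_slope]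
  refine ((H.tendsto_remainder hω 1).neg.mono_left nhdsWithin_le_nhds).congr' ?_
  filter_upwards [self_mem_nhdsWithin, nhdsWithin_le_nhds hΩ] with ω' h1 h2
  have h3 := H.expansion 0 hω h2 1
  have h4 : ω' - ω ≠ 0 := _root_.sub_ne_zero.mpr h1
  simp only [inv_zero, zero_sub, zero_add, Finset.range_one, Finset.sum_singleton, pow_zero,
    one_mul, moment_one, pow_one] at h3
  rw [slope_def_field, eq_div_iff h4]
  simp only [pow_one]
  linear_combination h3

/-- The vanishing of moments at a zero of finite order. -/
lemma moment_of_order (H : SeparableModel ε v Rc) {g ω : ℂ} (hω : ω ∈ offContinuum Rc)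
    (h0 : g⁻¹ - Ksep ε v ω = 0)
    (hord : analyticOrderAt (fun ω => g⁻¹ - Ksep ε v ω) ω ≠ ⊤) :
    analyticOrderNatAt (fun ω => g⁻¹ - Ksep ε v ω) ω ≠ 0 ∧
    (∀ j, 2 ≤ j → j ≤ analyticOrderNatAt (fun ω => g⁻¹ - Ksep ε v ω) ω → moment ε v ω j = 0) ∧
    moment ε v ω (analyticOrderNatAt (fun ω => g⁻¹ - Ksep ε v ω) ω + 1) ≠ 0 := by
  set D : ℂ → ℂ := fun ω => g⁻¹ - Ksep ε v ω
  set p := analyticOrderNatAt D ω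
  have hΩ := (isOpen_offContinuum H.isClosed).mem_nhds hω
  have hD : AnalyticAt ℂ D ω :=
    ((H.differentiableOn_Ksep.const_sub _).analyticOnNhd (isOpen_offContinuum H.isClosed)) ω hω
  obtain ⟨G, hGa, hG0, hG⟩ := hD.analyticOrderAt_ne_top.mp hord
  have hp : p ≠ 0 := by
    intro hp
    have := hG.self_of_nhds
    change D ω = (ω - ω) ^ p • G ω at this
    rw [hp, pow_zero, one_smul] at this
    exact hG0 (this.symm.trans h0)
  have h1 : g⁻¹ + moment ε v ω 1 = 0 := by rw [moment_one]; linear_combination h0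
  -- the limit of `D / (ω' - ω)ⁿ`
  have hlim : ∀ n, n ≠ 0 → (∀ j, 2 ≤ j → j ≤ n → moment ε v ω j = 0) →
      Tendsto (fun ω' => D ω' / (ω' - ω) ^ n) (𝓝[≠] ω) (𝓝 (moment ε v ω (n + 1))) := by
    intro n hn hj
    refine ((H.tendsto_remainder hω n).mono_left nhdsWithin_le_nhds).congr' ?_
    filter_upwards [self_mem_nhdsWithin, nhdsWithin_le_nhds hΩ] with ω' h2 h3
    have h4 : ω' - ω ≠ 0 := _root_.sub_ne_zero.mpr h2
    have h5 : D ω' = _ := H.expansion g hω h3 n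
    obtain ⟨m, rfl⟩ := Nat.exists_eq_succ_of_ne_zero hn
    rw [Finset.sum_range_succ', Finset.sum_eq_zero] at h5
    · rw [h5, eq_div_iff (pow_ne_zero _ h4)]
      simp only [pow_zero, one_mul, zero_add]
      linear_combination -h1
    · intro i hi
      have := Finset.mem_range.mp hi
      rw [hj (i + 1 + 1) (by omega) (by omega), mul_zero]
  -- The same quotients computed from D = (ω'-ω)^p G. Comparison with `hlim`, by induction on n,
  -- kills the moments 2, ..., p and gives G(ω) ≠ 0 as the next one.
  have hlim' : ∀ n, n ≤ p → Tendsto (fun ω' => D ω' / (ω' - ω) ^ n) (𝓝[≠] ω)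
      (𝓝 (0 ^ (p - n) * G ω)) := by
    intro n hn
    have e1 : Tendsto (fun ω' => (ω' - ω) ^ (p - n) * G ω') (𝓝[≠] ω)
        (𝓝 ((ω - ω) ^ (p - n) * G ω)) := by
      have := hGa.continuousAt
      have : ContinuousAt (fun ω' => (ω' - ω) ^ (p - n) * G ω') ω := by fun_prop
      exact this.tendsto.mono_left nhdsWithin_le_nhds
    rw [_root_.sub_self] at e1
    refine e1.congr' ?_
    filter_upwards [self_mem_nhdsWithin, nhdsWithin_le_nhds hG] with ω' h2 h3
    have h4 : ω' - ω ≠ 0 := _root_.sub_ne_zero.mpr h2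
    rw [h3, eq_div_iff (pow_ne_zero _ h4), smul_eq_mul, mul_right_comm, ← pow_add]
    congr 2; omega
  have hz : ∀ j, 2 ≤ j → j ≤ p → moment ε v ω j = 0 := by
    intro j
    induction j using Nat.strong_induction_on with
    | _ j ih =>
      intro h2 hjp
      obtain ⟨m, rfl⟩ : ∃ m, j = m + 1 := ⟨j - 1, by omega⟩
      have e1 := hlim m (by omega) fun i hi him => ih i (by omega) hi (by omega)
      have e2 := hlim' m (by omega)
      rw [zero_pow (by omega), zero_mul] at e2
      exact tendsto_nhds_unique e1 e2
  refine ⟨hp, hz, ?_⟩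
  have e1 := hlim p hp hz
  have e2 := hlim' p le_rfl
  rw [Nat.sub_self, pow_zero, one_mul] at e2
  rw [tendsto_nhds_unique e1 e2]
  exact hG0

/-! ### The Lippmann-Schwinger equation and bound states -/

/-- For fixed k the equation makes T(k,·) a multiple of v. Integration against v/(ω-ε) leaves a
scalar linear equation with coefficient 1 - gK = g(g⁻¹ - K), uniquely solvable when g⁻¹ ≠ K. -/
theorem solvesLippmannSchwinger_iff (H : SeparableModel ε v Rc) {g : ℂ} (hg : g ≠ 0) {ω : ℂ}
    (hω : ω ∈ offContinuum Rc) (hD : g⁻¹ - Ksep ε v ω ≠ 0) (T : V → V → ℂ) :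
    SolvesLippmannSchwinger ε g v ω T ↔ T = Tsep ε g v ω := by
  have hint : Integrable fun k => v k ^ 2 / (ω - (ε k : ℂ)) :=
    (H.integrable_sq_div hω one_ne_zero).neg.congr (.of_forall fun k => by
      simp only [Pi.neg_apply, pow_one]; rw [← div_neg, neg_sub])
  have hrank : ∀ t : ℂ, ∀ k'', v k'' / (ω - (ε k'' : ℂ)) * (v k'' * t) =
      v k'' ^ 2 / (ω - (ε k'' : ℂ)) * t := fun t k'' => by ring
  have hg1 : g * (g⁻¹ - Ksep ε v ω) = 1 - g * Ksep ε v ω := by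
    rw [mul_sub, mul_inv_cancel₀ hg]
  constructor
  · intro h
    funext k k'
    obtain ⟨-, hk⟩ := h k
    set A := ∫ k'', v k'' / (ω - (ε k'' : ℂ)) * T k k'' with hA
    have hT : ∀ k', T k k' = v k' * (g * (v k + A)) := fun k' => by rw [hk k']; ring
    have hA' : A = Ksep ε v ω * (g * (v k + A)) := by
      conv_lhs => rw [hA]
      simp only [hT, hrank]
      rw [integral_mul_const]; rfl
    have : g * (v k + A) * (g⁻¹ - Ksep ε v ω) = v k := by
      rw [mul_right_comm, hg1]; linear_combination hA'
    rw [hT, Tsep, eq_div_iff hD, mul_assoc, this, mul_comm]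
  · rintro rfl k
    have hT : ∀ k', Tsep ε g v ω k k' = v k' * (v k / (g⁻¹ - Ksep ε v ω)) := fun k' => by
      rw [Tsep]; ring
    simp only [hT, hrank]
    refine ⟨hint.mul_const _, fun k' => ?_⟩
    rw [integral_mul_const]
    change _ = _ + g * v k' * (Ksep ε v ω * _)
    have hi := mul_inv_cancel₀ hD
    rw [div_eq_mul_inv]
    linear_combination (v k' * v k) * (g * hi - (g⁻¹ - Ksep ε v ω)⁻¹ * hg1)

lemma ae_eq_of_shifted_zero {g E : ℂ} {ψ : Lp ℂ 2 (volume : Measure V)}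
    (h : ShiftedHamiltonian ε g v E ψ 0) :
    ∀ᵐ k, ((ε k : ℂ) - E) * ψ k = -(g * v k * ∫ k', v k' * ψ k') := by
  filter_upwards [h.2, Lp.coeFn_zero ℂ 2 (volume : Measure V)] with k hk h0
  rw [h0] at hk
  simp only [Pi.zero_apply] at hk
  linear_combination hk

/-- Since ε-ω never vanishes, an eigenvector is -(g c) v/(ε-ω) with c = ∫ vψ. Here c ≠ 0, as
otherwise ψ = 0, and integration against v gives c(g⁻¹ - K) = 0. Conversely v/(ε-ω) is an
eigenvector; it is nonzero because g times its integral against v is -1. -/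
theorem isBoundStateEnergy_iff (H : SeparableModel ε v Rc) {g : ℂ} (hg : g ≠ 0) {ω : ℂ}
    (hω : ω ∈ offContinuum Rc) :
    IsBoundStateEnergy ε g v ω ↔ g⁻¹ - Ksep ε v ω = 0 := by
  have hmom : g⁻¹ - Ksep ε v ω = g⁻¹ + moment ε v ω 1 := by rw [moment_one]; ring
  rw [hmom]
  constructor
  · rintro ⟨ψ, hψ0, hψ⟩
    have h1 := ae_eq_of_shifted_zero hψ
    set c := ∫ k', v k' * ψ k' with hc
    have h2 : ∀ᵐ k, ψ k = -(g * c) * resolventPow ε v ω 1 k := by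
      filter_upwards [h1] with k hk
      have := H.sub_ne_zero hω k
      rw [resolventPow, pow_one]
      field_simp
      linear_combination hk
    have hc0 : c ≠ 0 := by
      intro h0
      refine hψ0 (Lp.eq_zero_iff_ae_eq_zero.mpr ?_)
      filter_upwards [h2] with k hk
      simp [hk, h0]
    have h3 : c = -(g * c) * moment ε v ω 1 := by
      rw [← integral_mul_resolventPow, ← integral_const_mul, hc]
      refine integral_congr_ae ?_
      filter_upwards [h2] with k hk
      rw [← hc, hk]; ring
    have h4 : c * (g⁻¹ + moment ε v ω 1) = 0 := by
      field_simp
      linear_combination h3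
    exact (mul_eq_zero.mp h4).resolve_left hc0
  · intro h0
    have hL := H.memLp_resolventPow hω one_ne_zero
    have hae := hL.coeFn_toLp
    have hint : ∫ k, v k * hL.toLp _ k = moment ε v ω 1 := by
      rw [← integral_mul_resolventPow]
      refine integral_congr_ae ?_
      filter_upwards [hae] with k hk
      rw [hk]
    have hgm : g * moment ε v ω 1 = -1 := by
      have := congrArg (g * ·) h0
      simp only [mul_add, mul_inv_cancel₀ hg, mul_zero] at this
      linear_combination this
    refine ⟨hL.toLp _, fun hz => ?_, ?_, ?_⟩
    · have : moment ε v ω 1 = 0 := by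
        rw [← hint]
        rw [Lp.eq_zero_iff_ae_eq_zero] at hz
        refine (integral_congr_ae (g := fun _ => 0) ?_).trans (by simp)
        filter_upwards [hz] with k hk
        simp [hk]
      rw [this] at hgm
      simp at hgm
    · refine (H.integrable_mul_resolventPow hω one_ne_zero).congr ?_
      filter_upwards [hae] with k hk
      rw [hk]
    · filter_upwards [hae, Lp.coeFn_zero ℂ 2 (volume : Measure V)] with k hk hk0
      rw [hint, hk, hk0, resolventPow]
      have := H.sub_ne_zero hω k
      simp only [pow_one, Pi.zero_apply]
      have e : (ε k : ℂ) * (v k / ((ε k : ℂ) - ω)) - ω * (v k / ((ε k : ℂ) - ω)) = v k := by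
        field_simp
      linear_combination e + v k * hgm

end SeparableModel

end BoundStates

end SepScattering

/-! ### Jordan chains and the number of bound states -/

namespace SepScattering

section BoundStates

variable {V : Type*} [NormedAddCommGroup V] [InnerProductSpace ℝ V] [FiniteDimensional ℝ V]
  [MeasurableSpace V] [BorelSpace V]

namespace SeparableModel

variable {ε : V → ℝ} {v : V → ℂ} {Rc : Set ℝ}

/-- `v / (ε - ω)^(i+1)` as a square-integrable function. -/
noncomputable def rootLp (H : SeparableModel ε v Rc) {ω : ℂ} (hω : ω ∈ offContinuum Rc) (i : ℕ) :
    Lp ℂ 2 (volume : Measure V) :=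
  (H.memLp_resolventPow hω (Nat.succ_ne_zero i)).toLp _

lemma coeFn_rootLp (H : SeparableModel ε v Rc) {ω : ℂ} (hω : ω ∈ offContinuum Rc) (i : ℕ) :
    H.rootLp hω i =ᵐ[volume] resolventPow ε v ω (i + 1) :=
  (H.memLp_resolventPow hω (Nat.succ_ne_zero i)).coeFn_toLp

lemma mul_resolventPow_succ (H : SeparableModel ε v Rc) {ω : ℂ} (hω : ω ∈ offContinuum Rc)
    (i : ℕ) (k : V) :
    ((ε k : ℂ) - ω) * resolventPow ε v ω (i + 1) k = resolventPow ε v ω i k := by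
  have := H.sub_ne_zero hω k
  simp only [resolventPow]
  field_simp
  ring

/-- Multiplication by ε-ω lowers the power of the resolvent by one. The rank-one term adds g v times
a moment; this cancels v at the first step, where g·moment = -1, and vanishes at the later ones. -/
lemma isRootVector_rootLp (H : SeparableModel ε v Rc) {g : ℂ} (hg : g ≠ 0) {ω : ℂ}
    (hω : ω ∈ offContinuum Rc) (h0 : g⁻¹ + moment ε v ω 1 = 0) {p : ℕ}
    (hp : ∀ j, 2 ≤ j → j ≤ p → moment ε v ω j = 0) (i : ℕ) (hi : i < p) :
    IsRootVector ε g v ω (i + 1) (H.rootLp hω i) := by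
  have hint : ∀ i, Integrable fun k => v k * H.rootLp hω i k := fun i => by
    refine (H.integrable_mul_resolventPow hω (Nat.succ_ne_zero i)).congr ?_
    filter_upwards [H.coeFn_rootLp hω i] with k hk
    rw [hk]
  have hmom : ∀ i, ∫ k, v k * H.rootLp hω i k = moment ε v ω (i + 1) := fun i => by
    rw [← integral_mul_resolventPow]
    refine integral_congr_ae ?_
    filter_upwards [H.coeFn_rootLp hω i] with k hk
    rw [hk]
  induction i with
  | zero =>
    refine ⟨0, ⟨hint 0, ?_⟩, rfl⟩
    have hgm : g * moment ε v ω 1 = -1 := by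
      have := congrArg (g * ·) h0
      simp only [mul_add, mul_inv_cancel₀ hg, mul_zero] at this
      linear_combination this
    filter_upwards [H.coeFn_rootLp hω 0, Lp.coeFn_zero ℂ 2 (volume : Measure V)] with k hk hk0
    have := H.mul_resolventPow_succ hω 0 k
    have e0 : resolventPow ε v ω 0 k = v k := by simp [resolventPow]
    rw [hmom, hk, hk0, Pi.zero_apply]
    rw [e0] at this
    linear_combination this + v k * hgm
  | succ i ih =>
    refine ⟨_, ⟨hint (i + 1), ?_⟩, ih (by omega)⟩
    filter_upwards [H.coeFn_rootLp hω (i + 1), H.coeFn_rootLp hω i] with k hk hk'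
    have := H.mul_resolventPow_succ hω (i + 1) k
    rw [hmom, hp (i + 1 + 1) (by omega) (by omega), hk, hk']
    linear_combination this

/-- The chain cannot be longer than the order of the zero. Solving (H-ω)ψ = χ raises every power of
the resolvent by one, and pairing with v leaves only the top coefficient times the first
nonvanishing moment, so this coefficient is zero. -/
lemma eq_sum_of_isRootVector (H : SeparableModel ε v Rc) {g : ℂ} (hg : g ≠ 0) {ω : ℂ}
    (hω : ω ∈ offContinuum Rc) (h0 : g⁻¹ + moment ε v ω 1 = 0) {r : ℕ}
    (hp : ∀ j, 2 ≤ j → j ≤ r + 1 → moment ε v ω j = 0) (hr : moment ε v ω (r + 2) ≠ 0) (n : ℕ)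
    (ψ : Lp ℂ 2 (volume : Measure V)) (hψ : IsRootVector ε g v ω n ψ) :
    ∃ b : ℕ → ℂ, ψ =ᵐ[volume] fun k => ∑ i ∈ Finset.range (r + 1),
      b i * resolventPow ε v ω (i + 1) k := by
  induction n generalizing ψ with
  | zero =>
    obtain rfl : ψ = 0 := hψ
    refine ⟨0, ?_⟩
    filter_upwards [Lp.coeFn_zero ℂ 2 (volume : Measure V)] with k hk
    simp
  | succ n ih =>
    obtain ⟨χ, hχ, hroot⟩ := hψ
    obtain ⟨b, hb⟩ := ih χ hroot
    set c := ∫ k, v k * ψ k with hc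
    have h1 : ∀ᵐ k, ψ k = (∑ i ∈ Finset.range (r + 1), b i * resolventPow ε v ω (i + 2) k) -
        g * c * resolventPow ε v ω 1 k := by
      filter_upwards [hχ.2, hb] with k hk hk'
      rw [hk'] at hk
      have hne := H.sub_ne_zero hω k
      refine mul_left_cancel₀ hne ?_
      rw [mul_sub, Finset.mul_sum]
      have e : ∀ i ∈ Finset.range (r + 1), ((ε k : ℂ) - ω) * (b i * resolventPow ε v ω (i + 2) k) =
          b i * resolventPow ε v ω (i + 1) k := fun i _ => by
        rw [← H.mul_resolventPow_succ hω (i + 1) k]; ring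
      rw [Finset.sum_congr rfl e, ← hk]
      have e0 : resolventPow ε v ω 0 k = v k := by simp [resolventPow]
      have := H.mul_resolventPow_succ hω 0 k
      rw [e0] at this
      linear_combination g * c * this
    have hI : ∀ j, j ≠ 0 → Integrable fun k => v k * resolventPow ε v ω j k := fun j hj =>
      H.integrable_mul_resolventPow hω hj
    have h2 : c = (∑ i ∈ Finset.range (r + 1), b i * moment ε v ω (i + 2)) -
        g * c * moment ε v ω 1 := by
      conv_lhs => rw [hc]
      simp only [← integral_mul_resolventPow (ε := ε) (v := v) ω]
      rw [← integral_const_mul]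
      simp only [← integral_const_mul]
      rw [← integral_finsetSum _ fun i _ => (hI _ (by simp)).const_mul _,
        ← integral_sub (integrable_finsetSum _ fun i _ => (hI _ (by simp)).const_mul _)
        ((hI _ (by simp)).const_mul _)]
      refine integral_congr_ae ?_
      filter_upwards [h1] with k hk
      rw [hk, mul_sub, Finset.mul_sum]
      congr 1
      · exact Finset.sum_congr rfl fun i _ => by ring
      · ring
    have hgm : g * moment ε v ω 1 = -1 := by
      have := congrArg (g * ·) h0
      simp only [mul_add, mul_inv_cancel₀ hg, mul_zero] at this
      linear_combination this
    have h3 : b r = 0 := by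
      rw [Finset.sum_range_succ, Finset.sum_eq_zero] at h2
      · have : b r * moment ε v ω (r + 2) = 0 := by linear_combination -h2 + c * hgm
        exact (mul_eq_zero.mp this).resolve_right hr
      · intro i hi
        have := Finset.mem_range.mp hi
        rw [hp (i + 2) (by omega) (by omega), mul_zero]
    refine ⟨fun i => if i = 0 then -(g * c) else b (i - 1), ?_⟩
    filter_upwards [h1] with k hk
    rw [hk, Finset.sum_range_succ, h3, Finset.sum_range_succ']
    simp
    ring

lemma rootVector_eq_zero {g E : ℂ}
    (hE : ∀ ψ, ShiftedHamiltonian ε g v E ψ 0 → ψ = 0) (n : ℕ)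
    (ψ : Lp ℂ 2 (volume : Measure V)) (hψ : IsRootVector ε g v E n ψ) : ψ = 0 := by
  induction n generalizing ψ with
  | zero => exact hψ
  | succ n ih =>
    obtain ⟨χ, hχ, hroot⟩ := hψ
    rw [ih χ hroot] at hχ
    exact hE ψ hχ

/-- The family of root vectors belonging to a finite set of energies. -/
noncomputable def rootFamily (H : SeparableModel ε v Rc) (Z : Finset ℂ)
    (hZ : ∀ z ∈ Z, z ∈ offContinuum Rc) (p : ℂ → ℕ) (s : (z : Z) × Fin (p z)) :
    Lp ℂ 2 (volume : Measure V) :=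
  H.rootLp (hZ s.1 s.1.2) (p s.1 - 1 - s.2)

lemma linearIndependent_rootFamily (H : SeparableModel ε v Rc) (Z : Finset ℂ)
    (hZ : ∀ z ∈ Z, z ∈ offContinuum Rc) (p : ℂ → ℕ) :
    LinearIndependent ℂ (H.rootFamily Z hZ p) := by
  classical
  rw [Fintype.linearIndependent_iff]
  intro b hb
  -- The index s carries the power p - s, so that clearing denominators yields (X-z)^s, the form of
  -- the partial-fraction theorem used below.
  have hexp : ∀ s : (z : Z) × Fin (p z), p s.1 - 1 - s.2 + 1 = p s.1 - s.2 := fun s => by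
    have := s.2.2; omega
  have hae : (fun k => ∑ s, b s * resolventPow ε v (s.1 : ℂ) (p s.1 - s.2) k) =ᵐ[volume]
      fun _ => 0 := by
    have h1 := Lp.coeFn_zero ℂ 2 (volume : Measure V)
    rw [← hb] at h1
    have h2 : ⇑(∑ s, b s • H.rootFamily Z hZ p s) =ᵐ[volume]
        fun k => ∑ s, b s * H.rootFamily Z hZ p s k := by
      refine (Lp.coeFn_finsetSum _ _).trans ?_
      have h3 : ∀ᵐ k, ∀ s, (b s • H.rootFamily Z hZ p s : Lp ℂ 2 volume) k =
          b s * H.rootFamily Z hZ p s k :=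
        ae_all_iff.mpr fun s => by
          filter_upwards [Lp.coeFn_smul (b s) (H.rootFamily Z hZ p s)] with k hk
          simpa using hk
      filter_upwards [h3] with k hk
      simp [Finset.sum_apply, hk]
    have h4 : ∀ᵐ k, ∀ s, H.rootFamily Z hZ p s k =
        resolventPow ε v (s.1 : ℂ) (p s.1 - s.2) k :=
      ae_all_iff.mpr fun s => by
        filter_upwards [H.coeFn_rootLp (hZ s.1 s.1.2) (p s.1 - 1 - s.2)] with k hk
        rw [rootFamily, hk, hexp]
    filter_upwards [h1, h2, h4] with k e1 e2 e4
    rw [e1] at e2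
    simp only [e4] at e2
    exact e2.symm
  have hcont : Continuous fun k => ∑ s : (z : Z) × Fin (p z),
      b s * resolventPow ε v (s.1 : ℂ) (p s.1 - s.2) k :=
    continuous_finsetSum _ fun s _ =>
      continuous_const.mul (H.continuous_resolventPow (hZ s.1 s.1.2) _)
  have hall := (Continuous.ae_eq_iff_eq volume hcont continuous_const).mp hae
  -- After division by v and clearing of denominators, a linear relation becomes a polynomial
  -- identity at every value ε(k) with v(k) ≠ 0. Near k = 0 there are infinitely many such values,
  -- so the polynomial is zero, and uniqueness of partial fractions gives vanishing coefficients.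
  have hU : {k | v k ≠ 0} ∈ 𝓝 (0 : V) :=
    H.cont_v.continuousAt.eventually_ne (by rw [H.v_zero]; exact one_ne_zero)
  let gp : Z → Polynomial ℂ := fun z => Polynomial.X - Polynomial.C (z : ℂ)
  let r : (z : Z) → Fin (p z) → Polynomial ℂ := fun z j => Polynomial.C (b ⟨z, j⟩)
  let Q : Polynomial ℂ := ∑ z ∈ Finset.univ, ∑ j, r z j * gp z ^ j.1 *
    ∏ k ∈ Finset.univ.erase z, gp k ^ p k
  have hQ : Q = 0 := by
    refine Polynomial.eq_zero_of_infinite_isRoot Q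
      (((H.infinite _ hU).image (Complex.ofReal_injective.injOn)).mono ?_)
    rintro _ ⟨_, ⟨k, hk, rfl⟩, rfl⟩
    have hk0 := congrFun hall k
    simp only [Set.mem_ofPred_eq, Polynomial.IsRoot.def, Q, Polynomial.eval_finsetSum,
      Polynomial.eval_mul, Polynomial.eval_pow, Polynomial.eval_prod, r, gp, Polynomial.eval_sub,
      Polynomial.eval_X, Polynomial.eval_C]
    rw [Fintype.sum_sigma] at hk0
    have hP : (v k)⁻¹ * ∏ z : Z, ((ε k : ℂ) - z) ^ p z ≠ 0 :=
      mul_ne_zero (inv_ne_zero hk) (Finset.prod_ne_zero_iff.mpr fun z _ =>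
        pow_ne_zero _ (H.sub_ne_zero (hZ z z.2) k))
    refine Eq.trans ?_ ((congrArg (((v k)⁻¹ * ∏ z : Z, ((ε k : ℂ) - z) ^ p z) * ·) hk0).trans
      (mul_zero _))
    rw [Finset.mul_sum]
    refine Finset.sum_congr rfl fun z _ => ?_
    rw [Finset.mul_sum]
    refine Finset.sum_congr rfl fun j _ => ?_
    rw [← Finset.mul_prod_erase Finset.univ _ (Finset.mem_univ z)]
    have h1 := H.sub_ne_zero (hZ z z.2) k
    have h2 : v k ≠ 0 := hk
    have h3 : ((ε k : ℂ) - z) ^ p z = ((ε k : ℂ) - z) ^ (j : ℕ) * ((ε k : ℂ) - z) ^ (p z - j) := by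
      rw [← pow_add]; congr 1; have := j.2; omega
    rw [resolventPow, h3]
    field_simp
  have huniq := Polynomial.quo_mul_prod_pow_add_sum_rem_mul_prod_pow_unique (s := Finset.univ)
    (g := gp) (fun z _ => Polynomial.monic_X_sub_C _) (by
      intro x _ y _ hxy
      exact Polynomial.isCoprime_X_sub_C_of_isUnit_sub
        (_root_.sub_ne_zero.mpr fun h => hxy (Subtype.ext h)).isUnit) (n := fun z => p z) (q₁ := 0)
    (q₂ := 0) (r₁ := r) (r₂ := fun _ _ => 0)
    (fun z _ j => lt_of_le_of_lt Polynomial.degree_C_le (by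
      rw [Polynomial.degree_X_sub_C]; exact zero_lt_one))
    (fun z _ j => by simp [gp, Polynomial.degree_X_sub_C]) (by
      rw [zero_mul, zero_add]
      refine Eq.trans (hQ : _) ?_
      simp)
  rintro ⟨z, j⟩
  have := congrFun (huniq.2 z (Finset.mem_univ z)) j
  simpa [r] using this

/-- The number of bound states is the number of zeros of `g⁻¹ - K`, with multiplicity. -/
theorem finrank_boundStateSpace (H : SeparableModel ε v Rc) {g : ℂ} (hg : g ≠ 0) (Z : Finset ℂ)
    (hZ : ∀ z, z ∈ Z ↔ z ∈ offContinuum Rc ∧ g⁻¹ - Ksep ε v z = 0)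
    (hord : ∀ z ∈ Z, analyticOrderAt (fun ω => g⁻¹ - Ksep ε v ω) z ≠ ⊤)
    (hE : ∀ E ∈ insert 0 Rc, ∀ ψ, ShiftedHamiltonian ε g v ((E : ℝ) : ℂ) ψ 0 → ψ = 0) :
    FiniteDimensional ℂ (boundStateSpace ε g v) ∧
    boundStateNumber ε g v = ∑ z ∈ Z, analyticOrderNatAt (fun ω => g⁻¹ - Ksep ε v ω) z := by
  set p := analyticOrderNatAt (fun ω => g⁻¹ - Ksep ε v ω)
  have hZΩ : ∀ z ∈ Z, z ∈ offContinuum Rc := fun z hz => ((hZ z).mp hz).1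
  have hmom : ∀ ω, g⁻¹ - Ksep ε v ω = g⁻¹ + moment ε v ω 1 := fun ω => by rw [moment_one]; ring
  have hspan : boundStateSpace ε g v =
      Submodule.span ℂ (Set.range (H.rootFamily Z hZΩ p)) := by
    refine le_antisymm (Submodule.span_le.mpr ?_) (Submodule.span_mono ?_)
    · rintro ψ ⟨E, n, hψ⟩
      by_cases hEΩ : E ∈ offContinuum Rc
      · by_cases hD : g⁻¹ - Ksep ε v E = 0
        · have hEZ : E ∈ Z := (hZ E).mpr ⟨hEΩ, hD⟩
          obtain ⟨h1, h2, h3⟩ := H.moment_of_order hEΩ hD (hord E hEZ)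
          change p E ≠ 0 at h1
          change ∀ j, 2 ≤ j → j ≤ p E → moment ε v E j = 0 at h2
          change moment ε v E (p E + 1) ≠ 0 at h3
          obtain ⟨r, hr⟩ := Nat.exists_eq_succ_of_ne_zero h1
          rw [hr] at h2 h3
          obtain ⟨b, hb⟩ := H.eq_sum_of_isRootVector hg hEΩ (by rw [← hmom]; exact hD) h2 h3 n ψ hψ
          have hψ' : ψ = ∑ i ∈ Finset.range (r + 1), b i • H.rootLp hEΩ i := by
            refine Lp.ext (hb.trans ?_)
            have e1 : ∀ᵐ k, ∀ i, (b i • H.rootLp hEΩ i : Lp ℂ 2 volume) k =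
                b i * resolventPow ε v E (i + 1) k :=
              ae_all_iff.mpr fun i => by
                filter_upwards [Lp.coeFn_smul (b i) (H.rootLp hEΩ i), H.coeFn_rootLp hEΩ i]
                  with k hk hk'
                rw [hk]
                simp [hk']
            filter_upwards [Lp.coeFn_finsetSum (Finset.range (r + 1))
              (fun i => b i • H.rootLp hEΩ i), e1] with k hk hk'
            rw [hk]
            simp [Finset.sum_apply, hk']
          rw [hψ']
          refine Submodule.sum_mem _ fun i hi => Submodule.smul_mem _ _ (Submodule.subset_span ?_)
          have hi' : i < p E := by rw [hr]; exact Finset.mem_range.mp hi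
          -- `rootFamily` lists each chain in reverse order.
          refine ⟨⟨⟨E, hEZ⟩, ⟨p E - 1 - i, by change p E - 1 - i < p E; omega⟩⟩, ?_⟩
          simp only [rootFamily]
          congr 1
          omega
        · rw [rootVector_eq_zero (fun χ hχ => by
            by_contra hne
            exact hD ((H.isBoundStateEnergy_iff hg hEΩ).mp ⟨χ, hne, hχ⟩)) n ψ hψ]
          exact Submodule.zero_mem _
      · obtain ⟨x, hx, rfl⟩ : ∃ x ∈ insert 0 Rc, E = ((x : ℝ) : ℂ) := by
          by_contra hcon
          push Not at hcon
          exact hEΩ hcon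
        rw [rootVector_eq_zero (hE x hx) n ψ hψ]
        exact Submodule.zero_mem _
    · rintro _ ⟨s, rfl⟩
      have hs := (hZ s.1).mp s.1.2
      obtain ⟨-, h2, -⟩ := H.moment_of_order hs.1 hs.2 (hord _ s.1.2)
      exact ⟨s.1, _, H.isRootVector_rootLp hg hs.1 (by rw [← hmom]; exact hs.2) h2
        (p s.1 - 1 - s.2) (by have := s.2.2; change _ < p s.1; omega)⟩
  have hfin : FiniteDimensional ℂ (boundStateSpace ε g v) := by
    rw [hspan]
    exact FiniteDimensional.span_of_finite ℂ (Set.finite_range _)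
  refine ⟨hfin, ?_⟩
  rw [boundStateNumber, hspan, finrank_span_eq_card (H.linearIndependent_rootFamily Z hZΩ p),
    Fintype.card_sigma]
  simp only [Fintype.card_fin]
  exact Finset.sum_coe_sort Z p

/-- Square-integrable solutions at an energy of the continuum would have a finite boundary
value `K(E + i0) = g⁻¹`. -/
lemma tendsto_Ksep_of_shifted (H : SeparableModel ε v Rc) {g : ℂ} (hg : g ≠ 0) {E : ℝ}
    (hnull : ∀ᵐ k, ε k ≠ E) {ψ : Lp ℂ 2 (volume : Measure V)}
    (hψ : ShiftedHamiltonian ε g v E ψ 0) (h0 : ψ ≠ 0) :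
    Tendsto (fun η : ℝ => Ksep ε v ((E : ℂ) + (η : ℂ) * I)) (𝓝[>] 0) (𝓝 g⁻¹) := by
  have h1 := ae_eq_of_shifted_zero hψ
  set c := ∫ k', v k' * ψ k' with hc
  have hne : ∀ k, ε k ≠ E → (E : ℂ) - ε k ≠ 0 := fun k hk h => hk (by
    exact_mod_cast (_root_.sub_eq_zero.mp h).symm)
  have h2 : ∀ᵐ k, ψ k = (g * c) * (v k / ((E : ℂ) - ε k)) := by
    filter_upwards [h1, hnull] with k hk hkE
    have := hne k hkE
    field_simp
    linear_combination -hk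
  have hc0 : c ≠ 0 := by
    intro hz
    refine h0 (Lp.eq_zero_iff_ae_eq_zero.mpr ?_)
    filter_upwards [h2] with k hk
    simp [hk, hz]
  have h3 : ∀ᵐ k, v k ^ 2 / ((E : ℂ) - ε k) = (g * c)⁻¹ * (v k * ψ k) := by
    filter_upwards [h2] with k hk
    rw [hk]
    field_simp
  -- The eigenvalue equation makes v²/(E-ε) a multiple of vψ, hence integrable, with integral g⁻¹.
  -- It dominates the integrands of K(E+iη) because |E-ε| ≤ |E+iη-ε|.
  have hint : Integrable fun k => v k ^ 2 / ((E : ℂ) - ε k) :=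
    (hψ.1.const_mul (g * c)⁻¹).congr (h3.mono fun k hk => hk.symm)
  have hval : ∫ k, v k ^ 2 / ((E : ℂ) - ε k) = g⁻¹ := by
    rw [integral_congr_ae h3, integral_const_mul, ← hc]
    field_simp
  rw [← hval]
  have hce := Complex.continuous_ofReal.comp H.cont_ε
  refine tendsto_integral_filter_of_dominated_convergence _ ?_ ?_ hint.norm ?_
  · filter_upwards [self_mem_nhdsWithin] with η hη
    refine ((H.cont_v.pow 2).div (continuous_const.sub hce) fun k hk => ?_).aestronglyMeasurable
    have := congrArg Complex.im hk
    simp at this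
    exact (ne_of_gt hη) this
  · refine .of_forall fun η => ?_
    filter_upwards [hnull] with k hk
    rw [norm_div, norm_div]
    have : ‖(E : ℂ) - ε k‖ ≤ ‖(E : ℂ) + η * I - ε k‖ := by
      have h5 : |((E : ℂ) + η * I - ε k).re| ≤ ‖(E : ℂ) + η * I - ε k‖ := Complex.abs_re_le_norm _
      rw [← Complex.ofReal_sub, Complex.norm_real, Real.norm_eq_abs]
      simpa using h5
    have h6 : 0 < ‖(E : ℂ) - ε k‖ := norm_pos_iff.mpr (hne k hk)
    gcongr
  · filter_upwards [hnull] with k hk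
    have : ContinuousAt (fun η : ℝ => v k ^ 2 / ((E : ℂ) + η * I - ε k)) 0 := by
      refine ContinuousAt.div (by fun_prop) (by fun_prop) ?_
      simpa using hne k hk
    have h5 := this.tendsto.mono_left (nhdsWithin_le_nhds (s := Set.Ioi 0))
    simpa using h5

end SeparableModel

end BoundStates

end SepScattering

namespace SepScattering

/-! ### The local singular integral -/

/-- The oscillating density `t^(p-1) exp(i a t^q)`. -/
noncomputable def oscDensity (p q a t : ℝ) : ℂ :=
  ((t ^ (p - 1) : ℝ) : ℂ) * Complex.exp (I * ((a * t ^ q : ℝ) : ℂ))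

/-- The local Cauchy transform of the oscillating density around `t = 1`. -/
noncomputable def localCauchy (p q a η : ℝ) : ℂ :=
  ∫ t in (1 / 2 : ℝ)..(3 / 2), oscDensity p q a t / (1 + (η : ℂ) * I - (t : ℂ))

lemma rpow_le_two_rpow_abs {t : ℝ} (h1 : 1 / 2 ≤ t) (h2 : t ≤ 3 / 2) (r : ℝ) :
    t ^ r ≤ 2 ^ |r| := by
  have ht : 0 < t := by linarith
  rw [← Real.exp_log ht, ← Real.exp_log (show (0 : ℝ) < 2 by norm_num), ← Real.exp_mul,
    ← Real.exp_mul]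
  refine Real.exp_le_exp.mpr ?_
  have h3 : |Real.log t| ≤ Real.log 2 := by
    rw [abs_le]
    constructor
    · rw [← Real.log_inv]
      exact Real.log_le_log (by norm_num) (by linarith)
    · exact Real.log_le_log ht (by linarith)
  calc Real.log t * r ≤ |Real.log t * r| := le_abs_self _
    _ = |Real.log t| * |r| := abs_mul _ _
    _ ≤ _ := by gcongr

lemma norm_exp_I_mul (x : ℝ) : ‖Complex.exp (I * (x : ℂ))‖ = 1 := by
  rw [mul_comm]; exact Complex.norm_exp_ofReal_mul_I x

lemma norm_oscDensity {p q a t : ℝ} (ht : 0 < t) : ‖oscDensity p q a t‖ = t ^ (p - 1) := by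
  rw [oscDensity, norm_mul, norm_exp_I_mul, mul_one, Complex.norm_real, Real.norm_of_nonneg
    (Real.rpow_nonneg ht.le _)]

lemma oscDensity_one (p q a : ℝ) : oscDensity p q a 1 = Complex.exp (I * (a : ℂ)) := by
  simp [oscDensity]

lemma hasDerivAt_exp_rpow (q a : ℝ) {t : ℝ} (ht : 0 < t) :
    HasDerivAt (fun t : ℝ => Complex.exp (I * ((a * t ^ q : ℝ) : ℂ)))
      (I * a * ((q * t ^ (q - 1) : ℝ) : ℂ) * Complex.exp (I * ((a * t ^ q : ℝ) : ℂ))) t := by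
  have h1 : HasDerivAt (fun t : ℝ => a * t ^ q) (a * (q * t ^ (q - 1))) t :=
    (Real.hasDerivAt_rpow_const (Or.inl ht.ne')).const_mul a
  have h2 := (h1.ofReal_comp.const_mul I).cexp
  refine h2.congr_deriv ?_
  push_cast; ring

lemma hasDerivAt_oscDensity (p q a : ℝ) {t : ℝ} (ht : 0 < t) :
    HasDerivAt (oscDensity p q a)
      (((p - 1) * t ^ (p - 2) : ℝ) * Complex.exp (I * ((a * t ^ q : ℝ) : ℂ)) +
        I * a * ((q * t ^ (p + q - 2) : ℝ) : ℂ) * Complex.exp (I * ((a * t ^ q : ℝ) : ℂ))) t := by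
  have h1 : HasDerivAt (fun t : ℝ => t ^ (p - 1)) ((p - 1) * t ^ (p - 1 - 1)) t :=
    Real.hasDerivAt_rpow_const (Or.inl ht.ne')
  refine (h1.ofReal_comp.mul (hasDerivAt_exp_rpow q a ht)).congr_deriv ?_
  have h2 : t ^ (p + q - 2) = t ^ (p - 1) * t ^ (q - 1) := by
    rw [← Real.rpow_add ht]; congr 1; ring
  rw [h2, show p - 1 - 1 = p - 2 by ring]
  push_cast; ring

lemma continuousOn_oscDensity (p q a : ℝ) : ContinuousOn (oscDensity p q a) (Set.Ioi 0) :=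
  fun _ ht => (hasDerivAt_oscDensity p q a ht).continuousAt.continuousWithinAt

/-- A uniform Lipschitz bound. -/
lemma exists_lipschitz_oscDensity (p q : ℝ) : ∃ L, 0 ≤ L ∧ ∀ a x y : ℝ,
    x ∈ Set.Icc (1 / 2 : ℝ) (3 / 2) → y ∈ Set.Icc (1 / 2 : ℝ) (3 / 2) →
    ‖oscDensity p q a y - oscDensity p q a x‖ ≤ L * (1 + |a|) * |y - x| := by
  refine ⟨|p - 1| * 2 ^ |p - 2| + |q| * 2 ^ |p + q - 2|, by positivity, fun a x y hx hy => ?_⟩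
  refine Convex.norm_image_sub_le_of_norm_hasDerivWithin_le (s := Set.Icc (1 / 2 : ℝ) (3 / 2))
    (fun t ht => (hasDerivAt_oscDensity p q a (by linarith [ht.1])).hasDerivWithinAt)
    (fun t ht => ?_) (convex_Icc _ _) hx hy
  have ht0 : 0 < t := by linarith [ht.1]
  refine (norm_add_le _ _).trans ?_
  simp only [norm_mul, norm_exp_I_mul, mul_one, Complex.norm_I, one_mul, Complex.norm_real,
    Real.norm_eq_abs, abs_of_pos (Real.rpow_pos_of_pos ht0 _)]
  have h1 := rpow_le_two_rpow_abs ht.1 ht.2 (p - 2)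
  have h2 := rpow_le_two_rpow_abs ht.1 ht.2 (p + q - 2)
  have e1 : |p - 1| * t ^ (p - 2) ≤ |p - 1| * 2 ^ |p - 2| := by gcongr
  have e2 : |q| * t ^ (p + q - 2) ≤ |q| * 2 ^ |p + q - 2| := by gcongr
  have e3 : |a| * (|q| * t ^ (p + q - 2)) ≤ |a| * (|q| * 2 ^ |p + q - 2|) := by gcongr
  have e4 : 0 ≤ |q| * (2 : ℝ) ^ |p + q - 2| := by positivity
  have e5 : 0 ≤ |a| * (|p - 1| * (2 : ℝ) ^ |p - 2|) := by positivity
  nlinarith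

/-- A Lipschitz bound for the deviation from the constant phase. -/
lemma exists_lipschitz_oscDensity_sub (p q : ℝ) : ∃ L, 0 ≤ L ∧ ∀ a x y : ℝ,
    x ∈ Set.Icc (1 / 2 : ℝ) (3 / 2) → y ∈ Set.Icc (1 / 2 : ℝ) (3 / 2) →
    ‖(oscDensity p q a y - oscDensity p q 0 y) - (oscDensity p q a x - oscDensity p q 0 x)‖ ≤
      L * |a| * |y - x| := by
  refine ⟨|p - 1| * 2 ^ |p - 2| * 2 ^ |q| + |q| * 2 ^ |p + q - 2|, by positivity,
    fun a x y hx hy => ?_⟩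
  refine Convex.norm_image_sub_le_of_norm_hasDerivWithin_le (s := Set.Icc (1 / 2 : ℝ) (3 / 2))
    (f := fun t => oscDensity p q a t - oscDensity p q 0 t)
    (fun t ht => ((hasDerivAt_oscDensity p q a (by linarith [ht.1])).sub
      (hasDerivAt_oscDensity p q 0 (by linarith [ht.1]))).hasDerivWithinAt)
    (fun t ht => ?_) (convex_Icc _ _) hx hy
  have ht0 : 0 < t := by linarith [ht.1]
  have h1 := rpow_le_two_rpow_abs ht.1 ht.2 (p - 2)
  have h2 := rpow_le_two_rpow_abs ht.1 ht.2 (p + q - 2)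
  have h3 := rpow_le_two_rpow_abs ht.1 ht.2 q
  have h4 : ‖Complex.exp (I * ((a * t ^ q : ℝ) : ℂ)) - 1‖ ≤ |a| * 2 ^ |q| := by
    refine (Real.norm_exp_I_mul_ofReal_sub_one_le).trans ?_
    rw [Real.norm_eq_abs, abs_mul, abs_of_pos (Real.rpow_pos_of_pos ht0 _)]
    gcongr
  have e0 : (((p - 1) * t ^ (p - 2) : ℝ) * Complex.exp (I * ((a * t ^ q : ℝ) : ℂ)) +
        I * a * ((q * t ^ (p + q - 2) : ℝ) : ℂ) * Complex.exp (I * ((a * t ^ q : ℝ) : ℂ))) -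
      (((p - 1) * t ^ (p - 2) : ℝ) * Complex.exp (I * ((0 * t ^ q : ℝ) : ℂ)) +
        I * (0 : ℝ) * ((q * t ^ (p + q - 2) : ℝ) : ℂ) *
          Complex.exp (I * ((0 * t ^ q : ℝ) : ℂ))) =
      ((p - 1) * t ^ (p - 2) : ℝ) * (Complex.exp (I * ((a * t ^ q : ℝ) : ℂ)) - 1) +
        I * a * ((q * t ^ (p + q - 2) : ℝ) : ℂ) * Complex.exp (I * ((a * t ^ q : ℝ) : ℂ)) := by
    simp; ring
  rw [e0]
  refine (norm_add_le _ _).trans ?_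
  simp only [norm_mul, norm_exp_I_mul, mul_one, Complex.norm_I, one_mul, Complex.norm_real,
    Real.norm_eq_abs, abs_of_pos (Real.rpow_pos_of_pos ht0 _)]
  calc _ ≤ |p - 1| * 2 ^ |p - 2| * (|a| * 2 ^ |q|) + |a| * (|q| * 2 ^ |p + q - 2|) := by gcongr
    _ = _ := by ring

lemma denom_ne_zero {η : ℝ} (hη : 0 < η) (t : ℝ) : (1 + (η : ℂ) * I - (t : ℂ)) ≠ 0 := by
  intro h
  have := congrArg Complex.im h
  simp at this
  exact hη.ne' this

lemma abs_le_norm_denom (η t : ℝ) : |t - 1| ≤ ‖(1 + (η : ℂ) * I - (t : ℂ))‖ := by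
  have := Complex.abs_re_le_norm (1 + (η : ℂ) * I - (t : ℂ))
  rw [abs_sub_comm]
  simpa using this

lemma intervalIntegrable_div_denom {f : ℝ → ℂ} (hf : ContinuousOn f (Set.Ioi 0)) {η : ℝ}
    (hη : 0 < η) : IntervalIntegrable (fun t => f t / (1 + (η : ℂ) * I - (t : ℂ))) volume
      (1 / 2) (3 / 2) := by
  refine ContinuousOn.intervalIntegrable (ContinuousOn.div (hf.mono ?_) (by fun_prop)
    fun t _ => denom_ne_zero hη t)
  rw [Set.uIcc_of_le (by norm_num)]
  intro t ht
  exact lt_of_lt_of_le (by norm_num) ht.1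

/-- The logarithm of the local kernel. -/
lemma integral_inv_denom {η : ℝ} (hη : 0 < η) :
    ∫ t in (1 / 2 : ℝ)..(3 / 2), (1 : ℂ) / (1 + (η : ℂ) * I - (t : ℂ)) =
      Complex.log (1 / 2 + η * I) - Complex.log (-(1 / 2) + η * I) := by
  have hd : ∀ t ∈ Set.uIcc (1 / 2 : ℝ) (3 / 2),
      HasDerivAt (fun t : ℝ => -Complex.log (1 + (η : ℂ) * I - (t : ℂ)))
        (1 / (1 + (η : ℂ) * I - (t : ℂ))) t := by
    intro t _
    have h1 : HasDerivAt (fun t : ℝ => 1 + (η : ℂ) * I - (t : ℂ)) (-1) t := by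
      simpa using (Complex.ofRealCLM.hasDerivAt (x := t)).const_sub (1 + (η : ℂ) * I)
    have h2 : (1 + (η : ℂ) * I - (t : ℂ)) ∈ slitPlane := Or.inr (by simpa using hη.ne')
    refine (h1.clog_real h2).neg.congr_deriv ?_
    ring
  rw [intervalIntegral.integral_eq_sub_of_hasDerivAt hd
    (intervalIntegrable_div_denom continuousOn_const hη)]
  push_cast
  rw [show (1 : ℂ) + η * I - 3 / 2 = -(1 / 2) + η * I by ring,
    show (1 : ℂ) + η * I - 1 / 2 = 1 / 2 + η * I by ring]
  ring

/-- The interval is symmetric about 1, so the moduli in the two logarithms agree and only the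
argument π of the endpoint on the cut survives. This is the -iπ of the Plemelj formula. -/
lemma tendsto_integral_inv_denom :
    Tendsto (fun η : ℝ => ∫ t in (1 / 2 : ℝ)..(3 / 2), (1 : ℂ) / (1 + (η : ℂ) * I - (t : ℂ)))
      (𝓝[>] 0) (𝓝 (-(I * Real.pi))) := by
  have h1 : Tendsto (fun η : ℝ => Complex.log (1 / 2 + η * I)) (𝓝[>] 0)
      (𝓝 (Complex.log (1 / 2))) := by
    have : ContinuousAt (fun η : ℝ => Complex.log (1 / 2 + η * I)) 0 :=
      ContinuousAt.clog (by fun_prop) (Or.inl (by simp))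
    simpa using this.tendsto.mono_left (nhdsWithin_le_nhds (s := Set.Ioi 0))
  have h2 : Tendsto (fun η : ℝ => Complex.log (-(1 / 2) + η * I)) (𝓝[>] 0)
      (𝓝 (Real.log ‖(-(1 / 2) : ℂ)‖ + Real.pi * I)) := by
    refine (tendsto_log_nhdsWithin_im_nonneg_of_re_neg_of_im_zero (by norm_num) (by simp)).comp ?_
    refine tendsto_nhdsWithin_iff.mpr ⟨?_, ?_⟩
    · have : Tendsto (fun η : ℝ => (-(1 / 2) + η * I : ℂ)) (𝓝 0) (𝓝 (-(1 / 2))) :=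
        Continuous.tendsto' (by fun_prop) _ _ (by simp)
      exact this.mono_left nhdsWithin_le_nhds
    · filter_upwards [self_mem_nhdsWithin] with η hη
      simpa using (le_of_lt hη)
  have h3 : Complex.log (1 / 2) - (Real.log ‖(-(1 / 2) : ℂ)‖ + Real.pi * I) = -(I * Real.pi) := by
    have : Complex.log (1 / 2) = (Real.log (1 / 2) : ℝ) := by
      rw [Complex.ofReal_log (by norm_num)]; push_cast; rfl
    rw [this, norm_neg]
    norm_num
    ring
  rw [← h3]
  refine (h1.sub h2).congr' ?_
  filter_upwards [self_mem_nhdsWithin] with η hη using (integral_inv_denom hη).symm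

/-- The value at the singular point is split off. What remains has a bounded integrand, since the
density is Lipschitz. -/
lemma localCauchy_eq (p q a : ℝ) {η : ℝ} (hη : 0 < η) :
    localCauchy p q a η =
      (∫ t in (1 / 2 : ℝ)..(3 / 2), (oscDensity p q a t - oscDensity p q a 1) /
        (1 + (η : ℂ) * I - (t : ℂ))) +
      oscDensity p q a 1 *
        ∫ t in (1 / 2 : ℝ)..(3 / 2), (1 : ℂ) / (1 + (η : ℂ) * I - (t : ℂ)) := by
  rw [← intervalIntegral.integral_const_mul, ← intervalIntegral.integral_add, localCauchy]
  · congr 1; ext t; ring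
  · exact intervalIntegrable_div_denom ((continuousOn_oscDensity p q a).sub continuousOn_const) hη
  · exact (intervalIntegrable_div_denom continuousOn_const hη).const_mul _

/-- The regular part of the boundary value of the local Cauchy transform. -/
noncomputable def localRegular (p q a : ℝ) : ℂ :=
  ∫ t in (1 / 2 : ℝ)..(3 / 2), (oscDensity p q a t - oscDensity p q a 1) / (1 - (t : ℂ))

lemma continuous_oscDensity_param (p q t : ℝ) : Continuous fun a => oscDensity p q a t := by
  unfold oscDensity; fun_prop

/-- The limit is joint in phase and height because, after rescaling to unit size, the phase also
moves with ω. -/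
lemma tendsto_localCauchy (p q a₀ : ℝ) :
    Tendsto (fun x : ℝ × ℝ => localCauchy p q x.1 x.2) (𝓝 a₀ ×ˢ 𝓝[>] 0)
      (𝓝 (localRegular p q a₀ - I * Real.pi * Complex.exp (I * (a₀ : ℂ)))) := by
  obtain ⟨L, hL, hLip⟩ := exists_lipschitz_oscDensity p q
  have h1 : Tendsto (fun x : ℝ × ℝ => ∫ t in (1 / 2 : ℝ)..(3 / 2),
      (oscDensity p q x.1 t - oscDensity p q x.1 1) / (1 + (x.2 : ℂ) * I - (t : ℂ)))
      (𝓝 a₀ ×ˢ 𝓝[>] 0) (𝓝 (localRegular p q a₀)) := by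
    refine intervalIntegral.tendsto_integral_filter_of_dominated_convergence
      (fun _ => L * (1 + (|a₀| + 1))) ?_ ?_ intervalIntegrable_const ?_
    · filter_upwards [tendsto_snd.eventually (self_mem_nhdsWithin (a := (0 : ℝ)))] with x hx
      have := intervalIntegrable_div_denom (f := fun t => oscDensity p q x.1 t -
        oscDensity p q x.1 1) ((continuousOn_oscDensity p q x.1).sub continuousOn_const) hx
      exact (intervalIntegrable_iff.mp this).aestronglyMeasurable
    · have : ∀ᶠ a in 𝓝 a₀, |a| ≤ |a₀| + 1 :=
        (continuous_abs.tendsto a₀).eventually (eventually_le_nhds (by linarith))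
      filter_upwards [tendsto_fst.eventually this] with x hx
      refine .of_forall fun t ht => ?_
      rw [Set.uIoc_of_le (by norm_num)] at ht
      rw [norm_div]
      refine div_le_of_le_mul₀ (norm_nonneg _) (by positivity) ?_
      refine (hLip x.1 1 t (by norm_num) ⟨ht.1.le, ht.2⟩).trans ?_
      have := abs_le_norm_denom x.2 t
      gcongr
    · have hne : ∀ᵐ t : ℝ, t ≠ 1 := by
        simp [ae_iff]
      filter_upwards [hne] with t ht _
      have h2 : (1 : ℂ) + (0 : ℝ) * I - t ≠ 0 := by
        simpa [sub_eq_zero] using fun h : (1 : ℂ) = t => ht (by exact_mod_cast h.symm)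
      have h3 : ContinuousAt (fun x : ℝ × ℝ => (oscDensity p q x.1 t - oscDensity p q x.1 1) /
          (1 + (x.2 : ℂ) * I - (t : ℂ))) (a₀, 0) := by
        have e1 := continuous_oscDensity_param p q t
        have e2 := continuous_oscDensity_param p q 1
        exact ContinuousAt.div (by fun_prop) (by fun_prop) h2
      have h4 := h3.tendsto.mono_left (show 𝓝 a₀ ×ˢ 𝓝[>] (0 : ℝ) ≤ 𝓝 (a₀, 0) by
        rw [nhds_prod_eq]; exact prod_mono le_rfl nhdsWithin_le_nhds)
      simpa using h4
  have h2 : Tendsto (fun x : ℝ × ℝ => oscDensity p q x.1 1) (𝓝 a₀ ×ˢ 𝓝[>] 0)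
      (𝓝 (oscDensity p q a₀ 1)) :=
    ((continuous_oscDensity_param p q 1).tendsto a₀).comp tendsto_fst
  have h3 := h1.add (h2.mul (tendsto_integral_inv_denom.comp tendsto_snd))
  rw [oscDensity_one] at h3
  have e : localRegular p q a₀ + Complex.exp (I * (a₀ : ℂ)) * -(I * Real.pi) =
      localRegular p q a₀ - I * Real.pi * Complex.exp (I * (a₀ : ℂ)) := by ring
  rw [e] at h3
  refine h3.congr' ?_
  filter_upwards [tendsto_snd.eventually (self_mem_nhdsWithin (a := (0 : ℝ)))] with x hx
  exact (localCauchy_eq p q x.1 hx).symm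

/-- Integration by parts against the oscillating phase. -/
lemma exists_bound_far_oscillation (p q : ℝ) (hq : 0 < q) : ∃ C, ∀ a η δ s : ℝ, a ≠ 0 → 0 < η →
    0 < δ → δ ≤ 1 / 2 → (s = 1 ∨ s = -1) →
    ‖∫ x in δ..(1 / 2 : ℝ), ((x / (η ^ 2 + x ^ 2) : ℝ) : ℂ) * oscDensity p q a (1 + s * x)‖ ≤
      C / (|a| * δ) := by
  set M : ℝ := 2 ^ |p - q| / q + |p - q| * 2 ^ |p - q - 1| / q with hM
  have hM0 : 0 ≤ M := by positivity
  refine ⟨4 * M, fun a η δ s ha hη hδ hδ2 hs => ?_⟩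
  have hmem : ∀ x ∈ Set.Icc δ (1 / 2 : ℝ), 1 / 2 ≤ 1 + s * x ∧ 1 + s * x ≤ 3 / 2 := by
    intro x hx
    rcases hs with rfl | rfl <;> constructor <;> linarith [hx.1, hx.2]
  have hs1 : |s| = 1 := by rcases hs with rfl | rfl <;> simp
  have hss : s * s = 1 := by rcases hs with rfl | rfl <;> simp
  let k : ℝ → ℝ := fun x => x / (η ^ 2 + x ^ 2)
  let k' : ℝ → ℝ := fun x => (η ^ 2 - x ^ 2) / (η ^ 2 + x ^ 2) ^ 2
  have hk : ∀ x, HasDerivAt k (k' x) x := by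
    intro x
    have h0 : η ^ 2 + x ^ 2 ≠ 0 := by positivity
    refine ((hasDerivAt_id x).div (((hasDerivAt_id x).pow 2).const_add (η ^ 2)) h0).congr_deriv ?_
    simp only [k', id, Pi.pow_apply]
    congr 1
    push_cast
    ring
  -- t^(p-1) exp(i a t^q) equals t^(p-q)/(i a q) times the derivative of exp(i a t^q); `m` is the
  -- amplitude that multiplies this derivative, with the orientation sign. The kernel `k` is bounded
  -- by 1/x and its derivative by 1/x², uniformly in η, so every term after integration by parts is
  -- O(1/(|a|δ)).
  let m : ℝ → ℝ := fun x => s * (1 + s * x) ^ (p - q) / q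
  let m' : ℝ → ℝ := fun x => (p - q) * (1 + s * x) ^ (p - q - 1) / q
  have hm : ∀ x ∈ Set.Icc δ (1 / 2 : ℝ), HasDerivAt m (m' x) x := by
    intro x hx
    have h0 : 0 < 1 + s * x := by linarith [(hmem x hx).1]
    have h1 : HasDerivAt (fun x => 1 + s * x) s x := by
      simpa using ((hasDerivAt_id x).const_mul s).const_add 1
    refine (((h1.rpow_const (p := p - q) (Or.inl h0.ne')).const_mul s).div_const q).congr_deriv ?_
    simp only [m']
    linear_combination ((p - q) * (1 + s * x) ^ (p - q - 1) / q) * hss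
  let W : ℝ → ℂ := fun x => Complex.exp (I * ((a * (1 + s * x) ^ q : ℝ) : ℂ))
  let W' : ℝ → ℂ := fun x => s * (I * a * ((q * (1 + s * x) ^ (q - 1) : ℝ) : ℂ) * W x)
  have hW : ∀ x ∈ Set.Icc δ (1 / 2 : ℝ), HasDerivAt W (W' x) x := by
    intro x hx
    have h0 : 0 < 1 + s * x := by linarith [(hmem x hx).1]
    have h1 : HasDerivAt (fun x => 1 + s * x) s x := by
      simpa using ((hasDerivAt_id x).const_mul s).const_add 1
    have := (hasDerivAt_exp_rpow q a h0).scomp x h1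
    simpa [W, W', Function.comp_def] using this
  have hWn : ∀ x, ‖W x‖ = 1 := fun x => norm_exp_I_mul _
  have huIcc : Set.uIcc δ (1 / 2 : ℝ) = Set.Icc δ (1 / 2) := Set.uIcc_of_le hδ2
  have hcm : ContinuousOn (fun x : ℝ => 1 + s * x) (Set.Icc δ (1 / 2)) := by fun_prop
  have hcr : ∀ r : ℝ, ContinuousOn (fun x : ℝ => (1 + s * x) ^ r) (Set.Icc δ (1 / 2)) := fun r =>
    hcm.rpow_const fun x hx => Or.inl (by linarith [(hmem x hx).1])
  have hcW : ContinuousOn W (Set.Icc δ (1 / 2)) := fun x hx =>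
    (hW x hx).continuousAt.continuousWithinAt
  have hck : Continuous k := continuous_iff_continuousAt.mpr fun x => (hk x).continuousAt
  have hck' : Continuous k' := by
    refine Continuous.div (by fun_prop) (by fun_prop) fun x => ?_
    positivity
  have hcm' : ContinuousOn m' (Set.Icc δ (1 / 2)) := ((continuousOn_const.mul (hcr _)).div_const _)
  have hcmm : ContinuousOn m (Set.Icc δ (1 / 2)) := fun x hx =>
    (hm x hx).continuousAt.continuousWithinAt
  have hofc : ∀ {f : ℝ → ℝ}, ContinuousOn f (Set.Icc δ (1 / 2)) →
      ContinuousOn (fun x => ((f x : ℝ) : ℂ)) (Set.Icc δ (1 / 2)) := fun h =>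
    Complex.continuous_ofReal.comp_continuousOn h
  -- integration by parts
  have hibp := intervalIntegral.integral_mul_deriv_eq_deriv_mul (a := δ) (b := 1 / 2)
    (u := fun x => ((k x * m x : ℝ) : ℂ)) (v := W)
    (u' := fun x => ((k' x * m x + k x * m' x : ℝ) : ℂ)) (v' := W')
    (fun x hx => ((hk x).mul (hm x (huIcc ▸ hx))).ofReal_comp)
    (fun x hx => hW x (huIcc ▸ hx))
    (by
      refine ContinuousOn.intervalIntegrable ?_
      rw [huIcc]
      exact hofc ((hck'.continuousOn.mul hcmm).add (hck.continuousOn.mul hcm')))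
    (by
      refine ContinuousOn.intervalIntegrable ?_
      rw [huIcc]
      exact continuousOn_const.mul ((continuousOn_const.mul
        (hofc (continuousOn_const.mul (hcr _)))).mul hcW))
  have hid : ∫ x in δ..(1 / 2 : ℝ), ((k x : ℝ) : ℂ) * oscDensity p q a (1 + s * x) =
      (I * a)⁻¹ * ∫ x in δ..(1 / 2 : ℝ), ((k x * m x : ℝ) : ℂ) * W' x := by
    rw [← intervalIntegral.integral_const_mul]
    refine intervalIntegral.integral_congr fun x hx => ?_
    rw [huIcc] at hx
    have h0 : 0 < 1 + s * x := by linarith [(hmem x hx).1]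
    have hpw : (1 + s * x) ^ (p - 1) = (1 + s * x) ^ (p - q) * (1 + s * x) ^ (q - 1) := by
      rw [← Real.rpow_add h0]; congr 1; ring
    have haI : (I * a : ℂ) ≠ 0 := mul_ne_zero I_ne_zero (by exact_mod_cast ha)
    have hqC : (q : ℂ) ≠ 0 := by exact_mod_cast hq.ne'
    have hsC : (s : ℂ) * s = 1 := by exact_mod_cast hss
    simp only [oscDensity, hpw, m, W', W]
    push_cast
    have haC : (a : ℂ) ≠ 0 := by exact_mod_cast ha
    field_simp
    rw [pow_two, hsC, mul_one]
  have hmb : ∀ x ∈ Set.Icc δ (1 / 2 : ℝ), |m x| ≤ M := by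
    intro x hx
    have h0 : 0 < 1 + s * x := by linarith [(hmem x hx).1]
    have h1 := rpow_le_two_rpow_abs (hmem x hx).1 (hmem x hx).2 (p - q)
    simp only [m, abs_div, abs_mul, hs1, one_mul, abs_of_pos hq,
      abs_of_pos (Real.rpow_pos_of_pos h0 _)]
    have : (1 + s * x) ^ (p - q) / q ≤ 2 ^ |p - q| / q := by gcongr
    have h2 : 0 ≤ |p - q| * (2 : ℝ) ^ |p - q - 1| / q := by positivity
    linarith
  have hmb' : ∀ x ∈ Set.Icc δ (1 / 2 : ℝ), |m' x| ≤ M := by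
    intro x hx
    have h0 : 0 < 1 + s * x := by linarith [(hmem x hx).1]
    have h1 := rpow_le_two_rpow_abs (hmem x hx).1 (hmem x hx).2 (p - q - 1)
    simp only [m', abs_div, abs_mul, abs_of_pos hq, abs_of_pos (Real.rpow_pos_of_pos h0 _)]
    have : |p - q| * (1 + s * x) ^ (p - q - 1) / q ≤ |p - q| * 2 ^ |p - q - 1| / q := by gcongr
    have h2 : 0 ≤ (2 : ℝ) ^ |p - q| / q := by positivity
    linarith
  have hkb : ∀ x, 0 < x → |k x| ≤ 1 / x := by
    intro x hx
    rw [abs_of_nonneg (by positivity)]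
    simp only [k]
    rw [div_le_div_iff₀ (by positivity) hx]
    nlinarith [sq_nonneg η]
  have hkb' : ∀ x, 0 < x → |k' x| ≤ 1 / x ^ 2 := by
    intro x hx
    simp only [k', abs_div]
    rw [abs_of_pos (show 0 < (η ^ 2 + x ^ 2) ^ 2 by positivity),
      div_le_div_iff₀ (by positivity) (by positivity)]
    have h1 : |η ^ 2 - x ^ 2| ≤ η ^ 2 + x ^ 2 := by
      rw [abs_le]; constructor <;> nlinarith [sq_nonneg η, sq_nonneg x]
    nlinarith [sq_nonneg η, sq_nonneg x, abs_nonneg (η ^ 2 - x ^ 2)]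
  -- the three terms
  have hu : ∀ x, x ∈ Set.Icc δ (1 / 2 : ℝ) → ‖((k x * m x : ℝ) : ℂ) * W x‖ ≤ M / δ := by
    intro x hx
    have hx0 : 0 < x := lt_of_lt_of_le hδ hx.1
    rw [norm_mul, hWn, mul_one, Complex.norm_real, Real.norm_eq_abs, abs_mul]
    calc |k x| * |m x| ≤ 1 / x * M :=
          mul_le_mul (hkb x hx0) (hmb x hx) (abs_nonneg _) (by positivity)
      _ ≤ 1 / δ * M := by have := hx.1; gcongr
      _ = _ := by ring
  have hint : ‖∫ x in δ..(1 / 2 : ℝ), ((k' x * m x + k x * m' x : ℝ) : ℂ) * W x‖ ≤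
      2 * M / δ := by
    have hb : ∀ x ∈ Set.Ioc δ (1 / 2 : ℝ),
        ‖((k' x * m x + k x * m' x : ℝ) : ℂ) * W x‖ ≤ 2 * M * (x ^ 2)⁻¹ := by
      intro x hx
      have hx' : x ∈ Set.Icc δ (1 / 2 : ℝ) := ⟨hx.1.le, hx.2⟩
      have hx0 : 0 < x := hδ.trans hx.1
      rw [norm_mul, hWn, mul_one, Complex.norm_real, Real.norm_eq_abs]
      have h3 : 1 / x ≤ 1 / x ^ 2 := by
        gcongr
        nlinarith [hx.2]
      calc |k' x * m x + k x * m' x| ≤ |k' x| * |m x| + |k x| * |m' x| := by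
            rw [← abs_mul, ← abs_mul]; exact abs_add_le _ _
        _ ≤ 1 / x ^ 2 * M + 1 / x ^ 2 * M := by
            gcongr
            · exact hkb' x hx0
            · exact hmb x hx'
            · exact (hkb x hx0).trans h3
            · exact hmb' x hx'
        _ = _ := by ring
    have h0 : (0 : ℝ) ∉ Set.uIcc δ (1 / 2) := by
      rw [huIcc]; intro h; linarith [h.1]
    have hii : IntervalIntegrable (fun x : ℝ => 2 * M * (x ^ 2)⁻¹) volume δ (1 / 2) := by
      refine ContinuousOn.intervalIntegrable (continuousOn_const.mul
        (ContinuousOn.inv₀ (by fun_prop) fun x hx => ?_))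
      exact pow_ne_zero 2 fun h => h0 (h ▸ hx)
    refine (intervalIntegral.norm_integral_le_of_norm_le hδ2 (.of_forall hb) hii).trans ?_
    rw [intervalIntegral.integral_const_mul]
    have h4 : ∫ x in δ..(1 / 2 : ℝ), (x ^ 2)⁻¹ = δ⁻¹ - 2 := by
      have := intervalIntegral.integral_eq_sub_of_hasDerivAt (a := δ) (b := 1 / 2)
        (f := fun x : ℝ => -x⁻¹) (f' := fun x => (x ^ 2)⁻¹) (fun x hx => by
          have hx0 : x ≠ 0 := fun h => h0 (h ▸ hx)
          have h := (hasDerivAt_inv hx0).neg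
          rw [neg_neg] at h
          exact h) (by
          refine ContinuousOn.intervalIntegrable
            (ContinuousOn.inv₀ (by fun_prop) fun x hx => ?_)
          exact pow_ne_zero 2 fun h => h0 (h ▸ hx))
      rw [this]; norm_num; ring
    rw [h4]
    have : δ⁻¹ - 2 ≤ δ⁻¹ := by linarith
    calc 2 * M * (δ⁻¹ - 2) ≤ 2 * M * δ⁻¹ := by gcongr
      _ = _ := by ring
  change ‖∫ x in δ..(1 / 2 : ℝ), ((k x : ℝ) : ℂ) * oscDensity p q a (1 + s * x)‖ ≤ _
  rw [hid, hibp, norm_mul, norm_inv, norm_mul, Complex.norm_I, one_mul, Complex.norm_real,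
    Real.norm_eq_abs]
  have hb1 := hu (1 / 2) ⟨hδ2, le_rfl⟩
  have hb2 := hu δ ⟨le_rfl, hδ2⟩
  have htot : ‖((k (1 / 2) * m (1 / 2) : ℝ) : ℂ) * W (1 / 2) - ((k δ * m δ : ℝ) : ℂ) * W δ -
      ∫ x in δ..(1 / 2 : ℝ), ((k' x * m x + k x * m' x : ℝ) : ℂ) * W x‖ ≤ 4 * M / δ := by
    refine (norm_sub_le _ _).trans ?_
    have := norm_sub_le (((k (1 / 2) * m (1 / 2) : ℝ) : ℂ) * W (1 / 2)) (((k δ * m δ : ℝ) : ℂ) * W δ)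
    have e : 4 * M / δ = M / δ + M / δ + 2 * M / δ := by ring
    linarith
  have ha' : 0 < |a| := abs_pos.mpr ha
  calc |a|⁻¹ * _ ≤ |a|⁻¹ * (4 * M / δ) := by gcongr
    _ = _ := by field_simp

/-- The local Cauchy transform is bounded, uniformly in the phase. -/
theorem exists_bound_localCauchy (p q : ℝ) (hq : 0 < q) : ∃ B, 0 ≤ B ∧ ∀ a η : ℝ, 0 < η →
    ‖localCauchy p q a η‖ ≤ B := by
  -- Folding the interval at t = 1 separates an even part with the Poisson kernel η/(η²+x²), which
  -- is integrable uniformly in η, from an odd part with kernel x/(η²+x²), where the oscillation of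
  -- the density has to be used.
  obtain ⟨L, hL, hLip⟩ := exists_lipschitz_oscDensity p q
  obtain ⟨C, hC⟩ := exists_bound_far_oscillation p q hq
  set M : ℝ := 2 ^ |p - 1| with hM
  have hM0 : 0 ≤ M := by positivity
  have hC0 : 0 ≤ C := by
    have := (norm_nonneg _).trans (hC 1 1 (1 / 2) 1 one_ne_zero one_pos (by norm_num) le_rfl
      (Or.inl rfl))
    norm_num at this
    linarith
  refine ⟨2 * M * Real.pi + (3 * L + 2 * C), by have := Real.pi_pos; positivity,
    fun a η hη => ?_⟩
  let f : ℝ → ℂ := oscDensity p q a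
  have hfc : ContinuousOn f (Set.Ioi 0) := continuousOn_oscDensity p q a
  have hpos : ∀ x ∈ Set.Icc (0 : ℝ) (1 / 2), 0 < 1 + x ∧ 0 < 1 - x := fun x hx =>
    ⟨by linarith [hx.1], by linarith [hx.2]⟩
  have hc1 : ContinuousOn (fun x => f (1 + x)) (Set.Icc 0 (1 / 2)) :=
    hfc.comp (by fun_prop) fun x hx => (hpos x hx).1
  have hc2 : ContinuousOn (fun x => f (1 - x)) (Set.Icc 0 (1 / 2)) :=
    hfc.comp (by fun_prop) fun x hx => (hpos x hx).2
  have h0 : ∀ x : ℝ, η ^ 2 + x ^ 2 ≠ 0 := fun x => by positivity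
  have hp1 : Continuous fun x : ℝ => ((η / (η ^ 2 + x ^ 2) : ℝ) : ℂ) :=
    Complex.continuous_ofReal.comp (continuous_const.div (by fun_prop) h0)
  have hp2 : Continuous fun x : ℝ => ((x / (η ^ 2 + x ^ 2) : ℝ) : ℂ) :=
    Complex.continuous_ofReal.comp (continuous_id.div (by fun_prop) h0)
  have hii : ∀ {g : ℝ → ℂ} {α β : ℝ}, 0 ≤ α → α ≤ β → β ≤ 1 / 2 →
      ContinuousOn g (Set.Icc 0 (1 / 2)) → IntervalIntegrable g volume α β := by
    intro g α β h1 h2 h3 hg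
    refine (hg.mono ?_).intervalIntegrable
    rw [Set.uIcc_of_le h2]
    exact Set.Icc_subset_Icc h1 h3
  have hcA : ContinuousOn (fun x : ℝ => ((η / (η ^ 2 + x ^ 2) : ℝ) : ℂ) * (f (1 + x) + f (1 - x)))
      (Set.Icc 0 (1 / 2)) := hp1.continuousOn.mul (hc1.add hc2)
  have hcB : ContinuousOn (fun x : ℝ => ((x / (η ^ 2 + x ^ 2) : ℝ) : ℂ) * (f (1 + x) - f (1 - x)))
      (Set.Icc 0 (1 / 2)) := hp2.continuousOn.mul (hc1.sub hc2)
  -- the symmetric decomposition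
  have hdec : localCauchy p q a η =
      -(I * ∫ x in (0 : ℝ)..(1 / 2), ((η / (η ^ 2 + x ^ 2) : ℝ) : ℂ) * (f (1 + x) + f (1 - x))) -
      ∫ x in (0 : ℝ)..(1 / 2), ((x / (η ^ 2 + x ^ 2) : ℝ) : ℂ) * (f (1 + x) - f (1 - x)) := by
    have hi := intervalIntegrable_div_denom hfc hη
    have hi1 : IntervalIntegrable (fun t => f t / (1 + (η : ℂ) * I - (t : ℂ))) volume (1 / 2) 1 :=
      hi.mono_set (by
        rw [Set.uIcc_of_le (by norm_num), Set.uIcc_of_le (by norm_num)]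
        exact Set.Icc_subset_Icc le_rfl (by norm_num))
    have hi2 : IntervalIntegrable (fun t => f t / (1 + (η : ℂ) * I - (t : ℂ))) volume 1 (3 / 2) :=
      hi.mono_set (by
        rw [Set.uIcc_of_le (by norm_num), Set.uIcc_of_le (by norm_num)]
        exact Set.Icc_subset_Icc (by norm_num) le_rfl)
    rw [localCauchy, ← intervalIntegral.integral_add_adjacent_intervals hi1 hi2]
    have e1 : ∫ t in (1 / 2 : ℝ)..1, f t / (1 + (η : ℂ) * I - (t : ℂ)) =
        ∫ x in (0 : ℝ)..(1 / 2), f (1 - x) / (1 + (η : ℂ) * I - ((1 - x : ℝ) : ℂ)) := by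
      rw [intervalIntegral.integral_comp_sub_left
        (fun t : ℝ => f t / (1 + (η : ℂ) * I - (t : ℂ))) 1]
      norm_num
    have e2 : ∫ t in (1 : ℝ)..(3 / 2), f t / (1 + (η : ℂ) * I - (t : ℂ)) =
        ∫ x in (0 : ℝ)..(1 / 2), f (1 + x) / (1 + (η : ℂ) * I - ((1 + x : ℝ) : ℂ)) := by
      rw [intervalIntegral.integral_comp_add_left
        (fun t : ℝ => f t / (1 + (η : ℂ) * I - (t : ℂ))) 1]
      norm_num
    have hd1 : ∀ x : ℝ, (1 + (η : ℂ) * I - ((1 - x : ℝ) : ℂ)) ≠ 0 := fun x => denom_ne_zero hη _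
    have hd2 : ∀ x : ℝ, (1 + (η : ℂ) * I - ((1 + x : ℝ) : ℂ)) ≠ 0 := fun x => denom_ne_zero hη _
    change (∫ t in (1 / 2 : ℝ)..1, f t / (1 + (η : ℂ) * I - (t : ℂ))) +
      ∫ t in (1 : ℝ)..(3 / 2), f t / (1 + (η : ℂ) * I - (t : ℂ)) = _
    rw [e1, e2, ← intervalIntegral.integral_add, ← intervalIntegral.integral_const_mul,
      ← intervalIntegral.integral_neg, ← intervalIntegral.integral_sub]
    · refine intervalIntegral.integral_congr fun x _ => ?_
      have h3 := hd1 x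
      have h4 := hd2 x
      have h5 : ((η : ℂ) ^ 2 + (x : ℂ) ^ 2) ≠ 0 := by exact_mod_cast h0 x
      have h6 : (1 + (η : ℂ) * I - ((1 - x : ℝ) : ℂ)) * (1 + (η : ℂ) * I - ((1 + x : ℝ) : ℂ)) =
          -((η : ℂ) ^ 2 + (x : ℂ) ^ 2) := by
        push_cast
        linear_combination (η : ℂ) ^ 2 * I_sq
      have h7 : (1 : ℂ) / (1 + (η : ℂ) * I - ((1 - x : ℝ) : ℂ)) =
          -(η * I - x) / ((η : ℂ) ^ 2 + (x : ℂ) ^ 2) := by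
        rw [div_eq_div_iff h3 h5]
        push_cast at h6 ⊢
        linear_combination (η : ℂ) ^ 2 * I_sq
      have h8 : (1 : ℂ) / (1 + (η : ℂ) * I - ((1 + x : ℝ) : ℂ)) =
          -(η * I + x) / ((η : ℂ) ^ 2 + (x : ℂ) ^ 2) := by
        rw [div_eq_div_iff h4 h5]
        push_cast at h6 ⊢
        linear_combination (η : ℂ) ^ 2 * I_sq
      rw [div_eq_mul_one_div, h7, div_eq_mul_one_div (f (1 + x)), h8]
      push_cast
      ring
    · exact ((hii le_rfl (by norm_num) le_rfl hcA).const_mul I).neg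
    · exact hii le_rfl (by norm_num) le_rfl hcB
    · exact hii le_rfl (by norm_num) le_rfl (hc2.div (by fun_prop) fun x _ => hd1 x)
    · exact hii le_rfl (by norm_num) le_rfl (hc1.div (by fun_prop) fun x _ => hd2 x)
  have hfb : ∀ t, 1 / 2 ≤ t → t ≤ 3 / 2 → ‖f t‖ ≤ M := fun t h1 h2 => by
    rw [show f t = oscDensity p q a t from rfl, norm_oscDensity (by linarith)]
    exact rpow_le_two_rpow_abs h1 h2 _
  have hA : ‖∫ x in (0 : ℝ)..(1 / 2), ((η / (η ^ 2 + x ^ 2) : ℝ) : ℂ) * (f (1 + x) + f (1 - x))‖ ≤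
      2 * M * Real.pi := by
    have hd : ∀ x : ℝ, HasDerivAt (fun x => Real.arctan (x / η)) (η / (η ^ 2 + x ^ 2)) x := by
      intro x
      have h1 : HasDerivAt (fun x : ℝ => x / η) (1 / η) x := (hasDerivAt_id x).div_const η
      refine h1.arctan.congr_deriv ?_
      have := h0 x
      field_simp
    have hint : IntervalIntegrable (fun x : ℝ => 2 * M * (η / (η ^ 2 + x ^ 2))) volume 0 (1 / 2) :=
      (continuous_const.mul (continuous_const.div (by fun_prop) h0)).intervalIntegrable _ _
    refine (intervalIntegral.norm_integral_le_of_norm_le (by norm_num) (.of_forall ?_)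
      hint).trans ?_
    · intro x hx
      have hx1 := hx.1
      have hx2 := hx.2
      rw [norm_mul, Complex.norm_real, Real.norm_of_nonneg (by positivity), mul_comm]
      have := norm_add_le (f (1 + x)) (f (1 - x))
      have h1 := hfb (1 + x) (by linarith) (by linarith)
      have h2 := hfb (1 - x) (by linarith) (by linarith)
      gcongr
      linarith
    · rw [intervalIntegral.integral_const_mul, intervalIntegral.integral_eq_sub_of_hasDerivAt
        (fun x _ => hd x) ((continuous_const.div (by fun_prop) h0).intervalIntegrable _ _)]
      gcongr
      have h1 := Real.arctan_lt_pi_div_two (1 / 2 / η)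
      simp only [zero_div, Real.arctan_zero, sub_zero]
      linarith [Real.pi_pos]
  have hcB1 : ContinuousOn (fun x : ℝ => ((x / (η ^ 2 + x ^ 2) : ℝ) : ℂ) * f (1 + x))
      (Set.Icc 0 (1 / 2)) := hp2.continuousOn.mul hc1
  have hcB2 : ContinuousOn (fun x : ℝ => ((x / (η ^ 2 + x ^ 2) : ℝ) : ℂ) * f (1 - x))
      (Set.Icc 0 (1 / 2)) := hp2.continuousOn.mul hc2
  -- the odd part near the centre
  have hnear : ∀ δ, 0 ≤ δ → δ ≤ 1 / 2 →
      ‖∫ x in (0 : ℝ)..δ, ((x / (η ^ 2 + x ^ 2) : ℝ) : ℂ) * (f (1 + x) - f (1 - x))‖ ≤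
        2 * L * (1 + |a|) * δ := by
    intro δ h1 h2
    have := intervalIntegral.norm_integral_le_of_norm_le_const (a := 0) (b := δ)
      (f := fun x : ℝ => ((x / (η ^ 2 + x ^ 2) : ℝ) : ℂ) * (f (1 + x) - f (1 - x)))
      (C := 2 * L * (1 + |a|)) (by
        intro x hx
        rw [Set.uIoc_of_le h1] at hx
        have hx1 := hx.1
        have hx2 := hx.2
        rw [norm_mul, Complex.norm_real, Real.norm_of_nonneg (by positivity)]
        have hl := hLip a (1 - x) (1 + x) ⟨by linarith, by linarith⟩ ⟨by linarith, by linarith⟩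
        have e : |1 + x - (1 - x)| = 2 * x := by
          rw [show 1 + x - (1 - x) = 2 * x by ring, abs_of_pos (by linarith)]
        rw [e] at hl
        calc x / (η ^ 2 + x ^ 2) * ‖f (1 + x) - f (1 - x)‖
            ≤ x / (η ^ 2 + x ^ 2) * (L * (1 + |a|) * (2 * x)) := by gcongr
          _ = 2 * L * (1 + |a|) * (x ^ 2 / (η ^ 2 + x ^ 2)) := by ring
          _ ≤ 2 * L * (1 + |a|) * 1 := by
            gcongr
            rw [div_le_one (by positivity)]
            nlinarith [sq_nonneg η]
          _ = _ := mul_one _)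
    rwa [sub_zero, abs_of_nonneg h1] at this
  have hB : ‖∫ x in (0 : ℝ)..(1 / 2), ((x / (η ^ 2 + x ^ 2) : ℝ) : ℂ) * (f (1 + x) - f (1 - x))‖ ≤
      3 * L + 2 * C := by
    -- The Lipschitz constant is proportional to 1 + |a|, so for large |a| it is used only on [0,
    -- 1/|a|], where it contributes O(1). Beyond that point the oscillation bound C/(|a|δ) with δ =
    -- 1/|a| is O(1) too.
    rcases le_or_gt |a| 2 with ha | ha
    · refine (hnear (1 / 2) (by norm_num) le_rfl).trans ?_
      nlinarith
    · have ha0 : a ≠ 0 := fun h => by rw [h, abs_zero] at ha; linarith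
      have hδ0 : 0 < |a|⁻¹ := inv_pos.mpr (by linarith)
      have hδ : |a|⁻¹ ≤ 1 / 2 := by
        rw [one_div]; exact inv_anti₀ (by norm_num) ha.le
      have haδ : |a| * |a|⁻¹ = 1 := mul_inv_cancel₀ (by linarith)
      rw [← intervalIntegral.integral_add_adjacent_intervals (b := |a|⁻¹)
        (hii le_rfl hδ0.le hδ hcB) (hii hδ0.le hδ le_rfl hcB)]
      refine (norm_add_le _ _).trans ?_
      have e1 : ‖∫ x in |a|⁻¹..(1 / 2 : ℝ),
          ((x / (η ^ 2 + x ^ 2) : ℝ) : ℂ) * (f (1 + x) - f (1 - x))‖ ≤ 2 * C := by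
        simp only [mul_sub]
        rw [intervalIntegral.integral_sub (hii hδ0.le hδ le_rfl hcB1) (hii hδ0.le hδ le_rfl hcB2)]
        refine (norm_sub_le _ _).trans ?_
        have b1 := hC a η |a|⁻¹ 1 ha0 hη hδ0 hδ (Or.inl rfl)
        have b2 := hC a η |a|⁻¹ (-1) ha0 hη hδ0 hδ (Or.inr rfl)
        rw [haδ, div_one] at b1 b2
        simp only [one_mul, neg_mul, ← sub_eq_add_neg] at b1 b2
        simp only [f]
        linarith
      have e2 := hnear |a|⁻¹ hδ0.le hδ
      have e3 : 2 * L * (1 + |a|) * |a|⁻¹ ≤ 3 * L := by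
        have : 2 * L * (1 + |a|) * |a|⁻¹ = 2 * L * (|a|⁻¹ + 1) := by
          rw [mul_assoc, add_mul, haδ, one_mul]
        rw [this]
        nlinarith
      linarith
  rw [hdec]
  refine (norm_sub_le _ _).trans ?_
  rw [norm_neg, norm_mul, Complex.norm_I, one_mul]
  linarith

/-- The local Cauchy transform depends continuously on the phase at zero, uniformly. -/
theorem exists_bound_localCauchy_sub (p q : ℝ) (hq : 0 < q) : ∃ B, 0 ≤ B ∧ ∀ a η : ℝ, 0 < η →
    ‖localCauchy p q a η - localCauchy p q 0 η‖ ≤ B * |a| := by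
  obtain ⟨L, hL, hLip⟩ := exists_lipschitz_oscDensity_sub p q
  -- With p = 1 and zero phase the density is 1, so this bounds the integral of the bare kernel.
  obtain ⟨B, hB, hBb⟩ := exists_bound_localCauchy 1 q hq
  refine ⟨L + B, by positivity, fun a η hη => ?_⟩
  rw [localCauchy_eq p q a hη, localCauchy_eq p q 0 hη]
  set K := ∫ t in (1 / 2 : ℝ)..(3 / 2), (1 : ℂ) / (1 + (η : ℂ) * I - (t : ℂ)) with hK
  have hKb : ‖K‖ ≤ B := by
    have := hBb 0 η hη
    rw [localCauchy] at this
    simpa [oscDensity, hK] using this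
  have hint : ∀ a, IntervalIntegrable (fun t => (oscDensity p q a t - oscDensity p q a 1) /
      (1 + (η : ℂ) * I - (t : ℂ))) volume (1 / 2) (3 / 2) := fun a =>
    intervalIntegrable_div_denom ((continuousOn_oscDensity p q a).sub continuousOn_const) hη
  have h1 : ‖(∫ t in (1 / 2 : ℝ)..(3 / 2), (oscDensity p q a t - oscDensity p q a 1) /
      (1 + (η : ℂ) * I - (t : ℂ))) - ∫ t in (1 / 2 : ℝ)..(3 / 2),
        (oscDensity p q 0 t - oscDensity p q 0 1) / (1 + (η : ℂ) * I - (t : ℂ))‖ ≤ L * |a| := by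
    rw [← intervalIntegral.integral_sub (hint a) (hint 0)]
    have := intervalIntegral.norm_integral_le_of_norm_le_const (a := 1 / 2) (b := 3 / 2)
      (f := fun t : ℝ => (oscDensity p q a t - oscDensity p q a 1) / (1 + (η : ℂ) * I - (t : ℂ)) -
        (oscDensity p q 0 t - oscDensity p q 0 1) / (1 + (η : ℂ) * I - (t : ℂ)))
      (C := L * |a|) (by
        intro t ht
        rw [Set.uIoc_of_le (by norm_num)] at ht
        rw [← sub_div, norm_div]
        refine div_le_of_le_mul₀ (norm_nonneg _) (by positivity) ?_
        have h2 := hLip a 1 t (by norm_num) ⟨ht.1.le, ht.2⟩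
        have h3 := abs_le_norm_denom η t
        calc _ = ‖(oscDensity p q a t - oscDensity p q 0 t) -
              (oscDensity p q a 1 - oscDensity p q 0 1)‖ := by congr 1; ring
          _ ≤ L * |a| * |t - 1| := h2
          _ ≤ _ := by gcongr)
    norm_num at this
    simpa using this
  have h2 : ‖oscDensity p q a 1 - oscDensity p q 0 1‖ ≤ |a| := by
    rw [oscDensity_one, oscDensity_one]
    simpa using Real.norm_exp_I_mul_ofReal_sub_one_le (x := a)
  calc _ = ‖((∫ t in (1 / 2 : ℝ)..(3 / 2), (oscDensity p q a t - oscDensity p q a 1) /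
      (1 + (η : ℂ) * I - (t : ℂ))) - ∫ t in (1 / 2 : ℝ)..(3 / 2),
        (oscDensity p q 0 t - oscDensity p q 0 1) / (1 + (η : ℂ) * I - (t : ℂ))) +
        (oscDensity p q a 1 - oscDensity p q 0 1) * K‖ := by congr 1; ring
    _ ≤ L * |a| + |a| * B := by
        refine (norm_add_le _ _).trans (add_le_add h1 ?_)
        rw [norm_mul]
        gcongr
    _ = _ := by ring

end SepScattering

namespace SepScattering

/-! ### Fourier transforms of integrable weights -/

section Fourier

variable {X : Type*} [MeasurableSpace X] {μ : Measure X} {u : X → ℂ} {τ : X → ℝ}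

/-- The function `r ↦ ∫ u(x) exp(i r τ(x)) dμ(x)`. -/
noncomputable def fourierOf (μ : Measure X) (u : X → ℂ) (τ : X → ℝ) (r : ℝ) : ℂ :=
  ∫ x, u x * Complex.exp (I * ((r * τ x : ℝ) : ℂ)) ∂μ

lemma norm_fourierOf_le (r : ℝ) : ‖fourierOf μ u τ r‖ ≤ ∫ x, ‖u x‖ ∂μ := by
  refine (norm_integral_le_integral_norm _).trans (le_of_eq ?_)
  congr 1; ext x
  rw [norm_mul, norm_exp_I_mul, mul_one]

lemma integrable_fourierOf (hu : Integrable u μ) (hτ : Measurable τ) (r : ℝ) :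
    Integrable (fun x => u x * Complex.exp (I * ((r * τ x : ℝ) : ℂ))) μ := by
  refine hu.mul_bdd (c := 1) (by fun_prop) (.of_forall fun x => ?_)
  rw [norm_exp_I_mul]

lemma continuous_fourierOf (hu : Integrable u μ) (hτ : Measurable τ) :
    Continuous (fourierOf μ u τ) := by
  refine continuous_of_dominated (bound := fun x => ‖u x‖)
    (fun r => (integrable_fourierOf hu hτ r).aestronglyMeasurable)
    (fun r => .of_forall fun x => ?_) hu.norm (.of_forall fun x => by fun_prop)
  rw [norm_mul, norm_exp_I_mul, mul_one]

lemma conj_exp_I_mul (x : ℝ) : conj (Complex.exp (I * (x : ℂ))) = Complex.exp (I * ((-x : ℝ) : ℂ)) := by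
  rw [← Complex.exp_conj, map_mul, conj_I, conj_ofReal]
  push_cast; congr 1; ring

lemma conj_fourierOf (r : ℝ) :
    conj (fourierOf μ u τ r) = fourierOf μ (fun x => conj (u x)) (fun x => -τ x) r := by
  rw [fourierOf, fourierOf, ← integral_conj]
  congr 1; ext x
  rw [map_mul, conj_exp_I_mul, mul_neg]

end Fourier

/-- The Fourier transforms of integrable weights on measure spaces. -/
def IsFourier (s : ℝ → ℂ) : Prop :=
  ∃ (X : Type) (_ : MeasurableSpace X) (μ : Measure X) (_ : SFinite μ) (u : X → ℂ) (τ : X → ℝ),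
    Integrable u μ ∧ Measurable τ ∧ s = fourierOf μ u τ

lemma IsFourier.continuous {s : ℝ → ℂ} (h : IsFourier s) : Continuous s := by
  obtain ⟨X, _, μ, _, u, τ, hu, hτ, rfl⟩ := h
  exact continuous_fourierOf hu hτ

lemma IsFourier.exists_bound {s : ℝ → ℂ} (h : IsFourier s) : ∃ M, 0 ≤ M ∧ ∀ r, ‖s r‖ ≤ M := by
  obtain ⟨X, _, μ, _, u, τ, hu, hτ, rfl⟩ := h
  exact ⟨_, integral_nonneg fun _ => norm_nonneg _, norm_fourierOf_le⟩

lemma IsFourier.conj_fun {s : ℝ → ℂ} (h : IsFourier s) : IsFourier fun r => conj (s r) := by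
  obtain ⟨X, _, μ, _, u, τ, hu, hτ, rfl⟩ := h
  exact ⟨X, _, μ, ‹_›, _, _, Complex.conjLIE.toContinuousLinearEquiv.toContinuousLinearMap.integrable_comp hu, hτ.neg, funext conj_fourierOf⟩

lemma isFourier_const (c : ℂ) : IsFourier fun _ => c := by
  refine ⟨Unit, _, Measure.dirac (), inferInstance, fun _ => c, fun _ => 0, by fun_prop,
    measurable_const, ?_⟩
  ext r
  simp [fourierOf]

/-! ### Densities on the half-line and their Cauchy transforms -/

/-- The density `t^(p-1) s(t^q)`. -/
noncomputable def halfDensity (p q : ℝ) (s : ℝ → ℂ) (t : ℝ) : ℂ :=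
  ((t ^ (p - 1) : ℝ) : ℂ) * s (t ^ q)

/-- The Cauchy transform of a density on the half-line. -/
noncomputable def cauchy (p q : ℝ) (s : ℝ → ℂ) (ω : ℂ) : ℂ :=
  ∫ t in Set.Ioi (0 : ℝ), halfDensity p q s t / (ω - (t : ℂ))

/-- The standing assumptions on a density on the half-line. -/
structure IsHalfDensity (p q : ℝ) (s : ℝ → ℂ) : Prop where
  p_pos : 0 < p
  q_pos : 0 < q
  fourier : IsFourier s
  decay : ∃ C δ : ℝ, 0 < δ ∧ ∀ t : ℝ, 1 ≤ t → t ^ (p - 1) * ‖s (t ^ q)‖ ≤ C * t ^ (-δ)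

lemma norm_halfDensity {p q t : ℝ} {s : ℝ → ℂ} (ht : 0 < t) :
    ‖halfDensity p q s t‖ = t ^ (p - 1) * ‖s (t ^ q)‖ := by
  rw [halfDensity, norm_mul, Complex.norm_real, Real.norm_of_nonneg (Real.rpow_nonneg ht.le _)]

lemma conj_halfDensity (p q : ℝ) (s : ℝ → ℂ) (t : ℝ) :
    conj (halfDensity p q s t) = halfDensity p q (fun r => conj (s r)) t := by
  rw [halfDensity, halfDensity, map_mul, conj_ofReal]

lemma conj_cauchy (p q : ℝ) (s : ℝ → ℂ) (ω : ℂ) :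
    conj (cauchy p q s ω) = cauchy p q (fun r => conj (s r)) (conj ω) := by
  rw [cauchy, cauchy, ← integral_conj]
  congr 1; ext t
  rw [map_div₀, conj_halfDensity, map_sub, conj_ofReal]

/-- For p < 1 the boundedness of s alone gives decay, with rate 1 - p. -/
lemma isHalfDensity_of_lt_one {p q : ℝ} {s : ℝ → ℂ} (hp : 0 < p) (hp1 : p < 1) (hq : 0 < q)
    (hs : IsFourier s) : IsHalfDensity p q s := by
  obtain ⟨M, hM, hb⟩ := hs.exists_bound
  refine ⟨hp, hq, hs, M, 1 - p, by linarith, fun t ht => ?_⟩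
  rw [mul_comm, neg_sub]
  exact mul_le_mul_of_nonneg_right (hb _) (Real.rpow_nonneg (by linarith) _)

namespace IsHalfDensity

variable {p q : ℝ} {s : ℝ → ℂ}

lemma conj_fun (H : IsHalfDensity p q s) : IsHalfDensity p q fun r => conj (s r) :=
  ⟨H.p_pos, H.q_pos, H.fourier.conj_fun, by simpa only [RCLike.norm_conj] using H.decay⟩

lemma continuousOn (H : IsHalfDensity p q s) : ContinuousOn (halfDensity p q s) (Set.Ioi 0) := by
  have h1 : ∀ r : ℝ, ContinuousOn (fun t : ℝ => t ^ r) (Set.Ioi 0) := fun r t ht =>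
    (Real.continuousAt_rpow_const _ _ (Or.inl (ne_of_gt ht))).continuousWithinAt
  exact (Complex.continuous_ofReal.comp_continuousOn (h1 _)).mul
    (H.fourier.continuous.comp_continuousOn (h1 _))

lemma integrableOn (H : IsHalfDensity p q s) :
    IntegrableOn (fun t => ‖halfDensity p q s t‖ / (1 + t)) (Set.Ioi 0) := by
  have hm : ContinuousOn (fun t => ‖halfDensity p q s t‖ / (1 + t)) (Set.Ioi 0) :=
    H.continuousOn.norm.div (by fun_prop) fun t ht => by
      have : (0 : ℝ) < t := ht
      positivity
  obtain ⟨M, hM, hb⟩ := H.fourier.exists_bound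
  obtain ⟨C, δ, hδ, hdec⟩ := H.decay
  rw [← Set.Ioc_union_Ioi_eq_Ioi (zero_le_one (α := ℝ))]
  refine IntegrableOn.union ?_ ?_
  · have h1 : IntegrableOn (fun t : ℝ => M * t ^ (p - 1)) (Set.Ioc 0 1) := by
      have := intervalIntegral.intervalIntegrable_rpow' (a := 0) (b := 1)
        (show -1 < p - 1 by linarith [H.p_pos])
      exact ((intervalIntegrable_iff_integrableOn_Ioc_of_le zero_le_one).mp this).const_mul M
    refine h1.mono' ((hm.mono Set.Ioc_subset_Ioi_self).aestronglyMeasurable measurableSet_Ioc) ?_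
    filter_upwards [ae_restrict_mem measurableSet_Ioc] with t ht
    have ht0 : 0 < t := ht.1
    rw [Real.norm_of_nonneg (by positivity), norm_halfDensity ht0]
    refine (div_le_self (by positivity) (by linarith)).trans ?_
    rw [mul_comm]
    gcongr
    exact hb _
  · have h1 : IntegrableOn (fun t : ℝ => C * t ^ (-δ - 1)) (Set.Ioi 1) :=
      (integrableOn_Ioi_rpow_of_lt (by linarith) zero_lt_one).const_mul C
    refine h1.mono' ((hm.mono (Set.Ioi_subset_Ioi zero_le_one)).aestronglyMeasurable
      measurableSet_Ioi) ?_
    filter_upwards [ae_restrict_mem measurableSet_Ioi] with t ht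
    have ht1 : 1 < t := ht
    have ht0 : 0 < t := by linarith
    rw [Real.norm_of_nonneg (by positivity), norm_halfDensity ht0, show C * t ^ (-δ - 1) = C * t ^ (-δ) / t by
      rw [Real.rpow_sub_one ht0.ne', mul_div_assoc]]
    have := hdec t ht1.le
    have h0 : 0 ≤ C * t ^ (-δ) := le_trans (by positivity) this
    gcongr
    linarith

end IsHalfDensity

/-! ### Differentiability off the half-line -/

lemma isClosed_insert_Ioi : IsClosed (insert 0 (Set.Ioi (0 : ℝ))) := by
  rw [Set.Ioi_insert]; exact isClosed_Ici

lemma IsHalfDensity.integrableOn_div {p q : ℝ} {s : ℝ → ℂ} (H : IsHalfDensity p q s) {ω : ℂ}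
    (hω : ω ∈ offContinuum (Set.Ioi 0)) (n : ℕ) :
    IntegrableOn (fun t : ℝ => halfDensity p q s t / (ω - (t : ℂ)) ^ (n + 1)) (Set.Ioi 0) := by
  obtain ⟨c, hc, hb⟩ := exists_lower_bound_offContinuum isClosed_insert_Ioi hω
  have hb := hb.self_of_nhds
  refine (H.integrableOn.const_mul ((c ^ (n + 1))⁻¹)).mono' ?_ ?_
  · refine ContinuousOn.aestronglyMeasurable ?_ measurableSet_Ioi
    refine H.continuousOn.div (by fun_prop) fun t ht => pow_ne_zero _ ?_
    exact sub_ne_zero.mpr (hω t (Set.mem_insert_of_mem _ ht))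
  · filter_upwards [ae_restrict_mem measurableSet_Ioi] with t ht
    have ht0 : 0 < t := ht
    have h1 := hb t (Set.mem_insert_of_mem _ ht)
    rw [abs_of_pos ht0, norm_sub_rev] at h1
    rw [norm_div, norm_pow, ← div_eq_inv_mul, div_div]
    refine div_le_div_of_nonneg_left (norm_nonneg _) (by positivity) ?_
    calc (1 + t) * c ^ (n + 1) ≤ (1 + t) ^ (n + 1) * c ^ (n + 1) := by
          gcongr
          exact le_self_pow₀ (by linarith) (by omega)
      _ = (c * (1 + t)) ^ (n + 1) := by rw [mul_pow, mul_comm]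
      _ ≤ _ := by gcongr

lemma IsHalfDensity.differentiableOn_cauchy {p q : ℝ} {s : ℝ → ℂ} (H : IsHalfDensity p q s) :
    DifferentiableOn ℂ (cauchy p q s) (offContinuum (Set.Ioi 0)) := by
  intro ω hω
  have hΩ := (isOpen_offContinuum isClosed_insert_Ioi).mem_nhds hω
  obtain ⟨c, hc, hb⟩ := exists_lower_bound_offContinuum isClosed_insert_Ioi hω
  have hi := fun n {ω} (h : ω ∈ offContinuum (Set.Ioi 0)) => H.integrableOn_div h n
  refine (HasDerivAt.differentiableAt (f' := ∫ t in Set.Ioi (0 : ℝ),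
    -(halfDensity p q s t / (ω - (t : ℂ)) ^ (1 + 1))) ?_).differentiableWithinAt
  refine (hasDerivAt_integral_of_dominated_loc_of_deriv_le (μ := volume.restrict (Set.Ioi 0))
    (F := fun (ω : ℂ) (t : ℝ) => halfDensity p q s t / (ω - (t : ℂ)))
    (F' := fun (ω : ℂ) (t : ℝ) => -(halfDensity p q s t / (ω - (t : ℂ)) ^ (1 + 1)))
    (bound := fun t => (c ^ 2)⁻¹ * (‖halfDensity p q s t‖ / (1 + t)))
    (Filter.inter_mem hΩ hb) ?_ ?_ (hi 1 hω).neg.aestronglyMeasurable ?_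
    (H.integrableOn.const_mul _) ?_).2
  · filter_upwards [hΩ] with ω h
    have := hi 0 h
    simp only [zero_add, pow_one] at this
    exact this.aestronglyMeasurable
  · have := hi 0 hω
    simp only [zero_add, pow_one] at this
    exact this
  · filter_upwards [ae_restrict_mem measurableSet_Ioi] with t ht ω' hω'
    have ht0 : 0 < t := ht
    have h1 := hω'.2 t (Set.mem_insert_of_mem _ ht)
    rw [abs_of_pos ht0, norm_sub_rev] at h1
    rw [norm_neg, norm_div, norm_pow, ← div_eq_inv_mul, div_div]
    refine div_le_div_of_nonneg_left (norm_nonneg _) (by positivity) ?_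
    calc (1 + t) * c ^ 2 ≤ (1 + t) ^ (1 + 1) * c ^ 2 := by
          gcongr
          exact le_self_pow₀ (by linarith) (by omega)
      _ = (c * (1 + t)) ^ 2 := by rw [mul_pow, mul_comm]
      _ ≤ _ := by gcongr
  · filter_upwards [ae_restrict_mem measurableSet_Ioi] with t ht ω' hω'
    have h0 : ω' - (t : ℂ) ≠ 0 := sub_ne_zero.mpr (hω'.1 t (Set.mem_insert_of_mem _ ht))
    have h1 := (hasDerivAt_const ω' (halfDensity p q s t)).div
      ((hasDerivAt_id ω').sub_const (t : ℂ)) h0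
    refine h1.congr_deriv ?_
    simp [neg_div]

end SepScattering

namespace SepScattering

/-! ### Splitting the Cauchy transform -/

/-- The part of the half-line that is close to `ω`. -/
def nearSet (ω : ℂ) : Set ℝ := {t | |t - ω.re| < ω.re / 2 ∧ ω.im < ω.re}

lemma nearSet_eq_Ioo {ω : ℂ} (h : ω.im < ω.re) :
    nearSet ω = Set.Ioo (1 / 2 * ω.re) (3 / 2 * ω.re) := by
  ext t
  simp only [nearSet, Set.mem_ofPred_eq, h, and_true, abs_lt, Set.mem_Ioo]
  constructor <;> rintro ⟨h1, h2⟩ <;> constructor <;> linarith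

lemma nearSet_eq_empty {ω : ℂ} (h : ¬ ω.im < ω.re) : nearSet ω = ∅ := by
  ext t; simp [nearSet, h]

lemma measurableSet_nearSet (ω : ℂ) : MeasurableSet (nearSet ω) := by
  by_cases h : ω.im < ω.re
  · rw [nearSet_eq_Ioo h]; exact measurableSet_Ioo
  · rw [nearSet_eq_empty h]; exact MeasurableSet.empty

/-- Away from the near set either t is at distance at least Re ω/2 from Re ω, or Im ω ≥ Re ω. In
both cases |ω| ≤ 3|ω-t|, and t ≤ |ω| + |ω-t| then gives the constant 2·3 + 1 = 7. -/
lemma norm_add_le_of_notMem_nearSet {ω : ℂ} (h0 : 0 ≤ ω.im) {t : ℝ} (ht : 0 < t)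
    (hn : t ∉ nearSet ω) : ‖ω‖ + t ≤ 7 * ‖ω - (t : ℂ)‖ := by
  have h1 : ‖ω‖ ≤ 3 * ‖ω - (t : ℂ)‖ := by
    rw [← abs_of_nonneg (norm_nonneg ω), ← abs_of_nonneg (show 0 ≤ 3 * ‖ω - (t : ℂ)‖ by positivity),
      ← sq_le_sq, mul_pow, ← Complex.normSq_eq_norm_sq, ← Complex.normSq_eq_norm_sq,
      Complex.normSq_apply, Complex.normSq_apply]
    simp only [sub_re, ofReal_re, sub_im, ofReal_im, sub_zero]
    simp only [nearSet, Set.mem_ofPred_eq, not_and_or, not_lt] at hn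
    rcases hn with hn | hn
    · rcases le_or_gt ω.re 0 with hx | hx
      · nlinarith [mul_nonneg ht.le (neg_nonneg.mpr hx), sq_nonneg ω.re, sq_nonneg ω.im]
      · have : (ω.re / 2) ^ 2 ≤ (t - ω.re) ^ 2 := by
          rw [← sq_abs (t - ω.re)]; gcongr
        nlinarith [sq_nonneg ω.im]
    · rcases le_or_gt ω.re 0 with hx | hx
      · nlinarith [mul_nonneg ht.le (neg_nonneg.mpr hx), sq_nonneg ω.re, sq_nonneg ω.im]
      · nlinarith [sq_nonneg (ω.re - t)]
  have h2 : t ≤ ‖ω‖ + ‖ω - (t : ℂ)‖ := by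
    have := norm_sub_le ω (ω - (t : ℂ))
    rwa [sub_sub_cancel, Complex.norm_real, Real.norm_of_nonneg ht.le] at this
  linarith

/-- The part of the Cauchy transform away from `ω`. -/
noncomputable def farCauchy (p q : ℝ) (s : ℝ → ℂ) (ω : ℂ) : ℂ :=
  ∫ t in Set.Ioi (0 : ℝ), (nearSet ω)ᶜ.indicator
    (fun t => halfDensity p q s t / (ω - (t : ℂ))) t

lemma norm_far_le {p q : ℝ} {s : ℝ → ℂ} {ω : ℂ} (h0 : 0 < ω.im) {t : ℝ} (ht : 0 < t) :
    ‖(nearSet ω)ᶜ.indicator (fun t => halfDensity p q s t / (ω - (t : ℂ))) t‖ ≤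
      7 * (‖halfDensity p q s t‖ / (‖ω‖ + t)) := by
  by_cases hn : t ∈ nearSet ω
  · rw [Set.indicator_of_notMem (by simpa using hn), norm_zero]; positivity
  · rw [Set.indicator_of_mem (by simpa using hn), norm_div]
    have h1 := norm_add_le_of_notMem_nearSet h0.le ht hn
    have h2 : 0 < ‖ω‖ + t := by positivity
    rw [← mul_div_assoc, div_le_div_iff₀ (by linarith) h2]
    nlinarith [norm_nonneg (halfDensity p q s t)]

namespace IsHalfDensity

variable {p q : ℝ} {s : ℝ → ℂ}

lemma aestronglyMeasurable_far (H : IsHalfDensity p q s) {ω : ℂ} (h0 : 0 < ω.im) :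
    AEStronglyMeasurable ((nearSet ω)ᶜ.indicator
      (fun t => halfDensity p q s t / (ω - (t : ℂ)))) (volume.restrict (Set.Ioi 0)) := by
  refine AEStronglyMeasurable.indicator ?_ (measurableSet_nearSet ω).compl
  have := (H.integrableOn_div (mem_offContinuum_of_im_ne h0.ne') 0).aestronglyMeasurable
  simpa only [zero_add, pow_one] using this

lemma cauchy_eq_far_add (H : IsHalfDensity p q s) {ω : ℂ} (h0 : 0 < ω.im) :
    cauchy p q s ω = farCauchy p q s ω +
      ∫ t in Set.Ioi (0 : ℝ) ∩ nearSet ω, halfDensity p q s t / (ω - (t : ℂ)) := by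
  have hi := H.integrableOn_div (mem_offContinuum_of_im_ne (Rc := Set.Ioi 0) h0.ne') 0
  simp only [zero_add, pow_one] at hi
  rw [cauchy, farCauchy, setIntegral_indicator (measurableSet_nearSet ω).compl, add_comm]
  exact (integral_inter_add_sdiff (measurableSet_nearSet ω) hi).symm

/-- Dominated convergence for the far part. -/
lemma tendsto_farCauchy (H : IsHalfDensity p q s) {l : Filter ℂ} [l.IsCountablyGenerated]
    (hl : ∀ᶠ ω in l, 0 < ω.im) {c : ℝ} (hc : 0 < c) (hlc : ∀ᶠ ω in l, c ≤ ‖ω‖) {f : ℝ → ℂ}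
    (hf : ∀ᵐ t ∂volume.restrict (Set.Ioi (0 : ℝ)), Tendsto (fun ω => (nearSet ω)ᶜ.indicator
      (fun t => halfDensity p q s t / (ω - (t : ℂ))) t) l (𝓝 (f t))) :
    Tendsto (farCauchy p q s) l (𝓝 (∫ t in Set.Ioi (0 : ℝ), f t)) := by
  refine tendsto_integral_filter_of_dominated_convergence
    (fun t => 7 * (min c 1)⁻¹ * (‖halfDensity p q s t‖ / (1 + t))) ?_ ?_
    (H.integrableOn.const_mul _) hf
  · filter_upwards [hl] with ω h using H.aestronglyMeasurable_far h
  · filter_upwards [hl, hlc] with ω h h1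
    filter_upwards [ae_restrict_mem measurableSet_Ioi] with t ht
    have ht0 : 0 < t := ht
    refine (norm_far_le h ht0).trans ?_
    have hm : 0 < min c 1 := lt_min hc one_pos
    rw [mul_assoc, ← div_eq_inv_mul, div_div]
    refine mul_le_mul_of_nonneg_left ?_ (by norm_num)
    refine div_le_div_of_nonneg_left (norm_nonneg _) (by positivity) ?_
    nlinarith [min_le_left c 1, min_le_right c 1]

/-- The cutoff may jump in the limit only at t = E/2 and t = 3E/2, a null set. -/
lemma tendsto_farCauchy_real (H : IsHalfDensity p q s) {E : ℝ} (hE : 0 < E) :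
    Tendsto (farCauchy p q s) (𝓝[upper] (E : ℂ)) (𝓝 (farCauchy p q s E)) := by
  refine H.tendsto_farCauchy (c := E / 2) self_mem_nhdsWithin (by positivity) ?_ ?_
  · have : Tendsto (fun ω : ℂ => ‖ω‖) (𝓝[upper] (E : ℂ)) (𝓝 ‖(E : ℂ)‖) :=
      (continuous_norm.tendsto _).mono_left nhdsWithin_le_nhds
    refine this.eventually (le_mem_nhds ?_)
    rw [Complex.norm_real, Real.norm_of_nonneg hE.le]; linarith
  · have hne : ∀ᵐ t : ℝ, t ≠ E / 2 ∧ t ≠ 3 * E / 2 :=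
      (by simp [ae_iff] : ∀ᵐ t : ℝ, t ≠ E / 2).and (by simp [ae_iff])
    filter_upwards [ae_restrict_of_ae hne] with t ht
    refine Tendsto.mono_left ?_ nhdsWithin_le_nhds
    have hre : Tendsto (fun ω : ℂ => |t - ω.re|) (𝓝 (E : ℂ)) (𝓝 |t - E|) := by
      have : Continuous fun ω : ℂ => |t - ω.re| := by fun_prop
      simpa using this.tendsto (E : ℂ)
    have hre2 : Tendsto (fun ω : ℂ => ω.re / 2) (𝓝 (E : ℂ)) (𝓝 (E / 2)) := by
      have : Continuous fun ω : ℂ => ω.re / 2 := by fun_prop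
      simpa using this.tendsto (E : ℂ)
    rcases lt_trichotomy |t - E| (E / 2) with h | h | h
    · have h1 : ∀ᶠ ω : ℂ in 𝓝 (E : ℂ), t ∈ nearSet ω := by
        have h2 : ∀ᶠ ω : ℂ in 𝓝 (E : ℂ), ω.im < ω.re :=
          Complex.continuous_im.continuousAt.eventually_lt Complex.continuous_re.continuousAt
            (by simpa using hE)
        filter_upwards [hre.eventually_lt hre2 h, h2] with ω h3 h4 using ⟨h3, h4⟩
      rw [Set.indicator_of_notMem]
      · refine tendsto_const_nhds.congr' ?_
        filter_upwards [h1] with ω h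
        rw [Set.indicator_of_notMem (by simpa using h)]
      · simpa [nearSet] using ⟨h, hE⟩
    · rcases abs_eq (by linarith) |>.mp h with h | h
      · exact absurd (by linarith) ht.2
      · exact absurd (by linarith) ht.1
    · have h1 : ∀ᶠ ω : ℂ in 𝓝 (E : ℂ), t ∉ nearSet ω := by
        filter_upwards [hre2.eventually_lt hre h] with ω h3 h4 using absurd h4.1 (not_lt.mpr h3.le)
      have h2 : (E : ℂ) - t ≠ 0 := by
        rw [← ofReal_sub, ofReal_ne_zero]
        intro h3
        rw [show t - E = 0 by linarith, abs_zero] at h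
        linarith
      rw [Set.indicator_of_mem (by simpa using h1.self_of_nhds)]
      have h3 : ContinuousAt (fun ω : ℂ => halfDensity p q s t / (ω - (t : ℂ))) (E : ℂ) :=
        ContinuousAt.div (by fun_prop) (by fun_prop) h2
      refine h3.tendsto.congr' ?_
      filter_upwards [h1] with ω h
      rw [Set.indicator_of_mem (by simpa using h)]

lemma tendsto_farCauchy_cobounded (H : IsHalfDensity p q s) :
    Tendsto (farCauchy p q s) (Bornology.cobounded ℂ ⊓ 𝓟 upper) (𝓝 0) := by
  have hn : Tendsto (fun ω : ℂ => ‖ω‖) (Bornology.cobounded ℂ ⊓ 𝓟 upper) atTop :=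
    tendsto_norm_cobounded_atTop.mono_left inf_le_left
  have hu : ∀ᶠ ω : ℂ in Bornology.cobounded ℂ ⊓ 𝓟 upper, 0 < ω.im :=
    (eventually_principal.mpr fun _ h => h : ∀ᶠ ω in 𝓟 upper, 0 < ω.im).filter_mono inf_le_right
  have hcg : (Bornology.cobounded ℂ ⊓ 𝓟 upper).IsCountablyGenerated := by
    rw [← comap_norm_atTop]; infer_instance
  have := H.tendsto_farCauchy (f := fun _ => 0) hu one_pos (hn.eventually_ge_atTop 1) ?_
  · simpa using this
  · filter_upwards [ae_restrict_mem measurableSet_Ioi] with t ht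
    have ht0 : 0 < t := ht
    rw [tendsto_zero_iff_norm_tendsto_zero]
    have h1 : Tendsto (fun ω : ℂ => 7 * (‖halfDensity p q s t‖ / (‖ω‖ + t)))
        (Bornology.cobounded ℂ ⊓ 𝓟 upper) (𝓝 (7 * 0)) :=
      (tendsto_const_nhds.div_atTop (tendsto_atTop_add_const_right _ t hn)).const_mul 7
    rw [mul_zero] at h1
    refine squeeze_zero' (.of_forall fun _ => norm_nonneg _) ?_ h1
    filter_upwards [hu] with ω h using norm_far_le h ht0

/-- Near t = 0 the integrand is O(t^(p-2)), which is integrable exactly because p > 1. It is the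
majorant for the limit ω → 0. -/
lemma integrableOn_div_id (H : IsHalfDensity p q s) (hp : 1 < p) :
    IntegrableOn (fun t => ‖halfDensity p q s t‖ / t) (Set.Ioi 0) := by
  have hm : ContinuousOn (fun t => ‖halfDensity p q s t‖ / t) (Set.Ioi 0) :=
    H.continuousOn.norm.div (by fun_prop) fun t ht => ne_of_gt ht
  obtain ⟨M, hM, hb⟩ := H.fourier.exists_bound
  rw [← Set.Ioc_union_Ioi_eq_Ioi (zero_le_one (α := ℝ))]
  refine IntegrableOn.union ?_ ?_
  · have h1 : IntegrableOn (fun t : ℝ => M * t ^ (p - 1 - 1)) (Set.Ioc 0 1) := by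
      have := intervalIntegral.intervalIntegrable_rpow' (a := 0) (b := 1)
        (show -1 < p - 1 - 1 by linarith [H.p_pos])
      exact ((intervalIntegrable_iff_integrableOn_Ioc_of_le zero_le_one).mp this).const_mul M
    refine h1.mono' ((hm.mono Set.Ioc_subset_Ioi_self).aestronglyMeasurable measurableSet_Ioc) ?_
    filter_upwards [ae_restrict_mem measurableSet_Ioc] with t ht
    have ht0 : 0 < t := ht.1
    rw [Real.norm_of_nonneg (by positivity), norm_halfDensity ht0,
      Real.rpow_sub_one ht0.ne' (p - 1), mul_comm, ← mul_div_assoc]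
    gcongr
    exact hb _
  · refine ((H.integrableOn.mono_set (Set.Ioi_subset_Ioi zero_le_one)).const_mul 2).mono'
      ((hm.mono (Set.Ioi_subset_Ioi zero_le_one)).aestronglyMeasurable measurableSet_Ioi) ?_
    filter_upwards [ae_restrict_mem measurableSet_Ioi] with t ht
    have ht1 : 1 < t := ht
    have ht0 : 0 < t := by linarith
    rw [Real.norm_of_nonneg (by positivity), ← mul_div_assoc,
      div_le_div_iff₀ ht0 (by positivity)]
    nlinarith [norm_nonneg (halfDensity p q s t)]

lemma tendsto_farCauchy_zero (H : IsHalfDensity p q s) (hp : 1 < p) :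
    Tendsto (farCauchy p q s) (𝓝[upper] 0)
      (𝓝 (∫ t in Set.Ioi (0 : ℝ), halfDensity p q s t / (0 - (t : ℂ)))) := by
  refine tendsto_integral_filter_of_dominated_convergence
    (fun t => 7 * (‖halfDensity p q s t‖ / t)) ?_ ?_ ((H.integrableOn_div_id hp).const_mul _) ?_
  · filter_upwards [self_mem_nhdsWithin] with ω h using H.aestronglyMeasurable_far h
  · filter_upwards [self_mem_nhdsWithin] with ω h
    filter_upwards [ae_restrict_mem measurableSet_Ioi] with t ht
    have ht0 : 0 < t := ht
    refine (norm_far_le h ht0).trans ?_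
    gcongr
    linarith [norm_nonneg ω]
  · filter_upwards [ae_restrict_mem measurableSet_Ioi] with t ht
    have ht0 : 0 < t := ht
    refine Tendsto.mono_left ?_ nhdsWithin_le_nhds
    have h1 : ∀ᶠ ω : ℂ in 𝓝 0, t ∉ nearSet ω := by
      have : Tendsto (fun ω : ℂ => 3 / 2 * ω.re) (𝓝 0) (𝓝 0) := by
        have : Continuous fun ω : ℂ => 3 / 2 * ω.re := by fun_prop
        simpa using this.tendsto 0
      filter_upwards [this.eventually (gt_mem_nhds ht0)] with ω h1 h2
      have := (abs_lt.mp h2.1).2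
      linarith
    have h3 : ContinuousAt (fun ω : ℂ => halfDensity p q s t / (ω - (t : ℂ))) 0 :=
      ContinuousAt.div (by fun_prop) (by fun_prop) (by simpa using ht0.ne')
    refine h3.tendsto.congr' ?_
    filter_upwards [h1] with ω h
    rw [Set.indicator_of_mem (by simpa using h)]

end IsHalfDensity

/-! ### The local part -/

section Local

variable {X : Type*} [MeasurableSpace X] {μ : Measure X} [SFinite μ] {u : X → ℂ} {τ : X → ℝ}

/-- The average of the local Cauchy transforms. -/
noncomputable def localAverage (μ : Measure X) (u : X → ℂ) (τ : X → ℝ) (p q x η : ℝ) : ℂ :=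
  ∫ y, u y * localCauchy p q (x ^ q * τ y) η ∂μ

/-- The boundary value of the average of the local Cauchy transforms, without the residue. -/
noncomputable def regularAverage (μ : Measure X) (u : X → ℂ) (τ : X → ℝ) (p q x : ℝ) : ℂ :=
  ∫ y, u y * localRegular p q (x ^ q * τ y) ∂μ

/-- Scaling moves the singularity to t = 1. The size x of the energy then appears only in the
prefactor x^(p-1) and in the frequencies, as x^q. -/
lemma local_scaling (p q : ℝ) (s : ℝ → ℂ) {x η : ℝ} (hx : 0 < x) :
    ∫ t in (1 / 2 * x)..(3 / 2 * x), halfDensity p q s t / (((x : ℂ) + (x * η : ℝ) * I) - (t : ℂ)) =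
      ((x ^ (p - 1) : ℝ) : ℂ) * ∫ t in (1 / 2 : ℝ)..(3 / 2),
        ((t ^ (p - 1) : ℝ) : ℂ) * s (x ^ q * t ^ q) / (1 + (η : ℂ) * I - (t : ℂ)) := by
  have h1 := intervalIntegral.smul_integral_comp_mul_left (a := 1 / 2) (b := 3 / 2)
    (fun t : ℝ => halfDensity p q s t / (((x : ℂ) + (x * η : ℝ) * I) - (t : ℂ))) x
  rw [mul_comm (1 / 2) x, mul_comm (3 / 2) x, ← h1, ← intervalIntegral.integral_smul,
    ← intervalIntegral.integral_const_mul]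
  refine intervalIntegral.integral_congr fun t ht => ?_
  rw [Set.uIcc_of_le (by norm_num)] at ht
  have ht0 : 0 ≤ t := by linarith [ht.1]
  have hx' : (x : ℂ) ≠ 0 := by exact_mod_cast hx.ne'
  simp only [halfDensity, Complex.real_smul]
  rw [Real.mul_rpow hx.le ht0, Real.mul_rpow hx.le ht0,
    show (x : ℂ) + ((x * η : ℝ) : ℂ) * I - ((x * t : ℝ) : ℂ) = x * (1 + (η : ℂ) * I - t) by
      push_cast; ring, ← mul_div_assoc, mul_div_mul_left _ _ hx']
  push_cast
  ring

/-- Fubini: s is a superposition of exponentials, so the scaled near part is an average of local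
Cauchy transforms with phases x^q τ. -/
lemma local_eq_localAverage (hu : Integrable u μ) (hτ : Measurable τ) (p q : ℝ) {x η : ℝ}
    (hη : 0 < η) :
    ∫ t in (1 / 2 : ℝ)..(3 / 2), ((t ^ (p - 1) : ℝ) : ℂ) * fourierOf μ u τ (x ^ q * t ^ q) /
      (1 + (η : ℂ) * I - (t : ℂ)) = localAverage μ u τ p q x η := by
  have e1 : ∀ t : ℝ, ((t ^ (p - 1) : ℝ) : ℂ) * fourierOf μ u τ (x ^ q * t ^ q) /
      (1 + (η : ℂ) * I - (t : ℂ)) =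
      ∫ y, u y * (oscDensity p q (x ^ q * τ y) t / (1 + (η : ℂ) * I - (t : ℂ))) ∂μ := by
    intro t
    rw [fourierOf, mul_comm, mul_div_assoc, ← integral_mul_const]
    congr 1; ext y
    rw [oscDensity, show x ^ q * t ^ q * τ y = x ^ q * τ y * t ^ q by ring]
    ring
  simp only [e1, localAverage, localCauchy]
  rw [intervalIntegral_integral_swap]
  · congr 1; ext y
    rw [intervalIntegral.integral_const_mul]
  · have h1 : Integrable (fun t : ℝ => ((t ^ (p - 1) : ℝ) : ℂ) / (1 + (η : ℂ) * I - (t : ℂ)))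
        (volume.restrict (Set.uIoc (1 / 2) (3 / 2))) := by
      refine intervalIntegrable_iff.mp (intervalIntegrable_div_denom ?_ hη)
      exact Complex.continuous_ofReal.comp_continuousOn fun t ht =>
        (Real.continuousAt_rpow_const _ _ (Or.inl (ne_of_gt ht))).continuousWithinAt
    have h2 := (h1.mul_prod hu).mul_bdd (c := 1)
      (g := fun z : ℝ × X => Complex.exp (I * ((x ^ q * τ z.2 * z.1 ^ q : ℝ) : ℂ)))
      (by fun_prop) (.of_forall fun z => by rw [norm_exp_I_mul])
    refine h2.congr (.of_forall fun z => ?_)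
    simp only [Function.uncurry, oscDensity]
    ring

omit [SFinite μ] in
lemma norm_localAverage_le (hu : Integrable u μ) {p q B : ℝ}
    (hB : ∀ a η : ℝ, 0 < η → ‖localCauchy p q a η‖ ≤ B) (x : ℝ) {η : ℝ} (hη : 0 < η) :
    ‖localAverage μ u τ p q x η‖ ≤ (∫ y, ‖u y‖ ∂μ) * B := by
  rw [← integral_mul_const]
  refine norm_integral_le_of_norm_le (hu.norm.mul_const B) (.of_forall fun y => ?_)
  rw [norm_mul]
  exact mul_le_mul_of_nonneg_left (hB _ _ hη) (norm_nonneg _)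

end Local

end SepScattering

/-! ### Boundary values of the Cauchy transform and their jump -/

namespace SepScattering

lemma continuous_localCauchy (p q : ℝ) {η : ℝ} (hη : 0 < η) :
    Continuous fun a => localCauchy p q a η := by
  have h0 := intervalIntegrable_div_denom (continuousOn_oscDensity p q 0) hη
  refine intervalIntegral.continuous_of_dominated_interval
    (bound := fun t => ‖oscDensity p q 0 t / (1 + (η : ℂ) * I - (t : ℂ))‖) (fun a => ?_) (fun a => ?_)
    h0.norm ?_
  · exact (intervalIntegrable_iff.mp
      (intervalIntegrable_div_denom (continuousOn_oscDensity p q a) hη)).aestronglyMeasurable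
  · refine .of_forall fun t ht => ?_
    rw [Set.uIoc_of_le (by norm_num)] at ht
    have ht0 : 0 < t := lt_trans (by norm_num) ht.1
    rw [norm_div, norm_div, norm_oscDensity ht0, norm_oscDensity ht0]
  · exact .of_forall fun t _ => (continuous_oscDensity_param p q t).div_const _

lemma localRegular_neg (p q a : ℝ) : localRegular p q (-a) = conj (localRegular p q a) := by
  rw [localRegular, localRegular, intervalIntegral.integral_of_le (by norm_num),
    intervalIntegral.integral_of_le (by norm_num), ← integral_conj]
  have h : ∀ t, conj (oscDensity p q a t) = oscDensity p q (-a) t := fun t => by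
    rw [oscDensity, oscDensity, map_mul, conj_ofReal, conj_exp_I_mul, neg_mul]
  congr 1; ext t
  rw [map_div₀, map_sub, map_sub, h, h, map_one, conj_ofReal]

/-- The boundary value of the local Cauchy transform. -/
noncomputable def localBoundary (p q a : ℝ) : ℂ :=
  localRegular p q a - I * Real.pi * Complex.exp (I * (a : ℂ))

/-- Presents the boundary value as a pointwise limit of continuous functions of the phase, from
which it inherits measurability and the uniform bound. -/
lemma tendsto_localBoundary_seq (p q a : ℝ) :
    Tendsto (fun n : ℕ => localCauchy p q a (1 / ((n : ℝ) + 1))) atTop (𝓝 (localBoundary p q a)) := by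
  have h1 : Tendsto (fun n : ℕ => 1 / ((n : ℝ) + 1)) atTop (𝓝[>] 0) :=
    tendsto_nhdsWithin_iff.mpr ⟨tendsto_one_div_add_atTop_nhds_zero_nat,
      .of_forall fun n => by simp only [Set.mem_Ioi]; positivity⟩
  have h2 : Tendsto (fun n : ℕ => (a, 1 / ((n : ℝ) + 1))) atTop (𝓝 a ×ˢ 𝓝[>] 0) :=
    tendsto_const_nhds.prodMk h1
  rw [localBoundary]
  have h3 := Tendsto.comp (tendsto_localCauchy p q a) h2
  simpa only [Function.comp_def] using h3

lemma measurable_localBoundary (p q : ℝ) : Measurable (localBoundary p q) :=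
  measurable_of_tendsto_metrizable (f := fun (n : ℕ) a => localCauchy p q a (1 / ((n : ℝ) + 1)))
    (fun _ => (continuous_localCauchy p q (by positivity)).measurable)
    (tendsto_pi_nhds.mpr fun a => tendsto_localBoundary_seq p q a)

lemma norm_localBoundary_le {p q B : ℝ} (hB : ∀ a η : ℝ, 0 < η → ‖localCauchy p q a η‖ ≤ B)
    (a : ℝ) : ‖localBoundary p q a‖ ≤ B :=
  le_of_tendsto (tendsto_localBoundary_seq p q a).norm
    (.of_forall fun _ => hB _ _ (by positivity))

section Local

variable {X : Type*} [MeasurableSpace X] {μ : Measure X} {u : X → ℂ} {τ : X → ℝ}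

/-- Dominated convergence over the weight u. The bound on `localCauchy` is uniform in the phase, so
no smoothness of the Fourier transform is required. -/
lemma tendsto_localAverage (hu : Integrable u μ) (hτ : Measurable τ) {p q : ℝ} (hq : 0 < q) {E : ℝ}
    (hE : 0 < E) :
    Tendsto (fun z : ℝ × ℝ => localAverage μ u τ p q z.1 z.2) (𝓝 E ×ˢ 𝓝[>] 0)
      (𝓝 (regularAverage μ u τ p q E - I * Real.pi * fourierOf μ u τ (E ^ q))) := by
  obtain ⟨B, hB0, hB⟩ := exists_bound_localCauchy p q hq
  have hb : Integrable (fun y => u y * localBoundary p q (E ^ q * τ y)) μ :=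
    hu.mul_bdd (c := B) ((measurable_localBoundary p q).comp
      (measurable_const.mul hτ)).aestronglyMeasurable (.of_forall fun y => norm_localBoundary_le hB _)
  have hf := (integrable_fourierOf hu hτ (E ^ q)).const_mul (I * Real.pi)
  have e : regularAverage μ u τ p q E - I * Real.pi * fourierOf μ u τ (E ^ q) =
      ∫ y, u y * localBoundary p q (E ^ q * τ y) ∂μ := by
    have : regularAverage μ u τ p q E = ∫ y, (u y * localBoundary p q (E ^ q * τ y) +
        I * Real.pi * (u y * Complex.exp (I * ((E ^ q * τ y : ℝ) : ℂ)))) ∂μ := by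
      rw [regularAverage]
      congr 1; ext y
      rw [localBoundary]; ring
    rw [this, integral_add hb hf, integral_const_mul, fourierOf, add_sub_cancel_right]
  rw [e]
  refine tendsto_integral_filter_of_dominated_convergence (fun y => ‖u y‖ * B) ?_ ?_
    (hu.norm.mul_const B) (.of_forall fun y => ?_)
  · filter_upwards [tendsto_snd.eventually (self_mem_nhdsWithin (a := (0 : ℝ)))] with z hz
    exact hu.aestronglyMeasurable.mul ((continuous_localCauchy p q hz).measurable.comp
      (measurable_const.mul hτ)).aestronglyMeasurable
  · filter_upwards [tendsto_snd.eventually (self_mem_nhdsWithin (a := (0 : ℝ)))] with z hz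
    refine .of_forall fun y => ?_
    rw [norm_mul]
    exact mul_le_mul_of_nonneg_left (hB _ _ hz) (norm_nonneg _)
  · have h1 : Tendsto (fun z : ℝ × ℝ => z.1 ^ q * τ y) (𝓝 E ×ˢ 𝓝[>] 0) (𝓝 (E ^ q * τ y)) :=
      (((Real.continuousAt_rpow_const _ _ (Or.inl hE.ne')).tendsto.comp tendsto_fst).mul_const _)
    have h2 : Tendsto (fun z : ℝ × ℝ => (z.1 ^ q * τ y, z.2)) (𝓝 E ×ˢ 𝓝[>] 0)
        (𝓝 (E ^ q * τ y) ×ˢ 𝓝[>] 0) := h1.prodMk tendsto_snd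
    exact ((tendsto_localCauchy p q _).comp h2).const_mul _

lemma regularAverage_conj (p q x : ℝ) :
    regularAverage μ (fun y => conj (u y)) (fun y => -τ y) p q x =
      conj (regularAverage μ u τ p q x) := by
  rw [regularAverage, regularAverage, ← integral_conj]
  congr 1; ext y
  rw [map_mul, ← localRegular_neg, mul_neg]

end Local

/-- The near part, scaled to unit size. -/
lemma near_eq_scaled (p q : ℝ) (s : ℝ → ℂ) {ω : ℂ} (h0 : 0 < ω.im) (h : ω.im < ω.re) :
    ∫ t in Set.Ioi (0 : ℝ) ∩ nearSet ω, halfDensity p q s t / (ω - (t : ℂ)) =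
      ((ω.re ^ (p - 1) : ℝ) : ℂ) * ∫ t in (1 / 2 : ℝ)..(3 / 2),
        ((t ^ (p - 1) : ℝ) : ℂ) * s (ω.re ^ q * t ^ q) /
          (1 + ((ω.im / ω.re : ℝ) : ℂ) * I - (t : ℂ)) := by
  have hx : 0 < ω.re := h0.trans h
  rw [← local_scaling p q s hx, nearSet_eq_Ioo h, Set.inter_eq_right.mpr,
    intervalIntegral.integral_of_le (by linarith), integral_Ioc_eq_integral_Ioo]
  · congr 1; ext t
    rw [mul_div_cancel₀ _ hx.ne', Complex.re_add_im]
  · intro t ht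
    have := ht.1
    simp only [Set.mem_Ioi]
    linarith

lemma near_eq_zero {f : ℝ → ℂ} {ω : ℂ} (h : ¬ ω.im < ω.re) :
    ∫ t in Set.Ioi (0 : ℝ) ∩ nearSet ω, f t = 0 := by
  rw [nearSet_eq_empty h, Set.inter_empty, Measure.restrict_empty, integral_zero_measure]

lemma tendsto_ratio_nhds {E : ℝ} (hE : 0 < E) :
    Tendsto (fun ω : ℂ => (ω.re, ω.im / ω.re)) (𝓝[upper] (E : ℂ)) (𝓝 E ×ˢ 𝓝[>] 0) := by
  have h1 : Tendsto (fun ω : ℂ => ω.re) (𝓝[upper] (E : ℂ)) (𝓝 E) := by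
    have := (Complex.continuous_re.tendsto (E : ℂ)).mono_left (nhdsWithin_le_nhds (s := upper))
    simpa using this
  have h2 : Tendsto (fun ω : ℂ => ω.im) (𝓝[upper] (E : ℂ)) (𝓝 0) := by
    have := (Complex.continuous_im.tendsto (E : ℂ)).mono_left (nhdsWithin_le_nhds (s := upper))
    simpa using this
  refine h1.prodMk (tendsto_nhdsWithin_iff.mpr ⟨?_, ?_⟩)
  · have := h2.div h1 hE.ne'
    rwa [zero_div] at this
  · filter_upwards [self_mem_nhdsWithin, h1.eventually (lt_mem_nhds hE)] with ω h3 h4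
    exact div_pos h3 h4

lemma eventually_im_lt_re {E : ℝ} (hE : 0 < E) : ∀ᶠ ω : ℂ in 𝓝[upper] (E : ℂ), ω.im < ω.re :=
  nhdsWithin_le_nhds (Complex.continuous_im.continuousAt.eventually_lt
    Complex.continuous_re.continuousAt (by simpa using hE))

section Boundary

variable {X : Type*} [MeasurableSpace X] {μ : Measure X} [SFinite μ] {u : X → ℂ} {τ : X → ℝ}

lemma tendsto_cauchy_upper_aux {p q : ℝ} (H : IsHalfDensity p q (fourierOf μ u τ))
    (hu : Integrable u μ) (hτ : Measurable τ) {E : ℝ} (hE : 0 < E) :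
    Tendsto (cauchy p q (fourierOf μ u τ)) (𝓝[upper] (E : ℂ))
      (𝓝 (farCauchy p q (fourierOf μ u τ) E +
        ((E ^ (p - 1) : ℝ) : ℂ) * regularAverage μ u τ p q E -
        I * Real.pi * halfDensity p q (fourierOf μ u τ) E)) := by
  have h1 := H.tendsto_farCauchy_real hE
  have h2 := (tendsto_localAverage hu hτ (p := p) H.q_pos hE).comp (tendsto_ratio_nhds hE)
  have h3 : Tendsto (fun ω : ℂ => ((ω.re ^ (p - 1) : ℝ) : ℂ)) (𝓝[upper] (E : ℂ))
      (𝓝 ((E ^ (p - 1) : ℝ) : ℂ)) :=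
    (Complex.continuous_ofReal.tendsto _).comp ((Real.continuousAt_rpow_const _ _
      (Or.inl hE.ne')).tendsto.comp (tendsto_fst.comp (tendsto_ratio_nhds hE)))
  have h4 := h1.add (h3.mul h2)
  have e : farCauchy p q (fourierOf μ u τ) E + ((E ^ (p - 1) : ℝ) : ℂ) *
      (regularAverage μ u τ p q E - I * Real.pi * fourierOf μ u τ (E ^ q)) =
      farCauchy p q (fourierOf μ u τ) E + ((E ^ (p - 1) : ℝ) : ℂ) * regularAverage μ u τ p q E -
        I * Real.pi * halfDensity p q (fourierOf μ u τ) E := by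
    rw [halfDensity]; ring
  rw [e] at h4
  refine h4.congr' ?_
  filter_upwards [self_mem_nhdsWithin, eventually_im_lt_re hE] with ω h0 h
  rw [H.cauchy_eq_far_add h0, near_eq_scaled p q _ h0 h,
    local_eq_localAverage hu hτ p q (div_pos h0 (h0.trans h))]
  rfl

end Boundary

/-- The boundary values of the Cauchy transform on the half-line, and their jump. -/
theorem IsHalfDensity.exists_boundary {p q : ℝ} {s : ℝ → ℂ} (H : IsHalfDensity p q s) {E : ℝ}
    (hE : 0 < E) : ∃ R : ℂ,
      Tendsto (cauchy p q s) (𝓝[upper] (E : ℂ)) (𝓝 (R - I * Real.pi * halfDensity p q s E)) ∧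
      Tendsto (cauchy p q s) (𝓝[lower] (E : ℂ)) (𝓝 (R + I * Real.pi * halfDensity p q s E)) := by
  have H' := H.conj_fun
  obtain ⟨X, _, μ, _, u, τ, hu, hτ, rfl⟩ := H.fourier
  refine ⟨_, tendsto_cauchy_upper_aux H hu hτ hE, ?_⟩
  -- The lower boundary value is the conjugate of the upper one for the conjugate density.
  -- Conjugating back recovers the regular part unchanged and reverses the sign of the residue term.
  have e1 : (fun r => conj (fourierOf μ u τ r)) =
      fourierOf μ (fun x => conj (u x)) (fun x => -τ x) := funext conj_fourierOf
  rw [e1] at H'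
  have h1 := tendsto_cauchy_upper_aux H'
    (Complex.conjLIE.toContinuousLinearEquiv.toContinuousLinearMap.integrable_comp hu) hτ.neg hE
  have h2 := h1.comp (by simpa using tendsto_conj_lower (E : ℂ))
  have h3 := (Complex.continuous_conj.tendsto _).comp h2
  have e2 : ∀ ω, conj (cauchy p q (fourierOf μ (fun x => conj (u x)) (fun x => -τ x)) (conj ω)) =
      cauchy p q (fourierOf μ u τ) ω := fun ω => by
    rw [← e1, ← conj_cauchy, Complex.conj_conj]
  have e3 : conj (farCauchy p q (fourierOf μ (fun x => conj (u x)) (fun x => -τ x)) E) =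
      farCauchy p q (fourierOf μ u τ) E := by
    rw [← e1, farCauchy, farCauchy, ← integral_conj]
    congr 1; ext t
    by_cases ht : t ∈ (nearSet (E : ℂ))ᶜ
    · rw [Set.indicator_of_mem ht, Set.indicator_of_mem ht, map_div₀, conj_halfDensity, map_sub,
        conj_ofReal, conj_ofReal]
      simp only [Complex.conj_conj]
    · rw [Set.indicator_of_notMem ht, Set.indicator_of_notMem ht, map_zero]
  have e4 : conj (halfDensity p q (fourierOf μ (fun x => conj (u x)) (fun x => -τ x)) E) =
      halfDensity p q (fourierOf μ u τ) E := by
    rw [← e1, ← conj_halfDensity, Complex.conj_conj]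
  refine (h3.congr fun ω => e2 ω).trans_eq ?_
  rw [map_sub, map_add, map_mul, map_mul, map_mul, regularAverage_conj, Complex.conj_conj, e3, e4,
    conj_I, conj_ofReal, conj_ofReal]
  congr 1; ring

end SepScattering

namespace SepScattering

/-! ### The Cauchy transform at infinity -/

lemma norm_le_two_mul_re {ω : ℂ} (h0 : 0 < ω.im) (h : ω.im < ω.re) : ‖ω‖ ≤ 2 * ω.re := by
  refine (Complex.norm_le_abs_re_add_abs_im ω).trans ?_
  rw [abs_of_pos h0, abs_of_pos (h0.trans h)]
  linarith

lemma IsHalfDensity.exists_near_bound {p q : ℝ} {s : ℝ → ℂ} (H : IsHalfDensity p q s) :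
    ∃ N, 0 ≤ N ∧ ∀ ω : ℂ, 0 < ω.im → ω.im < ω.re →
      ‖∫ t in Set.Ioi (0 : ℝ) ∩ nearSet ω, halfDensity p q s t / (ω - (t : ℂ))‖ ≤
        N * ω.re ^ (p - 1) := by
  obtain ⟨X, _, μ, _, u, τ, hu, hτ, rfl⟩ := H.fourier
  obtain ⟨B, hB0, hB⟩ := exists_bound_localCauchy p q H.q_pos
  refine ⟨(∫ y, ‖u y‖ ∂μ) * B, mul_nonneg (integral_nonneg fun _ => norm_nonneg _) hB0,
    fun ω h0 h => ?_⟩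
  have hx := h0.trans h
  rw [near_eq_scaled p q _ h0 h, local_eq_localAverage hu hτ p q (div_pos h0 hx), norm_mul,
    Complex.norm_real, Real.norm_of_nonneg (Real.rpow_nonneg hx.le _), mul_comm]
  exact mul_le_mul_of_nonneg_right (norm_localAverage_le hu hB _ (div_pos h0 hx))
    (Real.rpow_nonneg hx.le _)

/-- Decay of the near part implies decay of the Cauchy transform. -/
lemma IsHalfDensity.tendsto_cauchy_cobounded_of_near {p q : ℝ} {s : ℝ → ℂ}
    (H : IsHalfDensity p q s) {N x₀ κ : ℝ} (hN : 0 ≤ N) (hκ : 0 < κ)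
    (hb : ∀ ω : ℂ, 0 < ω.im → ω.im < ω.re → x₀ ≤ ω.re →
      ‖∫ t in Set.Ioi (0 : ℝ) ∩ nearSet ω, halfDensity p q s t / (ω - (t : ℂ))‖ ≤
        N * ω.re ^ (-κ)) :
    Tendsto (cauchy p q s) (Bornology.cobounded ℂ ⊓ 𝓟 upper) (𝓝 0) := by
  have hn : Tendsto (fun ω : ℂ => ‖ω‖) (Bornology.cobounded ℂ ⊓ 𝓟 upper) atTop :=
    tendsto_norm_cobounded_atTop.mono_left inf_le_left
  have hu : ∀ᶠ ω : ℂ in Bornology.cobounded ℂ ⊓ 𝓟 upper, 0 < ω.im :=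
    (eventually_principal.mpr fun _ h => h : ∀ᶠ ω in 𝓟 upper, 0 < ω.im).filter_mono inf_le_right
  have h1 : Tendsto (fun ω : ℂ => ∫ t in Set.Ioi (0 : ℝ) ∩ nearSet ω,
      halfDensity p q s t / (ω - (t : ℂ))) (Bornology.cobounded ℂ ⊓ 𝓟 upper) (𝓝 0) := by
    have h2 : Tendsto (fun ω : ℂ => N * (‖ω‖ / 2) ^ (-κ)) (Bornology.cobounded ℂ ⊓ 𝓟 upper)
        (𝓝 (N * 0)) :=
      ((tendsto_rpow_neg_atTop hκ).comp (hn.atTop_div_const two_pos)).const_mul N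
    rw [mul_zero] at h2
    refine squeeze_zero_norm' ?_ h2
    filter_upwards [hu, hn.eventually_ge_atTop (2 * x₀), hn.eventually_gt_atTop 0] with ω h0 h3 h4
    by_cases h : ω.im < ω.re
    · have h5 := norm_le_two_mul_re h0 h
      refine (hb ω h0 h (by linarith)).trans ?_
      refine mul_le_mul_of_nonneg_left ?_ hN
      exact Real.rpow_le_rpow_of_nonpos (by positivity) (by linarith) (by linarith)
    · rw [near_eq_zero h, norm_zero]; positivity
  have h3 := H.tendsto_farCauchy_cobounded.add h1
  rw [add_zero] at h3
  refine h3.congr' ?_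
  filter_upwards [hu] with ω h0 using (H.cauchy_eq_far_add h0).symm

/-- The near part is O(x^(p-1)), which already decays when p < 1. -/
theorem IsHalfDensity.tendsto_cauchy_cobounded_of_lt_one {p q : ℝ} {s : ℝ → ℂ}
    (H : IsHalfDensity p q s) (hp : p < 1) :
    Tendsto (cauchy p q s) (Bornology.cobounded ℂ ⊓ 𝓟 upper) (𝓝 0) := by
  obtain ⟨N, hN, hb⟩ := H.exists_near_bound
  refine H.tendsto_cauchy_cobounded_of_near (N := N) (x₀ := 0) (κ := 1 - p) hN (by linarith)
    fun ω h0 h _ => ?_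
  rw [neg_sub]
  exact hb ω h0 h

lemma intervalIntegrable_abs_sub_one_rpow {r : ℝ} (hr : -1 < r) :
    IntervalIntegrable (fun t : ℝ => |t - 1| ^ r) volume (1 / 2) (3 / 2) := by
  have h1 : IntervalIntegrable (fun t : ℝ => |t| ^ r) volume 0 (1 / 2) := by
    refine (intervalIntegral.intervalIntegrable_rpow' hr).congr fun t ht => ?_
    rw [Set.uIoc_of_le (by norm_num)] at ht
    simp only [abs_of_pos ht.1]
  have h2 : IntervalIntegrable (fun t : ℝ => |t| ^ r) volume (-(1 / 2)) 0 := by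
    have := (h1.comp_mul_left (c := -1)).symm
    simp only [neg_mul, one_mul, abs_neg] at this
    norm_num at this ⊢
    exact this
  have h3 := (h2.trans h1).comp_sub_right 1
  norm_num at h3 ⊢
  exact h3

/-- A difference that is bounded and Hölder is Hölder with a smaller exponent and constant. -/
lemma le_interpolate {y a b l : ℝ} (hy : 0 ≤ y) (ha : y ≤ a) (hb : y ≤ b) (hl0 : 0 ≤ l)
    (hl1 : l ≤ 1) : y ≤ a ^ (1 - l) * b ^ l := by
  rcases hy.eq_or_lt with h | h
  · rw [← h] at ha hb ⊢
    positivity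
  · calc y = y ^ (1 - l) * y ^ l := by
          rw [← Real.rpow_add h, sub_add_cancel, Real.rpow_one]
      _ ≤ _ := by
          have ha0 := h.le.trans ha
          gcongr

/-- For p ≥ 1 the bound x^(p-1) on the near part no longer decays. The decay hypothesis gives s =
O(x^(-κ)) on the scaled interval, with κ = δ + p - 1, while Hölder continuity controls increments by
x^(qθ)|t-1|^θ. Interpolation between the two with a small weight keeps a positive power of |t-1|,
which makes the kernel integrable, and sacrifices only half of the decay rate δ. -/
theorem IsHalfDensity.tendsto_cauchy_cobounded_of_holder {p q : ℝ} {s : ℝ → ℂ}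
    (H : IsHalfDensity p q s) (hp : 1 ≤ p)
    (hs : ∃ C θ : ℝ, 0 < θ ∧ ∀ x y : ℝ, 0 ≤ x → 0 ≤ y → ‖s x - s y‖ ≤ C * |x - y| ^ θ) :
    Tendsto (cauchy p q s) (Bornology.cobounded ℂ ⊓ 𝓟 upper) (𝓝 0) := by
  obtain ⟨C₁, θ, hθ, hC₁⟩ := hs
  obtain ⟨C, δ, hδ, hdec⟩ := H.decay
  -- With p = q + 1 and zero phase the density is t^q, so `L` is a Lipschitz constant of t^q on
  -- [1/2, 3/2].
  obtain ⟨L, hL, hLip⟩ := exists_lipschitz_oscDensity (q + 1) q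
  obtain ⟨B, hB0, hB⟩ := exists_bound_localCauchy p q H.q_pos
  have hq := H.q_pos
  have hC0 : 0 ≤ C := by
    have := hdec 1 le_rfl
    simp only [Real.one_rpow, one_mul, mul_one] at this
    exact (norm_nonneg _).trans this
  have hC₁0 : 0 ≤ C₁ := by
    have := hC₁ 1 0 zero_le_one le_rfl
    norm_num at this
    exact (norm_nonneg _).trans this
  set κ := δ + (p - 1) with hκ
  have hκ0 : 0 < κ := by linarith
  set A := C * 2 ^ κ with hA
  have hA0 : 0 ≤ A := by positivity
  -- Chosen so that l(κ + qθ) = δ/2. The interpolated power of x is then -κ + δ/2 = 1 - p - δ/2,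
  -- which beats the prefactor x^(p-1) by x^(-δ/2).
  set l := δ / (2 * (κ + q * θ)) with hl
  have hqθ : 0 < q * θ := mul_pos hq hθ
  have hl0 : 0 < l := by positivity
  have hl1 : l ≤ 1 := by
    rw [hl, div_le_one (by positivity)]
    linarith
  have hlκ : l * (κ + q * θ) = δ / 2 := by
    rw [hl]; field_simp
  set M := (2 * A) ^ (1 - l) * (C₁ * L ^ θ) ^ l with hM
  have hM0 : 0 ≤ M := by positivity
  set J := ∫ t in (1 / 2 : ℝ)..(3 / 2), |t - 1| ^ (θ * l - 1) with hJ
  have hJ0 : 0 ≤ J :=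
    intervalIntegral.integral_nonneg (by norm_num) fun t _ => Real.rpow_nonneg (abs_nonneg _) _
  -- pointwise bounds
  have hsup : ∀ x t : ℝ, 2 ≤ x → 1 / 2 ≤ t → ‖s (x ^ q * t ^ q)‖ ≤ A * x ^ (-κ) := by
    intro x t hx ht
    have hxt : 1 ≤ x * t := by nlinarith
    have h0 : 0 < x * t := by linarith
    have h1 := hdec (x * t) hxt
    rw [← Real.mul_rpow (by linarith) (by linarith)]
    have h2 : ‖s ((x * t) ^ q)‖ ≤ C * (x * t) ^ (-κ) := by
      have h3 : (x * t) ^ (-κ) = (x * t) ^ (-δ) / (x * t) ^ (p - 1) := by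
        rw [← Real.rpow_sub h0]; congr 1; rw [hκ]; ring
      rw [h3, ← mul_div_assoc, le_div_iff₀ (by positivity), mul_comm]
      exact h1
    refine h2.trans ?_
    have h4 : (x * t) ^ (-κ) ≤ (x / 2) ^ (-κ) :=
      Real.rpow_le_rpow_of_nonpos (by positivity) (by nlinarith) (by linarith)
    have h5 : (x / 2) ^ (-κ) = 2 ^ κ * x ^ (-κ) := by
      rw [Real.div_rpow (by linarith) two_pos.le, Real.rpow_neg two_pos.le κ, div_inv_eq_mul,
        mul_comm]
    rw [hA, mul_assoc, ← h5]
    gcongr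
  have hdiff : ∀ x t : ℝ, 2 ≤ x → t ∈ Set.Icc (1 / 2 : ℝ) (3 / 2) →
      ‖s (x ^ q * t ^ q) - s (x ^ q)‖ ≤ M * x ^ (1 - p - δ / 2) * |t - 1| ^ (θ * l) := by
    intro x t hx ht
    have hx0 : 0 < x := by linarith
    have ht0 : 0 < t := by linarith [ht.1]
    have h1 : ‖s (x ^ q * t ^ q) - s (x ^ q)‖ ≤ 2 * A * x ^ (-κ) := by
      have e1 := hsup x t hx ht.1
      have e2 := hsup x 1 hx (by norm_num)
      rw [Real.one_rpow, mul_one] at e2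
      refine (norm_sub_le _ _).trans ?_
      linarith
    have h2 : ‖s (x ^ q * t ^ q) - s (x ^ q)‖ ≤ C₁ * L ^ θ * (x ^ (q * θ) * |t - 1| ^ θ) := by
      have e1 := hC₁ (x ^ q * t ^ q) (x ^ q) (by positivity) (by positivity)
      have e2 : |t ^ q - 1| ≤ L * |t - 1| := by
        have := hLip 0 1 t (by norm_num) ht
        simp only [oscDensity, add_sub_cancel_right, zero_mul, ofReal_zero, mul_zero,
          Complex.exp_zero, mul_one, Real.one_rpow, abs_zero, add_zero] at this
        rwa [← ofReal_sub, Complex.norm_real] at this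
      refine e1.trans ?_
      rw [mul_assoc]
      refine mul_le_mul_of_nonneg_left ?_ hC₁0
      rw [← mul_sub_one, abs_mul, abs_of_pos (Real.rpow_pos_of_pos hx0 q),
        Real.mul_rpow (by positivity) (abs_nonneg _), ← Real.rpow_mul hx0.le]
      calc x ^ (q * θ) * |t ^ q - 1| ^ θ ≤ x ^ (q * θ) * (L * |t - 1|) ^ θ := by gcongr
        _ = _ := by rw [Real.mul_rpow hL (abs_nonneg _)]; ring
    refine (le_interpolate (norm_nonneg _) h1 h2 hl0.le hl1).trans (le_of_eq ?_)
    have e1 : (2 * A * x ^ (-κ)) ^ (1 - l) = (2 * A) ^ (1 - l) * x ^ (-κ * (1 - l)) := by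
      rw [Real.mul_rpow (by positivity) (by positivity), ← Real.rpow_mul hx0.le]
    have e2 : (C₁ * L ^ θ * (x ^ (q * θ) * |t - 1| ^ θ)) ^ l =
        (C₁ * L ^ θ) ^ l * (x ^ (q * θ * l) * |t - 1| ^ (θ * l)) := by
      rw [Real.mul_rpow (x := C₁ * L ^ θ) (by positivity) (by positivity),
        Real.mul_rpow (x := x ^ (q * θ)) (by positivity) (by positivity), ← Real.rpow_mul hx0.le,
        ← Real.rpow_mul (abs_nonneg _)]
    rw [e1, e2, hM]
    have e : x ^ (1 - p - δ / 2) = x ^ (-κ * (1 - l)) * x ^ (q * θ * l) := by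
      rw [← Real.rpow_add hx0]; congr 1; linear_combination hκ - hlκ
    rw [e]; ring
  refine H.tendsto_cauchy_cobounded_of_near (N := 2 ^ |p - 1| * M * J + A * B) (x₀ := 2)
    (κ := δ / 2) (by positivity) (by linarith) fun ω h0 h hx => ?_
  set x := ω.re
  have hx0 : 0 < x := by linarith
  set η := ω.im / x with hη'
  have hη : 0 < η := div_pos h0 hx0
  have hsc : ∀ r : ℝ, ContinuousOn (fun t : ℝ => t ^ r) (Set.Ioi 0) := fun r t ht =>
    (Real.continuousAt_rpow_const _ _ (Or.inl (ne_of_gt ht))).continuousWithinAt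
  have hc1 : ContinuousOn (fun t : ℝ => ((t ^ (p - 1) : ℝ) : ℂ) *
      (s (x ^ q * t ^ q) - s (x ^ q))) (Set.Ioi 0) :=
    (Complex.continuous_ofReal.comp_continuousOn (hsc _)).mul
      ((H.fourier.continuous.comp_continuousOn (continuousOn_const.mul (hsc _))).sub
        continuousOn_const)
  have hsplit : ∫ t in (1 / 2 : ℝ)..(3 / 2), ((t ^ (p - 1) : ℝ) : ℂ) * s (x ^ q * t ^ q) /
      (1 + (η : ℂ) * I - (t : ℂ)) =
      (∫ t in (1 / 2 : ℝ)..(3 / 2), ((t ^ (p - 1) : ℝ) : ℂ) * (s (x ^ q * t ^ q) - s (x ^ q)) /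
        (1 + (η : ℂ) * I - (t : ℂ))) + s (x ^ q) * localCauchy p q 0 η := by
    rw [localCauchy, ← intervalIntegral.integral_const_mul, ← intervalIntegral.integral_add]
    · congr 1; ext t
      simp only [oscDensity, zero_mul, ofReal_zero, mul_zero, Complex.exp_zero]
      ring
    · exact intervalIntegrable_div_denom hc1 hη
    · exact (intervalIntegrable_div_denom (continuousOn_oscDensity p q 0) hη).const_mul _
  have hfirst : ‖∫ t in (1 / 2 : ℝ)..(3 / 2), ((t ^ (p - 1) : ℝ) : ℂ) *
      (s (x ^ q * t ^ q) - s (x ^ q)) / (1 + (η : ℂ) * I - (t : ℂ))‖ ≤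
      2 ^ |p - 1| * M * x ^ (1 - p - δ / 2) * J := by
    rw [hJ, ← intervalIntegral.integral_const_mul]
    refine intervalIntegral.norm_integral_le_of_norm_le (by norm_num) ?_
      ((intervalIntegrable_abs_sub_one_rpow (by nlinarith [mul_pos hθ hl0])).const_mul _)
    have hne : ∀ᵐ t : ℝ, t ≠ 1 := by simp [ae_iff]
    filter_upwards [hne] with t ht1 ht
    have ht0 : 0 < t := by linarith [ht.1]
    have habs : 0 < |t - 1| := abs_pos.mpr (sub_ne_zero.mpr ht1)
    rw [norm_div, norm_mul, Complex.norm_real, Real.norm_of_nonneg (by positivity)]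
    have e1 := rpow_le_two_rpow_abs ht.1.le ht.2 (p - 1)
    have e2 := hdiff x t hx ⟨ht.1.le, ht.2⟩
    have e3 := abs_le_norm_denom η t
    have e4 : |t - 1| ^ (θ * l - 1) = |t - 1| ^ (θ * l) / |t - 1| := by
      rw [Real.rpow_sub_one habs.ne']
    calc _ ≤ 2 ^ |p - 1| * (M * x ^ (1 - p - δ / 2) * |t - 1| ^ (θ * l)) / |t - 1| := by gcongr
      _ = _ := by rw [e4]; ring
  have e5 : x ^ (p - 1) * x ^ (1 - p - δ / 2) = x ^ (-(δ / 2)) := by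
    rw [← Real.rpow_add hx0]; congr 1; ring
  have e6 : x ^ (p - 1) * x ^ (-κ) ≤ x ^ (-(δ / 2)) := by
    rw [← Real.rpow_add hx0]
    exact Real.rpow_le_rpow_of_exponent_le (by linarith) (by rw [hκ]; linarith)
  have e7 := hsup x 1 hx (by norm_num)
  rw [Real.one_rpow, mul_one] at e7
  rw [near_eq_scaled p q s h0 h, norm_mul, Complex.norm_real,
    Real.norm_of_nonneg (Real.rpow_nonneg hx0.le _), hsplit]
  calc _ ≤ x ^ (p - 1) * (2 ^ |p - 1| * M * x ^ (1 - p - δ / 2) * J + A * x ^ (-κ) * B) := by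
        refine mul_le_mul_of_nonneg_left ((norm_add_le _ _).trans (add_le_add hfirst ?_))
          (Real.rpow_nonneg hx0.le _)
        rw [norm_mul]
        exact mul_le_mul e7 (hB 0 η hη) (norm_nonneg _) (by positivity)
    _ = 2 ^ |p - 1| * M * J * (x ^ (p - 1) * x ^ (1 - p - δ / 2)) +
        A * B * (x ^ (p - 1) * x ^ (-κ)) := by ring
    _ ≤ 2 ^ |p - 1| * M * J * x ^ (-(δ / 2)) + A * B * x ^ (-(δ / 2)) := by
        rw [e5]; gcongr
    _ = _ := by ring

end SepScattering

namespace SepScattering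

/-! ### The Cauchy transform at zero -/

/-- For `p > 1` the Cauchy transform is continuous at zero. -/
theorem IsHalfDensity.tendsto_cauchy_zero_of_one_lt {p q : ℝ} {s : ℝ → ℂ}
    (H : IsHalfDensity p q s) (hp : 1 < p) :
    Tendsto (cauchy p q s) (𝓝[upper] 0)
      (𝓝 (∫ t in Set.Ioi (0 : ℝ), halfDensity p q s t / (0 - (t : ℂ)))) := by
  obtain ⟨N, hN, hb⟩ := H.exists_near_bound
  have h1 : Tendsto (fun ω : ℂ => ∫ t in Set.Ioi (0 : ℝ) ∩ nearSet ω,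
      halfDensity p q s t / (ω - (t : ℂ))) (𝓝[upper] 0) (𝓝 0) := by
    have h2 : Tendsto (fun ω : ℂ => N * |ω.re| ^ (p - 1)) (𝓝[upper] 0) (𝓝 0) := by
      have h3 : Continuous fun ω : ℂ => N * |ω.re| ^ (p - 1) :=
        continuous_const.mul ((Complex.continuous_re.abs).rpow_const fun _ => Or.inr (by linarith))
      have := (h3.tendsto 0).mono_left (nhdsWithin_le_nhds (s := upper))
      rwa [zero_re, abs_zero, Real.zero_rpow (by linarith), mul_zero] at this
    refine squeeze_zero_norm' ?_ h2
    filter_upwards [self_mem_nhdsWithin] with ω h0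
    by_cases h : ω.im < ω.re
    · rw [abs_of_pos (lt_trans h0 h)]
      exact hb ω h0 h
    · rw [near_eq_zero h, norm_zero]; positivity
  have h3 := (H.tendsto_farCauchy_zero hp).add h1
  rw [add_zero] at h3
  refine h3.congr' ?_
  filter_upwards [self_mem_nhdsWithin] with ω h0 using (H.cauchy_eq_far_add h0).symm

/-- The substitution t ↦ rt absorbs r^(1-p) and leaves the integral of t^(p-1) ψ((rt)^q)/(1+t). It
is dominated because 0 < p < 1, and its integrand tends to zero because ψ(0) = 0. -/
lemma tendsto_halfScale {ψ : ℝ → ℝ} (hψ : Continuous ψ) {M : ℝ} (hM : ∀ t, |ψ t| ≤ M)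
    (h0 : ψ 0 = 0) {p q : ℝ} (hp0 : 0 < p) (hp1 : p < 1) (hq : 0 < q) :
    Tendsto (fun r : ℝ => r ^ (1 - p) * ∫ t in Set.Ioi (0 : ℝ), t ^ (p - 1) * ψ (t ^ q) / (r + t))
      (𝓝[>] 0) (𝓝 0) := by
  have hcq : Continuous fun t : ℝ => t ^ q := continuous_id.rpow_const fun _ => Or.inr hq.le
  have hint : IntegrableOn (fun t : ℝ => M * (‖halfDensity p q (fun _ => 1) t‖ / (1 + t)))
      (Set.Ioi 0) :=
    (isHalfDensity_of_lt_one hp0 hp1 hq (isFourier_const 1)).integrableOn.const_mul M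
  have hlim : Tendsto (fun r : ℝ => ∫ t in Set.Ioi (0 : ℝ),
      t ^ (p - 1) * ψ ((r * t) ^ q) / (1 + t)) (𝓝[>] 0) (𝓝 (∫ t in Set.Ioi (0 : ℝ), (0 : ℝ))) := by
    refine tendsto_integral_filter_of_dominated_convergence _ ?_ ?_ hint ?_
    · refine .of_forall fun r => ContinuousOn.aestronglyMeasurable ?_ measurableSet_Ioi
      refine ContinuousOn.div (ContinuousOn.mul (fun t ht =>
        (Real.continuousAt_rpow_const _ _ (Or.inl (ne_of_gt ht))).continuousWithinAt) ?_)
        (by fun_prop) fun t ht => ?_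
      · exact (hψ.comp (hcq.comp (by fun_prop))).continuousOn
      · have : (0 : ℝ) < t := ht
        positivity
    · refine .of_forall fun r => ?_
      filter_upwards [ae_restrict_mem measurableSet_Ioi] with t ht
      have ht0 : 0 < t := ht
      rw [norm_halfDensity ht0, norm_one, mul_one, norm_div, norm_mul, Real.norm_of_nonneg
        (Real.rpow_nonneg ht0.le _), Real.norm_of_nonneg (show 0 ≤ 1 + t by positivity),
        Real.norm_eq_abs, ← mul_div_assoc, mul_comm M]
      gcongr
      exact hM _
    · refine .of_forall fun t => ?_
      have h1 : Continuous fun r : ℝ => t ^ (p - 1) * ψ ((r * t) ^ q) / (1 + t) :=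
        (continuous_const.mul (hψ.comp (hcq.comp (by fun_prop)))).div_const _
      have h2 := (h1.tendsto 0).mono_left (nhdsWithin_le_nhds (s := Set.Ioi 0))
      rwa [zero_mul, Real.zero_rpow hq.ne', h0, mul_zero, zero_div] at h2
  rw [integral_zero] at hlim
  refine hlim.congr' ?_
  filter_upwards [self_mem_nhdsWithin] with r hr
  have hr0 : 0 < r := hr
  have h1 := integral_comp_mul_left_Ioi (fun t : ℝ => t ^ (p - 1) * ψ (t ^ q) / (r + t)) 0 hr0
  rw [mul_zero, smul_eq_mul] at h1
  have h2 : (∫ t in Set.Ioi (0 : ℝ), t ^ (p - 1) * ψ (t ^ q) / (r + t)) =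
      r * ∫ t in Set.Ioi (0 : ℝ), (r * t) ^ (p - 1) * ψ ((r * t) ^ q) / (r + r * t) := by
    rw [h1, mul_inv_cancel_left₀ hr0.ne']
  rw [h2, ← mul_assoc, ← integral_const_mul]
  refine setIntegral_congr_fun measurableSet_Ioi fun t ht => ?_
  have ht0 : 0 < t := ht
  have e1 : r ^ (1 - p) * r ^ (p - 1) = 1 := by
    rw [← Real.rpow_add hr0]; simp
  have h1t : 1 + t ≠ 0 := by positivity
  change t ^ (p - 1) * ψ ((r * t) ^ q) / (1 + t) =
    r ^ (1 - p) * r * ((r * t) ^ (p - 1) * ψ ((r * t) ^ q) / (r + r * t))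
  rw [Real.mul_rpow (z := p - 1) hr0.le ht0.le, ← mul_one_add]
  generalize ψ ((r * t) ^ q) = z at *
  field_simp
  linear_combination -z * e1

lemma near_const_eq (p q : ℝ) (c : ℂ) {ω : ℂ} (h0 : 0 < ω.im) (h : ω.im < ω.re) :
    ∫ t in Set.Ioi (0 : ℝ) ∩ nearSet ω, halfDensity p q (fun _ => c) t / (ω - (t : ℂ)) =
      ((ω.re ^ (p - 1) : ℝ) : ℂ) * (c * localCauchy p q 0 (ω.im / ω.re)) := by
  rw [near_eq_scaled p q _ h0 h, localCauchy, ← intervalIntegral.integral_const_mul c]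
  congr 2; ext t
  simp only [oscDensity, zero_mul, ofReal_zero, mul_zero, Complex.exp_zero]
  ring

/-- For `p < 1`, only the value of `s` at zero matters at low energy. -/
theorem IsHalfDensity.tendsto_cauchy_sub_zero {p q : ℝ} {s : ℝ → ℂ}
    (H : IsHalfDensity p q s) (hp : p < 1) :
    Tendsto (fun ω : ℂ => ((‖ω‖ ^ (1 - p) : ℝ) : ℂ) *
      (cauchy p q s ω - cauchy p q (fun _ => s 0) ω)) (𝓝[upper] 0) (𝓝 0) := by
  have hp0 := H.p_pos
  have hq := H.q_pos
  have H' : IsHalfDensity p q (fun _ => s 0) := isHalfDensity_of_lt_one hp0 hp hq (isFourier_const _)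
  obtain ⟨M, hM, hMb⟩ := H.fourier.exists_bound
  have hnorm : Tendsto (fun ω : ℂ => ‖ω‖) (𝓝[upper] 0) (𝓝[>] 0) := by
    refine tendsto_nhdsWithin_iff.mpr ⟨?_, ?_⟩
    · have := (continuous_norm.tendsto (0 : ℂ)).mono_left (nhdsWithin_le_nhds (s := upper))
      rwa [norm_zero] at this
    · filter_upwards [self_mem_nhdsWithin] with ω h
      exact norm_pos_iff.mpr fun h0 => by simp [h0, upper] at h
  -- the far part
  have hfar : Tendsto (fun ω : ℂ => ((‖ω‖ ^ (1 - p) : ℝ) : ℂ) *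
      (farCauchy p q s ω - farCauchy p q (fun _ => s 0) ω)) (𝓝[upper] 0) (𝓝 0) := by
    have h1 := (tendsto_halfScale (ψ := fun r => ‖s r - s 0‖)
      (H.fourier.continuous.sub continuous_const).norm (M := 2 * M) (fun t => by
        rw [abs_norm]
        refine (norm_sub_le _ _).trans ?_
        linarith [hMb t, hMb 0]) (by simp) hp0 hp hq).comp hnorm
    have h2 := h1.const_mul 7
    rw [mul_zero] at h2
    refine squeeze_zero_norm' ?_ h2
    filter_upwards [self_mem_nhdsWithin] with ω h0
    have hω : 0 < ‖ω‖ := norm_pos_iff.mpr fun h => by simp [h, upper] at h0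
    have hi : ∀ {s}, IsHalfDensity p q s → IntegrableOn ((nearSet ω)ᶜ.indicator
        (fun t => halfDensity p q s t / (ω - (t : ℂ)))) (Set.Ioi 0) := fun {s} H => by
      have := H.integrableOn_div (mem_offContinuum_of_im_ne (Rc := Set.Ioi 0) (ne_of_gt h0)) 0
      simp only [zero_add, pow_one] at this
      exact this.indicator (measurableSet_nearSet ω).compl
    rw [norm_mul, Complex.norm_real, Real.norm_of_nonneg (by positivity), farCauchy, farCauchy,
      ← integral_sub (hi H) (hi H')]
    simp only [Function.comp]
    rw [mul_left_comm, ← integral_const_mul]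
    refine mul_le_mul_of_nonneg_left (norm_integral_le_of_norm_le ?_ ?_) (by positivity)
    · refine Integrable.const_mul ?_ 7
      have h5 := ((isHalfDensity_of_lt_one hp0 hp hq (isFourier_const
        (2 * M : ℝ))).integrableOn.const_mul (min ‖ω‖ 1)⁻¹)
      refine h5.mono' ?_ ?_
      · refine ContinuousOn.aestronglyMeasurable ?_ measurableSet_Ioi
        refine ContinuousOn.div (ContinuousOn.mul (fun t ht =>
          (Real.continuousAt_rpow_const _ _ (Or.inl (ne_of_gt ht))).continuousWithinAt) ?_)
          (by fun_prop) fun t ht => ?_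
        · exact ((H.fourier.continuous.comp (continuous_id.rpow_const
            fun _ => Or.inr hq.le)).sub continuous_const).norm.continuousOn
        · have : (0 : ℝ) < t := ht
          positivity
      · filter_upwards [ae_restrict_mem measurableSet_Ioi] with t ht
        have ht0 : 0 < t := ht
        have hm : 0 < min ‖ω‖ 1 := lt_min hω one_pos
        have h6 : ‖s (t ^ q) - s 0‖ ≤ 2 * M := by
          refine (norm_sub_le _ _).trans ?_
          linarith [hMb (t ^ q), hMb 0]
        rw [Real.norm_of_nonneg (by positivity), norm_halfDensity ht0, Complex.norm_real,
          Real.norm_of_nonneg (by positivity), ← div_eq_inv_mul, div_div]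
        gcongr
        nlinarith [min_le_left ‖ω‖ 1, min_le_right ‖ω‖ 1]
    · filter_upwards [ae_restrict_mem measurableSet_Ioi] with t ht
      have ht0 : 0 < t := ht
      have h7 := norm_far_le (p := p) (q := q) (s := fun r => s r - s 0) h0 ht0
      rw [norm_halfDensity ht0] at h7
      refine le_trans (le_of_eq ?_) h7
      congr 1
      by_cases hn : t ∈ (nearSet ω)ᶜ
      · simp only [Set.indicator_of_mem hn, halfDensity]
        ring
      · simp only [Set.indicator_of_notMem hn, sub_zero]
  -- the near part
  have hnear : Tendsto (fun ω : ℂ => ((‖ω‖ ^ (1 - p) : ℝ) : ℂ) *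
      ((∫ t in Set.Ioi (0 : ℝ) ∩ nearSet ω, halfDensity p q s t / (ω - (t : ℂ))) -
        ∫ t in Set.Ioi (0 : ℝ) ∩ nearSet ω, halfDensity p q (fun _ => s 0) t / (ω - (t : ℂ))))
      (𝓝[upper] 0) (𝓝 0) := by
    obtain ⟨X, _, μ, _, u, τ, hu, hτ, rfl⟩ := H.fourier
    obtain ⟨B, hB0, hB⟩ := exists_bound_localCauchy p q hq
    obtain ⟨B', hB'0, hB'⟩ := exists_bound_localCauchy_sub p q hq
    -- The local transforms with phases x^q τ and 0 differ by at most 2B and by at most B'|x^q τ|.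
    -- The minimum tends to zero pointwise and is dominated by 2B‖u‖, although τ·u need not be
    -- integrable.
    have hg : Tendsto (fun ω : ℂ => 2 ^ (1 - p) * ∫ y, ‖u y‖ * min (2 * B) (B' * |(|ω.re| ^ q) * τ y|) ∂μ)
        (𝓝[upper] 0) (𝓝 (2 ^ (1 - p) * ∫ y, (0 : ℝ) ∂μ)) := by
      refine Tendsto.const_mul _ ?_
      refine tendsto_integral_filter_of_dominated_convergence (fun y => ‖u y‖ * (2 * B))
        (.of_forall fun ω => ?_) (.of_forall fun ω => .of_forall fun y => ?_) (hu.norm.mul_const _)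
        (.of_forall fun y => ?_)
      · exact hu.aestronglyMeasurable.norm.mul (by fun_prop)
      · rw [Real.norm_of_nonneg (by positivity)]
        gcongr
        exact min_le_left _ _
      · have h1 : Continuous fun ω : ℂ => ‖u y‖ * min (2 * B) (B' * |(|ω.re| ^ q) * τ y|) := by
          have : Continuous fun ω : ℂ => |ω.re| ^ q :=
            (Complex.continuous_re.abs).rpow_const fun _ => Or.inr hq.le
          fun_prop
        have h2 := (h1.tendsto 0).mono_left (nhdsWithin_le_nhds (s := upper))
        rwa [zero_re, abs_zero, Real.zero_rpow hq.ne', zero_mul, abs_zero, mul_zero,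
          min_eq_right (by positivity), mul_zero] at h2
    rw [integral_zero, mul_zero] at hg
    refine squeeze_zero_norm' ?_ hg
    filter_upwards [self_mem_nhdsWithin] with ω h0
    have hgn : 0 ≤ ∫ y, ‖u y‖ * min (2 * B) (B' * |(|ω.re| ^ q) * τ y|) ∂μ :=
      integral_nonneg fun y => by positivity
    by_cases h : ω.im < ω.re
    · have hx : 0 < ω.re := lt_trans h0 h
      have hη := div_pos h0 hx
      have e0 : fourierOf μ u τ 0 * localCauchy p q 0 (ω.im / ω.re) =
          ∫ y, u y * localCauchy p q 0 (ω.im / ω.re) ∂μ := by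
        rw [integral_mul_const]
        simp [fourierOf]
      rw [near_const_eq p q _ h0 h, near_eq_scaled p q _ h0 h, local_eq_localAverage hu hτ p q hη,
        ← mul_sub, e0, localAverage, ← integral_sub, norm_mul, norm_mul, ← mul_assoc,
        Complex.norm_real, Complex.norm_real, Real.norm_of_nonneg (by positivity),
        Real.norm_of_nonneg (by positivity)]
      -- On the near set |ω| ≤ 2 Re ω, so |ω|^(1-p) cancels the prefactor (Re ω)^(p-1) up to
      -- 2^(1-p).
      · refine mul_le_mul ?_ ?_ (norm_nonneg _) (by positivity)
        · calc ‖ω‖ ^ (1 - p) * ω.re ^ (p - 1) ≤ (2 * ω.re) ^ (1 - p) * ω.re ^ (p - 1) := by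
                refine mul_le_mul_of_nonneg_right (Real.rpow_le_rpow (norm_nonneg _)
                  (norm_le_two_mul_re h0 h) (by linarith)) (by positivity)
            _ = 2 ^ (1 - p) := by
                rw [Real.mul_rpow two_pos.le hx.le, mul_assoc, ← Real.rpow_add hx]
                simp
        · refine norm_integral_le_of_norm_le ?_ (.of_forall fun y => ?_)
          · refine (hu.norm.mul_const (2 * B)).mono' (hu.aestronglyMeasurable.norm.mul
              (by fun_prop)) (.of_forall fun y => ?_)
            rw [Real.norm_of_nonneg (by positivity)]
            gcongr
            exact min_le_left _ _
          · rw [← mul_sub, norm_mul, abs_of_pos hx]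
            refine mul_le_mul_of_nonneg_left (le_min ?_ (hB' _ _ hη)) (norm_nonneg _)
            refine (norm_sub_le _ _).trans ?_
            linarith [hB (ω.re ^ q * τ y) _ hη, hB 0 _ hη]
      · refine hu.mul_bdd (c := B) ((continuous_localCauchy p q hη).measurable.comp
          (measurable_const.mul hτ)).aestronglyMeasurable (.of_forall fun y => hB _ _ hη)
      · exact hu.mul_const _
    · rw [near_eq_zero h, near_eq_zero h, sub_zero, mul_zero, norm_zero]
      positivity
  have h3 := hfar.add hnear
  rw [add_zero] at h3
  refine h3.congr' ?_
  filter_upwards [self_mem_nhdsWithin] with ω h0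
  rw [H.cauchy_eq_far_add h0, H'.cauchy_eq_far_add h0]
  ring

end SepScattering

namespace SepScattering

/-! ### The Cauchy transform of a power -/

/-- The Cauchy transform of `t^(p-1)`. -/
noncomputable def powerCauchy (p : ℝ) (ω : ℂ) : ℂ := cauchy p 1 (fun _ => 1) ω

/-- The value of `powerCauchy` at `-1`. -/
noncomputable def powerConst (p : ℝ) : ℂ := powerCauchy p (-1)

lemma cauchy_const (p q : ℝ) (c ω : ℂ) : cauchy p q (fun _ => c) ω = c * powerCauchy p ω := by
  rw [powerCauchy, cauchy, cauchy, ← integral_const_mul]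
  congr 1; ext t
  simp only [halfDensity]
  ring

/-- Homogeneity under positive dilations: the value at -1 determines the transform on the whole
negative axis. -/
lemma powerCauchy_mul (p : ℝ) {r : ℝ} (hr : 0 < r) (ω : ℂ) :
    powerCauchy p (r * ω) = ((r ^ (p - 1) : ℝ) : ℂ) * powerCauchy p ω := by
  have h1 := integral_comp_mul_left_Ioi
    (fun t : ℝ => halfDensity p 1 (fun _ => 1) t / (r * ω - (t : ℂ))) 0 hr
  rw [mul_zero, Complex.real_smul] at h1
  have hr' : (r : ℂ) ≠ 0 := by exact_mod_cast hr.ne'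
  have h2 : powerCauchy p (r * ω) = r * ∫ t in Set.Ioi (0 : ℝ),
      halfDensity p 1 (fun _ => 1) (r * t) / (r * ω - ((r * t : ℝ) : ℂ)) := by
    rw [h1, ofReal_inv, mul_inv_cancel_left₀ hr']
    rfl
  rw [h2, powerCauchy, cauchy, ← integral_const_mul, ← integral_const_mul]
  refine setIntegral_congr_fun measurableSet_Ioi fun t ht => ?_
  have ht0 : 0 < t := ht
  simp only [halfDensity]
  rw [Real.mul_rpow (z := p - 1) hr.le ht0.le]
  push_cast
  rw [← mul_sub, ← mul_div_assoc, mul_div_mul_left _ _ hr']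
  ring

lemma mem_offContinuum_Ioi_iff {ω : ℂ} : ω ∈ offContinuum (Set.Ioi 0) ↔ -ω ∈ slitPlane := by
  rw [Complex.mem_slitPlane_iff]
  constructor
  · intro h
    by_contra hc
    simp only [neg_re, neg_im, not_or, not_lt, not_not, neg_eq_zero, Left.neg_nonpos_iff] at hc
    refine h ω.re ?_ (Complex.ext rfl (by simpa using hc.2))
    rw [Set.Ioi_insert]; exact hc.1
  · rintro h E hE rfl
    rw [Set.Ioi_insert] at hE
    have hE0 : 0 ≤ E := hE
    simp at h
    linarith

lemma isPreconnected_offContinuum_Ioi : IsPreconnected (offContinuum (Set.Ioi 0)) := by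
  have h : offContinuum (Set.Ioi 0) = Neg.neg '' slitPlane := by
    ext ω
    rw [mem_offContinuum_Ioi_iff, Set.image_neg_eq_neg, Set.mem_neg]
  rw [h]
  exact (starConvex_one_slitPlane.isPathConnected
    (by simp : (1 : ℂ) ∈ slitPlane)).isConnected.isPreconnected.image _ continuous_neg.continuousOn

lemma isHalfDensity_one {p : ℝ} (hp : 0 < p) (hp1 : p < 1) : IsHalfDensity p 1 fun _ => 1 :=
  isHalfDensity_of_lt_one hp hp1 one_pos (isFourier_const 1)

/-- Both sides are homogeneous of degree p - 1 and agree at -1, hence on the negative axis. The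
identity theorem extends this to the connected slit plane. -/
lemma powerCauchy_eq {p : ℝ} (hp : 0 < p) (hp1 : p < 1) {ω : ℂ}
    (hω : ω ∈ offContinuum (Set.Ioi 0)) :
    powerCauchy p ω = powerConst p * (-ω) ^ ((p - 1 : ℝ) : ℂ) := by
  have ho := isOpen_offContinuum isClosed_insert_Ioi
  have h1 : AnalyticOnNhd ℂ (powerCauchy p) (offContinuum (Set.Ioi 0)) :=
    (isHalfDensity_one hp hp1).differentiableOn_cauchy.analyticOnNhd ho
  have h2 : AnalyticOnNhd ℂ (fun ω => powerConst p * (-ω) ^ ((p - 1 : ℝ) : ℂ))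
      (offContinuum (Set.Ioi 0)) := by
    refine DifferentiableOn.analyticOnNhd (fun ω hω => ?_) ho
    refine (DifferentiableAt.const_mul ?_ _).differentiableWithinAt
    exact differentiableAt_id.neg.cpow (differentiableAt_const _) (mem_offContinuum_Ioi_iff.mp hω)
  have h3 : (-1 : ℂ) ∈ offContinuum (Set.Ioi 0) := mem_offContinuum_Ioi_iff.mpr (by simp)
  refine h1.eqOn_of_preconnected_of_frequently_eq h2 isPreconnected_offContinuum_Ioi h3 ?_ hω
  have h4 : Tendsto (fun x : ℝ => (x : ℂ)) (𝓝[≠] (-1)) (𝓝[≠] (-1)) := by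
    refine tendsto_nhdsWithin_iff.mpr ⟨?_, ?_⟩
    · have := (Complex.continuous_ofReal.tendsto (-1)).mono_left
        (nhdsWithin_le_nhds (s := {(-1 : ℝ)}ᶜ))
      simpa using this
    · filter_upwards [self_mem_nhdsWithin] with x hx hx'
      exact hx (by have := Set.mem_singleton_iff.mp hx'; exact_mod_cast this)
  refine h4.frequently (Eventually.frequently ?_)
  have h5 : ∀ᶠ x : ℝ in 𝓝[≠] (-1), x < 0 :=
    nhdsWithin_le_nhds (gt_mem_nhds (by norm_num))
  filter_upwards [h5] with x hx
  have h6 := powerCauchy_mul p (neg_pos.mpr hx) (-1)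
  push_cast at h6
  rw [neg_mul_neg, mul_one] at h6
  rw [h6, ← powerConst, mul_comm, Complex.ofReal_cpow (neg_pos.mpr hx).le]
  push_cast; rfl

/-- The power function in the upper half-plane. -/
lemma powerCauchy_upper {p : ℝ} (hp : 0 < p) (hp1 : p < 1) {ω : ℂ} (h0 : 0 < ω.im) :
    powerCauchy p ω = powerConst p * (((‖ω‖ ^ (p - 1) : ℝ) : ℂ) *
      Complex.exp (I * (p - 1 : ℝ) * ((arg ω - Real.pi : ℝ) : ℂ))) := by
  have hω : 0 < ‖ω‖ := norm_pos_iff.mpr fun h => by simp [h] at h0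
  rw [powerCauchy_eq hp hp1 (mem_offContinuum_of_im_ne h0.ne'), Complex.cpow_def_of_ne_zero
    (neg_ne_zero.mpr (norm_pos_iff.mp hω)), Complex.log, norm_neg,
    Complex.arg_neg_eq_arg_sub_pi_of_im_pos h0, Real.rpow_def_of_pos hω]
  push_cast
  rw [← Complex.exp_add]
  congr 2
  ring

lemma conj_powerConst (p : ℝ) : conj (powerConst p) = powerConst p := by
  rw [powerConst, powerCauchy, conj_cauchy]
  simp

/-- Euler's reflection integral, in the form of the jump of the power function. -/
theorem powerConst_mul_sin {p : ℝ} (hp : 0 < p) (hp1 : p < 1) :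
    powerConst p * Real.sin (Real.pi * p) = -Real.pi := by
  -- The jump at 1 is evaluated twice. By the Plemelj formula it is 2πi, the density being 1 there;
  -- from the closed form (-ω)^(p-1) it is -2i sin(πp) times `powerConst`.
  obtain ⟨R, hu, hl⟩ := (isHalfDensity_one hp hp1).exists_boundary one_pos
  have hd : halfDensity p 1 (fun _ => 1) 1 = 1 := by simp [halfDensity]
  rw [hd, mul_one, ofReal_one] at hu hl
  have : (𝓝[upper] (1 : ℂ)).NeBot := by simpa using nhdsWithin_upper_neBot 1
  have : (𝓝[lower] (1 : ℂ)).NeBot := by simpa using nhdsWithin_lower_neBot 1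
  have h1 : Tendsto (powerCauchy p) (𝓝[upper] 1)
      (𝓝 (powerConst p * Complex.exp (-(I * (p - 1 : ℝ) * Real.pi)))) := by
    have hc : ContinuousAt (fun ω : ℂ => powerConst p * (((‖ω‖ ^ (p - 1) : ℝ) : ℂ) *
        Complex.exp (I * (p - 1 : ℝ) * ((arg ω - Real.pi : ℝ) : ℂ)))) 1 := by
      have e1 : ContinuousAt arg 1 := Complex.continuousAt_arg (by simp)
      have e2 : ContinuousAt (fun ω : ℂ => ‖ω‖ ^ (p - 1)) 1 :=
        continuous_norm.continuousAt.rpow_const (Or.inl (by simp))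
      fun_prop
    have h2 := hc.tendsto.mono_left (nhdsWithin_le_nhds (s := upper))
    simp only [norm_one, Real.one_rpow, ofReal_one, one_mul, arg_one, zero_sub, ofReal_neg,
      mul_neg] at h2
    refine h2.congr' ?_
    filter_upwards [self_mem_nhdsWithin] with ω h0 using (powerCauchy_upper hp hp1 h0).symm
  have h2 := tendsto_nhds_unique h1 hu
  have h3 : Tendsto (powerCauchy p) (𝓝[lower] 1)
      (𝓝 (conj (powerConst p * Complex.exp (-(I * (p - 1 : ℝ) * Real.pi))))) := by
    have := (Complex.continuous_conj.tendsto _).comp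
      (h1.comp (show Tendsto conj (𝓝[lower] (1 : ℂ)) (𝓝[upper] 1) by
        simpa using tendsto_conj_lower 1))
    refine this.congr fun ω => ?_
    simp only [Function.comp, powerCauchy]
    rw [conj_cauchy, Complex.conj_conj]
    simp
  have h4 := tendsto_nhds_unique h3 hl
  rw [map_mul, conj_powerConst, ← Complex.exp_conj, map_neg, map_mul, map_mul, conj_I, conj_ofReal,
    conj_ofReal, neg_mul, neg_mul, neg_neg] at h4
  have h5 : (Real.sin (Real.pi * p) : ℂ) =
      (Complex.exp (-(I * (p - 1 : ℝ) * Real.pi)) - Complex.exp (I * (p - 1 : ℝ) * Real.pi)) /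
        (2 * I) := by
    have e : Real.sin (Real.pi * p) = -Real.sin ((p - 1) * Real.pi) := by
      rw [show (p - 1) * Real.pi = Real.pi * p - Real.pi by ring, Real.sin_sub_pi, neg_neg]
    rw [e, ofReal_neg, ofReal_sin, Complex.sin]
    push_cast
    rw [show -((p - 1 : ℂ) * Real.pi) * I = -(I * (p - 1) * Real.pi) by ring,
      show ((p - 1 : ℂ) * Real.pi) * I = I * (p - 1) * Real.pi by ring]
    have hI := Complex.I_ne_zero
    field_simp
    linear_combination (Complex.exp (I * (p - 1) * Real.pi) -
      Complex.exp (-(I * (p - 1) * Real.pi))) * Complex.I_sq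
  rw [h5, ← mul_div_assoc, mul_sub, h2, h4]
  have hI := Complex.I_ne_zero
  field_simp
  ring

lemma tendsto_norm_nhdsWithin_upper_zero : Tendsto (fun ω : ℂ => ‖ω‖) (𝓝[upper] 0) (𝓝[>] 0) := by
  refine tendsto_nhdsWithin_iff.mpr ⟨?_, ?_⟩
  · have := (continuous_norm.tendsto (0 : ℂ)).mono_left (nhdsWithin_le_nhds (s := upper))
    rwa [norm_zero] at this
  · filter_upwards [self_mem_nhdsWithin] with ω h
    exact norm_pos_iff.mpr fun h0 => by simp [h0, upper] at h

/-- The low-energy asymptotics of the Cauchy transform for `p < 1`. -/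
theorem IsHalfDensity.tendsto_cauchy_zero_of_lt_one {p q : ℝ} {s : ℝ → ℂ}
    (H : IsHalfDensity p q s) (hp : p < 1) :
    Tendsto (fun ω : ℂ => cauchy p q s ω * ((‖ω‖ ^ (1 - p) : ℝ) : ℂ) *
        Complex.exp (-(I * (p - 1 : ℝ) * arg ω))) (𝓝[upper] 0)
      (𝓝 (s 0 * powerConst p * Complex.exp (-(I * (p - 1 : ℝ) * Real.pi)))) := by
  have h1 : Tendsto (fun ω : ℂ => ((‖ω‖ ^ (1 - p) : ℝ) : ℂ) *
      (cauchy p q s ω - cauchy p q (fun _ => s 0) ω) * Complex.exp (-(I * (p - 1 : ℝ) * arg ω)))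
      (𝓝[upper] 0) (𝓝 0) := by
    rw [tendsto_zero_iff_norm_tendsto_zero]
    refine (H.tendsto_cauchy_sub_zero hp).norm.congr' ?_ |>.trans_eq (by rw [norm_zero])
    refine .of_forall fun ω => ?_
    beta_reduce
    rw [norm_mul _ (Complex.exp _), show -(I * ((p - 1 : ℝ) : ℂ) * arg ω) =
      I * ((-((p - 1) * arg ω) : ℝ) : ℂ) by push_cast; ring, norm_exp_I_mul, mul_one]
  have h2 := h1.add_const (s 0 * powerConst p * Complex.exp (-(I * (p - 1 : ℝ) * Real.pi)))
  rw [zero_add] at h2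
  refine h2.congr' ?_
  filter_upwards [self_mem_nhdsWithin] with ω h0
  have hω : 0 < ‖ω‖ := norm_pos_iff.mpr fun h => by simp [h, upper] at h0
  rw [cauchy_const, powerCauchy_upper H.p_pos hp h0]
  have e1 : ((‖ω‖ ^ (1 - p) : ℝ) : ℂ) * ((‖ω‖ ^ (p - 1) : ℝ) : ℂ) = 1 := by
    rw [← ofReal_mul, ← Real.rpow_add hω]; simp
  have e2 : Complex.exp (I * (p - 1 : ℝ) * ((arg ω - Real.pi : ℝ) : ℂ)) *
      Complex.exp (-(I * (p - 1 : ℝ) * arg ω)) = Complex.exp (-(I * (p - 1 : ℝ) * Real.pi)) := by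
    rw [← Complex.exp_add]; congr 1; push_cast; ring
  rw [← e2]
  linear_combination -(s 0 * powerConst p * Complex.exp (I * (p - 1 : ℝ) *
    ((arg ω - Real.pi : ℝ) : ℂ)) * Complex.exp (-(I * (p - 1 : ℝ) * arg ω))) * e1

/-- The low-energy asymptotics of the Cauchy transform for `p = 1`. -/
theorem IsHalfDensity.tendsto_cauchy_zero_of_eq_one {q : ℝ} {s : ℝ → ℂ}
    (H : IsHalfDensity 1 q s) :
    Tendsto (fun ω : ℂ => cauchy 1 q s ω * ((1 / (1 + |Real.log ‖ω‖|) : ℝ) : ℂ)) (𝓝[upper] 0)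
      (𝓝 (-s 0)) := by
  have hq := H.q_pos
  obtain ⟨M, hM, hMb⟩ := H.fourier.exists_bound
  obtain ⟨N, hN, hNb⟩ := H.exists_near_bound
  have hρ : ∀ t : ℝ, halfDensity 1 q s t = s (t ^ q) := fun t => by simp [halfDensity]
  set N' := ∫ t in Set.Ioi (0 : ℝ), ‖halfDensity 1 q s t‖ / (1 + t) with hN'
  have hcs : Continuous fun t : ℝ => s (t ^ q) :=
    H.fourier.continuous.comp (continuous_id.rpow_const fun _ => Or.inr hq.le)
  -- Λ(r) = log(1+r) - log r is the model of the singularity. The transform is compared with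
  -- -s(0)Λ(|ω|), with error at most 7εΛ plus a constant depending on ε.
  set Λ : ℝ → ℝ := fun r => ∫ t in Set.Ioc (0 : ℝ) 1, 1 / (r + t) with hΛ
  have hΛeq : ∀ r : ℝ, 0 < r → Λ r = Real.log (1 + r) - Real.log r := by
    intro r hr
    have hd : ∀ t ∈ Set.uIcc (0 : ℝ) 1, HasDerivAt (fun t => Real.log (r + t)) (1 / (r + t)) t := by
      intro t ht
      rw [Set.uIcc_of_le zero_le_one] at ht
      exact ((hasDerivAt_id t).const_add r).log (by simp only [id]; linarith [ht.1])
    rw [hΛ]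
    simp only
    rw [← intervalIntegral.integral_of_le zero_le_one,
      intervalIntegral.integral_eq_sub_of_hasDerivAt hd, add_zero, add_comm]
    refine ContinuousOn.intervalIntegrable (continuousOn_const.div (by fun_prop) fun t ht => ?_)
    rw [Set.uIcc_of_le zero_le_one] at ht
    linarith [ht.1]
  have hcont : ∀ r : ℝ, 0 < r → ∀ t ∈ Set.Icc (0 : ℝ) 1, r + t ≠ 0 := fun r hr t ht => by
    linarith [ht.1]
  have hi1 : ∀ r : ℝ, 0 < r → IntegrableOn (fun t => 1 / (r + t)) (Set.Ioc 0 1) := fun r hr =>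
    ((continuousOn_const.div (by fun_prop) (hcont r hr)).integrableOn_compact
      isCompact_Icc).mono_set Set.Ioc_subset_Icc_self
  have hi2 : ∀ r : ℝ, 0 < r → IntegrableOn (fun t => r / (r + t) ^ 2) (Set.Ioc 0 1) := fun r hr =>
    ((continuousOn_const.div (by fun_prop) fun t ht => pow_ne_zero 2
      (hcont r hr t ht)).integrableOn_compact isCompact_Icc).mono_set Set.Ioc_subset_Icc_self
  have hi2v : ∀ r : ℝ, 0 < r → ∫ t in Set.Ioc (0 : ℝ) 1, r / (r + t) ^ 2 ≤ 1 := by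
    intro r hr
    have hd : ∀ t ∈ Set.uIcc (0 : ℝ) 1, HasDerivAt (fun t => -(r / (r + t))) (r / (r + t) ^ 2) t := by
      intro t ht
      rw [Set.uIcc_of_le zero_le_one] at ht
      have h1 := ((hasDerivAt_const t r).div ((hasDerivAt_id t).const_add r) (hcont r hr t ht)).neg
      refine h1.congr_deriv ?_
      simp only [id, zero_mul, zero_sub, mul_one, neg_div, neg_neg]
    rw [← intervalIntegral.integral_of_le zero_le_one,
      intervalIntegral.integral_eq_sub_of_hasDerivAt hd, add_zero, div_self hr.ne']
    · have : 0 ≤ r / (r + 1) := by positivity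
      linarith
    · exact (intervalIntegrable_iff_integrableOn_Ioc_of_le zero_le_one).mpr (hi2 r hr)
  -- the estimate
  have key : ∀ ε : ℝ, 0 < ε → ∃ A : ℝ, ∀ ω : ℂ, 0 < ω.im → 
      ‖cauchy 1 q s ω + s 0 * (Λ ‖ω‖ : ℝ)‖ ≤ 7 * ε * Λ ‖ω‖ + A ∨ 1 < ‖ω‖ := by
    intro ε hε
    have h1 : ∀ᶠ t : ℝ in 𝓝 0, ‖s (t ^ q) - s 0‖ < ε := by
      have h2 : Tendsto (fun t : ℝ => ‖s (t ^ q) - s 0‖) (𝓝 0) (𝓝 0) := by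
        have := (hcs.sub (continuous_const (y := s 0))).norm.tendsto (0 : ℝ)
        simp only [Pi.sub_apply] at this
        rwa [Real.zero_rpow hq.ne', sub_self, norm_zero] at this
      exact h2.eventually (gt_mem_nhds hε)
    obtain ⟨δ, hδ, hδb⟩ := Metric.eventually_nhds_iff.mp h1
    refine ⟨7 * (2 * M / δ) + 14 * M + 14 * N' + N, fun ω h0 => ?_⟩
    rcases lt_or_ge 1 ‖ω‖ with hω1 | hω1
    · exact Or.inr hω1
    left
    have hω : 0 < ‖ω‖ := norm_pos_iff.mpr fun h => by simp [h] at h0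
    set r := ‖ω‖
    set F := (nearSet ω)ᶜ.indicator (fun t => halfDensity 1 q s t / (ω - (t : ℂ))) with hF
    have hFi : IntegrableOn F (Set.Ioi 0) := by
      have := H.integrableOn_div (mem_offContinuum_of_im_ne (Rc := Set.Ioi 0) (ne_of_gt h0)) 0
      simp only [zero_add, pow_one] at this
      exact this.indicator (measurableSet_nearSet ω).compl
    have hψ : ∀ t : ℝ, 0 < t → ‖s (t ^ q) - s 0‖ / (r + t) ≤ ε * (1 / (r + t)) + 2 * M / δ := by
      intro t ht
      rcases lt_or_ge t δ with htδ | htδ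
      · have h2 : ‖s (t ^ q) - s 0‖ ≤ ε := (hδb (by
          rw [Real.dist_eq, sub_zero, abs_of_pos ht]; exact htδ)).le
        have : 0 ≤ 2 * M / δ := by positivity
        rw [mul_one_div]
        have : ‖s (t ^ q) - s 0‖ / (r + t) ≤ ε / (r + t) := by gcongr
        linarith
      · have h2 : ‖s (t ^ q) - s 0‖ ≤ 2 * M := by
          refine (norm_sub_le _ _).trans ?_
          linarith [hMb (t ^ q), hMb 0]
        have h3 : ‖s (t ^ q) - s 0‖ / (r + t) ≤ 2 * M / δ := by
          gcongr
          linarith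
        have : 0 ≤ ε * (1 / (r + t)) := by positivity
        linarith
    -- Replacing 1/(ω-t) by -1/(r+t) costs a multiple of r/(r+t)², whose integral over (0,1] is at
    -- most 1. The variation of s costs ε/(r+t) close to 0 and a constant elsewhere. On the near
    -- set, where the far integrand is cut to zero, t ≤ 3r/2 makes 1/(r+t) itself of the order
    -- r/(r+t)².
    have hpt : ∀ t ∈ Set.Ioc (0 : ℝ) 1, ‖F t + s 0 * ((1 / (r + t) : ℝ) : ℂ)‖ ≤
        7 * (ε * (1 / (r + t)) + 2 * M / δ) + 14 * M * (r / (r + t) ^ 2) := by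
      intro t ht
      have ht0 : 0 < t := ht.1
      have hrt : 0 < r + t := by positivity
      have hrtC : (r : ℂ) + t ≠ 0 := by exact_mod_cast hrt.ne'
      by_cases hn : t ∈ nearSet ω
      · have h2 : t ≤ 3 / 2 * r := by
          have := (abs_lt.mp hn.1).2
          have := Complex.re_le_norm ω
          change _ ≤ r at this
          linarith
        rw [hF, Set.indicator_of_notMem (by simpa using hn), zero_add, norm_mul, Complex.norm_real,
          Real.norm_of_nonneg (by positivity)]
        have h3 : 1 / (r + t) ≤ 14 * (r / (r + t) ^ 2) := by
          rw [← mul_div_assoc, div_le_div_iff₀ hrt (by positivity)]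
          nlinarith
        have h4 : ‖s 0‖ * (1 / (r + t)) ≤ M * (14 * (r / (r + t) ^ 2)) := by
          gcongr
          exact hMb 0
        have h5 : 0 ≤ 7 * (ε * (1 / (r + t)) + 2 * M / δ) := by positivity
        linarith
      · have h2 := norm_add_le_of_notMem_nearSet h0.le ht0 hn
        change r + t ≤ _ at h2
        have h3 : ω - (t : ℂ) ≠ 0 := fun h => by rw [h, norm_zero] at h2; linarith
        have e1 : F t + s 0 * ((1 / (r + t) : ℝ) : ℂ) = (s (t ^ q) - s 0) / (ω - t) +
            s 0 * ((ω + r) / ((ω - t) * ((r + t : ℝ) : ℂ))) := by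
          rw [hF, Set.indicator_of_mem (by simpa using hn), hρ]
          push_cast
          field_simp
          ring
        have h4 : ‖(s (t ^ q) - s 0) / (ω - t)‖ ≤ 7 * (‖s (t ^ q) - s 0‖ / (r + t)) := by
          rw [norm_div, ← mul_div_assoc, div_le_div_iff₀ (by linarith) hrt]
          nlinarith [norm_nonneg (s (t ^ q) - s 0)]
        have h5 : ‖s 0 * ((ω + r) / ((ω - t) * ((r + t : ℝ) : ℂ)))‖ ≤
            14 * M * (r / (r + t) ^ 2) := by
          rw [norm_mul, norm_div, norm_mul, Complex.norm_real, Real.norm_of_nonneg hrt.le]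
          have h6 : ‖ω + r‖ ≤ 2 * r := by
            refine (norm_add_le _ _).trans ?_
            rw [Complex.norm_real, Real.norm_of_nonneg hω.le]
            linarith
          have h7 : ‖ω + r‖ / (‖ω - t‖ * (r + t)) ≤ 14 * (r / (r + t) ^ 2) := by
            rw [← mul_div_assoc, div_le_div_iff₀ (by positivity) (by positivity)]
            calc ‖ω + r‖ * (r + t) ^ 2 ≤ (2 * r) * ((7 * ‖ω - t‖) * (r + t)) := by
                  rw [sq]; gcongr
              _ = _ := by ring
          calc _ ≤ M * (14 * (r / (r + t) ^ 2)) := by gcongr; exact hMb 0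
            _ = _ := by ring
        rw [e1]
        refine (norm_add_le _ _).trans ?_
        linarith [hψ t ht0]
    have hfar1 : ‖(∫ t in Set.Ioc (0 : ℝ) 1, F t) + s 0 * (Λ r : ℝ)‖ ≤
        7 * (ε * Λ r + 2 * M / δ) + 14 * M := by
      have e2 : (∫ t in Set.Ioc (0 : ℝ) 1, F t) + s 0 * (Λ r : ℝ) =
          ∫ t in Set.Ioc (0 : ℝ) 1, (F t + s 0 * ((1 / (r + t) : ℝ) : ℂ)) := by
        have hs0 : IntegrableOn (fun t : ℝ => s 0 * ((1 / (r + t) : ℝ) : ℂ)) (Set.Ioc 0 1) :=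
          (Integrable.ofReal (𝕜 := ℂ) (hi1 r hω)).const_mul _
        have hF1 : IntegrableOn F (Set.Ioc 0 1) := hFi.mono_set Set.Ioc_subset_Ioi_self
        have e3 : ∫ t in Set.Ioc (0 : ℝ) 1, ((1 / (r + t) : ℝ) : ℂ) = (Λ r : ℝ) := integral_ofReal
        rw [← e3, ← integral_const_mul, ← integral_add hF1 hs0]
      rw [e2]
      have hci : IntegrableOn (fun _ : ℝ => 2 * M / δ) (Set.Ioc 0 1) :=
        integrableOn_const (by simp)
      have hB := (((hi1 r hω).const_mul ε).add hci).const_mul 7 |>.add ((hi2 r hω).const_mul (14 * M))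
      refine (norm_integral_le_of_norm_le hB ?_).trans ?_
      · filter_upwards [ae_restrict_mem measurableSet_Ioc] with t ht using hpt t ht
      · rw [integral_add' ((((hi1 r hω).const_mul ε).add hci).const_mul 7)
          ((hi2 r hω).const_mul (14 * M)), integral_const_mul, integral_const_mul,
          integral_add' ((hi1 r hω).const_mul ε) hci, integral_const_mul, setIntegral_const]
        simp only [measureReal_def, Real.volume_Ioc, sub_zero, ENNReal.ofReal_one,
          ENNReal.toReal_one, one_smul]
        have := mul_le_mul_of_nonneg_left (hi2v r hω) (show 0 ≤ 14 * M by positivity)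
        linarith
    have hfar2 : ‖∫ t in Set.Ioi (1 : ℝ), F t‖ ≤ 14 * N' := by
      have h6 : IntegrableOn (fun t => 14 * (‖halfDensity 1 q s t‖ / (1 + t))) (Set.Ioi 0) :=
        H.integrableOn.const_mul 14
      refine (norm_integral_le_of_norm_le (h6.mono_set (Set.Ioi_subset_Ioi zero_le_one)) ?_).trans ?_
      · filter_upwards [ae_restrict_mem measurableSet_Ioi] with t ht
        have ht1 : 1 < t := ht
        have ht0 : 0 < t := by linarith
        refine (norm_far_le h0 ht0).trans ?_
        have : ‖halfDensity 1 q s t‖ / (‖ω‖ + t) ≤ 2 * (‖halfDensity 1 q s t‖ / (1 + t)) := by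
          rw [← mul_div_assoc, div_le_div_iff₀ (by positivity) (by positivity)]
          nlinarith [norm_nonneg (halfDensity 1 q s t), norm_nonneg ω]
        linarith
      · rw [hN', ← integral_const_mul]
        refine setIntegral_mono_set h6 ?_ (Set.Ioi_subset_Ioi zero_le_one).eventuallyLE
        filter_upwards [ae_restrict_mem measurableSet_Ioi] with t ht
        have ht0 : 0 < t := ht
        simp only [Pi.zero_apply]
        positivity
    have hnear : ‖∫ t in Set.Ioi (0 : ℝ) ∩ nearSet ω, halfDensity 1 q s t / (ω - (t : ℂ))‖ ≤ N := by
      by_cases h : ω.im < ω.re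
      · simpa using hNb ω h0 h
      · rw [near_eq_zero h, norm_zero]; exact hN
    have hsplit : farCauchy 1 q s ω = (∫ t in Set.Ioc (0 : ℝ) 1, F t) + ∫ t in Set.Ioi (1 : ℝ), F t := by
      rw [farCauchy, ← setIntegral_union (Set.Ioc_disjoint_Ioi le_rfl) measurableSet_Ioi
        (hFi.mono_set Set.Ioc_subset_Ioi_self) (hFi.mono_set (Set.Ioi_subset_Ioi zero_le_one)),
        Set.Ioc_union_Ioi_eq_Ioi zero_le_one]
    rw [H.cauchy_eq_far_add h0, hsplit]
    calc _ = ‖((∫ t in Set.Ioc (0 : ℝ) 1, F t) + s 0 * (Λ r : ℝ)) + (∫ t in Set.Ioi (1 : ℝ), F t) +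
          ∫ t in Set.Ioi (0 : ℝ) ∩ nearSet ω, halfDensity 1 q s t / (ω - (t : ℂ))‖ := by
          congr 1; ring
      _ ≤ (7 * (ε * Λ r + 2 * M / δ) + 14 * M) + 14 * N' + N := by
          refine (norm_add_le _ _).trans (add_le_add ((norm_add_le _ _).trans
            (add_le_add hfar1 hfar2)) hnear)
      _ = _ := by ring
  -- conclusion
  have hlog : Tendsto (fun ω : ℂ => 1 + |Real.log ‖ω‖|) (𝓝[upper] 0) atTop :=
    tendsto_atTop_add_const_left _ _ (tendsto_abs_atBot_atTop.comp
      (Real.tendsto_log_nhdsGT_zero.comp tendsto_norm_nhdsWithin_upper_zero))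
  have hsmall : ∀ᶠ ω : ℂ in 𝓝[upper] 0, ‖ω‖ < 1 :=
    (tendsto_norm_nhdsWithin_upper_zero.mono_right nhdsWithin_le_nhds).eventually
      (gt_mem_nhds one_pos)
  have hΛh : ∀ ω : ℂ, 0 < ω.im → ‖ω‖ < 1 → |Λ ‖ω‖ - (1 + |Real.log ‖ω‖|)| ≤ 1 := by
    intro ω h0 h1
    have hω : 0 < ‖ω‖ := norm_pos_iff.mpr fun h => by simp [h] at h0
    rw [hΛeq _ hω, abs_of_neg (Real.log_neg hω h1)]
    have h2 : 0 ≤ Real.log (1 + ‖ω‖) := Real.log_nonneg (by linarith)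
    have h3 : Real.log (1 + ‖ω‖) ≤ ‖ω‖ := by
      have := Real.log_le_sub_one_of_pos (show 0 < 1 + ‖ω‖ by linarith)
      linarith
    rw [abs_le]; constructor <;> linarith
  rw [tendsto_iff_norm_sub_tendsto_zero]
  refine Metric.tendsto_nhds.mpr fun ε hε => ?_
  -- Since Λ ≤ L + 1 ≤ 2L, the choice ε/28 makes the term 7(ε/28)Λ at most (ε/2)L; the constants are
  -- absorbed by the other half.
  obtain ⟨A, hA⟩ := key (ε / 28) (by positivity)
  have hlim : ∀ᶠ ω : ℂ in 𝓝[upper] 0, (|A| + M + 1) / (1 + |Real.log ‖ω‖|) < ε / 2 :=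
    (tendsto_const_nhds.div_atTop hlog).eventually (gt_mem_nhds (by positivity))
  filter_upwards [self_mem_nhdsWithin, hsmall, hlim] with ω h0 h1 h2
  have hL : 0 < 1 + |Real.log ‖ω‖| := by positivity
  set L := 1 + |Real.log ‖ω‖| with hLdef
  have hb := hΛh ω h0 h1
  have hA' := (hA ω h0).resolve_right (not_lt.mpr h1.le)
  rw [dist_zero_right, norm_norm]
  have hLC : (L : ℂ) ≠ 0 := by exact_mod_cast hL.ne'
  have e3 : cauchy 1 q s ω * ((1 / L : ℝ) : ℂ) - -s 0 =
      ((cauchy 1 q s ω + s 0 * (Λ ‖ω‖ : ℝ)) - s 0 * ((Λ ‖ω‖ - L : ℝ) : ℂ)) / (L : ℂ) := by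
    push_cast
    field_simp
    ring
  have hL1 : 1 ≤ L := by rw [hLdef]; linarith [abs_nonneg (Real.log ‖ω‖)]
  have h3 : ‖s 0 * ((Λ ‖ω‖ - L : ℝ) : ℂ)‖ ≤ M := by
    rw [norm_mul, Complex.norm_real, Real.norm_eq_abs]
    calc _ ≤ M * 1 := by gcongr; exact hMb 0
      _ = M := mul_one M
  rw [e3, norm_div, Complex.norm_real, Real.norm_of_nonneg hL.le, div_lt_iff₀ hL]
  refine (norm_sub_le _ _).trans_lt ?_
  rw [div_lt_iff₀ hL] at h2
  have h4 := (abs_le.mp hb).2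
  have h5 := le_abs_self A
  nlinarith

end SepScattering

namespace SepScattering

/-! ### Densities on the whole line -/

lemma neg_mem_lower {ω : ℂ} (h : ω ∈ upper) : -ω ∈ lower := by
  simp only [lower, Set.mem_ofPred_eq, neg_im]
  exact neg_neg_of_pos h

lemma neg_mem_upper {ω : ℂ} (h : ω ∈ lower) : -ω ∈ upper := by
  simp only [upper, Set.mem_ofPred_eq, neg_im]
  exact neg_pos_of_neg h

lemma tendsto_neg_upper (z : ℂ) : Tendsto (fun ω : ℂ => -ω) (𝓝[upper] z) (𝓝[lower] (-z)) :=
  tendsto_nhdsWithin_iff.mpr ⟨(continuous_neg.tendsto z).mono_left nhdsWithin_le_nhds,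
    eventually_nhdsWithin_of_forall fun _ => neg_mem_lower⟩

lemma tendsto_neg_lower (z : ℂ) : Tendsto (fun ω : ℂ => -ω) (𝓝[lower] z) (𝓝[upper] (-z)) :=
  tendsto_nhdsWithin_iff.mpr ⟨(continuous_neg.tendsto z).mono_left nhdsWithin_le_nhds,
    eventually_nhdsWithin_of_forall fun _ => neg_mem_upper⟩

lemma tendsto_neg_cobounded' : Tendsto (fun ω : ℂ => -ω) (Bornology.cobounded ℂ)
    (Bornology.cobounded ℂ) := by
  rw [← tendsto_norm_atTop_iff_cobounded]
  simpa using tendsto_norm_cobounded_atTop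

/-- The Cauchy transform of the density that is `t^(p-1) s₁(t^q)` at `t` and `t^(p-1) s₂(t^q)` at
`-t`, for `t > 0`. -/
noncomputable def twoSided (p q : ℝ) (s₁ s₂ : ℝ → ℂ) (ω : ℂ) : ℂ :=
  cauchy p q s₁ ω - cauchy p q s₂ (-ω)

/-- The density on the line. -/
noncomputable def lineDensity (p q : ℝ) (s₁ s₂ : ℝ → ℂ) (E : ℝ) : ℂ :=
  if 0 < E then halfDensity p q s₁ E else halfDensity p q s₂ (-E)

variable {p q : ℝ} {s s₁ s₂ : ℝ → ℂ}

lemma conj_twoSided (p q : ℝ) (s₁ s₂ : ℝ → ℂ) (ω : ℂ) :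
    conj (twoSided p q s₁ s₂ ω) =
      twoSided p q (fun r => conj (s₁ r)) (fun r => conj (s₂ r)) (conj ω) := by
  rw [twoSided, twoSided, map_sub, conj_cauchy, conj_cauchy, map_neg]

lemma IsHalfDensity.tendsto_cauchy_neg (H : IsHalfDensity p q s) {E : ℝ} (hE : E < 0) :
    Tendsto (cauchy p q s) (𝓝 (E : ℂ)) (𝓝 (cauchy p q s E)) := by
  have h1 : (E : ℂ) ∈ offContinuum (Set.Ioi 0) :=
    ofReal_mem_offContinuum hE.ne (not_lt.mpr hE.le)
  exact ((H.differentiableOn_cauchy.continuousOn).continuousAt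
    ((isOpen_offContinuum isClosed_insert_Ioi).mem_nhds h1)).tendsto

/-- Boundary values on the line, and their jump. -/
theorem exists_boundary_twoSided (H₁ : IsHalfDensity p q s₁) (H₂ : IsHalfDensity p q s₂) {E : ℝ}
    (hE : E ≠ 0) : ∃ R : ℂ,
      Tendsto (twoSided p q s₁ s₂) (𝓝[upper] (E : ℂ))
        (𝓝 (R - I * Real.pi * lineDensity p q s₁ s₂ E)) ∧
      Tendsto (twoSided p q s₁ s₂) (𝓝[lower] (E : ℂ))
        (𝓝 (R + I * Real.pi * lineDensity p q s₁ s₂ E)) := by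
  rcases hE.lt_or_gt with hE | hE
  -- The reflection ω ↦ -ω exchanges the half-planes; the minus sign in `twoSided` then restores the
  -- orientation of the jump.
  · obtain ⟨R, hu, hl⟩ := H₂.exists_boundary (neg_pos.mpr hE)
    rw [ofReal_neg] at hu hl
    have h1 := H₁.tendsto_cauchy_neg hE
    refine ⟨cauchy p q s₁ E - R, ?_, ?_⟩
    · rw [lineDensity, if_neg (not_lt.mpr hE.le)]
      have := (h1.mono_left (nhdsWithin_le_nhds (s := upper))).sub (hl.comp (tendsto_neg_upper E))
      rwa [← sub_sub] at this
    · rw [lineDensity, if_neg (not_lt.mpr hE.le)]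
      have := (h1.mono_left (nhdsWithin_le_nhds (s := lower))).sub (hu.comp (tendsto_neg_lower E))
      rwa [← sub_add] at this
  · obtain ⟨R, hu, hl⟩ := H₁.exists_boundary hE
    have h1 := H₂.tendsto_cauchy_neg (neg_neg_of_pos hE)
    rw [ofReal_neg] at h1
    refine ⟨R - cauchy p q s₂ (-E), ?_, ?_⟩
    · rw [lineDensity, if_pos hE]
      have := hu.sub ((h1.mono_left (nhdsWithin_le_nhds (s := lower))).comp (tendsto_neg_upper E))
      rwa [sub_right_comm] at this
    · rw [lineDensity, if_pos hE]
      have := hl.sub ((h1.mono_left (nhdsWithin_le_nhds (s := upper))).comp (tendsto_neg_lower E))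
      rwa [add_sub_right_comm] at this

/-- The half-line densities whose Cauchy transform vanishes at infinity. -/
structure IsDecaying (p q : ℝ) (s : ℝ → ℂ) : Prop extends IsHalfDensity p q s where
  regular : p < 1 ∨
    ∃ C θ : ℝ, 0 < θ ∧ ∀ x y : ℝ, 0 ≤ x → 0 ≤ y → ‖s x - s y‖ ≤ C * |x - y| ^ θ

lemma IsDecaying.conj_fun (H : IsDecaying p q s) : IsDecaying p q fun r => conj (s r) :=
  ⟨H.toIsHalfDensity.conj_fun, by
    simpa only [← map_sub, RCLike.norm_conj] using H.regular⟩

lemma IsDecaying.tendsto_upper (H : IsDecaying p q s) :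
    Tendsto (cauchy p q s) (Bornology.cobounded ℂ ⊓ 𝓟 upper) (𝓝 0) := by
  rcases lt_or_ge p 1 with hp | hp
  · exact H.tendsto_cauchy_cobounded_of_lt_one hp
  · exact H.tendsto_cauchy_cobounded_of_holder hp (H.regular.resolve_left (not_lt.mpr hp))

lemma IsDecaying.tendsto_lower (H : IsDecaying p q s) :
    Tendsto (cauchy p q s) (Bornology.cobounded ℂ ⊓ 𝓟 lower) (𝓝 0) := by
  have h := (Complex.continuous_conj.tendsto _).comp
    (H.conj_fun.tendsto_upper.comp tendsto_conj_cobounded_lower)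
  rw [map_zero] at h
  refine h.congr fun ω => ?_
  simp only [Function.comp]
  rw [← conj_cauchy, Complex.conj_conj]

lemma tendsto_twoSided_cobounded_upper (H₁ : IsDecaying p q s₁) (H₂ : IsDecaying p q s₂) :
    Tendsto (twoSided p q s₁ s₂) (Bornology.cobounded ℂ ⊓ 𝓟 upper) (𝓝 0) := by
  have h := H₁.tendsto_upper.sub (H₂.tendsto_lower.comp (tendsto_neg_cobounded'.inf
    (tendsto_principal_principal.mpr fun _ => neg_mem_lower)))
  rwa [sub_zero] at h

lemma tendsto_twoSided_cobounded_lower (H₁ : IsDecaying p q s₁) (H₂ : IsDecaying p q s₂) :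
    Tendsto (twoSided p q s₁ s₂) (Bornology.cobounded ℂ ⊓ 𝓟 lower) (𝓝 0) := by
  have h := H₁.tendsto_lower.sub (H₂.tendsto_upper.comp (tendsto_neg_cobounded'.inf
    (tendsto_principal_principal.mpr fun _ => neg_mem_upper)))
  rwa [sub_zero] at h

/-- The low-energy asymptotics in the upper half-plane. -/
theorem tendsto_twoSided_zero_upper (H₁ : IsHalfDensity p q s₁) (H₂ : IsHalfDensity p q s₂)
    (hp : p < 1) :
    Tendsto (fun ω : ℂ => twoSided p q s₁ s₂ ω * ((‖ω‖ ^ (1 - p) : ℝ) : ℂ) *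
        Complex.exp (-(I * (p - 1 : ℝ) * arg ω))) (𝓝[upper] 0)
      (𝓝 (powerConst p * (s₁ 0 * Complex.exp (-(I * (p - 1 : ℝ) * Real.pi)) - s₂ 0))) := by
  have h1 := H₁.tendsto_cauchy_zero_of_lt_one hp
  have h2 := H₂.conj_fun.tendsto_cauchy_zero_of_lt_one hp
  -- The second density is evaluated at -ω, in the lower half-plane. The map ω ↦ conj(-ω) preserves
  -- the upper half-plane and sends arg ω to π - arg ω, so the asymptotics of the conjugate density
  -- apply.
  have h3 : Tendsto (fun ω : ℂ => conj (-ω)) (𝓝[upper] 0) (𝓝[upper] 0) := by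
    have e1 := tendsto_neg_upper 0
    have e2 := tendsto_conj_lower (-0)
    rw [neg_zero] at e1 e2
    rw [map_zero] at e2
    exact e2.comp e1
  have h4 := ((Complex.continuous_conj.tendsto _).comp (h2.comp h3)).mul_const
    (Complex.exp (-(I * (p - 1 : ℝ) * Real.pi)))
  have h5 := h1.sub h4
  have e : s₁ 0 * powerConst p * Complex.exp (-(I * (p - 1 : ℝ) * Real.pi)) -
      conj (conj (s₂ 0) * powerConst p * Complex.exp (-(I * (p - 1 : ℝ) * Real.pi))) *
        Complex.exp (-(I * (p - 1 : ℝ) * Real.pi)) =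
      powerConst p * (s₁ 0 * Complex.exp (-(I * (p - 1 : ℝ) * Real.pi)) - s₂ 0) := by
    rw [map_mul, map_mul, Complex.conj_conj, conj_powerConst, ← Complex.exp_conj, map_neg, map_mul,
      map_mul, conj_I, conj_ofReal, conj_ofReal, mul_assoc (s₂ 0 * powerConst p),
      ← Complex.exp_add]
    rw [show -(-I * ((p - 1 : ℝ) : ℂ) * Real.pi) + -(I * ((p - 1 : ℝ) : ℂ) * Real.pi) = 0 by ring,
      Complex.exp_zero]
    ring
  rw [e] at h5
  refine h5.congr' ?_
  filter_upwards [self_mem_nhdsWithin] with ω h0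
  have harg : arg (conj (-ω)) = Real.pi - arg ω := by
    have h0' : 0 < ω.im := h0
    have e1 : arg (-ω) = arg ω - Real.pi := Complex.arg_neg_eq_arg_sub_pi_of_im_pos h0'
    have e2 : arg (-ω) ≠ Real.pi := by
      rw [e1]
      have := Complex.arg_le_pi ω
      have := Real.pi_pos
      intro h
      linarith
    rw [Complex.arg_conj, if_neg e2, e1]; ring
  simp only [Function.comp, twoSided]
  rw [harg, RCLike.norm_conj, norm_neg, map_mul, map_mul, conj_cauchy, Complex.conj_conj,
    ← Complex.exp_conj, map_neg, map_mul, map_mul, conj_I, conj_ofReal, conj_ofReal, conj_ofReal]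
  simp only [Complex.conj_conj]
  rw [mul_assoc _ _ (Complex.exp (-(I * ((p - 1 : ℝ) : ℂ) * Real.pi))), ← Complex.exp_add,
    show -(-I * ((p - 1 : ℝ) : ℂ) * ((Real.pi - arg ω : ℝ) : ℂ)) +
      -(I * ((p - 1 : ℝ) : ℂ) * Real.pi) = -(I * ((p - 1 : ℝ) : ℂ) * arg ω) by push_cast; ring]
  ring

/-- The transfer of low-energy asymptotics to the lower half-plane. -/
lemma tendsto_zero_lower_of_upper {F : ℂ → ℂ} {h : ℝ → ℝ} {e : ℝ} {c : ℂ}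
    (hF : Tendsto (fun ω : ℂ => conj (F (conj ω)) * h ‖ω‖ * Complex.exp (-(I * e * arg ω)))
      (𝓝[upper] 0) (𝓝 c)) :
    Tendsto (fun ω : ℂ => F ω * h ‖ω‖ * Complex.exp (-(I * e * arg ω))) (𝓝[lower] 0)
      (𝓝 (conj c)) := by
  have h3 : Tendsto (fun ω : ℂ => conj ω) (𝓝[lower] 0) (𝓝[upper] 0) := by
    have e2 := tendsto_conj_lower 0
    rwa [map_zero] at e2
  refine ((Complex.continuous_conj.tendsto _).comp (hF.comp h3)).congr' ?_
  filter_upwards [self_mem_nhdsWithin] with ω h0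
  have h1 : arg ω ≠ Real.pi := fun h => by
    have h0' : ω.im < 0 := h0
    have := (Complex.arg_eq_pi_iff.mp h).2
    linarith
  simp only [Function.comp]
  rw [map_mul, map_mul, Complex.conj_conj, Complex.conj_conj, ← Complex.exp_conj, map_neg, map_mul,
    map_mul, conj_I, conj_ofReal, conj_ofReal, conj_ofReal, RCLike.norm_conj, Complex.arg_conj,
    if_neg h1]
  push_cast
  congr 2
  ring

theorem tendsto_twoSided_zero_lower (H₁ : IsHalfDensity p q s₁) (H₂ : IsHalfDensity p q s₂)
    (hp : p < 1) :
    Tendsto (fun ω : ℂ => twoSided p q s₁ s₂ ω * ((‖ω‖ ^ (1 - p) : ℝ) : ℂ) *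
        Complex.exp (-(I * (p - 1 : ℝ) * arg ω))) (𝓝[lower] 0)
      (𝓝 (powerConst p * (s₁ 0 * Complex.exp (I * (p - 1 : ℝ) * Real.pi) - s₂ 0))) := by
  have h1 := tendsto_twoSided_zero_upper H₁.conj_fun H₂.conj_fun hp
  have h2 := tendsto_zero_lower_of_upper (F := twoSided p q s₁ s₂) (h := fun r => r ^ (1 - p))
    (e := p - 1) (by simpa only [conj_twoSided, Complex.conj_conj] using h1)
  refine h2.trans_eq ?_
  rw [map_mul, map_sub, map_mul, Complex.conj_conj, Complex.conj_conj, conj_powerConst,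
    ← Complex.exp_conj, map_neg, map_mul, map_mul, conj_I, conj_ofReal, conj_ofReal, neg_mul,
    neg_mul, neg_neg]

/-- Limits on a half-plane pass to the boundary values. -/
lemma tendsto_boundary_of_upper {G : ℂ → ℂ} {Gb : ℝ → ℂ} {c : ℂ} {J : Set ℝ}
    (h0 : Tendsto G (𝓝[upper] 0) (𝓝 c))
    (hb : ∀ E ∈ J, Tendsto G (𝓝[upper] (E : ℂ)) (𝓝 (Gb E))) : Tendsto Gb (𝓝[J] 0) (𝓝 c) := by
  refine (closed_nhds_basis c).tendsto_right_iff.mpr fun W ⟨hW, hWc⟩ => ?_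
  have h1 : ∀ᶠ ω in 𝓝 (0 : ℂ), ω ∈ upper → G ω ∈ W := eventually_nhdsWithin_iff.mp (h0 hW)
  have h2 : ∀ᶠ E : ℝ in 𝓝 0, ∀ᶠ ω in 𝓝 (E : ℂ), ω ∈ upper → G ω ∈ W := by
    have := Complex.continuous_ofReal.tendsto 0
    rw [ofReal_zero] at this
    exact this.eventually h1.eventually_nhds
  filter_upwards [nhdsWithin_le_nhds h2, self_mem_nhdsWithin] with E h3 hE
  exact hWc.mem_of_tendsto (hb E hE) (eventually_nhdsWithin_iff.mpr h3)

lemma tendsto_vertical_upper (E : ℝ) :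
    Tendsto (fun η : ℝ => (E : ℂ) + (η : ℂ) * I) (𝓝[>] 0) (𝓝[upper] (E : ℂ)) := by
  refine tendsto_nhdsWithin_iff.mpr ⟨?_, ?_⟩
  · have h : Continuous fun η : ℝ => (E : ℂ) + (η : ℂ) * I := by fun_prop
    have := (h.tendsto 0).mono_left (nhdsWithin_le_nhds (s := Set.Ioi 0))
    simpa using this
  · filter_upwards [self_mem_nhdsWithin] with η hη
    simpa [upper] using hη

lemma tendsto_vertical_lower (E : ℝ) :
    Tendsto (fun η : ℝ => (E : ℂ) - (η : ℂ) * I) (𝓝[>] 0) (𝓝[lower] (E : ℂ)) := by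
  refine tendsto_nhdsWithin_iff.mpr ⟨?_, ?_⟩
  · have h : Continuous fun η : ℝ => (E : ℂ) - (η : ℂ) * I := by fun_prop
    have := (h.tendsto 0).mono_left (nhdsWithin_le_nhds (s := Set.Ioi 0))
    simpa using this
  · filter_upwards [self_mem_nhdsWithin] with η hη
    simpa [lower] using hη

lemma fromAbove_eq {f : ℂ → ℂ} {E : ℝ} {a : ℂ} (h : Tendsto f (𝓝[upper] (E : ℂ)) (𝓝 a)) :
    fromAbove f E = a :=
  (h.comp (tendsto_vertical_upper E)).limUnder_eq

lemma fromBelow_eq {f : ℂ → ℂ} {E : ℝ} {a : ℂ} (h : Tendsto f (𝓝[lower] (E : ℂ)) (𝓝 a)) :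
    fromBelow f E = a :=
  (h.comp (tendsto_vertical_lower E)).limUnder_eq

end SepScattering

/-! ### Separable models whose K is a Cauchy transform on the line -/

namespace SepScattering

section LineModel

variable {V : Type*} [NormedAddCommGroup V] [InnerProductSpace ℝ V] [FiniteDimensional ℝ V]
  [MeasurableSpace V] [BorelSpace V]

/-- A separable model in which `K` is the Cauchy transform of a density on the line. -/
structure LineModel (ε : V → ℝ) (v : V → ℂ) (Rc : Set ℝ) (p q : ℝ) (s₁ s₂ : ℝ → ℂ) : Prop
    extends SeparableModel ε v Rc where
  isOpen : IsOpen Rc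
  zero_notMem : (0 : ℝ) ∉ Rc
  null : ∀ E : ℝ, ∀ᵐ k, ε k ≠ E
  density₁ : IsHalfDensity p q s₁
  density₂ : IsHalfDensity p q s₂
  Ksep_eq : ∀ ω : ℂ, ω.im ≠ 0 → Ksep ε v ω = twoSided p q s₁ s₂ ω

namespace LineModel

variable {ε : V → ℝ} {v : V → ℂ} {Rc : Set ℝ} {p q : ℝ} {s₁ s₂ : ℝ → ℂ} {g : ℂ}

lemma eqOn_upper (M : LineModel ε v Rc p q s₁ s₂) {ω : ℂ} (h : ω ∈ upper) :
    twoSided p q s₁ s₂ ω = Ksep ε v ω := (M.Ksep_eq ω (ne_of_gt h)).symm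

lemma eqOn_lower (M : LineModel ε v Rc p q s₁ s₂) {ω : ℂ} (h : ω ∈ lower) :
    twoSided p q s₁ s₂ ω = Ksep ε v ω := (M.Ksep_eq ω (ne_of_lt h)).symm

lemma boundary (M : LineModel ε v Rc p q s₁ s₂) {E : ℝ} (hE : E ≠ 0) :
    Tendsto (Ksep ε v) (𝓝[upper] (E : ℂ)) (𝓝 (fromAbove (Ksep ε v) E)) ∧
    Tendsto (Ksep ε v) (𝓝[lower] (E : ℂ)) (𝓝 (fromBelow (Ksep ε v) E)) ∧
    fromBelow (Ksep ε v) E - fromAbove (Ksep ε v) E =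
      2 * Real.pi * I * lineDensity p q s₁ s₂ E := by
  obtain ⟨R, hu, hl⟩ := exists_boundary_twoSided M.density₁ M.density₂ hE
  have hu' : Tendsto (Ksep ε v) (𝓝[upper] (E : ℂ)) _ :=
    hu.congr' (eventually_nhdsWithin_of_forall fun ω h => M.eqOn_upper h)
  have hl' : Tendsto (Ksep ε v) (𝓝[lower] (E : ℂ)) _ :=
    hl.congr' (eventually_nhdsWithin_of_forall fun ω h => M.eqOn_lower h)
  rw [fromAbove_eq hu', fromBelow_eq hl']
  exact ⟨hu', hl', by ring⟩

lemma hasBoundaryValues (M : LineModel ε v Rc p q s₁ s₂) {E : ℝ} (hE : E ≠ 0) :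
    HasBoundaryValues (Ksep ε v) E :=
  ⟨(M.boundary hE).1.comp (tendsto_vertical_upper E),
    (M.boundary hE).2.1.comp (tendsto_vertical_lower E)⟩

/-- The ratio of the boundary values in terms of the density. -/
lemma ratio_eq (M : LineModel ε v Rc p q s₁ s₂) {E : ℝ} (hE : E ≠ 0)
    (hb : ¬ IsBoundStateInContinuum ε g v E) :
    (g⁻¹ - fromBelow (Ksep ε v) E) / (g⁻¹ - fromAbove (Ksep ε v) E) =
      1 - 2 * Real.pi * I * lineDensity p q s₁ s₂ E / (g⁻¹ - fromAbove (Ksep ε v) E) := by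
  have h1 : g⁻¹ - fromAbove (Ksep ε v) E ≠ 0 := hb
  rw [← (M.boundary hE).2.2, eq_sub_iff_add_eq, ← add_div, sub_add_sub_cancel, div_self h1]

lemma fromAbove_Tsep (M : LineModel ε v Rc p q s₁ s₂) {E : ℝ} (hE : E ≠ 0)
    (hb : ¬ IsBoundStateInContinuum ε g v E) (k k' : V) :
    fromAbove (fun ω => Tsep ε g v ω k k') E =
      v k * v k' / (g⁻¹ - fromAbove (Ksep ε v) E) :=
  fromAbove_eq (tendsto_const_nhds.div ((M.boundary hE).1.const_sub g⁻¹) hb)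

/-- The data of `g⁻¹ - K`, from its behaviour at zero. -/
theorem halfPlaneData (M : LineModel ε v Rc p q s₁ s₂) (hg : g ≠ 0)
    (h₁ : IsDecaying p q s₁) (h₂ : IsDecaying p q s₂)
    (hb : ∀ E ∈ Rc, ¬ IsBoundStateInContinuum ε g v E)
    (hl : ∀ E ∈ Rc, g⁻¹ - fromBelow (Ksep ε v) E ≠ 0) {h : ℝ → ℝ} (hpos : ∀ r, 0 < r → 0 < h r)
    (hcont : ContinuousOn h (Set.Ioi 0)) {e : ℝ} {c₁ c₂ : ℂ} (hc₁ : c₁ ≠ 0) (hc₂ : c₂ ≠ 0)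
    (z₁ : Tendsto (fun ω => (g⁻¹ - Ksep ε v ω) * h ‖ω‖ * Complex.exp (-(I * e * arg ω)))
      (𝓝[upper] 0) (𝓝 c₁))
    (z₂ : Tendsto (fun ω => (g⁻¹ - Ksep ε v ω) * h ‖ω‖ * Complex.exp (-(I * e * arg ω)))
      (𝓝[lower] 0) (𝓝 c₂)) :
    HalfPlaneData Rc (fun ω => g⁻¹ - Ksep ε v ω) (fun E => g⁻¹ - fromAbove (Ksep ε v) E)
      (fun E => g⁻¹ - fromBelow (Ksep ε v) E) g⁻¹ h e c₁ c₂ := by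
  have hne : ∀ E ∈ Rc, E ≠ 0 := fun E hE h0 => M.zero_notMem (h0 ▸ hE)
  refine ⟨M.isOpen, M.zero_notMem, M.isClosed, M.differentiableOn_Ksep.const_sub _,
    fun E hE => (M.boundary (hne E hE)).1.const_sub _,
    fun E hE => (M.boundary (hne E hE)).2.1.const_sub _, hb, hl, inv_ne_zero hg, ?_, ?_, hpos, hcont,
    hc₁, hc₂, z₁, z₂⟩
  · have := (tendsto_twoSided_cobounded_upper h₁ h₂).const_sub g⁻¹
    rw [sub_zero] at this
    refine this.congr' (Filter.mem_inf_of_right ?_)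
    exact mem_principal.mpr fun ω h => by simp only [Set.mem_ofPred_eq, M.eqOn_upper h]
  · have := (tendsto_twoSided_cobounded_lower h₁ h₂).const_sub g⁻¹
    rw [sub_zero] at this
    refine this.congr' (Filter.mem_inf_of_right ?_)
    exact mem_principal.mpr fun ω h => by simp only [Set.mem_ofPred_eq, M.eqOn_lower h]

/-- No square-integrable eigenvector has its energy in the continuum or at its edge. -/
lemma eq_zero_of_shifted (M : LineModel ε v Rc p q s₁ s₂) (hg : g ≠ 0) {h : ℝ → ℝ} {e C : ℝ}
    {c₁ c₂ : ℂ}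
    (H : HalfPlaneData Rc (fun ω => g⁻¹ - Ksep ε v ω) (fun E => g⁻¹ - fromAbove (Ksep ε v) E)
      (fun E => g⁻¹ - fromBelow (Ksep ε v) E) g⁻¹ h e c₁ c₂)
    (hC : ∀ᶠ r in 𝓝[>] 0, h r ≤ C) {E : ℝ} (hE : E ∈ insert 0 Rc)
    {ψ : Lp ℂ 2 (volume : Measure V)} (hψ : ShiftedHamiltonian ε g v (E : ℂ) ψ 0) : ψ = 0 := by
  by_contra h0
  have h1 := M.tendsto_Ksep_of_shifted hg (M.null E) hψ h0
  rcases hE with rfl | hE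
  -- At zero energy an eigenvector would give D(iη) → 0. As h stays bounded near 0, the rescaled
  -- limit would vanish, contrary to c₁ ≠ 0.
  · have h2 := tendsto_vertical_upper 0
    rw [ofReal_zero] at h1 h2
    have h3 : Tendsto (fun η : ℝ => ‖(0 : ℂ) + η * I‖) (𝓝[>] 0) (𝓝[>] 0) :=
      tendsto_norm_nhdsWithin_upper_zero.comp h2
    have h4 : Tendsto (fun η : ℝ => ‖g⁻¹ - Ksep ε v (0 + η * I)‖ * C) (𝓝[>] 0) (𝓝 0) := by
      have := (h1.const_sub g⁻¹).norm.mul_const C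
      rwa [sub_self, norm_zero, zero_mul] at this
    have h5 := (H.zero_upper.comp h2).norm
    have h6 := squeeze_zero' (.of_forall fun (η : ℝ) => norm_nonneg
      (((fun ω => (g⁻¹ - Ksep ε v ω) * h ‖ω‖ * Complex.exp (-(I * e * arg ω))) ∘
        fun η : ℝ => (0 : ℂ) + η * I) η)) ?_ h4
    · exact H.c₁_ne_zero (norm_eq_zero.mp (tendsto_nhds_unique h5 h6))
    · filter_upwards [h3.eventually hC, h3.eventually self_mem_nhdsWithin] with η h7 h8
      simp only [Function.comp]
      rw [norm_mul, norm_mul, Complex.norm_real, Real.norm_of_nonneg (H.h_pos _ h8).le,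
        show -(I * (e : ℂ) * arg (0 + η * I)) = I * ((-(e * arg (0 + η * I)) : ℝ) : ℂ) by
          push_cast; ring, norm_exp_I_mul, mul_one]
      gcongr
  · have hne : E ≠ 0 := fun h0 => M.zero_notMem (h0 ▸ hE)
    have h2 := tendsto_nhds_unique h1 ((M.boundary hne).1.comp (tendsto_vertical_upper E))
    exact H.upper_ne_zero E hE (sub_eq_zero.mpr h2)

lemma eq_of_exp_eq_one {δ : ℝ → ℝ} {J : Set ℝ} (hJ : IsPreconnected J) (hδ : ContinuousOn δ J)
    (h1 : ∀ E ∈ J, Complex.exp (2 * I * δ E) = 1) {x y : ℝ} (hx : x ∈ J) (hy : y ∈ J) :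
    δ x = δ y := by
  have h2 := eq_of_exp_eq_const hJ (g := fun E => 2 * I * (δ E : ℂ))
    (continuousOn_const.mul (Complex.continuous_ofReal.comp_continuousOn hδ)) h1 hx hy
  have h3 := mul_left_cancel₀ (mul_ne_zero two_ne_zero Complex.I_ne_zero) h2
  exact_mod_cast h3

/-- Levinson's theorem for a line model. -/
theorem levinson (M : LineModel ε v Rc p q s₁ s₂) (hg : g ≠ 0) {h : ℝ → ℝ} {e C : ℝ} {c₁ c₂ : ℂ}
    (H : HalfPlaneData Rc (fun ω => g⁻¹ - Ksep ε v ω) (fun E => g⁻¹ - fromAbove (Ksep ε v) E)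
      (fun E => g⁻¹ - fromBelow (Ksep ε v) E) g⁻¹ h e c₁ c₂)
    (hC : ∀ᶠ r in 𝓝[>] 0, h r ≤ C) {f : ℝ → ℂ}
    (hf : ∀ E ∈ Rc, f E = (g⁻¹ - fromBelow (Ksep ε v) E) / (g⁻¹ - fromAbove (Ksep ε v) E)) :
    FiniteDimensional ℂ (boundStateSpace ε g v) ∧ ∃ Δneg Δpos : ℝ,
      (Set.Iio 0 ⊆ Rc → HasPhaseChange f (Set.Iio 0) atBot (𝓝[<] 0) Δneg) ∧
      (Set.Ioi 0 ⊆ Rc → HasPhaseChange f (Set.Ioi 0) (𝓝[>] 0) atTop Δpos) ∧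
      (Disjoint (Set.Iio 0) Rc → Δneg = 0) ∧ (Disjoint (Set.Ioi 0) Rc → Δpos = 0) ∧
      Δneg + Δpos = -Real.pi * boundStateNumber ε g v - Real.pi * e := by
  set Z := H.finite_zeros.toFinset
  have hZ : ∀ z, z ∈ Z ↔ z ∈ offContinuum Rc ∧ g⁻¹ - Ksep ε v z = 0 := fun z => by
    simp [Z]
  obtain ⟨hfin, hN⟩ := M.finrank_boundStateSpace hg Z hZ (fun z _ => by
    rw [Ne, analyticOrderAt_eq_top]; exact H.not_eventually_zero)
    fun E hE ψ hψ => M.eq_zero_of_shifted hg H hC hE hψ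
  obtain ⟨δ, hδc, hδ, hδ1, a, b, b', a', ha, hb, hb', ha', hsum⟩ := H.exists_phase Z hZ
  have hf0 : ∀ E ∈ Rc, f E ≠ 0 := fun E hE => by
    rw [hf E hE]
    exact div_ne_zero (H.lower_ne_zero E hE) (H.upper_ne_zero E hE)
  have hphase : ∀ J : Set ℝ, J ⊆ Rc → (0 : ℝ) ∉ J → IsScatteringPhase f J δ := fun J hJ h0 =>
    ⟨hδc.mono fun x hx h => h0 (h ▸ hx), fun E hE => by
      rw [hf E (hJ hE)]; exact hδ E (hJ hE)⟩
  refine ⟨hfin, b - a, a' - b', fun hJ => ?_, fun hJ => ?_, fun hd => ?_, fun hd => ?_, ?_⟩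
  · exact hasPhaseChange_of_phase isPreconnected_Iio (Iio_mem_atBot 0) self_mem_nhdsWithin
      (fun E hE => hf0 E (hJ hE)) (hphase _ hJ (by simp)) ha hb
  · exact hasPhaseChange_of_phase isPreconnected_Ioi self_mem_nhdsWithin (Ioi_mem_atTop 0)
      (fun E hE => hf0 E (hJ hE)) (hphase _ hJ (by simp)) hb' ha'
  -- On a half-line outside the continuum exp(2iδ) = 1, so δ is constant there and contributes
  -- nothing.
  · have hm : (-1 : ℝ) ∈ Set.Iio (0 : ℝ) := by simp
    have h1 : ∀ x ∈ Set.Iio (0 : ℝ), δ (-1) = δ x := fun x hx =>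
      eq_of_exp_eq_one isPreconnected_Iio (hδc.mono fun x hx => ne_of_lt hx)
        (fun E hE => hδ1 E (ne_of_lt hE) (Set.disjoint_left.mp hd hE)) hm hx
    have e1 := tendsto_nhds_unique ha (tendsto_const_nhds.congr' (by
      filter_upwards [Iio_mem_atBot (0 : ℝ)] with x hx using h1 x hx))
    have e2 := tendsto_nhds_unique hb (tendsto_const_nhds.congr' (by
      filter_upwards [self_mem_nhdsWithin] with x hx using h1 x hx))
    rw [e1, e2, sub_self]
  · have hm : (1 : ℝ) ∈ Set.Ioi (0 : ℝ) := by simp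
    have h1 : ∀ x ∈ Set.Ioi (0 : ℝ), δ 1 = δ x := fun x hx =>
      eq_of_exp_eq_one isPreconnected_Ioi (hδc.mono fun x hx => ne_of_gt hx)
        (fun E hE => hδ1 E (ne_of_gt hE) (Set.disjoint_left.mp hd hE)) hm hx
    have e1 := tendsto_nhds_unique ha' (tendsto_const_nhds.congr' (by
      filter_upwards [Ioi_mem_atTop (0 : ℝ)] with x hx using h1 x hx))
    have e2 := tendsto_nhds_unique hb' (tendsto_const_nhds.congr' (by
      filter_upwards [self_mem_nhdsWithin] with x hx using h1 x hx))
    rw [e1, e2, sub_self]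
  · rw [hN, hsum]; push_cast; ring

/-! ### Low energies, `p < 1` -/

/-- The limit of the rescaled `g⁻¹ - K` at zero, in the upper half-plane. -/
noncomputable def lowConst (p : ℝ) (a b : ℂ) : ℂ :=
  powerConst p * (a * Complex.exp (-(I * p * Real.pi)) + b)

lemma neg_powerConst_mul (p : ℝ) (a b : ℂ) :
    -(powerConst p * (a * Complex.exp (-(I * (p - 1 : ℝ) * Real.pi)) - b)) = lowConst p a b := by
  have : Complex.exp (-(I * (p - 1 : ℝ) * Real.pi)) = -Complex.exp (-(I * p * Real.pi)) := by
    rw [show -(I * ((p - 1 : ℝ) : ℂ) * Real.pi) = -(I * p * Real.pi) + Real.pi * I by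
      push_cast; ring, Complex.exp_add, Complex.exp_pi_mul_I]
    ring
  rw [lowConst, this]; ring

lemma neg_powerConst_mul' (p : ℝ) (a b : ℂ) :
    -(powerConst p * (a * Complex.exp (I * (p - 1 : ℝ) * Real.pi) - b)) =
      powerConst p * (a * Complex.exp (I * p * Real.pi) + b) := by
  have : Complex.exp (I * (p - 1 : ℝ) * Real.pi) = -Complex.exp (I * p * Real.pi) := by
    rw [show I * ((p - 1 : ℝ) : ℂ) * Real.pi = I * p * Real.pi + -(Real.pi * I) by
      push_cast; ring, Complex.exp_add, Complex.exp_neg, Complex.exp_pi_mul_I]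
    norm_num
  rw [this]; ring

/-- For p < 1 a constant is negligible against |ω|^(p-1); this is how the coupling g drops out of
the low-energy limit. -/
lemma tendsto_scaled_const {l : Filter ℂ} (hl : l ≤ 𝓝 0) (hp : p < 1) (c : ℂ) :
    Tendsto (fun ω : ℂ => c * ((‖ω‖ ^ (1 - p) : ℝ) : ℂ) *
      Complex.exp (-(I * (p - 1 : ℝ) * arg ω))) l (𝓝 0) := by
  rw [tendsto_zero_iff_norm_tendsto_zero]
  have h1 : Continuous fun ω : ℂ => ‖c‖ * ‖ω‖ ^ (1 - p) :=
    continuous_const.mul (continuous_norm.rpow_const fun _ => Or.inr (by linarith))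
  have h2 := (h1.tendsto 0).mono_left hl
  rw [norm_zero, Real.zero_rpow (by linarith), mul_zero] at h2
  refine h2.congr fun ω => ?_
  rw [norm_mul, norm_mul, Complex.norm_real, Real.norm_of_nonneg (by positivity),
    show -(I * ((p - 1 : ℝ) : ℂ) * arg ω) = I * ((-((p - 1) * arg ω) : ℝ) : ℂ) by push_cast; ring,
    norm_exp_I_mul, mul_one]

lemma zero_upper_of_lt_one (M : LineModel ε v Rc p q s₁ s₂) (hp : p < 1) (g : ℂ) :
    Tendsto (fun ω => (g⁻¹ - Ksep ε v ω) * ((‖ω‖ ^ (1 - p) : ℝ) : ℂ) *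
      Complex.exp (-(I * (p - 1 : ℝ) * arg ω))) (𝓝[upper] 0) (𝓝 (lowConst p (s₁ 0) (s₂ 0))) := by
  have h1 := (tendsto_scaled_const nhdsWithin_le_nhds hp g⁻¹).sub
    (tendsto_twoSided_zero_upper M.density₁ M.density₂ hp)
  rw [zero_sub, neg_powerConst_mul] at h1
  refine h1.congr' (eventually_nhdsWithin_of_forall fun ω h => ?_)
  beta_reduce
  rw [M.eqOn_upper h]; ring

lemma zero_lower_of_lt_one (M : LineModel ε v Rc p q s₁ s₂) (hp : p < 1) (g : ℂ) :
    Tendsto (fun ω => (g⁻¹ - Ksep ε v ω) * ((‖ω‖ ^ (1 - p) : ℝ) : ℂ) *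
      Complex.exp (-(I * (p - 1 : ℝ) * arg ω))) (𝓝[lower] 0)
      (𝓝 (powerConst p * (s₁ 0 * Complex.exp (I * p * Real.pi) + s₂ 0))) := by
  have h1 := (tendsto_scaled_const nhdsWithin_le_nhds hp g⁻¹).sub
    (tendsto_twoSided_zero_lower M.density₁ M.density₂ hp)
  rw [zero_sub, neg_powerConst_mul'] at h1
  refine h1.congr' (eventually_nhdsWithin_of_forall fun ω h => ?_)
  beta_reduce
  rw [M.eqOn_lower h]; ring

lemma powerConst_ne_zero {p : ℝ} (hp : 0 < p) (hp1 : p < 1) : powerConst p ≠ 0 := fun h => by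
  have := powerConst_mul_sin hp hp1
  rw [h, zero_mul] at this
  exact Real.pi_ne_zero (by exact_mod_cast neg_eq_zero.mp this.symm)

lemma eventually_rpow_le (hp : p < 1) : ∀ᶠ r : ℝ in 𝓝[>] 0, r ^ (1 - p) ≤ 1 := by
  filter_upwards [Ioo_mem_nhdsGT (zero_lt_one (α := ℝ))] with r hr
  exact Real.rpow_le_one hr.1.le hr.2.le (by linarith)

/-- The data of `g⁻¹ - K` for `p < 1`. -/
theorem halfPlaneData_of_lt_one (M : LineModel ε v Rc p q s₁ s₂) (hg : g ≠ 0) (hp : p < 1)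
    (hb : ∀ E ∈ Rc, ¬ IsBoundStateInContinuum ε g v E)
    (hl : ∀ E ∈ Rc, g⁻¹ - fromBelow (Ksep ε v) E ≠ 0)
    (hc₁ : s₁ 0 * Complex.exp (-(I * p * Real.pi)) + s₂ 0 ≠ 0)
    (hc₂ : s₁ 0 * Complex.exp (I * p * Real.pi) + s₂ 0 ≠ 0) :
    HalfPlaneData Rc (fun ω => g⁻¹ - Ksep ε v ω) (fun E => g⁻¹ - fromAbove (Ksep ε v) E)
      (fun E => g⁻¹ - fromBelow (Ksep ε v) E) g⁻¹ (fun r => r ^ (1 - p)) (p - 1)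
      (lowConst p (s₁ 0) (s₂ 0))
      (powerConst p * (s₁ 0 * Complex.exp (I * p * Real.pi) + s₂ 0)) := by
  have hκ := powerConst_ne_zero M.density₁.p_pos hp
  refine M.halfPlaneData hg ⟨M.density₁, Or.inl hp⟩ ⟨M.density₂, Or.inl hp⟩ hb hl
    (fun r hr => Real.rpow_pos_of_pos hr _)
    (fun r hr => (Real.continuousAt_rpow_const _ _ (Or.inl (ne_of_gt hr))).continuousWithinAt)
    (mul_ne_zero hκ hc₁) (mul_ne_zero hκ hc₂) ?_ ?_
  · exact M.zero_upper_of_lt_one hp g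
  · exact M.zero_lower_of_lt_one hp g

/-- The boundary values at low positive energy. -/
theorem tendsto_rpow_div_pos (M : LineModel ε v Rc p q s₁ s₂) (hp : p < 1) (g : ℂ)
    (hc : s₁ 0 * Complex.exp (-(I * p * Real.pi)) + s₂ 0 ≠ 0) :
    Tendsto (fun E : ℝ => ((E ^ (p - 1) : ℝ) : ℂ) / (g⁻¹ - fromAbove (Ksep ε v) E)) (𝓝[>] 0)
      (𝓝 (lowConst p (s₁ 0) (s₂ 0))⁻¹) := by
  have h1 := tendsto_boundary_of_upper (J := Set.Ioi 0)
    (Gb := fun E => (g⁻¹ - fromAbove (Ksep ε v) E) * ((E ^ (1 - p) : ℝ) : ℂ))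
    (M.zero_upper_of_lt_one hp g) fun E hE => by
      have hE0 : 0 < E := hE
      have e1 : Tendsto (fun ω : ℂ => ((‖ω‖ ^ (1 - p) : ℝ) : ℂ) *
          Complex.exp (-(I * (p - 1 : ℝ) * arg ω))) (𝓝[upper] (E : ℂ))
          (𝓝 ((E ^ (1 - p) : ℝ) : ℂ)) := by
        have hc : ContinuousAt (fun ω : ℂ => ((‖ω‖ ^ (1 - p) : ℝ) : ℂ) *
            Complex.exp (-(I * (p - 1 : ℝ) * arg ω))) E := by
          have e1 : ContinuousAt arg (E : ℂ) := Complex.continuousAt_arg (by simp [hE0])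
          have e2 : ContinuousAt (fun ω : ℂ => ‖ω‖ ^ (1 - p)) (E : ℂ) :=
            continuous_norm.continuousAt.rpow_const (Or.inl (by simpa using hE0.ne'))
          fun_prop
        have := hc.tendsto.mono_left (nhdsWithin_le_nhds (s := upper))
        simpa [Complex.arg_ofReal_of_nonneg hE0.le, abs_of_pos hE0] using this
      have := ((M.boundary hE0.ne').1.const_sub g⁻¹).mul e1
      simpa only [mul_assoc] using this
  have h2 := h1.inv₀ (mul_ne_zero (powerConst_ne_zero M.density₁.p_pos hp) hc)
  refine h2.congr' (eventually_nhdsWithin_of_forall fun E hE => ?_)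
  have hE0 : 0 < E := hE
  beta_reduce
  rw [show p - 1 = -(1 - p) by ring, Real.rpow_neg hE0.le, ofReal_inv, mul_inv, mul_comm,
    div_eq_mul_inv]

/-- The boundary values at low negative energy. -/
theorem tendsto_rpow_div_neg (M : LineModel ε v Rc p q s₁ s₂) (hp : p < 1) (g : ℂ)
    (hc : s₁ 0 * Complex.exp (-(I * p * Real.pi)) + s₂ 0 ≠ 0) :
    Tendsto (fun E : ℝ => (((-E) ^ (p - 1) : ℝ) : ℂ) / (g⁻¹ - fromAbove (Ksep ε v) E)) (𝓝[<] 0)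
      (𝓝 ((lowConst p (s₁ 0) (s₂ 0))⁻¹ * -Complex.exp (-(I * p * Real.pi)))) := by
  have h1 := tendsto_boundary_of_upper (J := Set.Iio 0)
    (Gb := fun E => (g⁻¹ - fromAbove (Ksep ε v) E) * (((-E) ^ (1 - p) : ℝ) : ℂ) *
      -Complex.exp (-(I * p * Real.pi)))
    (M.zero_upper_of_lt_one hp g) fun E hE => by
      have hE0 : E < 0 := hE
      have hmem : (E : ℂ) ∈ upperClosed := ⟨by simp, by exact_mod_cast hE0.ne⟩
      have e1 : Tendsto (fun ω : ℂ => ((‖ω‖ ^ (1 - p) : ℝ) : ℂ)) (𝓝[upper] (E : ℂ))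
          (𝓝 (((-E) ^ (1 - p) : ℝ) : ℂ)) := by
        have e2 : ContinuousAt (fun ω : ℂ => ((‖ω‖ ^ (1 - p) : ℝ) : ℂ)) (E : ℂ) :=
          Complex.continuous_ofReal.continuousAt.comp
            (continuous_norm.continuousAt.rpow_const (Or.inl (by simpa using hE0.ne)))
        have := e2.tendsto.mono_left (nhdsWithin_le_nhds (s := upper))
        rwa [Complex.norm_real, Real.norm_of_nonpos hE0.le] at this
      -- From above, arg tends to π on the negative axis, and exp(-i(p-1)π) = -exp(-ipπ).
      have e3 : Tendsto (fun ω : ℂ => Complex.exp (-(I * (p - 1 : ℝ) * arg ω))) (𝓝[upper] (E : ℂ))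
          (𝓝 (-Complex.exp (-(I * p * Real.pi)))) := by
        have e4 : Tendsto arg (𝓝[upper] (E : ℂ)) (𝓝 Real.pi) := by
          have := (continuousOn_arg_upperClosed _ hmem).mono upper_subset_upperClosed
          rw [ContinuousWithinAt, Complex.arg_ofReal_of_neg hE0] at this
          exact this
        have hc : Continuous fun x : ℝ => Complex.exp (-(I * (p - 1 : ℝ) * x)) := by fun_prop
        have := (hc.tendsto Real.pi).comp e4
        rw [show -(I * ((p - 1 : ℝ) : ℂ) * Real.pi) = -(I * p * Real.pi) + Real.pi * I by
          push_cast; ring, Complex.exp_add, Complex.exp_pi_mul_I, mul_neg_one] at this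
        exact this
      exact (((M.boundary hE0.ne).1.const_sub g⁻¹).mul e1).mul e3
  have h2 := (h1.inv₀ (mul_ne_zero (powerConst_ne_zero M.density₁.p_pos hp) hc)).mul_const
    (-Complex.exp (-(I * p * Real.pi)))
  refine h2.congr' (eventually_nhdsWithin_of_forall fun E hE => ?_)
  have hE0 : E < 0 := hE
  have hexp : -Complex.exp (-(I * p * Real.pi)) ≠ 0 := neg_ne_zero.mpr (Complex.exp_ne_zero _)
  beta_reduce
  rw [show p - 1 = -(1 - p) by ring, Real.rpow_neg (neg_pos.mpr hE0).le, ofReal_inv, mul_inv,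
    inv_mul_cancel_right₀ hexp, mul_inv, mul_comm, div_eq_mul_inv]

end LineModel

end LineModel

end SepScattering

namespace SepScattering

/-! ### The Fourier transform of an integrable function -/

section UnitaryFourier

variable {V : Type*} [NormedAddCommGroup V] [InnerProductSpace ℝ V] [FiniteDimensional ℝ V]
  [MeasurableSpace V] [BorelSpace V] {w : V → ℂ}

lemma norm_exp_neg_I_mul (x : ℝ) : ‖Complex.exp (-(I * (x : ℂ)))‖ = 1 := by
  rw [show -(I * (x : ℂ)) = I * ((-x : ℝ) : ℂ) by push_cast; ring, norm_exp_I_mul]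

lemma continuous_unitaryFourier (hw : Integrable w) : Continuous (unitaryFourier w) := by
  refine continuous_const.mul (continuous_of_dominated (bound := fun x => ‖w x‖)
    (fun k => (show Continuous fun z : V => Complex.exp (-(I * ((inner ℝ k z : ℝ) : ℂ))) by
      fun_prop).aestronglyMeasurable.mul hw.aestronglyMeasurable)
    (fun r => .of_forall fun x => ?_) hw.norm (.of_forall fun x => by fun_prop))
  rw [norm_mul, norm_exp_neg_I_mul, one_mul]

lemma exists_bound_unitaryFourier (w : V → ℂ) : ∃ M, 0 ≤ M ∧ ∀ k, ‖unitaryFourier w k‖ ≤ M := by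
  refine ⟨‖(((Real.sqrt (2 * Real.pi))⁻¹ ^ Module.finrank ℝ V : ℝ) : ℂ)‖ * ∫ z, ‖w z‖,
    by positivity, fun k => ?_⟩
  rw [unitaryFourier, norm_mul]
  gcongr
  refine (norm_integral_le_integral_norm _).trans (le_of_eq ?_)
  congr 1; ext x
  rw [norm_mul, norm_exp_neg_I_mul, one_mul]

lemma unitaryFourier_zero (w : V → ℂ) : unitaryFourier w 0 =
    (((Real.sqrt (2 * Real.pi))⁻¹ ^ Module.finrank ℝ V : ℝ) : ℂ) * ∫ z, w z := by
  simp [unitaryFourier]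

lemma unitaryFourier_sq (w : V → ℂ) (k : V) : unitaryFourier w k ^ 2 =
    ((((Real.sqrt (2 * Real.pi))⁻¹ ^ Module.finrank ℝ V : ℝ) : ℂ)) ^ 2 *
      ∫ z : V × V, w z.1 * w z.2 * Complex.exp (-(I * ((inner ℝ k (z.1 + z.2) : ℝ) : ℂ))) := by
  rw [unitaryFourier, mul_pow, sq (∫ z, _), ← integral_prod_mul]
  congr 2; ext z
  rw [inner_add_right, ofReal_add, mul_add, neg_add, Complex.exp_add]
  ring

end UnitaryFourier

/-- Averages of `v²` along rays are Fourier transforms. -/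
lemma isFourier_average {V : Type} [NormedAddCommGroup V] [InnerProductSpace ℝ V]
    [FiniteDimensional ℝ V] [MeasurableSpace V] [BorelSpace V] {w : V → ℂ} (hw : Integrable w)
    {Y : Type} [MeasurableSpace Y] (ν : Measure Y) [IsFiniteMeasure ν] {Θ : Y → V}
    (hΘ : Measurable Θ) (C : ℂ) :
    IsFourier fun y => C * ∫ θ, unitaryFourier w (y • Θ θ) ^ 2 ∂ν := by
  set c : ℂ := (((Real.sqrt (2 * Real.pi))⁻¹ ^ Module.finrank ℝ V : ℝ) : ℂ) ^ 2
  -- v² is a double integral over positions z₁, z₂. Together with the direction this is one integral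
  -- with weight w(z₁)w(z₂) and frequency -⟨Θ, z₁+z₂⟩.
  have hu : Integrable (fun x : Y × V × V => C * c * (w x.2.1 * w x.2.2))
      (ν.prod (volume.prod volume)) := by
    have h1 : Integrable (fun z : V × V => w z.1 * w z.2) (volume.prod volume) := hw.mul_prod hw
    exact (integrable_const (C * c)).mul_prod h1
  have hτ : Measurable fun x : Y × V × V => -(inner ℝ (Θ x.1) (x.2.1 + x.2.2) : ℝ) := by fun_prop
  refine ⟨Y × V × V, _, ν.prod (volume.prod volume), inferInstance, _, _, hu, hτ, ?_⟩
  ext y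
  rw [fourierOf, integral_prod _ (integrable_fourierOf hu hτ y), ← integral_const_mul]
  congr 1; ext θ
  rw [unitaryFourier_sq, ← mul_assoc, ← integral_const_mul]
  congr 1; ext z
  rw [inner_smul_left, mul_assoc (C * c)]
  congr 4
  simp

/-! ### One dimension -/

section Line

/-- The momentum directions on which the energy has the sign `τ`. -/
noncomputable def branches (σ : ℝ) (m : ℕ) (τ : ℝ) : Finset ℝ :=
  ({1, -1} : Finset ℝ).filter fun θ => σ * θ ^ m = τ

/-- The reduced density of `v²` on a set of branches. -/
noncomputable def branchDensity (v : ℝ → ℂ) (d : ℝ) (m : ℕ) (A : Finset ℝ) (y : ℝ) : ℂ :=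
  ((1 / (m : ℝ) * d ^ (-(1 / (m : ℝ))) : ℝ) : ℂ) * ∑ θ ∈ A, v (θ * (d ^ (-(1 / (m : ℝ))) * y)) ^ 2

/-- The finitely many branches carry counting measure, which plays the role of the measure on
directions in `isFourier_average`. -/
lemma isFourier_branchDensity {w : ℝ → ℂ} (hw : Integrable w) (d : ℝ) (m : ℕ) (A : Finset ℝ) :
    IsFourier (branchDensity (unitaryFourier w) d m A) := by
  have : IsFiniteMeasure (Measure.count.restrict (A : Set ℝ)) := ⟨by simp⟩
  have h := isFourier_average hw (Measure.count.restrict (A : Set ℝ))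
    (Θ := fun θ => θ * d ^ (-(1 / (m : ℝ)))) (by fun_prop)
    ((1 / (m : ℝ) * d ^ (-(1 / (m : ℝ))) : ℝ) : ℂ)
  convert h using 2 with y
  rw [branchDensity, setIntegral_finset]
  · congr 1
    refine Finset.sum_congr rfl fun θ _ => ?_
    simp only [Measure.real, Measure.count_singleton, ENNReal.toReal_one, one_smul, smul_eq_mul]
    ring_nf
  · have := IntegrableOn.finset (μ := Measure.count.restrict (A : Set ℝ)) (s := A)
      (f := fun θ : ℝ => unitaryFourier w (y • (θ * d ^ (-(1 / (m : ℝ))))) ^ 2)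
    rwa [IntegrableOn, Measure.restrict_restrict A.measurableSet, Set.inter_self] at this

lemma branchDensity_zero {v : ℝ → ℂ} (hv : v 0 = 1) (d : ℝ) (m : ℕ) (A : Finset ℝ) :
    branchDensity v d m A 0 = ((1 / (m : ℝ) * d ^ (-(1 / (m : ℝ))) : ℝ) : ℂ) * A.card := by
  simp [branchDensity, hv]

variable {m : ℕ} {σ d : ℝ}

lemma dispersion_mul (σ d : ℝ) (m : ℕ) (θ k : ℝ) :
    dispersion σ d m (θ * k) = σ * θ ^ m * (d * k ^ m) := by
  rw [dispersion]; ring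

/-- The substitution `t = d kᵐ`. -/
lemma integral_comp_dispersion (hm : 2 ≤ m) (hd : 0 < d) (f : ℝ → ℝ → ℂ) :
    ∫ k in Set.Ioi (0 : ℝ), f k (d * k ^ m) = ∫ t in Set.Ioi (0 : ℝ),
      ((1 / (m : ℝ) * d ^ (-(1 / (m : ℝ))) * t ^ (1 / (m : ℝ) - 1) : ℝ) : ℂ) *
        f (d ^ (-(1 / (m : ℝ))) * t ^ (1 / (m : ℝ))) t := by
  have hm0 : (0 : ℝ) < m := by positivity
  have hb : 0 < d ^ (-(1 / (m : ℝ))) := Real.rpow_pos_of_pos hd _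
  have h1 := integral_comp_mul_left_Ioi' (fun k => f k (d * k ^ m)) 0 hb
  rw [mul_zero] at h1
  rw [← h1, ← integral_comp_rpow_Ioi_of_pos (p := 1 / (m : ℝ)) (by positivity), ← integral_smul]
  refine setIntegral_congr_fun measurableSet_Ioi fun t ht => ?_
  have ht0 : 0 < t := ht
  have e : d * (d ^ (-(1 / (m : ℝ))) * t ^ (1 / (m : ℝ))) ^ m = t := by
    rw [mul_pow, ← Real.rpow_natCast, ← Real.rpow_natCast, ← Real.rpow_mul hd.le,
      ← Real.rpow_mul ht0.le, neg_mul, one_div_mul_cancel hm0.ne', Real.rpow_one,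
      Real.rpow_neg_one, mul_inv_cancel_left₀ hd.ne']
  rw [e, real_smul, real_smul]
  push_cast; ring

lemma pow_eq_or (hσ : σ = 1 ∨ σ = -1) {θ : ℝ} (hθ : θ = 1 ∨ θ = -1) :
    σ * θ ^ m = 1 ∨ σ * θ ^ m = -1 := by
  rcases hθ with rfl | rfl <;> rcases hσ with rfl | rfl <;>
    rcases neg_one_pow_eq_or ℝ m with h | h <;> simp [h]

lemma sum_branches (hσ : σ = 1 ∨ σ = -1) (F : ℝ → ℂ) :
    F 1 + F (-1) = ∑ θ ∈ branches σ m 1, F θ + ∑ θ ∈ branches σ m (-1), F θ := by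
  have h : branches σ m (-1) = ({1, -1} : Finset ℝ).filter fun θ => ¬ σ * θ ^ m = 1 := by
    refine Finset.filter_congr fun θ hθ => ?_
    simp only [Finset.mem_insert, Finset.mem_singleton] at hθ
    rcases pow_eq_or (m := m) hσ hθ with h | h <;> rw [h] <;> norm_num
  rw [h, branches, Finset.sum_filter_add_sum_filter_not, Finset.sum_pair (by norm_num)]

lemma finite_dispersion_eq (hm : 2 ≤ m) (hσ : σ = 1 ∨ σ = -1) (hd : 0 < d) (E : ℝ) :
    {k | dispersion σ d m k = E}.Finite := by
  refine (Multiset.finite_toSet (Polynomial.nthRoots m (E / (σ * d)))).subset fun k hk => ?_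
  have hσd : σ * d ≠ 0 := mul_ne_zero (by rcases hσ with rfl | rfl <;> norm_num) hd.ne'
  refine (Polynomial.mem_nthRoots (by omega)).mpr ?_
  rw [eq_div_iff hσd, ← (show dispersion σ d m k = E from hk), dispersion, mul_comm]

/-- The dispersion relation has finite fibres, so a finite image would make a neighbourhood of 0
finite. -/
lemma infinite_image_dispersion (hm : 2 ≤ m) (hσ : σ = 1 ∨ σ = -1) (hd : 0 < d) {U : Set ℝ}
    (hU : U ∈ 𝓝 (0 : ℝ)) : (dispersion σ d m '' U).Infinite := fun h => by
  have h1 : (dispersion σ d m ⁻¹' (dispersion σ d m '' U)).Finite :=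
    h.preimage' fun E _ => finite_dispersion_eq hm hσ hd E
  exact infinite_of_mem_nhds (0 : ℝ) hU (h1.subset (Set.subset_preimage_image _ _))

variable {w v : ℝ → ℂ} {Rc : Set ℝ}

lemma mem_insert_of_continuum (hσ : σ = 1 ∨ σ = -1) (hd : 0 < d)
    (hRe : Even m → Rc = continuumEven σ) (hRo : Odd m → Rc = {0}ᶜ) (k : ℝ) :
    dispersion σ d m k ∈ insert 0 Rc := by
  rcases Nat.even_or_odd m with h | h
  · rw [hRe h]
    rcases eq_or_ne (k ^ m) 0 with h0 | h0
    · left; simp [dispersion, h0]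
    · right
      have : 0 < k ^ m := lt_of_le_of_ne (h.pow_nonneg k) (Ne.symm h0)
      rw [continuumEven, Set.mem_ofPred_eq, dispersion]
      rcases hσ with rfl | rfl <;> simp <;> positivity
  · rw [hRo h, ← Set.union_singleton, Set.compl_union_self]; trivial

lemma isClosed_continuum (hσ : σ = 1 ∨ σ = -1)
    (hRe : Even m → Rc = continuumEven σ) (hRo : Odd m → Rc = {0}ᶜ) :
    IsClosed (insert 0 Rc) ∧ IsOpen Rc ∧ (0 : ℝ) ∉ Rc := by
  rcases Nat.even_or_odd m with h | h
  · rw [hRe h]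
    refine ⟨?_, isOpen_lt continuous_const (by fun_prop), by simp [continuumEven]⟩
    have : insert 0 (continuumEven σ) = {E | 0 ≤ σ * E} := by
      ext E
      simp only [continuumEven, Set.mem_insert_iff, Set.mem_ofPred_eq, le_iff_lt_or_eq]
      rcases hσ with rfl | rfl <;> simp [or_comm, eq_comm]
    rw [this]
    exact isClosed_le continuous_const (by fun_prop)
  · rw [hRo h, ← Set.union_singleton, Set.compl_union_self]
    exact ⟨isClosed_univ, isOpen_compl_singleton, by simp⟩

theorem separableModel_dispersion (hm : 2 ≤ m) (hσ : σ = 1 ∨ σ = -1) (hd : 0 < d)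
    (hw : Integrable w) (hw1 : (((Real.sqrt (2 * Real.pi))⁻¹ : ℝ) : ℂ) * ∫ z, w z = 1)
    (hRe : Even m → Rc = continuumEven σ) (hRo : Odd m → Rc = {0}ᶜ) :
    SeparableModel (dispersion σ d m) (unitaryFourier w) Rc where
  cont_ε := by unfold dispersion; fun_prop
  cont_v := continuous_unitaryFourier hw
  isClosed := (isClosed_continuum hσ hRe hRo).1
  mem := mem_insert_of_continuum hσ hd hRe hRo
  integrable := by
    obtain ⟨M, hM, hb⟩ := exists_bound_unitaryFourier w
    refine (integrable_inv_one_add_sq.const_mul (M ^ 2 * (2 + 1 / d))).mono'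
      (((continuous_unitaryFourier hw).norm.pow 2).div
        (continuous_const.add (show Continuous (dispersion σ d m) by
          unfold dispersion; fun_prop).abs) fun k => (add_pos_of_pos_of_nonneg one_pos
          (abs_nonneg _)).ne').aestronglyMeasurable (.of_forall fun k => ?_)
    have h1 : |dispersion σ d m k| = d * |k| ^ m := by
      rw [dispersion, abs_mul, abs_mul, abs_pow, abs_of_pos hd]
      rcases hσ with rfl | rfl <;> simp
    -- Since m ≥ 2, k² ≤ 1 + |k|^m; the summand 1/d in the constant compensates the coefficient d.
    -- The integrable majorant is thus 1/(1+k²).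
    have h2 : 1 + k ^ 2 ≤ (2 + 1 / d) * (1 + d * |k| ^ m) := by
      have h3 : k ^ 2 ≤ 1 + |k| ^ m := by
        rw [← sq_abs]
        rcases le_total |k| 1 with h | h
        · have : |k| ^ 2 ≤ 1 := pow_le_one₀ (abs_nonneg k) h
          have : 0 ≤ |k| ^ m := by positivity
          linarith
        · have := pow_le_pow_right₀ h hm
          linarith
      have h4 : (2 + 1 / d) * (1 + d * |k| ^ m) =
          2 + 1 / d + 2 * (d * |k| ^ m) + |k| ^ m := by
        field_simp; ring
      have : 0 ≤ 1 / d + 2 * (d * |k| ^ m) := by positivity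
      linarith
    rw [Real.norm_of_nonneg (by positivity), h1, mul_assoc, div_le_iff₀ (by positivity)]
    have h5 : 1 ≤ (2 + 1 / d) * ((1 + k ^ 2)⁻¹ * (1 + d * |k| ^ m)) := by
      rw [mul_left_comm, inv_mul_eq_div, one_le_div (by positivity)]; exact h2
    calc ‖unitaryFourier w k‖ ^ 2 ≤ M ^ 2 * 1 := by rw [mul_one]; gcongr; exact hb k
      _ ≤ M ^ 2 * ((2 + 1 / d) * ((1 + k ^ 2)⁻¹ * (1 + d * |k| ^ m))) := by gcongr
      _ = _ := by ring
  v_zero := by rw [unitaryFourier_zero, Module.finrank_self, pow_one, hw1]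
  infinite := fun _ hU => infinite_image_dispersion hm hσ hd hU

/-- `K` on the half-line of momenta in the direction `θ`. -/
lemma integral_branch (hm : 2 ≤ m) (hd : 0 < d) (v : ℝ → ℂ) {θ τ : ℝ} (h : σ * θ ^ m = τ) (ω : ℂ) :
    ∫ k in Set.Ioi (0 : ℝ), v (θ * k) ^ 2 / (ω - (dispersion σ d m (θ * k) : ℂ)) =
      ∫ t in Set.Ioi (0 : ℝ), halfDensity (1 / m) (1 / m) (branchDensity v d m {θ}) t /
        (ω - τ * t) := by
  have h1 := integral_comp_dispersion hm hd fun k t => v (θ * k) ^ 2 / (ω - τ * t)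
  simp only [dispersion_mul, h, ofReal_mul] at h1 ⊢
  rw [h1]
  refine setIntegral_congr_fun measurableSet_Ioi fun t ht => ?_
  simp only [halfDensity, branchDensity, Finset.sum_singleton]
  push_cast; ring

lemma cauchy_branchDensity (hm : 2 ≤ m) (hw : Integrable w) (d : ℝ) (A : Finset ℝ) {ω : ℂ}
    (hω : ω.im ≠ 0) : cauchy (1 / m) (1 / m) (branchDensity (unitaryFourier w) d m A) ω =
      ∑ θ ∈ A, cauchy (1 / m) (1 / m) (branchDensity (unitaryFourier w) d m {θ}) ω := by
  have hm1 : (1 : ℝ) < m := by exact_mod_cast hm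
  simp only [cauchy]
  rw [← integral_finsetSum]
  · congr 1; ext t
    simp only [halfDensity, branchDensity, Finset.sum_singleton, ← Finset.sum_div,
      ← Finset.mul_sum]
  · intro θ _
    have H := isHalfDensity_of_lt_one (p := 1 / (m : ℝ)) (q := 1 / (m : ℝ)) (by positivity)
      ((div_lt_one (by positivity)).mpr hm1) (by positivity) (isFourier_branchDensity hw d m {θ})
    simpa only [zero_add, pow_one, IntegrableOn] using H.integrableOn_div
      (mem_offContinuum_of_im_ne hω) 0

/-- K is split into the two half-lines of momenta. On each, t = d|k|^m is ± the energy, and the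
half-lines are sorted by this sign into the two densities. -/
theorem lineModel_dispersion (hm : 2 ≤ m) (hσ : σ = 1 ∨ σ = -1) (hd : 0 < d)
    (hw : Integrable w) (hw1 : (((Real.sqrt (2 * Real.pi))⁻¹ : ℝ) : ℂ) * ∫ z, w z = 1)
    (hRe : Even m → Rc = continuumEven σ) (hRo : Odd m → Rc = {0}ᶜ) :
    LineModel (dispersion σ d m) (unitaryFourier w) Rc (1 / m) (1 / m)
      (branchDensity (unitaryFourier w) d m (branches σ m 1))
      (branchDensity (unitaryFourier w) d m (branches σ m (-1))) where
  toSeparableModel := separableModel_dispersion hm hσ hd hw hw1 hRe hRo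
  isOpen := (isClosed_continuum hσ hRe hRo).2.1
  zero_notMem := (isClosed_continuum hσ hRe hRo).2.2
  null := fun E => by
    have := (finite_dispersion_eq hm hσ hd E).measure_zero volume
    exact measure_eq_zero_iff_ae_notMem.mp this
  density₁ := isHalfDensity_of_lt_one (by positivity)
    ((div_lt_one (by positivity)).mpr (by exact_mod_cast hm)) (by positivity)
    (isFourier_branchDensity hw d m _)
  density₂ := isHalfDensity_of_lt_one (by positivity)
    ((div_lt_one (by positivity)).mpr (by exact_mod_cast hm)) (by positivity)
    (isFourier_branchDensity hw d m _)
  Ksep_eq := fun ω hω => by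
    have M := separableModel_dispersion hm hσ hd hw hw1 hRe hRo
    set v := unitaryFourier w
    have hint : Integrable fun k => v k ^ 2 / (ω - (dispersion σ d m k : ℂ)) := by
      have := (M.integrable_sq_div (mem_offContinuum_of_im_ne hω) one_ne_zero).neg
      refine this.congr (.of_forall fun k => ?_)
      simp only [Pi.neg_apply, pow_one]
      rw [← div_neg, neg_sub]
    have e1 : Ksep (dispersion σ d m) v ω =
        (∫ k in Set.Ioi (0 : ℝ), v (1 * k) ^ 2 / (ω - (dispersion σ d m (1 * k) : ℂ))) +
        ∫ k in Set.Ioi (0 : ℝ), v (-1 * k) ^ 2 / (ω - (dispersion σ d m (-1 * k) : ℂ)) := by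
      have h1 := integral_comp_neg_Ioi (E := ℂ) 0
        fun k => v k ^ 2 / (ω - (dispersion σ d m k : ℂ))
      rw [neg_zero] at h1
      simp only [one_mul, neg_mul, h1]
      rw [Ksep, add_comm, intervalIntegral.integral_Iic_add_Ioi hint.integrableOn hint.integrableOn]
    have hω' : (-ω).im ≠ 0 := by simpa using hω
    rw [e1, sum_branches (m := m) hσ fun θ => ∫ k in Set.Ioi (0 : ℝ),
      v (θ * k) ^ 2 / (ω - (dispersion σ d m (θ * k) : ℂ)), twoSided,
      cauchy_branchDensity hm hw d _ hω, cauchy_branchDensity hm hw d _ hω', sub_eq_add_neg,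
      ← Finset.sum_neg_distrib]
    congr 1 <;> refine Finset.sum_congr rfl fun θ hθ => ?_
    · rw [integral_branch hm hd v (Finset.mem_filter.mp hθ).2, cauchy, ofReal_one]
      simp only [one_mul, v]
    · rw [integral_branch hm hd v (Finset.mem_filter.mp hθ).2, cauchy, ← integral_neg]
      congr 1; ext t
      rw [← div_neg]
      push_cast; congr 1; ring

end Line

end SepScattering

/-! ### The S-matrix in one dimension -/

namespace SepScattering

section LineScattering

variable {m : ℕ} {σ d : ℝ} {g : ℂ} {w : ℝ → ℂ} {Rc : Set ℝ}

lemma branches_of_odd (hm : Odd m) (hσ : σ = 1 ∨ σ = -1) {τ : ℝ} (hτ : τ = 1 ∨ τ = -1) :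
    branches σ m τ = {σ * τ} := by
  ext θ
  simp only [branches, Finset.mem_filter, Finset.mem_insert, Finset.mem_singleton]
  constructor
  · rintro ⟨rfl | rfl, h⟩ <;> rcases hσ with rfl | rfl <;> simp [hm.neg_one_pow] at h <;>
      simp [← h]
  · rintro rfl
    rcases hσ with rfl | rfl <;> rcases hτ with rfl | rfl <;> simp [hm.neg_one_pow]

lemma branches_of_even (hm : Even m) (σ : ℝ) : branches σ m σ = {1, -1} := by
  refine Finset.filter_true_of_mem fun θ hθ => ?_
  simp only [Finset.mem_insert, Finset.mem_singleton] at hθ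
  rcases hθ with rfl | rfl <;> simp [hm.neg_one_pow]

lemma card_branches (hσ : σ = 1 ∨ σ = -1) (m : ℕ) :
    (branches σ m 1).card + (branches σ m (-1)).card = 2 := by
  have h := sum_branches (m := m) hσ fun _ => (1 : ℂ)
  simp only [Finset.sum_const, nsmul_eq_mul, mul_one] at h
  norm_num at h
  exact_mod_cast h.symm

/-- The factor of `v(k_α) v(k_β)` in the S-matrix. -/
noncomputable def onShellFactor (σ d : ℝ) (m : ℕ) (g : ℂ) (v : ℝ → ℂ) (E : ℝ) : ℂ :=
  -(2 * Real.pi * I) * ((1 / (m : ℝ) * d ^ (-(1 / (m : ℝ))) : ℝ) : ℂ) *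
    (((|E| ^ (1 / (m : ℝ) - 1) : ℝ) : ℂ) / (g⁻¹ - fromAbove (Ksep (dispersion σ d m) v) E))

lemma momentum_eq (hd : 0 < d) (m : ℕ) (E : ℝ) :
    (|E| / d) ^ (1 / (m : ℝ)) = d ^ (-(1 / (m : ℝ))) * |E| ^ (1 / (m : ℝ)) := by
  rw [Real.div_rpow (abs_nonneg _) hd.le, Real.rpow_neg hd.le, div_eq_inv_mul]

/-- The inverse velocity at energy E is the Jacobian dk/dt, with the constant that occurs in
`branchDensity`. The normalisation of S therefore matches the jump of K. -/
lemma sqrt_deriv_dispersion (hm : 2 ≤ m) (hσ : σ = 1 ∨ σ = -1) (hd : 0 < d) {E : ℝ} (hE : E ≠ 0)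
    {k k' : ℝ} (hk : |k| = (|E| / d) ^ (1 / (m : ℝ))) (hk' : |k'| = (|E| / d) ^ (1 / (m : ℝ))) :
    (Real.sqrt |deriv (dispersion σ d m) k * deriv (dispersion σ d m) k'|)⁻¹ =
      1 / (m : ℝ) * d ^ (-(1 / (m : ℝ))) * |E| ^ (1 / (m : ℝ) - 1) := by
  have hm0 : (0 : ℝ) < m := by positivity
  have hE0 : 0 < |E| := abs_pos.mpr hE
  have h1 : ∀ k : ℝ, |k| = (|E| / d) ^ (1 / (m : ℝ)) →
      |deriv (dispersion σ d m) k| = d * m * (|E| / d) ^ (1 - 1 / (m : ℝ)) := fun k hk => by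
    have e : deriv (dispersion σ d m) k = σ * d * (m * k ^ (m - 1)) := by
      unfold dispersion
      rw [deriv_const_mul _ (by fun_prop), deriv_pow_field]
    have hσ1 : |σ| = 1 := by rcases hσ with rfl | rfl <;> simp
    rw [e, abs_mul, abs_mul, hσ1, one_mul, abs_mul, abs_pow, hk, abs_of_pos hd, abs_of_pos hm0,
      ← Real.rpow_natCast, ← Real.rpow_mul (by positivity), Nat.cast_sub (by omega), ← mul_assoc]
    congr 2
    field_simp; push_cast; ring
  rw [abs_mul, h1 k hk, h1 k' hk', Real.sqrt_mul_self (by positivity),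
    Real.div_rpow hE0.le hd.le, Real.rpow_sub hd, Real.rpow_one, Real.rpow_neg hd.le,
    show 1 - 1 / (m : ℝ) = -(1 / (m : ℝ) - 1) by ring, Real.rpow_neg hE0.le]
  have := (Real.rpow_pos_of_pos hd (1 / (m : ℝ))).ne'
  have := (Real.rpow_pos_of_pos hE0 (1 / (m : ℝ) - 1)).ne'
  field_simp

variable {s₁ s₂ : ℝ → ℂ} {v : ℝ → ℂ}

lemma onShellS_apply (hm : 2 ≤ m) (hσ : σ = 1 ∨ σ = -1) (hd : 0 < d)
    (M : LineModel (dispersion σ d m) v Rc (1 / m) (1 / m) s₁ s₂) {E : ℝ} (hE : E ≠ 0)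
    (hb : ¬ IsBoundStateInContinuum (dispersion σ d m) g v E) {n : ℕ} {k : Fin n → ℝ}
    (hk : ∀ α, |k α| = (|E| / d) ^ (1 / (m : ℝ))) (α β : Fin n) :
    onShellS (dispersion σ d m) g v E k α β =
      (if α = β then 1 else 0) + onShellFactor σ d m g v E * (v (k α) * v (k β)) := by
  rw [onShellS, M.fromAbove_Tsep hE hb, div_eq_mul_inv _ (((Real.sqrt _ : ℝ) : ℂ)), ← ofReal_inv,
    sqrt_deriv_dispersion hm hσ hd hE (hk α) (hk β), onShellFactor]
  push_cast; ring

lemma abs_momentum_even (hd : 0 < d) (E : ℝ) (α : Fin 2) :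
    |(![(|E| / d) ^ (1 / (m : ℝ)), -(|E| / d) ^ (1 / (m : ℝ))] : Fin 2 → ℝ) α| =
      (|E| / d) ^ (1 / (m : ℝ)) := by
  fin_cases α
  · simpa using abs_of_nonneg (show 0 ≤ (|E| / d) ^ (m : ℝ)⁻¹ by positivity)
  · simpa using abs_of_nonneg (show 0 ≤ (|E| / d) ^ (m : ℝ)⁻¹ by positivity)

lemma abs_momentum_odd (hσ : σ = 1 ∨ σ = -1) (hd : 0 < d) {E : ℝ} (hE : E ≠ 0) (α : Fin 1) :
    |(![σ * Real.sign E * (|E| / d) ^ (1 / (m : ℝ))] : Fin 1 → ℝ) α| =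
      (|E| / d) ^ (1 / (m : ℝ)) := by
  have h1 : |σ * Real.sign E| = 1 := by
    rcases hσ with rfl | rfl <;> rcases hE.lt_or_gt with h | h <;>
      simp [Real.sign_of_neg, Real.sign_of_pos, h]
  have h2 : 0 ≤ (|E| / d) ^ (1 / (m : ℝ)) := by positivity
  simp only [Matrix.cons_val_fin_one]
  rw [abs_mul, h1, one_mul, abs_of_nonneg h2]

lemma lineDensity_branches (hd : 0 < d) {E : ℝ} (hE : E ≠ 0) :
    lineDensity (1 / m) (1 / m) (branchDensity v d m (branches σ m 1))
      (branchDensity v d m (branches σ m (-1))) E =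
    ((1 / (m : ℝ) * d ^ (-(1 / (m : ℝ))) : ℝ) : ℂ) * ((|E| ^ (1 / (m : ℝ) - 1) : ℝ) : ℂ) *
      ∑ θ ∈ branches σ m (Real.sign E), v (θ * (|E| / d) ^ (1 / (m : ℝ))) ^ 2 := by
  rw [momentum_eq hd]
  rcases hE.lt_or_gt with h | h
  · rw [lineDensity, if_neg (not_lt.mpr h.le), Real.sign_of_neg h, abs_of_neg h, halfDensity,
      branchDensity]
    ring
  · rw [lineDensity, if_pos h, Real.sign_of_pos h, abs_of_pos h, halfDensity, branchDensity]
    ring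

lemma ratio_eq_onShell (hd : 0 < d)
    (M : LineModel (dispersion σ d m) v Rc (1 / m) (1 / m) (branchDensity v d m (branches σ m 1))
      (branchDensity v d m (branches σ m (-1)))) {E : ℝ} (hE : E ≠ 0)
    (hb : ¬ IsBoundStateInContinuum (dispersion σ d m) g v E) :
    (g⁻¹ - fromBelow (Ksep (dispersion σ d m) v) E) /
        (g⁻¹ - fromAbove (Ksep (dispersion σ d m) v) E) =
      1 + onShellFactor σ d m g v E *
        ∑ θ ∈ branches σ m (Real.sign E), v (θ * (|E| / d) ^ (1 / (m : ℝ))) ^ 2 := by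
  rw [M.ratio_eq hE hb, lineDensity_branches hd hE, onShellFactor]
  ring

lemma det_SOdd (hm : 2 ≤ m) (ho : Odd m) (hσ : σ = 1 ∨ σ = -1) (hd : 0 < d)
    (M : LineModel (dispersion σ d m) v Rc (1 / m) (1 / m) (branchDensity v d m (branches σ m 1))
      (branchDensity v d m (branches σ m (-1)))) {E : ℝ} (hE : E ≠ 0)
    (hb : ¬ IsBoundStateInContinuum (dispersion σ d m) g v E) :
    (SOdd σ d m g v E).det = (g⁻¹ - fromBelow (Ksep (dispersion σ d m) v) E) /
        (g⁻¹ - fromAbove (Ksep (dispersion σ d m) v) E) := by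
  have hs : Real.sign E = 1 ∨ Real.sign E = -1 := by
    rcases hE.lt_or_gt with h | h
    · exact Or.inr (Real.sign_of_neg h)
    · exact Or.inl (Real.sign_of_pos h)
  rw [Matrix.det_fin_one, SOdd, onShellS_apply hm hσ hd M hE hb (abs_momentum_odd hσ hd hE),
    ratio_eq_onShell hd M hE hb, branches_of_odd ho hσ hs, Finset.sum_singleton, sq]
  simp

/-- The matrix is 1 + x u uᵀ with u = (v(k₁), v(k₂)), so its determinant is 1 + x(u₁² + u₂²), and
the sum is the line density on the two branches. -/
lemma det_SEven (hm : 2 ≤ m) (he : Even m) (hσ : σ = 1 ∨ σ = -1) (hd : 0 < d)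
    (M : LineModel (dispersion σ d m) v Rc (1 / m) (1 / m) (branchDensity v d m (branches σ m 1))
      (branchDensity v d m (branches σ m (-1)))) {E : ℝ} (hE : E ∈ continuumEven σ)
    (hb : ¬ IsBoundStateInContinuum (dispersion σ d m) g v E) :
    (SEven σ d m g v E).det = (g⁻¹ - fromBelow (Ksep (dispersion σ d m) v) E) /
        (g⁻¹ - fromAbove (Ksep (dispersion σ d m) v) E) := by
  have hE' : 0 < σ * E := hE
  have hE0 : E ≠ 0 := fun h => by simp [h] at hE'
  have hs : Real.sign E = σ := by
    rcases hσ with rfl | rfl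
    · exact Real.sign_of_pos (by linarith)
    · exact Real.sign_of_neg (by linarith)
  have hap := onShellS_apply hm hσ hd M hE0 hb (abs_momentum_even hd E)
  rw [Matrix.det_fin_two, SEven, hap, hap, hap, hap, ratio_eq_onShell hd M hE0 hb, hs,
    branches_of_even he, Finset.sum_pair (by norm_num)]
  simp
  ring

/-! ### Low energies -/

lemma sin_pi_div_pos (hm : 2 ≤ m) : 0 < Real.sin (Real.pi * (1 / (m : ℝ))) := by
  have hm1 : (1 : ℝ) < m := by exact_mod_cast hm
  have : 1 / (m : ℝ) < 1 := (div_lt_one (by positivity)).mpr hm1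
  refine Real.sin_pos_of_pos_of_lt_pi (by positivity) ?_
  nlinarith [Real.pi_pos]

/-- The imaginary part forces a = 0 and the real part then forces b = 0, against a + b = 2. -/
lemma lowDenominator_ne_zero {x : ℝ} (hx : Real.sin x ≠ 0) {a b : ℕ} (hab : a + b = 2) :
    (a : ℂ) * Complex.exp (I * x) + b ≠ 0 := fun h => by
  have h1 := congrArg Complex.im h
  have h2 := congrArg Complex.re h
  rw [mul_comm I] at h1 h2
  simp [Complex.exp_ofReal_mul_I_re, Complex.exp_ofReal_mul_I_im, hx] at h1 h2
  rw [h1] at h2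
  simp at h2
  omega

lemma branch_zero_ne_zero (hd : 0 < d) (hm : 2 ≤ m) (hσ : σ = 1 ∨ σ = -1) (hv : v 0 = 1) {x : ℝ}
    (hx : Real.sin x ≠ 0) :
    branchDensity v d m (branches σ m 1) 0 * Complex.exp (I * x) +
      branchDensity v d m (branches σ m (-1)) 0 ≠ 0 := by
  have hC : ((1 / (m : ℝ) * d ^ (-(1 / (m : ℝ))) : ℝ) : ℂ) ≠ 0 := by
    have := Real.rpow_pos_of_pos hd (-(1 / (m : ℝ)))
    exact_mod_cast (show 0 < 1 / (m : ℝ) * d ^ (-(1 / (m : ℝ))) by positivity).ne'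
  rw [branchDensity_zero hv, branchDensity_zero hv, mul_assoc, ← mul_add]
  exact mul_ne_zero hC (lowDenominator_ne_zero hx (card_branches hσ m))

lemma branch_zero_ne_zero_neg (hd : 0 < d) (hm : 2 ≤ m) (hσ : σ = 1 ∨ σ = -1) (hv : v 0 = 1) :
    branchDensity v d m (branches σ m 1) 0 *
      Complex.exp (-(I * ((1 / (m : ℝ) : ℝ) : ℂ) * Real.pi)) +
      branchDensity v d m (branches σ m (-1)) 0 ≠ 0 := by
  have := branch_zero_ne_zero hd hm hσ hv (x := -(Real.pi * (1 / (m : ℝ))))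
    (by rw [Real.sin_neg]; exact neg_ne_zero.mpr (sin_pi_div_pos hm).ne')
  convert this using 4
  push_cast; ring

lemma branch_zero_ne_zero_pos (hd : 0 < d) (hm : 2 ≤ m) (hσ : σ = 1 ∨ σ = -1) (hv : v 0 = 1) :
    branchDensity v d m (branches σ m 1) 0 *
      Complex.exp (I * ((1 / (m : ℝ) : ℝ) : ℂ) * Real.pi) +
      branchDensity v d m (branches σ m (-1)) 0 ≠ 0 := by
  have := branch_zero_ne_zero hd hm hσ hv (x := Real.pi * (1 / (m : ℝ))) (sin_pi_div_pos hm).ne'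
  convert this using 4
  push_cast; ring

/-- The reflection formula turns 2πi divided by `powerConst` into a difference of exponentials, and
the Jacobian constants cancel. Only exp(iπ/m) and the numbers of branches on the two sides remain,
which is the universality of the limit. -/
lemma onShellFactor_limit (hd : 0 < d) (hm : 2 ≤ m) (hv : v 0 = 1) (A B : Finset ℝ) :
    -(2 * Real.pi * I) * ((1 / (m : ℝ) * d ^ (-(1 / (m : ℝ))) : ℝ) : ℂ) *
      (LineModel.lowConst (1 / m) (branchDensity v d m A 0) (branchDensity v d m B 0))⁻¹ =
    (Complex.exp (Real.pi * I / m) - (Complex.exp (Real.pi * I / m))⁻¹) /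
      (A.card * (Complex.exp (Real.pi * I / m))⁻¹ + B.card) := by
  have hm1 : (1 : ℝ) < m := by exact_mod_cast hm
  have hC : ((1 / (m : ℝ) * d ^ (-(1 / (m : ℝ))) : ℝ) : ℂ) ≠ 0 := by
    have := Real.rpow_pos_of_pos hd (-(1 / (m : ℝ)))
    exact_mod_cast (show 0 < 1 / (m : ℝ) * d ^ (-(1 / (m : ℝ))) by positivity).ne'
  have hp1 : 1 / (m : ℝ) < 1 := (div_lt_one (by positivity)).mpr hm1
  have hκ : powerConst (1 / m) * Complex.sin (Real.pi * (1 / (m : ℝ) : ℝ)) = -Real.pi := by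
    exact_mod_cast powerConst_mul_sin (p := 1 / (m : ℝ)) (by positivity) hp1
  have hκ0 : powerConst (1 / m) ≠ 0 := LineModel.powerConst_ne_zero (by positivity) hp1
  rw [LineModel.lowConst, branchDensity_zero hv, branchDensity_zero hv]
  set C := ((1 / (m : ℝ) * d ^ (-(1 / (m : ℝ))) : ℝ) : ℂ)
  have e1 : Complex.exp (-(I * ((1 / (m : ℝ) : ℝ) : ℂ) * Real.pi)) =
      (Complex.exp (Real.pi * I / m))⁻¹ := by
    rw [← Complex.exp_neg]; push_cast; congr 1; ring
  have e2 : Complex.exp (Real.pi * I / m) - (Complex.exp (Real.pi * I / m))⁻¹ =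
      2 * I * Complex.sin (Real.pi * (1 / (m : ℝ) : ℝ)) := by
    rw [Complex.sin, ← Complex.exp_neg]
    push_cast
    rw [show (-(Real.pi * (1 / (m : ℂ))) * I : ℂ) = -(Real.pi * I / m) by ring,
      show (Real.pi * (1 / (m : ℂ)) * I : ℂ) = Real.pi * I / m by ring]
    linear_combination (Complex.exp (Real.pi * I / m) - Complex.exp (-(Real.pi * I / m))) * I_sq
  rw [e1, e2, show C * (A.card : ℂ) * (Complex.exp (Real.pi * I / m))⁻¹ + C * (B.card : ℂ) =
    C * (A.card * (Complex.exp (Real.pi * I / m))⁻¹ + B.card) by ring, mul_inv, mul_inv]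
  have e3 : -(2 * Real.pi * I) * (powerConst (1 / m))⁻¹ =
      2 * I * Complex.sin (Real.pi * (1 / (m : ℝ) : ℝ)) := by
    rw [mul_inv_eq_iff_eq_mul₀ hκ0]
    linear_combination (-2 * I) * hκ
  rw [← e3, div_eq_mul_inv]
  field_simp

lemma tendsto_onShellFactor_pos (hm : 2 ≤ m) (hσ : σ = 1 ∨ σ = -1) (hd : 0 < d)
    (M : LineModel (dispersion σ d m) v Rc (1 / m) (1 / m) (branchDensity v d m (branches σ m 1))
      (branchDensity v d m (branches σ m (-1)))) (g : ℂ) :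
    Tendsto (onShellFactor σ d m g v) (𝓝[>] 0)
      (𝓝 ((Complex.exp (Real.pi * I / m) - (Complex.exp (Real.pi * I / m))⁻¹) /
        ((branches σ m 1).card * (Complex.exp (Real.pi * I / m))⁻¹ +
          (branches σ m (-1)).card))) := by
  have hm1 : (1 : ℝ) < m := by exact_mod_cast hm
  have h := (M.tendsto_rpow_div_pos ((div_lt_one (by positivity)).mpr hm1) g
    (branch_zero_ne_zero_neg hd hm hσ M.v_zero)).const_mul
    (-(2 * Real.pi * I) * ((1 / (m : ℝ) * d ^ (-(1 / (m : ℝ))) : ℝ) : ℂ))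
  rw [onShellFactor_limit hd hm M.v_zero] at h
  refine h.congr' (eventually_nhdsWithin_of_forall fun E hE => ?_)
  rw [onShellFactor, abs_of_pos hE]

lemma tendsto_onShellFactor_neg (hm : 2 ≤ m) (hσ : σ = 1 ∨ σ = -1) (hd : 0 < d)
    (M : LineModel (dispersion σ d m) v Rc (1 / m) (1 / m) (branchDensity v d m (branches σ m 1))
      (branchDensity v d m (branches σ m (-1)))) (g : ℂ) :
    Tendsto (onShellFactor σ d m g v) (𝓝[<] 0)
      (𝓝 ((Complex.exp (Real.pi * I / m) - (Complex.exp (Real.pi * I / m))⁻¹) /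
        ((branches σ m 1).card * (Complex.exp (Real.pi * I / m))⁻¹ +
          (branches σ m (-1)).card) * -(Complex.exp (Real.pi * I / m))⁻¹)) := by
  have hm1 : (1 : ℝ) < m := by exact_mod_cast hm
  have h := (M.tendsto_rpow_div_neg ((div_lt_one (by positivity)).mpr hm1) g
    (branch_zero_ne_zero_neg hd hm hσ M.v_zero)).const_mul
    (-(2 * Real.pi * I) * ((1 / (m : ℝ) * d ^ (-(1 / (m : ℝ))) : ℝ) : ℂ))
  rw [← mul_assoc, onShellFactor_limit hd hm M.v_zero, show
    Complex.exp (-(I * ((1 / (m : ℝ) : ℝ) : ℂ) * Real.pi)) = (Complex.exp (Real.pi * I / m))⁻¹ by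
      rw [← Complex.exp_neg]; push_cast; congr 1; ring] at h
  refine h.congr' (eventually_nhdsWithin_of_forall fun E hE => ?_)
  rw [onShellFactor, abs_of_neg hE]

/-- The factor is 0 at a bound state in the continuum, by division by zero. A nonzero limit at zero
energy therefore excludes such states at low energies, without any hypothesis. -/
lemma not_boundState_of_onShellFactor {E : ℝ} (h : onShellFactor σ d m g v E ≠ 0) :
    ¬ IsBoundStateInContinuum (dispersion σ d m) g v E := fun hb =>
  h (by rw [onShellFactor, show g⁻¹ - fromAbove (Ksep (dispersion σ d m) v) E = 0 from hb, div_zero,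
    mul_zero])

/-- The low-energy limit of the S-matrix, entry by entry. -/
lemma tendsto_onShellS (hm : 2 ≤ m) (hσ : σ = 1 ∨ σ = -1) (hd : 0 < d)
    (M : LineModel (dispersion σ d m) v Rc (1 / m) (1 / m) s₁ s₂) {J : Set ℝ} (hJ : (0 : ℝ) ∉ J)
    {c : ℂ} (hc : c ≠ 0) (h : Tendsto (onShellFactor σ d m g v) (𝓝[J] 0) (𝓝 c)) {n : ℕ}
    {k : ℝ → Fin n → ℝ} (hk : ∀ E, E ≠ 0 → ∀ α, |k E α| = (|E| / d) ^ (1 / (m : ℝ)))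
    (α β : Fin n) :
    Tendsto (fun E => onShellS (dispersion σ d m) g v E (k E) α β) (𝓝[J] 0)
      (𝓝 ((if α = β then 1 else 0) + c)) := by
  have hne : ∀ᶠ E in 𝓝[J] (0 : ℝ), E ≠ 0 :=
    eventually_nhdsWithin_of_forall fun E hE h0 => hJ (h0 ▸ hE)
  have h1 : ∀ α, Tendsto (fun E => v (k E α)) (𝓝[J] 0) (𝓝 1) := fun α => by
    rw [← M.v_zero]
    refine (M.cont_v.tendsto 0).comp (tendsto_zero_iff_abs_tendsto_zero _ |>.mpr ?_)
    have hcont : Continuous fun E : ℝ => (|E| / d) ^ (1 / (m : ℝ)) :=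
      (by fun_prop : Continuous fun E : ℝ => |E| / d).rpow_const fun _ => Or.inr (by positivity)
    have h2 := (hcont.tendsto 0).mono_left (nhdsWithin_le_nhds (s := J))
    rw [abs_zero, zero_div, Real.zero_rpow (by positivity)] at h2
    refine h2.congr' ?_
    filter_upwards [hne] with E hE using (hk E hE α).symm
  have h2 := (h.mul ((h1 α).mul (h1 β))).const_add (if α = β then (1 : ℂ) else 0)
  rw [mul_one, mul_one] at h2
  refine h2.congr' ?_
  filter_upwards [hne, h.eventually_ne hc] with E hE hb
  rw [onShellS_apply hm hσ hd M hE (not_boundState_of_onShellFactor hb) (hk E hE)]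

lemma exp_sub_inv_ne_zero (hm : 2 ≤ m) :
    Complex.exp (Real.pi * I / m) - (Complex.exp (Real.pi * I / m))⁻¹ ≠ 0 := fun h => by
  rw [← Complex.exp_neg] at h
  have h1 := congrArg Complex.im h
  have e : (Real.pi * I / m : ℂ) = ((Real.pi * (1 / (m : ℝ)) : ℝ) : ℂ) * I := by push_cast; ring
  rw [e, ← neg_mul, ← ofReal_neg, sub_im, Complex.exp_ofReal_mul_I_im, Complex.exp_ofReal_mul_I_im,
    Real.sin_neg, zero_im] at h1
  linarith [sin_pi_div_pos hm]

lemma exp_inv_add_one_ne_zero (hm : 2 ≤ m) : (Complex.exp (Real.pi * I / m))⁻¹ + 1 ≠ 0 := by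
  have := lowDenominator_ne_zero (x := -(Real.pi * (1 / (m : ℝ))))
    (by rw [Real.sin_neg]; exact neg_ne_zero.mpr (sin_pi_div_pos hm).ne') (a := 1) (b := 1) rfl
  rw [Nat.cast_one, one_mul] at this
  rw [← Complex.exp_neg]
  convert this using 3
  push_cast; ring

/-- There is one branch on each side. With z = exp(iπ/m) the factor tends to (z - z⁻¹)/(z⁻¹ + 1) = z
- 1 from above and to z⁻¹ - 1 from below. -/
theorem tendsto_SOdd (hm : 2 ≤ m) (ho : Odd m) (hσ : σ = 1 ∨ σ = -1) (hd : 0 < d)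
    (M : LineModel (dispersion σ d m) v Rc (1 / m) (1 / m) (branchDensity v d m (branches σ m 1))
      (branchDensity v d m (branches σ m (-1)))) (g : ℂ) :
    Tendsto (fun E => SOdd σ d m g v E 0 0) (𝓝[>] 0) (𝓝 (Complex.exp (Real.pi * I / m))) ∧
    Tendsto (fun E => SOdd σ d m g v E 0 0) (𝓝[<] 0) (𝓝 (Complex.exp (-(Real.pi * I / m)))) := by
  have h1 := tendsto_onShellFactor_pos hm hσ hd M g
  have h2 := tendsto_onShellFactor_neg hm hσ hd M g
  rw [branches_of_odd ho hσ (Or.inl rfl), branches_of_odd ho hσ (Or.inr rfl),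
    Finset.card_singleton, Finset.card_singleton, Nat.cast_one, one_mul] at h1 h2
  have hz := Complex.exp_ne_zero (Real.pi * I / m)
  have hz1 := exp_inv_add_one_ne_zero hm
  have hz2 := exp_sub_inv_ne_zero hm
  rw [Complex.exp_neg]
  set z := Complex.exp (Real.pi * I / m)
  have hz3 : 1 + z ≠ 0 := fun h => hz1 (by field_simp; rw [h, mul_zero])
  have hk : ∀ E : ℝ, E ≠ 0 → ∀ α : Fin 1, |(![σ * Real.sign E * (|E| / d) ^ (1 / (m : ℝ))] :
      Fin 1 → ℝ) α| = (|E| / d) ^ (1 / (m : ℝ)) := fun E hE => abs_momentum_odd hσ hd hE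
  constructor
  · refine (tendsto_onShellS hm hσ hd M (by simp) (div_ne_zero hz2 hz1) h1 hk 0 0).trans_eq ?_
    rw [if_pos rfl]
    congr 1
    field_simp; ring
  · refine (tendsto_onShellS hm hσ hd M (by simp) (mul_ne_zero (div_ne_zero hz2 hz1)
      (neg_ne_zero.mpr (inv_ne_zero hz))) h2 hk 0 0).trans_eq ?_
    rw [if_pos rfl]
    congr 1
    field_simp; ring

/-- Both branches lie on the side σ and none on the other, so only one of the two terms in the
denominator survives. -/
lemma tendsto_onShellFactor_even (hm : 2 ≤ m) (he : Even m) (hσ : σ = 1 ∨ σ = -1) (hd : 0 < d)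
    (M : LineModel (dispersion σ d m) v Rc (1 / m) (1 / m) (branchDensity v d m (branches σ m 1))
      (branchDensity v d m (branches σ m (-1)))) (g : ℂ) :
    Tendsto (onShellFactor σ d m g v) (𝓝[continuumEven σ] 0)
      (𝓝 (Complex.exp (σ * I * Real.pi / m) * (σ * I * Real.sin (Real.pi / m)))) := by
  have h1 := tendsto_onShellFactor_pos hm hσ hd M g
  have h2 := tendsto_onShellFactor_neg hm hσ hd M g
  have hcard := card_branches hσ m
  have hz := Complex.exp_ne_zero (Real.pi * I / m)
  have e : I * Real.sin (Real.pi / m) =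
      (Complex.exp (Real.pi * I / m) - (Complex.exp (Real.pi * I / m))⁻¹) / 2 := by
    rw [ofReal_sin, Complex.sin, ← Complex.exp_neg]
    push_cast
    rw [show (-(Real.pi / (m : ℂ)) * I : ℂ) = -(Real.pi * I / m) by ring,
      show (Real.pi / (m : ℂ) * I : ℂ) = Real.pi * I / m by ring]
    linear_combination (Complex.exp (-(Real.pi * I / m)) - Complex.exp (Real.pi * I / m)) / 2 * I_sq
  rcases hσ with rfl | rfl
  · have hc : continuumEven 1 = Set.Ioi 0 := by ext; simp [continuumEven]
    have h3 : (branches 1 m 1).card = 2 := by rw [branches_of_even he, Finset.card_pair (by norm_num)]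
    have h4 : (branches 1 m (-1)).card = 0 := by omega
    rw [h3, h4] at h1
    rw [hc]
    convert h1 using 2
    rw [ofReal_one, one_mul, e, mul_comm I]
    field_simp; simp
  · have hc : continuumEven (-1) = Set.Iio 0 := by ext; simp [continuumEven]
    have h3 : (branches (-1) m (-1)).card = 2 := by
      rw [branches_of_even he, Finset.card_pair (by norm_num)]
    have h4 : (branches (-1) m 1).card = 0 := by omega
    rw [h3, h4] at h2
    rw [hc]
    convert h2 using 2
    rw [ofReal_neg, ofReal_one, neg_one_mul, neg_mul I (Real.sin _ : ℂ), e,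
      show (-I * Real.pi / m : ℂ) = -(Real.pi * I / m) by ring, Complex.exp_neg]
    field_simp; simp; ring

theorem tendsto_SEven (hm : 2 ≤ m) (he : Even m) (hσ : σ = 1 ∨ σ = -1) (hd : 0 < d)
    (M : LineModel (dispersion σ d m) v Rc (1 / m) (1 / m) (branchDensity v d m (branches σ m 1))
      (branchDensity v d m (branches σ m (-1)))) (g : ℂ) :
    Tendsto (SEven σ d m g v) (𝓝[continuumEven σ] 0) (𝓝 (Complex.exp (σ * I * Real.pi / m) •
      !![(Real.cos (Real.pi / m) : ℂ), σ * I * Real.sin (Real.pi / m);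
         σ * I * Real.sin (Real.pi / m), (Real.cos (Real.pi / m) : ℂ)])) := by
  have hσ0 : (σ : ℂ) ≠ 0 := by rcases hσ with rfl | rfl <;> simp
  have hs : (Real.sin (Real.pi / m) : ℂ) ≠ 0 := by
    rw [div_eq_mul_one_div]; exact_mod_cast (sin_pi_div_pos hm).ne'
  have h := tendsto_onShellS hm hσ hd M (J := continuumEven σ) (by simp [continuumEven])
    (mul_ne_zero (Complex.exp_ne_zero _) (mul_ne_zero (mul_ne_zero hσ0 I_ne_zero) hs))
    (tendsto_onShellFactor_even hm he hσ hd M g) fun E _ => abs_momentum_even (m := m) hd E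
  -- With x = π/m this is exp(-iσx) = cos x - iσ sin x, multiplied by exp(iσx).
  have hdiag : 1 + Complex.exp (σ * I * Real.pi / m) * (σ * I * Real.sin (Real.pi / m)) =
      Complex.exp (σ * I * Real.pi / m) * Real.cos (Real.pi / m) := by
    have e1 : Complex.exp (-(σ * I * Real.pi / m)) =
        Real.cos (Real.pi / m) - σ * I * Real.sin (Real.pi / m) := by
      rw [show (-(σ * I * Real.pi / m) : ℂ) = ((-(σ * (Real.pi / m)) : ℝ) : ℂ) * I by
        push_cast; ring, Complex.exp_mul_I, ← ofReal_cos, ← ofReal_sin, Real.cos_neg, Real.sin_neg]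
      rcases hσ with rfl | rfl <;> simp <;> ring
    have e2 : Complex.exp (σ * I * Real.pi / m) * Complex.exp (-(σ * I * Real.pi / m)) = 1 := by
      rw [← Complex.exp_add, add_neg_cancel, Complex.exp_zero]
    rw [e1] at e2
    linear_combination -e2
  refine tendsto_pi_nhds.mpr fun α => tendsto_pi_nhds.mpr fun β => (h α β).trans_eq ?_
  fin_cases α <;> fin_cases β <;> simp [-ofReal_cos, -ofReal_sin, hdiag]

/-! ### Levinson's theorem -/

section Levinson

variable (hm : 2 ≤ m) (hσ : σ = 1 ∨ σ = -1) (hd : 0 < d) (hg : g ≠ 0)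
  (M : LineModel (dispersion σ d m) v Rc (1 / m) (1 / m) (branchDensity v d m (branches σ m 1))
    (branchDensity v d m (branches σ m (-1))))
  (hb : ∀ E ∈ Rc, ¬ IsBoundStateInContinuum (dispersion σ d m) g v E) {f : ℝ → ℂ}
  (hf : ∀ E ∈ Rc, f E = (g⁻¹ - fromBelow (Ksep (dispersion σ d m) v) E) /
    (g⁻¹ - fromAbove (Ksep (dispersion σ d m) v) E)) (hf0 : ∀ E ∈ Rc, f E ≠ 0)

include hm hσ hd hg M hb hf hf0

/-- The fractional term comes from the exponent e = 1/m - 1 of g⁻¹ - K at zero energy. -/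
theorem levinson_dispersion :
    FiniteDimensional ℂ (boundStateSpace (dispersion σ d m) g v) ∧ ∃ Δneg Δpos : ℝ,
      (Set.Iio 0 ⊆ Rc → HasPhaseChange f (Set.Iio 0) atBot (𝓝[<] 0) Δneg) ∧
      (Set.Ioi 0 ⊆ Rc → HasPhaseChange f (Set.Ioi 0) (𝓝[>] 0) atTop Δpos) ∧
      (Disjoint (Set.Iio 0) Rc → Δneg = 0) ∧ (Disjoint (Set.Ioi 0) Rc → Δpos = 0) ∧
      Δneg + Δpos = -Real.pi * boundStateNumber (dispersion σ d m) g v +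
        Real.pi * ((m - 1) / m) := by
  have hm1 : (1 : ℝ) < m := by exact_mod_cast hm
  have hp1 : 1 / (m : ℝ) < 1 := (div_lt_one (by positivity)).mpr hm1
  have H := M.halfPlaneData_of_lt_one hg hp1 hb
    (fun E hE h0 => hf0 E hE (by rw [hf E hE, h0, zero_div]))
    (branch_zero_ne_zero_neg hd hm hσ M.v_zero) (branch_zero_ne_zero_pos hd hm hσ M.v_zero)
  obtain ⟨h1, Δn, Δp, h2, h3, h4, h5, h6⟩ := M.levinson hg H (LineModel.eventually_rpow_le hp1) hf
  refine ⟨h1, Δn, Δp, h2, h3, h4, h5, h6.trans ?_⟩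
  field_simp; ring

end Levinson

end LineScattering

end SepScattering

/-! ### The radial dispersion relation -/

namespace SepScattering

section Radial

variable {D : ℕ} {a : ℝ} {w v : EuclideanSpace ℝ (Fin D) → ℂ}

/-- Integration in polar coordinates. -/
theorem integral_polar (hD : 1 ≤ D) {f : EuclideanSpace ℝ (Fin D) → ℂ} (hf : Integrable f) :
    ∫ x, f x = ∫ r in Set.Ioi (0 : ℝ), ((r ^ (D - 1) : ℝ) : ℂ) *
      ∫ Ω : UnitSphere D, f (r • (Ω : EuclideanSpace ℝ (Fin D))) ∂(surfaceMeasure D) := by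
  have : Nonempty (Fin D) := ⟨⟨0, hD⟩⟩
  have hP := (volume : Measure (EuclideanSpace ℝ (Fin D))).measurePreserving_homeomorphUnitSphereProd
  have hE := (homeomorphUnitSphereProd (EuclideanSpace ℝ (Fin D))).measurableEmbedding
  set F : UnitSphere D × Set.Ioi (0 : ℝ) → ℂ :=
    fun x => f ((x.2 : ℝ) • (x.1 : EuclideanSpace ℝ (Fin D)))
  have hF : ∀ x : ({0}ᶜ : Set (EuclideanSpace ℝ (Fin D))),
      F (homeomorphUnitSphereProd _ x) = f x := fun x => by
    have h0 : ‖(x : EuclideanSpace ℝ (Fin D))‖ ≠ 0 := norm_ne_zero_iff.mpr x.2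
    simp [F, smul_smul, mul_inv_cancel₀ h0]
  have h1 : ∫ x, f x = ∫ x : ({0}ᶜ : Set (EuclideanSpace ℝ (Fin D))), f x
      ∂(volume.comap Subtype.val) := by
    rw [integral_subtype_comap (measurableSet_singleton _).compl f, restrict_compl_singleton]
  have h2 : Integrable F ((surfaceMeasure D).prod
      (.volumeIoiPow (Module.finrank ℝ (EuclideanSpace ℝ (Fin D)) - 1))) := by
    rw [← hP.integrable_comp_emb hE]
    have : IntegrableOn f {0}ᶜ := hf.integrableOn
    rw [integrableOn_iff_comap_subtypeVal (measurableSet_singleton _).compl] at this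
    exact this.congr (.of_forall fun x => (hF x).symm)
  rw [h1, ← integral_congr_ae (.of_forall hF), hP.integral_comp hE, integral_prod_symm _ h2,
    Measure.volumeIoiPow, finrank_euclideanSpace_fin]
  simp only [ENNReal.ofReal]
  rw [integral_withDensity_eq_integral_smul
      (measurable_subtype_coe.pow_const _).real_toNNReal,
    integral_subtype_comap measurableSet_Ioi fun r : ℝ => Real.toNNReal (r ^ (D - 1)) •
      ∫ Ω : UnitSphere D, f (r • (Ω : EuclideanSpace ℝ (Fin D))) ∂(surfaceMeasure D)]
  refine setIntegral_congr_fun measurableSet_Ioi fun r hr => ?_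
  have hr0 : 0 < r := hr
  beta_reduce
  rw [NNReal.smul_def, Real.coe_toNNReal _ (by positivity), real_smul]

/-- The radial density of `v²`. -/
noncomputable def radialDensity (a : ℝ) (v : EuclideanSpace ℝ (Fin D) → ℂ) (y : ℝ) : ℂ :=
  ((1 / a : ℝ) : ℂ) *
    ∫ Ω : UnitSphere D, v (y • (Ω : EuclideanSpace ℝ (Fin D))) ^ 2 ∂(surfaceMeasure D)

lemma isFourier_radialDensity (hw : Integrable w) (a : ℝ) :
    IsFourier (radialDensity a (unitaryFourier w)) :=
  isFourier_average hw (surfaceMeasure D) measurable_subtype_coe _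

lemma norm_smul_sphere {r : ℝ} (hr : 0 ≤ r) (Ω : UnitSphere D) :
    ‖r • (Ω : EuclideanSpace ℝ (Fin D))‖ = r := by
  rw [norm_smul, Real.norm_of_nonneg hr, norm_eq_of_mem_sphere, mul_one]

section Decay

variable (hw : Integrable w) (ha : 0 < a)
  (hdec : ∃ γ : ℝ, (D : ℝ) < γ ∧
    (fun k => ‖unitaryFourier w k‖ ^ 2) =o[Bornology.cobounded (EuclideanSpace ℝ (Fin D))]
      fun k => ‖k‖ ^ (a - γ))

include hw hdec in
-- The little-o condition holds beyond some radius; compactness covers the remaining momenta with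
-- |k| ≥ 1.
lemma exists_decay_bound : ∃ γ C : ℝ, (D : ℝ) < γ ∧ ∀ k, 1 ≤ ‖k‖ →
    ‖unitaryFourier w k‖ ^ 2 ≤ C * ‖k‖ ^ (a - γ) := by
  obtain ⟨γ, hγ, ho⟩ := hdec
  have h1 := ho.bound one_pos
  rw [← comap_norm_atTop, eventually_comap] at h1
  obtain ⟨R, hR⟩ := eventually_atTop.mp h1
  obtain ⟨C, hC⟩ := (isCompact_closedBall (0 : EuclideanSpace ℝ (Fin D)) R).exists_bound_of_continuousOn
    (f := fun k => ‖unitaryFourier w k‖ ^ 2 * (max 1 ‖k‖) ^ (γ - a))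
    (((continuous_unitaryFourier hw).norm.pow 2).mul ((by fun_prop :
      Continuous fun k : EuclideanSpace ℝ (Fin D) => max 1 ‖k‖).rpow_const fun k =>
        Or.inl (by positivity))).continuousOn
  refine ⟨γ, max C 1, hγ, fun k hk => ?_⟩
  have hk0 : 0 < ‖k‖ := by linarith
  rcases le_total ‖k‖ R with h | h
  · have h2 := hC k (by simpa using h)
    rw [max_eq_right hk, Real.norm_of_nonneg (by positivity)] at h2
    have h3 : ‖unitaryFourier w k‖ ^ 2 =
        ‖unitaryFourier w k‖ ^ 2 * ‖k‖ ^ (γ - a) * ‖k‖ ^ (a - γ) := by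
      rw [mul_assoc, ← Real.rpow_add hk0, sub_add_sub_cancel, sub_self, Real.rpow_zero, mul_one]
    rw [h3]
    gcongr
    exact h2.trans (le_max_left _ _)
  · have h2 := hR _ h k rfl
    rw [Real.norm_of_nonneg (by positivity), Real.norm_of_nonneg (by positivity)] at h2
    refine h2.trans ?_
    gcongr
    exact le_max_right _ _

include hw ha hdec in
-- At large momenta the integrand is O(|k|^(-γ)), and γ > D.
lemma integrable_radial :
    Integrable fun k => ‖unitaryFourier w k‖ ^ 2 / (1 + |radialDispersion D a k|) := by
  obtain ⟨γ, C, hγ, hb⟩ := exists_decay_bound hw hdec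
  have hγ0 : 0 < γ := lt_of_le_of_lt (by positivity) hγ
  have hcont : Continuous fun k => ‖unitaryFourier w k‖ ^ 2 / (1 + |radialDispersion D a k|) := by
    refine ((continuous_unitaryFourier hw).norm.pow 2).div (continuous_const.add
      (continuous_norm.rpow_const fun k => Or.inr ha.le).abs) fun k => ?_
    have := abs_nonneg (radialDispersion D a k)
    positivity
  refine hcont.locallyIntegrable.integrable_of_isBigO_cocompact (g := fun k => (1 + ‖k‖) ^ (-γ)) ?_
    ((integrable_one_add_norm (by rwa [finrank_euclideanSpace_fin])).integrableAtFilter _)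
  rw [← Metric.cobounded_eq_cocompact]
  refine Asymptotics.IsBigO.of_bound (C * 2 ^ γ) ?_
  have h1 : ∀ᶠ k in Bornology.cobounded (EuclideanSpace ℝ (Fin D)), 1 ≤ ‖k‖ :=
    tendsto_norm_cobounded_atTop.eventually (eventually_ge_atTop 1)
  filter_upwards [h1] with k hk
  have hk0 : 0 < ‖k‖ := by linarith
  rw [Real.norm_of_nonneg (by positivity), Real.norm_of_nonneg (by positivity), radialDispersion,
    abs_of_nonneg (by positivity), div_le_iff₀ (by positivity)]
  have hC : 0 ≤ C := by
    have := (sq_nonneg _).trans (hb k hk)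
    exact nonneg_of_mul_nonneg_left this (by positivity)
  have h2 : 1 ≤ 2 ^ γ * (1 + ‖k‖) ^ (-γ) * ‖k‖ ^ γ := by
    rw [Real.rpow_neg (by positivity), mul_right_comm, ← Real.mul_rpow (by norm_num) hk0.le,
      ← div_eq_mul_inv, one_le_div (by positivity)]
    gcongr; linarith
  calc ‖unitaryFourier w k‖ ^ 2 ≤ C * ‖k‖ ^ (a - γ) := hb k hk
    _ ≤ C * ‖k‖ ^ (a - γ) * (2 ^ γ * (1 + ‖k‖) ^ (-γ) * ‖k‖ ^ γ) :=
        le_mul_of_one_le_right (by positivity) h2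
    _ = C * 2 ^ γ * (1 + ‖k‖) ^ (-γ) * ‖k‖ ^ a := by
        rw [Real.rpow_sub hk0]; field_simp
    _ ≤ _ := by gcongr; linarith

include hw ha hdec in
-- Power counting with |k| = t^(1/a): the exponent D/a - 1 + (a-γ)/a equals -(γ-D)/a, which is the
-- required negative rate.
lemma isHalfDensity_radial (hD : 1 ≤ D) :
    IsHalfDensity (D / a) (1 / a) (radialDensity a (unitaryFourier w)) := by
  obtain ⟨γ, C, hγ, hb⟩ := exists_decay_bound hw hdec
  have hD0 : (0 : ℝ) < D := by exact_mod_cast hD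
  refine ⟨by positivity, by positivity, isFourier_radialDensity hw a,
    1 / a * (C * (surfaceMeasure D).real Set.univ), (γ - D) / a, div_pos (by linarith) ha,
    fun t ht => ?_⟩
  have ht0 : 0 < t := by linarith
  have h1 : ‖radialDensity a (unitaryFourier w) (t ^ (1 / a))‖ ≤
      1 / a * (C * (t ^ (1 / a)) ^ (a - γ) * (surfaceMeasure D).real Set.univ) := by
    rw [radialDensity, norm_mul, Complex.norm_real, Real.norm_of_nonneg (by positivity)]
    gcongr
    refine norm_integral_le_of_norm_le_const (.of_forall fun Ω => ?_)
    have h2 : ‖t ^ (1 / a) • (Ω : EuclideanSpace ℝ (Fin D))‖ = t ^ (1 / a) :=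
      norm_smul_sphere (by positivity) Ω
    have := hb (t ^ (1 / a) • (Ω : EuclideanSpace ℝ (Fin D)))
      (by rw [h2]; exact Real.one_le_rpow ht (by positivity))
    rwa [h2, ← norm_pow] at this
  calc t ^ (D / a - 1) * ‖radialDensity a (unitaryFourier w) (t ^ (1 / a))‖
      ≤ t ^ (D / a - 1) *
        (1 / a * (C * (t ^ (1 / a)) ^ (a - γ) * (surfaceMeasure D).real Set.univ)) := by gcongr
    _ = 1 / a * (C * (surfaceMeasure D).real Set.univ) *
        (t ^ (D / a - 1) * (t ^ (1 / a)) ^ (a - γ)) := by ring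
    _ = _ := by
        rw [← Real.rpow_mul ht0.le, ← Real.rpow_add ht0]
        congr 2
        field_simp; ring

end Decay

lemma ae_radialDispersion_ne (hD : 1 ≤ D) (ha : 0 < a) (E : ℝ) :
    ∀ᵐ k, radialDispersion D a k ≠ E := by
  have : Nonempty (Fin D) := ⟨⟨0, hD⟩⟩
  refine measure_mono_null (t := Metric.sphere 0 (E ^ (1 / a))) (fun k hk => ?_)
    (Measure.addHaar_sphere _ _ _)
  have hk' : ‖k‖ ^ a = E := not_not.mp hk
  rw [mem_sphere_zero_iff_norm, ← hk', ← Real.rpow_mul (norm_nonneg _), mul_one_div_cancel ha.ne',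
    Real.rpow_one]

/-- Level sets lie in spheres and are null, so a finite image would make a neighbourhood of 0 null.
-/
lemma infinite_image_radialDispersion (hD : 1 ≤ D) (ha : 0 < a)
    {U : Set (EuclideanSpace ℝ (Fin D))} (hU : U ∈ 𝓝 0) :
    (radialDispersion D a '' U).Infinite := fun hfin => by
  have h1 : ∀ᵐ k, ∀ E ∈ radialDispersion D a '' U, radialDispersion D a k ≠ E :=
    (ae_ball_iff hfin.countable).mpr fun E _ => ae_radialDispersion_ne hD ha E
  have h2 : volume U = 0 := measure_eq_zero_iff_ae_notMem.mpr
    (h1.mono fun k h hk => h _ (Set.mem_image_of_mem _ hk) rfl)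
  exact (Measure.measure_pos_of_mem_nhds volume hU).ne' h2

lemma insert_Ioi_zero : insert (0 : ℝ) (Set.Ioi 0) = Set.Ici 0 := Set.Ioi_insert

/-- `K` as a Cauchy transform. -/
lemma Ksep_radial_eq (hD : 1 ≤ D) (ha : 0 < a) {ω : ℂ}
    (hint : Integrable fun k => v k ^ 2 / (ω - (radialDispersion D a k : ℂ))) :
    Ksep (radialDispersion D a) v ω = cauchy (D / a) (1 / a) (radialDensity a v) ω := by
  rw [Ksep, integral_polar hD hint, cauchy,
    ← integral_comp_rpow_Ioi_of_pos (p := 1 / a) (by positivity)]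
  refine setIntegral_congr_fun measurableSet_Ioi fun t ht => ?_
  have ht0 : 0 < t := ht
  have h2 : ∀ Ω : UnitSphere D, radialDispersion D a
      (t ^ (1 / a) • (Ω : EuclideanSpace ℝ (Fin D))) = t := fun Ω => by
    rw [radialDispersion, norm_smul_sphere (by positivity), ← Real.rpow_mul ht0.le,
      one_div_mul_cancel ha.ne', Real.rpow_one]
  have h3 : t ^ (1 / a - 1) * (t ^ (1 / a)) ^ (D - 1) = t ^ (D / a - 1) := by
    rw [← Real.rpow_natCast, ← Real.rpow_mul ht0.le, ← Real.rpow_add ht0, Nat.cast_sub hD]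
    congr 1
    field_simp; push_cast; ring
  simp only [h2]
  rw [integral_div, halfDensity, radialDensity, real_smul, ← h3]
  push_cast; ring

/-- The energies are nonnegative, so the density on the negative half-line is zero. -/
theorem lineModel_radial (hD : 1 ≤ D) (ha : 0 < a) (hw : Integrable w)
    (hw1 : (((Real.sqrt (2 * Real.pi))⁻¹ ^ D : ℝ) : ℂ) * ∫ z, w z = 1)
    (hdec : ∃ γ : ℝ, (D : ℝ) < γ ∧
      (fun k => ‖unitaryFourier w k‖ ^ 2) =o[Bornology.cobounded (EuclideanSpace ℝ (Fin D))]
        fun k => ‖k‖ ^ (a - γ)) :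
    LineModel (radialDispersion D a) (unitaryFourier w) (Set.Ioi 0) (D / a) (1 / a)
      (radialDensity a (unitaryFourier w)) fun _ => 0 := by
  have hD0 : (0 : ℝ) < D := by exact_mod_cast hD
  have M : SeparableModel (radialDispersion D a) (unitaryFourier w) (Set.Ioi 0) :=
    ⟨continuous_norm.rpow_const fun k => Or.inr ha.le, continuous_unitaryFourier hw,
      isClosed_insert_Ioi, fun k => by
        rw [insert_Ioi_zero]; exact Real.rpow_nonneg (norm_nonneg _) _,
      integrable_radial hw ha hdec, by rw [unitaryFourier_zero, finrank_euclideanSpace_fin, hw1],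
      fun U hU => infinite_image_radialDispersion hD ha hU⟩
  refine ⟨M, isOpen_Ioi, by simp, ae_radialDispersion_ne hD ha, isHalfDensity_radial hw ha hdec hD,
    ⟨by positivity, by positivity, isFourier_const 0, 0, 1, one_pos, fun t _ => by simp⟩,
    fun ω hω => ?_⟩
  set v := unitaryFourier w
  have hint : Integrable fun k => v k ^ 2 / (ω - (radialDispersion D a k : ℂ)) := by
    have := (M.integrable_sq_div (mem_offContinuum_of_im_ne hω) one_ne_zero).neg
    refine this.congr (.of_forall fun k => ?_)
    simp only [Pi.neg_apply, pow_one]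
    rw [← div_neg, neg_sub]
  have h0 : cauchy (D / a) (1 / a) (fun _ => 0) (-ω) = 0 := by simp [cauchy, halfDensity]
  rw [twoSided, h0, sub_zero, Ksep_radial_eq hD ha hint]

/-- Hölder continuity passes to the radial density. -/
lemma holder_radialDensity (ha : 0 < a) (hw : Integrable w)
    (hH : ∃ (C s : NNReal), 0 < s ∧ HolderWith C s (unitaryFourier w)) :
    ∃ C θ : ℝ, 0 < θ ∧ ∀ x y : ℝ, 0 ≤ x → 0 ≤ y →
      ‖radialDensity a (unitaryFourier w) x - radialDensity a (unitaryFourier w) y‖ ≤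
        C * |x - y| ^ θ := by
  obtain ⟨C, s, hs, hH⟩ := hH
  obtain ⟨M, hM, hb⟩ := exists_bound_unitaryFourier w
  refine ⟨1 / a * (2 * M * C * (surfaceMeasure D).real Set.univ), s, hs, fun x y _ _ => ?_⟩
  have hint : ∀ x : ℝ, Integrable (fun Ω : UnitSphere D =>
      unitaryFourier w (x • (Ω : EuclideanSpace ℝ (Fin D))) ^ 2) (surfaceMeasure D) := fun x => by
    refine Integrable.of_bound (C := M ^ 2) ?_ (.of_forall fun Ω => ?_)
    · have := continuous_unitaryFourier hw
      exact (by fun_prop : Continuous fun Ω : UnitSphere D =>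
        unitaryFourier w (x • (Ω : EuclideanSpace ℝ (Fin D))) ^ 2).aestronglyMeasurable
    · rw [norm_pow]; gcongr; exact hb _
  rw [radialDensity, radialDensity, ← mul_sub, ← integral_sub (hint x) (hint y), norm_mul,
    Complex.norm_real, Real.norm_of_nonneg (by positivity), mul_assoc]
  gcongr
  have h1 : ∀ Ω : UnitSphere D, ‖unitaryFourier w (x • (Ω : EuclideanSpace ℝ (Fin D))) ^ 2 -
      unitaryFourier w (y • (Ω : EuclideanSpace ℝ (Fin D))) ^ 2‖ ≤ 2 * M * (C * |x - y| ^ (s : ℝ)) :=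
    fun Ω => by
      rw [sq_sub_sq, norm_mul]
      have h2 := hH.dist_le (x • (Ω : EuclideanSpace ℝ (Fin D))) (y • (Ω : EuclideanSpace ℝ (Fin D)))
      rw [dist_eq_norm, dist_eq_norm, ← sub_smul, norm_smul, norm_eq_of_mem_sphere, mul_one,
        Real.norm_eq_abs] at h2
      have h3 : ‖unitaryFourier w (x • (Ω : EuclideanSpace ℝ (Fin D))) +
        unitaryFourier w (y • (Ω : EuclideanSpace ℝ (Fin D)))‖ ≤ 2 * M :=
        (norm_add_le _ _).trans ((add_le_add (hb _) (hb _)).trans (two_mul M).ge)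
      gcongr
  refine (norm_integral_le_of_norm_le_const (.of_forall h1)).trans (le_of_eq ?_)
  ring

end Radial

end SepScattering

/-! ### Low energies and Levinson's theorem for the radial model -/

namespace SepScattering

section RadialLowEnergy

variable {D : ℕ} {a : ℝ} {g : ℂ} {w v : EuclideanSpace ℝ (Fin D) → ℂ}

lemma twoSided_zero_right (p q : ℝ) (s : ℝ → ℂ) : twoSided p q s (fun _ => 0) = cauchy p q s := by
  ext ω
  simp [twoSided, cauchy, halfDensity]

lemma radialDensity_zero (hv : v 0 = 1) (a : ℝ) :
    radialDensity a v 0 = ((1 / a : ℝ) : ℂ) * ((surfaceMeasure D).real Set.univ : ℂ) := by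
  simp [radialDensity, hv]

lemma surfaceMeasure_univ_pos (hD : 1 ≤ D) : 0 < (surfaceMeasure D).real Set.univ := by
  have : Nonempty (Fin D) := ⟨⟨0, hD⟩⟩
  rw [Measure.toSphere_real_apply_univ, finrank_euclideanSpace_fin]
  have : 0 < volume.real (Metric.ball (0 : EuclideanSpace ℝ (Fin D)) 1) :=
    ENNReal.toReal_pos (Metric.measure_ball_pos _ _ one_pos).ne' measure_ball_lt_top.ne
  positivity

lemma radialDensity_zero_ne_zero (hD : 1 ≤ D) (ha : 0 < a) (hv : v 0 = 1) :
    radialDensity a v 0 ≠ 0 := by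
  rw [radialDensity_zero hv]
  have := surfaceMeasure_univ_pos hD
  exact_mod_cast (show 0 < 1 / a * (surfaceMeasure D).real Set.univ by positivity).ne'

/-- The line model of the dispersion relation `|k|ᵃ`. -/
abbrev RadialModel (D : ℕ) (a : ℝ) (v : EuclideanSpace ℝ (Fin D) → ℂ) : Prop :=
  LineModel (radialDispersion D a) v (Set.Ioi 0) (D / a) (1 / a) (radialDensity a v) fun _ => 0

/-- For a < D the singularity |k|^(-a) is integrable at the origin. Outside the unit ball 1 + |k|^a
≤ 2|k|^a reduces the claim to the integrability in the model. -/
lemma RadialModel.integrable_zero (M : RadialModel D a v) (hD : 1 ≤ D) (ha : 0 < a) (haD : a < D) :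
    Integrable fun k => v k ^ 2 / (0 - (radialDispersion D a k : ℂ)) := by
  have : Nonempty (Fin D) := ⟨⟨0, hD⟩⟩
  obtain ⟨C, hC⟩ := (isCompact_closedBall (0 : EuclideanSpace ℝ (Fin D)) 1).exists_bound_of_continuousOn
    M.cont_v.continuousOn
  have h1 : IntegrableOn (fun k : EuclideanSpace ℝ (Fin D) => ‖k‖ ^ (-a)) (Metric.ball 0 1) := by
    refine (integrableOn_fun_norm_addHaar volume (f := fun r => r ^ (-a))).mpr ?_
    have h2 := intervalIntegral.intervalIntegrable_rpow' (a := 0) (b := 1)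
      (r := (D : ℝ) - 1 - a) (by linarith)
    rw [intervalIntegrable_iff_integrableOn_Ioo_of_le zero_le_one] at h2
    refine h2.congr_fun (fun r hr => ?_) measurableSet_Ioo
    beta_reduce
    rw [finrank_euclideanSpace_fin, smul_eq_mul, ← Real.rpow_natCast, ← Real.rpow_add hr.1,
      Nat.cast_sub hD]
    push_cast; ring_nf
  have hm : AEStronglyMeasurable (fun k => v k ^ 2 / (0 - (radialDispersion D a k : ℂ))) := by
    have h3 := M.cont_ε.measurable
    have h4 := M.cont_v.measurable
    exact Measurable.aestronglyMeasurable (by fun_prop)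
  rw [← integrableOn_univ, ← Set.union_compl_self (Metric.ball 0 1)]
  refine IntegrableOn.union ((h1.const_mul (C ^ 2)).mono' hm.restrict ?_)
    ((M.integrable.const_mul 2).integrableOn.mono' hm.restrict ?_)
  · filter_upwards [ae_restrict_mem measurableSet_ball] with k hk
    rw [zero_sub, norm_div, norm_neg, Complex.norm_real, norm_pow, radialDispersion,
      Real.norm_of_nonneg (by positivity), Real.rpow_neg (norm_nonneg k), div_eq_mul_inv]
    gcongr
    exact hC k (Metric.ball_subset_closedBall hk)
  · filter_upwards [ae_restrict_mem measurableSet_ball.compl] with k hk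
    have hk1 : 1 ≤ ‖k‖ := by simpa using hk
    have h5 : 1 ≤ ‖k‖ ^ a := Real.one_le_rpow hk1 ha.le
    rw [zero_sub, norm_div, norm_neg, Complex.norm_real, norm_pow, radialDispersion,
      Real.norm_of_nonneg (by positivity), abs_of_nonneg (by positivity), mul_div_assoc',
      div_le_div_iff₀ (by positivity) (by positivity)]
    nlinarith [sq_nonneg ‖v k‖]

/-- Without a zero-energy state, `g⁻¹ - K(0) ≠ 0`. -/
lemma RadialModel.inv_sub_zero_ne_zero (M : RadialModel D a v) (hD : 1 ≤ D) (ha : 0 < a)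
    (haD : a < D) (hg : g ≠ 0) (hz : ¬ HasZeroEnergyState (radialDispersion D a) g v) :
    g⁻¹ - cauchy (D / a) (1 / a) (radialDensity a v) 0 ≠ 0 := fun h0 => by
  have hint := M.integrable_zero hD ha haD
  have hK : ∫ k, v k * (v k / (radialDispersion D a k : ℂ)) = -g⁻¹ := by
    rw [sub_eq_zero.mp h0, ← Ksep_radial_eq hD ha hint, Ksep, ← integral_neg]
    congr 1; ext k
    rw [zero_sub, div_neg, neg_neg]; ring
  -- If K(0) = g⁻¹, then ψ = v/ε has ∫ vψ = -K(0) = -g⁻¹ ≠ 0, and εψ + g v ∫ vψ = v - v = 0.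
  refine hz ⟨fun k => v k / (radialDispersion D a k : ℂ), ?_, ?_, ?_, ?_⟩
  · have h3 := M.cont_ε.measurable
    have h4 := M.cont_v.measurable
    exact Measurable.aestronglyMeasurable (by fun_prop)
  · refine hint.neg.congr (.of_forall fun k => ?_)
    simp only [Pi.neg_apply]
    rw [zero_sub, div_neg, neg_neg]; ring
  · rw [hK]; exact neg_ne_zero.mpr (inv_ne_zero hg)
  · filter_upwards [M.null 0] with k hk
    have hk' : (radialDispersion D a k : ℂ) ≠ 0 := by exact_mod_cast hk
    rw [hK, mul_div_cancel₀ _ hk']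
    field_simp; ring

/-- The weight of the low-energy asymptotics for `p ≥ 1`. -/
noncomputable def lowWeight (p r : ℝ) : ℝ := if p = 1 then 1 / (1 + |Real.log r|) else 1

lemma lowWeight_pos (p r : ℝ) : 0 < lowWeight p r := by
  unfold lowWeight
  split_ifs <;> positivity

lemma lowWeight_le (p r : ℝ) : lowWeight p r ≤ 1 := by
  unfold lowWeight
  split_ifs
  · rw [div_le_one (by positivity)]; linarith [abs_nonneg (Real.log r)]
  · exact le_rfl

lemma continuousOn_lowWeight (p : ℝ) : ContinuousOn (lowWeight p) (Set.Ioi 0) := by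
  unfold lowWeight
  split_ifs
  · refine continuousOn_const.div (continuousOn_const.add
      (Real.continuousOn_log.mono fun x hx => ne_of_gt hx).abs) fun r _ => ?_
    positivity
  · exact continuousOn_const

/-- The power of E in the density of states, measured against the growth of g⁻¹ - K, vanishes at
zero energy. This is why S tends to the identity when a ≤ D. -/
lemma tendsto_rpow_mul_lowWeight {p : ℝ} (hp : 1 ≤ p) :
    Tendsto (fun E : ℝ => E ^ (p - 1) * lowWeight p E) (𝓝[>] 0) (𝓝 0) := by
  rcases hp.eq_or_lt with rfl | hp
  · have h1 : Tendsto (fun E : ℝ => 1 + |Real.log E|) (𝓝[>] 0) atTop :=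
      tendsto_atTop_add_const_left _ _ (tendsto_abs_atBot_atTop.comp Real.tendsto_log_nhdsGT_zero)
    refine h1.inv_tendsto_atTop.congr fun E => ?_
    simp [lowWeight]
  · have h1 := ((Real.continuous_rpow_const (show 0 ≤ p - 1 by linarith)).tendsto 0).mono_left
      (nhdsWithin_le_nhds (s := Set.Ioi 0))
    rw [Real.zero_rpow (by linarith)] at h1
    refine h1.congr fun E => ?_
    rw [lowWeight, if_neg hp.ne', mul_one]

/-- The low-energy asymptotics of `g⁻¹ - K` for `p ≥ 1`. -/
lemma IsHalfDensity.exists_low {p q : ℝ} {s : ℝ → ℂ} (H : IsHalfDensity p q s) (hp : 1 ≤ p)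
    (hs : s 0 ≠ 0) (x : ℂ) (hx : 1 < p → x - cauchy p q s 0 ≠ 0) : ∃ c : ℂ, c ≠ 0 ∧
      Tendsto (fun ω => (x - cauchy p q s ω) * lowWeight p ‖ω‖) (𝓝[upper] 0) (𝓝 c) := by
  rcases hp.eq_or_lt with rfl | hp
  · refine ⟨s 0, hs, ?_⟩
    have h1 : Tendsto (fun ω : ℂ => x * ((1 / (1 + |Real.log ‖ω‖|) : ℝ) : ℂ)) (𝓝[upper] 0)
        (𝓝 (x * ((0 : ℝ) : ℂ))) := by
      refine tendsto_const_nhds.mul ((Complex.continuous_ofReal.tendsto 0).comp ?_)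
      have h2 := (tendsto_rpow_mul_lowWeight le_rfl).comp tendsto_norm_nhdsWithin_upper_zero
      refine h2.congr fun ω => ?_
      simp [lowWeight]
    have h3 := h1.sub H.tendsto_cauchy_zero_of_eq_one
    rw [ofReal_zero, mul_zero, zero_sub, neg_neg] at h3
    refine h3.congr fun ω => ?_
    rw [lowWeight, if_pos rfl, sub_mul]
  · refine ⟨_, hx hp, ((H.tendsto_cauchy_zero_of_one_lt hp).const_sub x).congr fun ω => ?_⟩
    rw [lowWeight, if_neg hp.ne', ofReal_one, mul_one]

lemma RadialModel.exists_low (M : RadialModel D a v) (hD : 1 ≤ D) (ha : 0 < a) (haD : a ≤ D)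
    (hg : g ≠ 0) (hz : ¬ HasZeroEnergyState (radialDispersion D a) g v) : ∃ c : ℂ, c ≠ 0 ∧
      Tendsto (fun ω => (g⁻¹ - Ksep (radialDispersion D a) v ω) * lowWeight (D / a) ‖ω‖)
        (𝓝[upper] 0) (𝓝 c) := by
  obtain ⟨c, hc, h⟩ := M.density₁.exists_low ((one_le_div ha).mpr haD)
    (radialDensity_zero_ne_zero hD ha M.v_zero) g⁻¹
    fun h => M.inv_sub_zero_ne_zero hD ha ((one_lt_div ha).mp h) hg hz
  refine ⟨c, hc, h.congr' (eventually_nhdsWithin_of_forall fun ω hω => ?_)⟩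
  beta_reduce
  rw [← M.eqOn_upper hω, twoSided_zero_right]

lemma RadialModel.exists_low_lower (M : RadialModel D a v) (hD : 1 ≤ D) (ha : 0 < a) (haD : a ≤ D)
    (hg : g ≠ 0) (hz : ¬ HasZeroEnergyState (radialDispersion D a) g v) : ∃ c : ℂ, c ≠ 0 ∧
      Tendsto (fun ω => (g⁻¹ - Ksep (radialDispersion D a) v ω) * lowWeight (D / a) ‖ω‖ *
        Complex.exp (-(I * (0 : ℝ) * arg ω))) (𝓝[lower] 0) (𝓝 c) := by
  have hconj : ∀ ω, cauchy (D / a) (1 / a) (fun y => conj (radialDensity a v y)) ω =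
      conj (cauchy (D / a) (1 / a) (radialDensity a v) (conj ω)) := fun ω => by
    rw [conj_cauchy, Complex.conj_conj]
  obtain ⟨c, hc, h⟩ := M.density₁.conj_fun.exists_low ((one_le_div ha).mpr haD)
    ((map_ne_zero _).mpr (radialDensity_zero_ne_zero hD ha M.v_zero)) (conj g⁻¹)
    fun h => by
      rw [hconj, map_zero, ← map_sub]
      exact (map_ne_zero _).mpr (M.inv_sub_zero_ne_zero hD ha ((one_lt_div ha).mp h) hg hz)
  refine ⟨conj c, (map_ne_zero _).mpr hc, tendsto_zero_lower_of_upper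
    (F := fun ω => g⁻¹ - Ksep (radialDispersion D a) v ω)
    (h.congr' (eventually_nhdsWithin_of_forall fun ω hω => ?_))⟩
  have hω' : conj ω ∈ lower := by
    have : 0 < ω.im := hω
    simpa [lower] using this
  beta_reduce
  rw [hconj, ← map_sub, ← M.eqOn_lower hω', twoSided_zero_right]
  simp

/-- Levinson's theorem for radial dispersion relations. -/
theorem RadialModel.levinson (M : RadialModel D a v) (hD : 1 ≤ D) (ha : 0 < a) (hg : g ≠ 0)
    (hz : ¬ HasZeroEnergyState (radialDispersion D a) g v)
    (hb : ∀ E : ℝ, 0 < E → ¬ IsBoundStateInContinuum (radialDispersion D a) g v E) {f : ℝ → ℂ}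
    (hf : ∀ E : ℝ, 0 < E → f E = (g⁻¹ - fromBelow (Ksep (radialDispersion D a) v) E) /
      (g⁻¹ - fromAbove (Ksep (radialDispersion D a) v) E)) (hf0 : ∀ E : ℝ, 0 < E → f E ≠ 0)
    (hH : a ≤ D → ∃ C θ : ℝ, 0 < θ ∧ ∀ x y : ℝ, 0 ≤ x → 0 ≤ y →
      ‖radialDensity a v x - radialDensity a v y‖ ≤ C * |x - y| ^ θ) :
    FiniteDimensional ℂ (boundStateSpace (radialDispersion D a) g v) ∧
      HasPhaseChange f (Set.Ioi 0) (𝓝[>] 0) atTop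
        (-Real.pi * boundStateNumber (radialDispersion D a) g v -
          Real.pi * (if D < a then D / a - 1 else 0)) := by
  have hD0 : (0 : ℝ) < D := by exact_mod_cast hD
  have hl : ∀ E ∈ Set.Ioi (0 : ℝ), g⁻¹ - fromBelow (Ksep (radialDispersion D a) v) E ≠ 0 :=
    fun E hE h0 => hf0 E hE (by rw [hf E hE, h0, zero_div])
  -- For a > D the model at zero is r^(D/a-1) with winding exponent D/a - 1. For a ≤ D it is
  -- constant or logarithmic and has exponent 0; only then is Hölder continuity needed, for the
  -- decay of K at infinity.
  obtain ⟨h, e, C, c₁, c₂, H, hC, he⟩ : ∃ (h : ℝ → ℝ) (e C : ℝ) (c₁ c₂ : ℂ),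
      HalfPlaneData (Set.Ioi 0) (fun ω => g⁻¹ - Ksep (radialDispersion D a) v ω)
        (fun E => g⁻¹ - fromAbove (Ksep (radialDispersion D a) v) E)
        (fun E => g⁻¹ - fromBelow (Ksep (radialDispersion D a) v) E) g⁻¹ h e c₁ c₂ ∧
      (∀ᶠ r in 𝓝[>] 0, h r ≤ C) ∧ e = if D < a then D / a - 1 else 0 := by
    have hs := radialDensity_zero_ne_zero hD ha M.v_zero
    rcases lt_or_ge (D : ℝ) a with haD | haD
    · have hp : D / a < 1 := (div_lt_one ha).mpr haD
      refine ⟨_, _, 1, _, _, M.halfPlaneData_of_lt_one hg hp hb hl ?_ ?_,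
        LineModel.eventually_rpow_le hp, by rw [if_pos haD]⟩
      · rw [add_zero]; exact mul_ne_zero hs (Complex.exp_ne_zero _)
      · rw [add_zero]; exact mul_ne_zero hs (Complex.exp_ne_zero _)
    · obtain ⟨c₁, hc₁, h₁⟩ := M.exists_low hD ha haD hg hz
      obtain ⟨c₂, hc₂, h₂⟩ := M.exists_low_lower hD ha haD hg hz
      refine ⟨lowWeight (D / a), 0, 1, c₁, c₂, M.halfPlaneData hg ⟨M.density₁, Or.inr (hH haD)⟩
        ⟨M.density₂, Or.inr ⟨0, 1, one_pos, by simp⟩⟩ hb hl (fun r _ => lowWeight_pos _ r)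
        (continuousOn_lowWeight _) hc₁ hc₂ ?_ h₂, .of_forall (lowWeight_le _),
        by rw [if_neg (not_lt.mpr haD)]⟩
      simpa using h₁
  obtain ⟨h1, Δn, Δp, -, h3, h4, -, h6⟩ := LineModel.levinson M hg H hC hf
  refine ⟨h1, ?_⟩
  have h7 : Δn = 0 := h4 (Set.disjoint_left.mpr fun x hx hx' => lt_asymm (Set.mem_Iio.mp hx) (Set.mem_Ioi.mp hx'))
  rw [h7, zero_add, he] at h6
  rw [← h6]
  exact h3 subset_rfl

end RadialLowEnergy

end SepScattering

/-! ### The S-matrix in angular momentum channels -/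

namespace SepScattering

section Angular

variable {D : ℕ} {a : ℝ} {g : ℂ} {v : EuclideanSpace ℝ (Fin D) → ℂ} {ι : Type*}

/-- The coefficient of `Y_α` in the separable potential at momentum `κ`, with its phase. -/
noncomputable def channelIn (B : AngularBasis D ι) (v : EuclideanSpace ℝ (Fin D) → ℂ) (κ : ℝ)
    (α : ι) : ℂ :=
  (-I) ^ B.degree α * ∫ Ω, v (κ • (Ω : EuclideanSpace ℝ (Fin D))) * B.Y α Ω ∂(surfaceMeasure D)

/-- The coefficient of `conj Y_α` in the separable potential at momentum `κ`, with its phase. -/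
noncomputable def channelOut (B : AngularBasis D ι) (v : EuclideanSpace ℝ (Fin D) → ℂ) (κ : ℝ)
    (α : ι) : ℂ :=
  conj ((-I) ^ B.degree α) *
    ∫ Ω, conj (B.Y α Ω) * v (κ • (Ω : EuclideanSpace ℝ (Fin D))) ∂(surfaceMeasure D)

/-- The kernel has rank one, so the double integral over the sphere factorises into an incoming and
an outgoing channel coefficient. -/
lemma angularElement_Tsep (B : AngularBasis D ι) (ε : EuclideanSpace ℝ (Fin D) → ℝ) (g : ℂ)
    (v : EuclideanSpace ℝ (Fin D) → ℂ) (ω : ℂ) (κ : ℝ) (α β : ι) :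
    angularElement B (Tsep ε g v ω) κ α β = ((sphereArea D : ℝ) : ℂ)⁻¹ *
      (channelIn B v κ α * channelOut B v κ β) / (g⁻¹ - Ksep ε v ω) := by
  have h1 : ∀ Ω' : UnitSphere D, ∫ Ω : UnitSphere D,
      conj (B.Y β Ω') * Tsep ε g v ω (κ • (Ω : EuclideanSpace ℝ (Fin D)))
        (κ • (Ω' : EuclideanSpace ℝ (Fin D))) * B.Y α Ω ∂(surfaceMeasure D) =
      conj (B.Y β Ω') * v (κ • (Ω' : EuclideanSpace ℝ (Fin D))) * ((g⁻¹ - Ksep ε v ω)⁻¹ *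
        ∫ Ω, v (κ • (Ω : EuclideanSpace ℝ (Fin D))) * B.Y α Ω ∂(surfaceMeasure D)) := fun Ω' => by
    rw [← mul_assoc, ← integral_const_mul]
    congr 1; ext Ω
    rw [Tsep]; ring
  simp only [angularElement, h1]
  rw [integral_mul_const, channelIn, channelOut]
  ring

lemma sphereArea_pos (hD : 1 ≤ D) : 0 < sphereArea D := by
  have : (0 : ℝ) < D := by exact_mod_cast hD
  have := Real.Gamma_pos_of_pos (show (0 : ℝ) < D / 2 by positivity)
  have := Real.pi_pos
  rw [sphereArea]; positivity

/-- The factor of the rank-one term in the S-matrix. -/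
noncomputable def radialFactor (D : ℕ) (a : ℝ) (g : ℂ) (v : EuclideanSpace ℝ (Fin D) → ℂ) (E : ℝ) :
    ℂ :=
  -(2 * Real.pi * I) * ((1 / a : ℝ) : ℂ) *
    (((E ^ ((D : ℝ) / a - 1) : ℝ) : ℂ) / (g⁻¹ - fromAbove (Ksep (radialDispersion D a) v) E))

-- The area of the sphere in the density of states cancels the normalisation of the angular momentum
-- states.
open Classical in
lemma SAngular_apply (hD : 1 ≤ D) (B : AngularBasis D ι) (M : RadialModel D a v) {E : ℝ}
    (hE : 0 < E) (hb : ¬ IsBoundStateInContinuum (radialDispersion D a) g v E) (α β : ι) :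
    SAngular B a g v E α β = (if α = β then 1 else 0) + radialFactor D a g v E *
      (channelIn B v (E ^ (1 / a)) α * channelOut B v (E ^ (1 / a)) β) := by
  have h1 : fromAbove (fun ω => angularElement B (Tsep (radialDispersion D a) g v ω)
      (E ^ (1 / a)) α β) E = ((sphereArea D : ℝ) : ℂ)⁻¹ *
      (channelIn B v (E ^ (1 / a)) α * channelOut B v (E ^ (1 / a)) β) /
        (g⁻¹ - fromAbove (Ksep (radialDispersion D a) v) E) := by
    simp only [angularElement_Tsep]
    exact fromAbove_eq (tendsto_const_nhds.div ((M.boundary hE.ne').1.const_sub g⁻¹) hb)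
  have hA : ((sphereArea D : ℝ) : ℂ) ≠ 0 := by exact_mod_cast (sphereArea_pos hD).ne'
  rw [SAngular, h1, densityOfStates, radialFactor, show -1 + (D : ℝ) / a = D / a - 1 by ring]
  push_cast
  field_simp
  ring

lemma memLp_sphere (M : Continuous v) (κ : ℝ) : MemLp (fun Ω : UnitSphere D =>
    v (κ • (Ω : EuclideanSpace ℝ (Fin D)))) 2 (surfaceMeasure D) := by
  have h : Continuous fun Ω : UnitSphere D => v (κ • (Ω : EuclideanSpace ℝ (Fin D))) := by fun_prop
  obtain ⟨C, hC⟩ := (isCompact_univ (X := UnitSphere D)).exists_bound_of_continuousOn h.continuousOn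
  exact MemLp.of_bound h.aestronglyMeasurable C (.of_forall fun Ω => hC Ω trivial)

/-- Parseval's identity for the channels. -/
lemma hasSum_channels (B : AngularBasis D ι) (hv : Continuous v) (κ : ℝ) :
    HasSum (fun α => channelOut B v κ α * channelIn B v κ α)
      (∫ Ω : UnitSphere D, v (κ • (Ω : EuclideanSpace ℝ (Fin D))) ^ 2 ∂(surfaceMeasure D)) := by
  have h1 := memLp_sphere hv κ
  have h2 : MemLp (fun Ω : UnitSphere D => conj (v (κ • (Ω : EuclideanSpace ℝ (Fin D))))) 2
    (surfaceMeasure D) := memLp_sphere (v := fun k => conj (v k)) (by fun_prop) κ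
  -- The square v², without absolute value, is the inner product of conj v with v; Parseval is
  -- applied to this pair.
  have h := B.Y.hasSum_inner_mul_inner h2.toLp h1.toLp
  have hf : (fun α => channelOut B v κ α * channelIn B v κ α) =
      fun α => inner ℂ h2.toLp (B.Y α) * inner ℂ (B.Y α) h1.toLp := by
    funext α
    have e1 : inner ℂ h2.toLp (B.Y α) =
        ∫ Ω, v (κ • (Ω : EuclideanSpace ℝ (Fin D))) * B.Y α Ω ∂(surfaceMeasure D) := by
      rw [L2.inner_def]
      refine integral_congr_ae ?_
      filter_upwards [h2.coeFn_toLp] with Ω hΩ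
      rw [hΩ, RCLike.inner_apply, Complex.conj_conj, mul_comm]
    have e2 : inner ℂ (B.Y α) h1.toLp =
        ∫ Ω, conj (B.Y α Ω) * v (κ • (Ω : EuclideanSpace ℝ (Fin D))) ∂(surfaceMeasure D) := by
      rw [L2.inner_def]
      refine integral_congr_ae ?_
      filter_upwards [h1.coeFn_toLp] with Ω hΩ
      rw [hΩ, RCLike.inner_apply, mul_comm]
    -- The phases of the plane-wave expansion cancel on the diagonal.
    have e3 : conj ((-I) ^ B.degree α) * (-I) ^ B.degree α = 1 := by
      rw [map_pow, ← mul_pow, map_neg, conj_I, neg_neg, mul_neg, I_mul_I, neg_neg, one_pow]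
    rw [e1, e2, channelIn, channelOut]
    linear_combination (∫ Ω, conj (B.Y α Ω) * v (κ • (Ω : EuclideanSpace ℝ (Fin D)))
      ∂(surfaceMeasure D)) * (∫ Ω, v (κ • (Ω : EuclideanSpace ℝ (Fin D))) * B.Y α Ω
      ∂(surfaceMeasure D)) * e3
  have hi : inner ℂ h2.toLp h1.toLp =
      ∫ Ω : UnitSphere D, v (κ • (Ω : EuclideanSpace ℝ (Fin D))) ^ 2 ∂(surfaceMeasure D) := by
    rw [L2.inner_def]
    refine integral_congr_ae ?_
    filter_upwards [h1.coeFn_toLp, h2.coeFn_toLp] with Ω hΩ hΩ'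
    rw [hΩ, hΩ', RCLike.inner_apply, Complex.conj_conj, sq]
  rw [hf, ← hi]
  exact h

/-- The matrix determinant lemma for a rank-one perturbation of the identity: det(1 + x yᵀ) = 1 +
yᵀx. -/
lemma finiteDet_eq (hD : 1 ≤ D) (B : AngularBasis D ι) (M : RadialModel D a v) {E : ℝ}
    (hE : 0 < E) (hb : ¬ IsBoundStateInContinuum (radialDispersion D a) g v E) (s : Finset ι) :
    finiteDet B a g v E s = 1 + radialFactor D a g v E *
      ∑ α ∈ s, channelOut B v (E ^ (1 / a)) α * channelIn B v (E ^ (1 / a)) α := by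
  classical
  have h1 : 1 +
      Matrix.replicateCol Unit (fun α : s => radialFactor D a g v E * channelIn B v (E ^ (1 / a)) α) *
        Matrix.replicateRow Unit (fun α : s => channelOut B v (E ^ (1 / a)) α) =
      Matrix.of fun α β : s => SAngular B a g v E α β := by
    ext α β
    rw [Matrix.of_apply]
    rw [SAngular_apply hD B M hE hb, Matrix.add_apply, Matrix.one_apply, Matrix.mul_apply]
    simp only [Matrix.replicateCol_apply, Matrix.replicateRow_apply, Finset.univ_unique,
      Finset.sum_singleton, mul_assoc, Subtype.ext_iff]
  have h2 := Matrix.det_one_add_replicateCol_mul_replicateRow (ι := Unit)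
    (fun α : s => radialFactor D a g v E * channelIn B v (E ^ (1 / a)) α)
    (fun α : s => channelOut B v (E ^ (1 / a)) α)
  rw [h1] at h2
  refine Eq.trans ?_ (h2.trans ?_)
  · rw [finiteDet]; congr!
  rw [dotProduct, Finset.mul_sum, ← Finset.sum_coe_sort s]
  congr 1
  exact Finset.sum_congr rfl fun α _ => by ring

/-- The determinant of the S-matrix. -/
theorem tendsto_finiteDet (hD : 1 ≤ D) (B : AngularBasis D ι) (M : RadialModel D a v)
    {E : ℝ} (hE : 0 < E) (hb : ¬ IsBoundStateInContinuum (radialDispersion D a) g v E) :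
    Tendsto (finiteDet B a g v E) atTop
      (𝓝 ((g⁻¹ - fromBelow (Ksep (radialDispersion D a) v) E) /
        (g⁻¹ - fromAbove (Ksep (radialDispersion D a) v) E))) := by
  have h0 := (hasSum_channels B M.cont_v (E ^ (1 / a))).mul_left (radialFactor D a g v E)
  rw [HasSum, SummationFilter.unconditional_filter] at h0
  have h := h0.const_add 1
  rw [M.ratio_eq hE.ne' hb, lineDensity, if_pos hE, halfDensity, radialDensity]
  refine (h.congr fun s => ?_).trans_eq (congrArg 𝓝 ?_)
  · rw [finiteDet_eq hD B M hE hb, Finset.mul_sum]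
  · rw [radialFactor]; ring

theorem detSAngular_eq (hD : 1 ≤ D) (B : AngularBasis D ι) (M : RadialModel D a v)
    {E : ℝ} (hE : 0 < E) (hb : ¬ IsBoundStateInContinuum (radialDispersion D a) g v E) :
    detSAngular B a g v E = (g⁻¹ - fromBelow (Ksep (radialDispersion D a) v) E) /
        (g⁻¹ - fromAbove (Ksep (radialDispersion D a) v) E) :=
  (tendsto_finiteDet hD B M hE hb).limUnder_eq

/-! ### Low energies -/

/-- On a shrinking shell v tends to v(0) = 1, boundedly, so only the mean value of the angular
function survives. -/
lemma tendsto_channel {v : EuclideanSpace ℝ (Fin D) → ℂ} (hv : Continuous v) (hv0 : v 0 = 1)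
    (ha : 0 < a) {y : UnitSphere D → ℂ} (hy : Integrable y (surfaceMeasure D)) :
    Tendsto (fun E : ℝ => ∫ Ω, v (E ^ (1 / a) • (Ω : EuclideanSpace ℝ (Fin D))) * y Ω
      ∂(surfaceMeasure D)) (𝓝[>] 0) (𝓝 (∫ Ω, y Ω ∂(surfaceMeasure D))) := by
  obtain ⟨C, hC⟩ := (isCompact_closedBall (0 : EuclideanSpace ℝ (Fin D)) 1).exists_bound_of_continuousOn
    hv.continuousOn
  refine tendsto_integral_filter_of_dominated_convergence (fun Ω => C * ‖y Ω‖) ?_ ?_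
    (hy.norm.const_mul C) (.of_forall fun Ω => ?_)
  · refine .of_forall fun E => AEStronglyMeasurable.mul ?_ hy.aestronglyMeasurable
    exact (by fun_prop : Continuous fun Ω : UnitSphere D =>
      v (E ^ (1 / a) • (Ω : EuclideanSpace ℝ (Fin D)))).aestronglyMeasurable
  · filter_upwards [Ioo_mem_nhdsGT (zero_lt_one (α := ℝ))] with E hE
    refine .of_forall fun Ω => ?_
    rw [norm_mul]
    gcongr
    refine hC _ ?_
    rw [mem_closedBall_zero_iff, norm_smul_sphere (Real.rpow_nonneg hE.1.le _)]
    exact Real.rpow_le_one hE.1.le hE.2.le (by positivity)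
  · have h1 : Continuous fun E : ℝ => v (E ^ (1 / a) • (Ω : EuclideanSpace ℝ (Fin D))) * y Ω := by
      have := Real.continuous_rpow_const (q := 1 / a) (by positivity)
      fun_prop
    have h2 := (h1.tendsto 0).mono_left (nhdsWithin_le_nhds (s := Set.Ioi 0))
    rwa [Real.zero_rpow (by positivity), zero_smul, hv0, one_mul] at h2

lemma integrable_Y (B : AngularBasis D ι) (α : ι) :
    Integrable (B.Y α : UnitSphere D → ℂ) (surfaceMeasure D) :=
  (Lp.memLp (B.Y α)).integrable (by norm_num)

lemma tendsto_channelIn (B : AngularBasis D ι) (M : RadialModel D a v) (ha : 0 < a) (α : ι) :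
    Tendsto (fun E : ℝ => channelIn B v (E ^ (1 / a)) α) (𝓝[>] 0)
      (𝓝 ((-I) ^ B.degree α * ∫ Ω, B.Y α Ω ∂(surfaceMeasure D))) :=
  (tendsto_channel M.cont_v M.v_zero ha (integrable_Y B α)).const_mul _

lemma tendsto_channelOut (B : AngularBasis D ι) (M : RadialModel D a v) (ha : 0 < a) (α : ι) :
    Tendsto (fun E : ℝ => channelOut B v (E ^ (1 / a)) α) (𝓝[>] 0)
      (𝓝 (conj ((-I) ^ B.degree α * ∫ Ω, B.Y α Ω ∂(surfaceMeasure D)))) := by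
  have h := (tendsto_channel M.cont_v M.v_zero ha (y := fun Ω => conj (B.Y α Ω))
    (Complex.conjLIE.toContinuousLinearEquiv.toContinuousLinearMap.integrable_comp
      (integrable_Y B α))).const_mul (conj ((-I) ^ B.degree α))
  rw [integral_conj, ← map_mul] at h
  exact h.congr fun E => by simp only [channelOut, mul_comm]

/-- The mean values of the spherical harmonics. -/
lemma integral_Y (B : AngularBasis D ι) : ∃ b : ℂ, ‖b‖ ^ 2 = (surfaceMeasure D).real Set.univ ∧
    ∀ α, ∫ Ω, B.Y α Ω ∂(surfaceMeasure D) = open Classical in if α = B.sWave then b else 0 := by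
  classical
  -- A harmonic polynomial of degree 0 is a constant c, and normalisation gives |c|² times the area
  -- equal to 1. The other basis vectors are orthogonal to it and so have mean zero, while b =
  -- area·c has |b|² = area.
  obtain ⟨P, hP, -, hY⟩ := B.harmonic B.sWave
  rw [(B.degree_eq_zero_iff B.sWave).mpr rfl] at hP
  set c := P.coeff 0
  have hPc : P = MvPolynomial.C c := by
    exact (MvPolynomial.totalDegree_eq_zero_iff_eq_C).mp (Nat.le_zero.mp hP.totalDegree_le)
  have hYc : (B.Y B.sWave : UnitSphere D → ℂ) =ᵐ[surfaceMeasure D] fun _ => c := by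
    refine hY.trans (.of_forall fun Ω => ?_)
    beta_reduce
    rw [hPc, MvPolynomial.eval_C]
  have hin : ∀ α, inner ℂ (B.Y B.sWave) (B.Y α) =
      conj c * ∫ Ω, B.Y α Ω ∂(surfaceMeasure D) := fun α => by
    rw [L2.inner_def, ← integral_const_mul]
    refine integral_congr_ae ?_
    filter_upwards [hYc] with Ω hΩ
    rw [hΩ, RCLike.inner_apply, mul_comm]
  have hs : ∫ Ω, B.Y B.sWave Ω ∂(surfaceMeasure D) =
      ((surfaceMeasure D).real Set.univ : ℂ) * c := by
    rw [integral_congr_ae hYc, integral_const, real_smul]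
  have h1 : conj c * (((surfaceMeasure D).real Set.univ : ℂ) * c) = 1 := by
    rw [← hs, ← hin, inner_self_eq_norm_sq_to_K, B.Y.orthonormal.1]; simp
  have hc : conj c ≠ 0 := left_ne_zero_of_mul_eq_one h1
  refine ⟨((surfaceMeasure D).real Set.univ : ℂ) * c, ?_, fun α => ?_⟩
  · have h2 : (((surfaceMeasure D).real Set.univ : ℝ) : ℂ) * ((‖c‖ ^ 2 : ℝ) : ℂ) = 1 := by
      rw [ofReal_pow, ← Complex.conj_mul']; linear_combination h1
    have h3 : (surfaceMeasure D).real Set.univ * ‖c‖ ^ 2 = 1 := by exact_mod_cast h2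
    rw [norm_mul, Complex.norm_real, Real.norm_of_nonneg measureReal_nonneg]
    linear_combination ((surfaceMeasure D).real Set.univ) * h3
  · split_ifs with h
    · rw [h, hs]
    · have h2 := hin α
      rw [B.Y.orthonormal.2 (Ne.symm h)] at h2
      exact (mul_eq_zero.mp h2.symm).resolve_left hc

open Classical in
lemma tendsto_SAngular (hD : 1 ≤ D) (ha : 0 < a) (B : AngularBasis D ι) (M : RadialModel D a v)
    {c : ℂ} (h : Tendsto (radialFactor D a g v) (𝓝[>] 0) (𝓝 c))
    (hb : ∀ᶠ E in 𝓝[>] 0, ¬ IsBoundStateInContinuum (radialDispersion D a) g v E) (α β : ι) :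
    Tendsto (fun E => SAngular B a g v E α β) (𝓝[>] 0) (𝓝 ((if α = β then 1 else 0) +
      c * (((-I) ^ B.degree α * ∫ Ω, B.Y α Ω ∂(surfaceMeasure D)) *
        conj ((-I) ^ B.degree β * ∫ Ω, B.Y β Ω ∂(surfaceMeasure D))))) := by
  refine ((h.mul ((tendsto_channelIn B M ha α).mul
    (tendsto_channelOut B M ha β))).const_add _).congr' ?_
  filter_upwards [hb, self_mem_nhdsWithin] with E hE hE0
  rw [SAngular_apply hD B M hE0 hE]

open Classical in
/-- The low-energy limit of the S-matrix for `a ≤ D`. -/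
theorem tendsto_SAngular_of_le (hD : 1 ≤ D) (ha : 0 < a) (haD : a ≤ D) (B : AngularBasis D ι)
    (M : RadialModel D a v) (hg : g ≠ 0) (hz : ¬ HasZeroEnergyState (radialDispersion D a) g v)
    (α β : ι) :
    Tendsto (fun E => SAngular B a g v E α β) (𝓝[>] 0) (𝓝 (if α = β then 1 else 0)) := by
  obtain ⟨c, hc, h⟩ := M.exists_low hD ha haD hg hz
  have hcont : ∀ E ∈ Set.Ioi (0 : ℝ), Tendsto (fun ω : ℂ => ((lowWeight (D / a) ‖ω‖ : ℝ) : ℂ))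
      (𝓝[upper] (E : ℂ)) (𝓝 ((lowWeight (D / a) E : ℝ) : ℂ)) := fun E hE => by
    have hE0 : 0 < E := hE
    have h1 := (continuousOn_lowWeight (D / a)).continuousAt (Ioi_mem_nhds hE0)
    have h2 : Tendsto (fun ω : ℂ => ‖ω‖) (𝓝[upper] (E : ℂ)) (𝓝 E) := by
      have := (continuous_norm.tendsto (E : ℂ)).mono_left (nhdsWithin_le_nhds (s := upper))
      rwa [Complex.norm_real, Real.norm_of_nonneg hE0.le] at this
    exact (Complex.continuous_ofReal.tendsto _).comp (h1.tendsto.comp h2)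
  have h1 := tendsto_boundary_of_upper (J := Set.Ioi 0) h fun E hE =>
    ((M.boundary (ne_of_gt hE)).1.const_sub g⁻¹).mul (hcont E hE)
  have hb : ∀ᶠ E in 𝓝[>] 0, ¬ IsBoundStateInContinuum (radialDispersion D a) g v E := by
    filter_upwards [h1.eventually_ne hc] with E hE
    exact left_ne_zero_of_mul hE
  -- Numerator and denominator are both multiplied by the low-energy weight: the numerator then
  -- tends to 0 and the denominator to c ≠ 0.
  have h2 : Tendsto (radialFactor D a g v) (𝓝[>] 0) (𝓝 0) := by
    have h3 := (Complex.continuous_ofReal.tendsto 0).comp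
      (tendsto_rpow_mul_lowWeight ((one_le_div ha).mpr haD))
    have h4 := ((h3.div h1 hc).const_mul (-(2 * Real.pi * I) * ((1 / a : ℝ) : ℂ)))
    rw [ofReal_zero, zero_div, mul_zero] at h4
    refine h4.congr' ?_
    filter_upwards with E
    have h5 : ((lowWeight (D / a) E : ℝ) : ℂ) ≠ 0 := by exact_mod_cast (lowWeight_pos _ E).ne'
    simp only [Function.comp, Pi.div_apply]
    rw [radialFactor, ofReal_mul, mul_div_mul_right _ _ h5]
  simpa using tendsto_SAngular hD ha B M h2 hb α β

open Classical in
/-- The low-energy limit of the S-matrix for `a > D`. -/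
theorem tendsto_SAngular_of_lt (hD : 1 ≤ D) (ha : 0 < a) (haD : D < a) (B : AngularBasis D ι)
    (M : RadialModel D a v) (g : ℂ) (α β : ι) :
    Tendsto (fun E => SAngular B a g v E α β) (𝓝[>] 0)
      (𝓝 (if α = B.sWave ∧ β = B.sWave then Complex.exp (2 * Real.pi * I * D / a)
        else if α = β then 1 else 0)) := by
  have hD0 : (0 : ℝ) < D := by exact_mod_cast hD
  have hp : D / a < 1 := (div_lt_one ha).mpr haD
  have hs := radialDensity_zero_ne_zero hD ha M.v_zero
  have hA := surfaceMeasure_univ_pos hD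
  have hA0 : ((surfaceMeasure D).real Set.univ : ℂ) ≠ 0 := by exact_mod_cast hA.ne'
  have ha0 : (a : ℂ) ≠ 0 := by exact_mod_cast ha.ne'
  have hc : radialDensity a v 0 * Complex.exp (-(I * ((D / a : ℝ) : ℂ) * Real.pi)) + 0 ≠ 0 := by
    rw [add_zero]; exact mul_ne_zero hs (Complex.exp_ne_zero _)
  set z := Complex.exp (Real.pi * I * D / a)
  have hz : z ≠ 0 := Complex.exp_ne_zero _
  have hz' : Complex.exp (-(I * ((D / a : ℝ) : ℂ) * Real.pi)) = z⁻¹ := by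
    rw [← Complex.exp_neg]; push_cast; congr 1; ring
  have hκ0 := LineModel.powerConst_ne_zero M.density₁.p_pos hp
  -- By the reflection formula the factor tends to (z²-1)/area with z = exp(iπD/a). The s-wave mean
  -- contributes |b|² = area, so the s-wave entry tends to z².
  have hlim : -(2 * Real.pi * I) * ((1 / a : ℝ) : ℂ) *
      (LineModel.lowConst (D / a) (radialDensity a v 0) 0)⁻¹ =
      (z ^ 2 - 1) / ((surfaceMeasure D).real Set.univ : ℂ) := by
    have hκ : powerConst (D / a) * Complex.sin (Real.pi * (D / a : ℝ)) = -Real.pi := by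
      exact_mod_cast powerConst_mul_sin M.density₁.p_pos hp
    have e2 : z - z⁻¹ = 2 * I * Complex.sin (Real.pi * (D / a : ℝ)) := by
      rw [Complex.sin, ← Complex.exp_neg]
      push_cast
      rw [show (-(Real.pi * ((D : ℂ) / a)) * I : ℂ) = -(Real.pi * I * D / a) by ring,
        show (Real.pi * ((D : ℂ) / a) * I : ℂ) = Real.pi * I * D / a by ring]
      linear_combination (z - Complex.exp (-(Real.pi * I * D / a))) * I_sq
    have e3 : -(2 * Real.pi * I) = powerConst (D / a) * (z - z⁻¹) := by
      rw [e2]; linear_combination (2 * I) * hκ.symm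
    rw [e3, LineModel.lowConst, add_zero, hz', radialDensity_zero M.v_zero]
    push_cast
    field_simp
  have h1 := (M.tendsto_rpow_div_pos hp g hc).const_mul (-(2 * Real.pi * I) * ((1 / a : ℝ) : ℂ))
  rw [hlim] at h1
  have h2 : Tendsto (radialFactor D a g v) (𝓝[>] 0) (𝓝 _) := h1
  have hb : ∀ᶠ E in 𝓝[>] 0, ¬ IsBoundStateInContinuum (radialDispersion D a) g v E := by
    have h3 := (M.tendsto_rpow_div_pos hp g hc).eventually_ne
      (inv_ne_zero (mul_ne_zero hκ0 hc))
    filter_upwards [h3] with E hE h4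
    exact hE (by rw [show g⁻¹ - fromAbove (Ksep (radialDispersion D a) v) E = 0 from h4, div_zero])
  obtain ⟨b, hb1, hb2⟩ := integral_Y B
  refine (tendsto_SAngular hD ha B M h2 hb α β).trans_eq ?_
  congr 1
  rw [hb2, hb2]
  by_cases hα : α = B.sWave
  · by_cases hβ : β = B.sWave
    · have hb3 : b * conj b = ((surfaceMeasure D).real Set.univ : ℂ) := by
        rw [Complex.mul_conj', ← hb1]; push_cast; rfl
      have hz2 : Complex.exp (2 * Real.pi * I * D / a) = z ^ 2 := by
        rw [← Complex.exp_nat_mul]; congr 1; push_cast; ring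
      subst hα
      subst hβ
      simp only [and_self, if_true]
      rw [(B.degree_eq_zero_iff _).mpr rfl, pow_zero, one_mul, hb3, hz2]
      field_simp; ring
    · simp only [hβ, and_false, if_false, mul_zero, map_zero, add_zero]
  · simp only [hα, false_and, if_false, mul_zero, zero_mul, add_zero]

end Angular

end SepScattering


/-! ### Assembly of the two cases -/

theorem mainTheorem8 :
    -- one dimension, `ε(k) = σ d kᵐ`
    (∀ (m : ℕ) (_ : 2 ≤ m) (σ d : ℝ) (_ : σ = 1 ∨ σ = -1) (_ : 0 < d) (g : ℂ) (_ : g ≠ 0)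
      (w : ℝ → ℂ) (_ : Integrable w)
      (_ : (((Real.sqrt (2 * Real.pi))⁻¹ : ℝ) : ℂ) * ∫ z, w z = 1)
      (ε : ℝ → ℝ) (_ : ε = SepScattering.dispersion σ d m)
      (v : ℝ → ℂ) (_ : v = SepScattering.unitaryFourier w)
      (Rc : Set ℝ) (_ : Even m → Rc = SepScattering.continuumEven σ) (_ : Odd m → Rc = {0}ᶜ),
      -- the T-matrix and the bound-state energies
      (∀ ω ∈ SepScattering.offContinuum Rc,
        (g⁻¹ - SepScattering.Ksep ε v ω ≠ 0 → ∀ T : ℝ → ℝ → ℂ,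
          (SepScattering.SolvesLippmannSchwinger ε g v ω T ↔
            T = SepScattering.Tsep ε g v ω)) ∧
        (SepScattering.IsBoundStateEnergy ε g v ω ↔ g⁻¹ - SepScattering.Ksep ε v ω = 0)) ∧
      (∀ E ∈ Rc, SepScattering.HasBoundaryValues (SepScattering.Ksep ε v) E) ∧
      -- universal limits
      (Odd m →
        Tendsto (fun E => SepScattering.SOdd σ d m g v E 0 0) (𝓝[>] 0)
          (𝓝 (Complex.exp (Real.pi * I / m))) ∧
        Tendsto (fun E => SepScattering.SOdd σ d m g v E 0 0) (𝓝[<] 0)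
          (𝓝 (Complex.exp (-(Real.pi * I / m))))) ∧
      (Even m →
        Tendsto (SepScattering.SEven σ d m g v) (𝓝[SepScattering.continuumEven σ] 0)
          (𝓝 (Complex.exp (σ * I * Real.pi / m) •
            !![(Real.cos (Real.pi / m) : ℂ), σ * I * Real.sin (Real.pi / m);
               σ * I * Real.sin (Real.pi / m), (Real.cos (Real.pi / m) : ℂ)]))) ∧
      -- determinant
      (∀ E ∈ Rc, ¬ SepScattering.IsBoundStateInContinuum ε g v E →
        (Odd m → (SepScattering.SOdd σ d m g v E).det =
          (g⁻¹ - SepScattering.fromBelow (SepScattering.Ksep ε v) E) /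
            (g⁻¹ - SepScattering.fromAbove (SepScattering.Ksep ε v) E)) ∧
        (Even m → (SepScattering.SEven σ d m g v E).det =
          (g⁻¹ - SepScattering.fromBelow (SepScattering.Ksep ε v) E) /
            (g⁻¹ - SepScattering.fromAbove (SepScattering.Ksep ε v) E))) ∧
      -- Levinson's theorem
      ((∀ E ∈ Rc, ¬ SepScattering.IsBoundStateInContinuum ε g v E) →
        (Odd m → (∀ E ∈ Rc, (SepScattering.SOdd σ d m g v E).det ≠ 0) →
          FiniteDimensional ℂ (SepScattering.boundStateSpace ε g v) ∧
          ∃ Δneg Δpos : ℝ,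
            SepScattering.HasPhaseChange (fun E => (SepScattering.SOdd σ d m g v E).det)
              (Set.Iio 0) atBot (𝓝[<] 0) Δneg ∧
            SepScattering.HasPhaseChange (fun E => (SepScattering.SOdd σ d m g v E).det)
              (Set.Ioi 0) (𝓝[>] 0) atTop Δpos ∧
            Δneg + Δpos = -Real.pi * SepScattering.boundStateNumber ε g v +
              Real.pi * ((m - 1) / m)) ∧
        (Even m → (∀ E ∈ Rc, (SepScattering.SEven σ d m g v E).det ≠ 0) →
          FiniteDimensional ℂ (SepScattering.boundStateSpace ε g v) ∧
          (σ = 1 → SepScattering.HasPhaseChange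
            (fun E => (SepScattering.SEven σ d m g v E).det) (Set.Ioi 0) (𝓝[>] 0) atTop
            (-Real.pi * SepScattering.boundStateNumber ε g v + Real.pi * ((m - 1) / m))) ∧
          (σ = -1 → SepScattering.HasPhaseChange
            (fun E => (SepScattering.SEven σ d m g v E).det) (Set.Iio 0) atBot (𝓝[<] 0)
            (-Real.pi * SepScattering.boundStateNumber ε g v +
              Real.pi * ((m - 1) / m)))))) ∧
    -- `D` dimensions, `ε(k) = |k|ᵃ`
    (∀ (D : ℕ) (_ : 1 ≤ D) (a : ℝ) (_ : 0 < a) (g : ℂ) (_ : g ≠ 0)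
      (w : EuclideanSpace ℝ (Fin D) → ℂ) (_ : Integrable w)
      (_ : (((Real.sqrt (2 * Real.pi))⁻¹ ^ D : ℝ) : ℂ) * ∫ z, w z = 1)
      (ε : EuclideanSpace ℝ (Fin D) → ℝ) (_ : ε = SepScattering.radialDispersion D a)
      (v : EuclideanSpace ℝ (Fin D) → ℂ) (_ : v = SepScattering.unitaryFourier w)
      -- no ultraviolet divergence (automatic when `a > D`)
      (_ : ∃ γ : ℝ, (D : ℝ) < γ ∧
        (fun k => ‖v k‖ ^ 2) =o[Bornology.cobounded (EuclideanSpace ℝ (Fin D))]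
          fun k => ‖k‖ ^ (a - γ))
      (ι : Type) (B : SepScattering.AngularBasis D ι),
      -- the T-matrix and the bound-state energies
      (∀ ω ∈ SepScattering.offContinuum (Set.Ioi 0),
        (g⁻¹ - SepScattering.Ksep ε v ω ≠ 0 →
          ∀ T : EuclideanSpace ℝ (Fin D) → EuclideanSpace ℝ (Fin D) → ℂ,
            (SepScattering.SolvesLippmannSchwinger ε g v ω T ↔
              T = SepScattering.Tsep ε g v ω)) ∧
        (SepScattering.IsBoundStateEnergy ε g v ω ↔ g⁻¹ - SepScattering.Ksep ε v ω = 0)) ∧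
      (∀ E : ℝ, 0 < E → SepScattering.HasBoundaryValues (SepScattering.Ksep ε v) E) ∧
      -- universal limits
      (¬ SepScattering.HasZeroEnergyState ε g v → ∀ α β : ι,
        (a ≤ D → Tendsto (fun E => SepScattering.SAngular B a g v E α β) (𝓝[>] 0)
          (𝓝 (open Classical in if α = β then 1 else 0))) ∧
        (D < a → Tendsto (fun E => SepScattering.SAngular B a g v E α β) (𝓝[>] 0)
          (𝓝 (open Classical in
            if α = B.sWave ∧ β = B.sWave then Complex.exp (2 * Real.pi * I * D / a)
            else if α = β then 1 else 0)))) ∧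
      -- determinant
      (∀ E : ℝ, 0 < E → ¬ SepScattering.IsBoundStateInContinuum ε g v E →
        Tendsto (SepScattering.finiteDet B a g v E) atTop
          (𝓝 (SepScattering.detSAngular B a g v E)) ∧
        SepScattering.detSAngular B a g v E =
          (g⁻¹ - SepScattering.fromBelow (SepScattering.Ksep ε v) E) /
            (g⁻¹ - SepScattering.fromAbove (SepScattering.Ksep ε v) E)) ∧
      -- Levinson's theorem
      (¬ SepScattering.HasZeroEnergyState ε g v →
        (∀ E : ℝ, 0 < E → ¬ SepScattering.IsBoundStateInContinuum ε g v E) →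
        (∀ E : ℝ, 0 < E → SepScattering.detSAngular B a g v E ≠ 0) →
        (D < a →
          FiniteDimensional ℂ (SepScattering.boundStateSpace ε g v) ∧
          SepScattering.HasPhaseChange (SepScattering.detSAngular B a g v)
            (Set.Ioi 0) (𝓝[>] 0) atTop
            (-Real.pi * SepScattering.boundStateNumber ε g v + Real.pi * ((a - D) / a))) ∧
        (a ≤ D → (∃ (C s : NNReal), 0 < s ∧ HolderWith C s v) →
          FiniteDimensional ℂ (SepScattering.boundStateSpace ε g v) ∧
          SepScattering.HasPhaseChange (SepScattering.detSAngular B a g v)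
            (Set.Ioi 0) (𝓝[>] 0) atTop
            (-Real.pi * SepScattering.boundStateNumber ε g v)))) := by
  refine ⟨?_, ?_⟩
  · rintro m hm σ d hσ hd g hg w hw hw1 ε rfl v rfl Rc hRe hRo
    have M := SepScattering.lineModel_dispersion hm hσ hd hw hw1 hRe hRo
    have hne : ∀ E ∈ Rc, E ≠ 0 := fun E hE h0 => M.zero_notMem (h0 ▸ hE)
    refine ⟨fun ω hω => ⟨fun h T => M.solvesLippmannSchwinger_iff hg hω h T,
      M.isBoundStateEnergy_iff hg hω⟩, fun E hE => M.hasBoundaryValues (hne E hE),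
      fun ho => SepScattering.tendsto_SOdd hm ho hσ hd M g,
      fun he => SepScattering.tendsto_SEven hm he hσ hd M g,
      fun E hE hb => ⟨fun ho => SepScattering.det_SOdd hm ho hσ hd M (hne E hE) hb,
        fun he => SepScattering.det_SEven hm he hσ hd M (hRe he ▸ hE) hb⟩,
      fun hb => ⟨fun ho hdet => ?_, fun he hdet => ?_⟩⟩
    · obtain ⟨h1, Δn, Δp, h2, h3, -, -, h4⟩ := SepScattering.levinson_dispersion hm hσ hd hg M hb
        (fun E hE => SepScattering.det_SOdd hm ho hσ hd M (hne E hE) (hb E hE)) hdet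
      rw [hRo ho] at h2 h3
      exact ⟨h1, Δn, Δp, h2 fun x hx => ne_of_lt hx, h3 fun x hx => ne_of_gt hx, h4⟩
    · obtain ⟨h1, Δn, Δp, h2, h3, h4, h5, h6⟩ := SepScattering.levinson_dispersion hm hσ hd hg M hb
        (fun E hE => SepScattering.det_SEven hm he hσ hd M (hRe he ▸ hE) (hb E hE)) hdet
      rw [hRe he] at h2 h3 h4 h5
      -- The continuum is one half-line. The phase change over the other one is zero, so the sum is
      -- the phase change over the continuum.
      refine ⟨h1, ?_, ?_⟩
      · rintro rfl
        rw [← h6, h4 (Set.disjoint_left.mpr fun x hx hx' => by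
          simp only [SepScattering.continuumEven, Set.mem_ofPred_eq, Set.mem_Iio] at hx hx'
          linarith), zero_add]
        exact h3 fun x hx => by simpa [SepScattering.continuumEven] using hx
      · rintro rfl
        rw [← h6, h5 (Set.disjoint_left.mpr fun x hx hx' => by
          simp only [SepScattering.continuumEven, Set.mem_ofPred_eq, Set.mem_Ioi] at hx hx'
          linarith), add_zero]
        exact h2 fun x hx => by simpa [SepScattering.continuumEven] using hx
  · rintro D hD a ha g hg w hw hw1 ε rfl v rfl hdec ι B
    have M : SepScattering.RadialModel D a (SepScattering.unitaryFourier w) :=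
      SepScattering.lineModel_radial hD ha hw hw1 hdec
    refine ⟨fun ω hω => ⟨fun h T => M.solvesLippmannSchwinger_iff hg hω h T,
      M.isBoundStateEnergy_iff hg hω⟩, fun E hE => M.hasBoundaryValues hE.ne',
      fun hz α β => ⟨fun haD => SepScattering.tendsto_SAngular_of_le hD ha haD B M hg hz α β,
        fun haD => SepScattering.tendsto_SAngular_of_lt hD ha haD B M g α β⟩,
      fun E hE hb => ?_, fun hz hb hdet => ?_⟩
    · have h := SepScattering.detSAngular_eq hD B M hE hb
      exact ⟨h ▸ SepScattering.tendsto_finiteDet hD B M hE hb, h⟩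
    · have h := SepScattering.RadialModel.levinson M hD ha hg hz hb
        (fun E hE => SepScattering.detSAngular_eq hD B M hE (hb E hE)) hdet
      refine ⟨fun haD => ?_, fun haD hH => ?_⟩
      -- For a > D the Hölder condition is required only under a ≤ D, so it is vacuous.
      · have h1 := h fun h => absurd h (not_le.mpr haD)
        rw [if_pos haD] at h1
        refine ⟨h1.1, ?_⟩
        convert h1.2 using 1
        field_simp; ring
      · have h1 := h fun _ => SepScattering.holder_radialDensity ha hw hH
        rw [if_neg (not_lt.mpr haD), mul_zero, sub_zero] at h1
        exact h1
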